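/- Let $G$ be a compact connected Lie group with Lie algebra $\mathfrak g$, let $(\cdot,\cdot)$ be a nondegenerate symmetric invariant bilinear form on $\mathfrak g$ (invariance: $([u,v],w)=(u,[v,w])$), let $\mathbb S^1=\mathbb R/\mathbb Z$ with coordinate $s$, and fix a real number $\alpha>\tfrac12$. Let $LG$ be the group, under pointwise multiplication, of continuous loops $\mathbb S^1\to G$ of Sobolev class $H^\alpha$ (a continuous loop $\gamma$ is of class $H^\alpha$ if $f\circ\gamma\in H^\alpha(\mathbb S^1,\mathbb R)$ for every smooth $f:G\to\mathbb R$), with its Lie group structure modelled on $L\mathfrak g:=H^\alpha(\mathbb S^1,\mathfrak g)$, in which a chart $\varphi$ of $G$ at $1$ induces the chart $\gamma\mapsto\varphi\circ\gamma$ of $LG$ at $1$. Let $L\mathfrak g^*$ be the space of $\mathfrak g$-valued $1$-forms $A=A(s)\,ds$ on $\mathbb S^1$ with $A(s)$ of Sobolev class $\alpha-1$. Then $LG$ is indeed a Hilbert Lie group, $$\gamma\cdot A=\operatorname{Ad}_\gamma A+(d\gamma)\gamma^{-1}$$ defines an action of $LG$ on $L\mathfrak g^*$ (the gauge action), and the following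 holds for its transformation groupoid $LG\times L\mathfrak g^*\rightrightarrows L\mathfrak g^*$, with source $(\gamma,A)\mapsto A$, target $(\gamma,A)\mapsto\gamma\cdot A$ and composition $(\gamma,\delta\cdot A)(\delta,A)=(\gamma\delta,A)$. Identify $T_{(\gamma,A)}(LG\times L\mathfrak g^*)\cong L\mathfrak g\times L\mathfrak g^*$ by left translations. The formula $$\omega_{LG\times L\mathfrak g^*}\big((v_1,A_1),(v_2,A_2)\big)_{(\gamma,A)}=\int_{\mathbb S^1}(A_1,v_2)-(A_2,v_1)-(A,[v_1,v_2])-(v_1,dv_2)$$ defines a smooth symplectic form on $LG\times L\mathfrak g^*$ (closed, and nondegenerate in the weak sense that $X\mapsto\omega(X,\cdot)$ is injective on each tangent space), and with it the transformation groupoid is a symplectic groupoid: it is a Lie groupoid (source, target, unit, inverse and composition are smooth, source and target are submersions), and the form is multiplicative, that is, $\mathrm{pr}_1^*\omega+\mathrm{pr}_2^*\omega=\mathbf m^*\omega$ on the manifold of composable pairs, where $\mathbf m$ is the composition and $\mathrm{pr}_1,\mathrm{pr}_2$ are the two projections. -/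

import Mathlib

open scoped Manifold ContDiff Topology

noncomputable section

/-! ### Differential forms of degree two on (possibly infinite-dimensional) manifolds -/

section Forms

variable {E : Type*} [NormedAddCommGroup E] [NormedSpace ℝ E]
  {H : Type*} [TopologicalSpace H] (I : ModelWithCorners ℝ E H)
  {M : Type*} [TopologicalSpace M] [ChartedSpace H M]

/-- A (not necessarily smooth) field of continuous alternating bilinear forms on the tangent
spaces of `M`. -/
abbrev TwoFormField (M : Type*) [TopologicalSpace M] [ChartedSpace H M] : Type _ :=
  (p : M) → (TangentSpace I p) [⋀^Fin 2]→L[ℝ] ℝ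

/-- The local expression of a 2-form in the preferred chart at `x`, i.e. its pullback under the
inverse of that chart. -/
def TwoFormField.inChart (Ω : TwoFormField I M) (x : M) (y : E) : E [⋀^Fin 2]→L[ℝ] ℝ :=
  (Ω ((extChartAt I x).symm y)).compContinuousLinearMap
    (mfderivWithin 𝓘(ℝ, E) I (extChartAt I x).symm (Set.range I) y)

/-- `Ω` is a (weakly) symplectic form: a smooth, closed 2-form such that
`v ↦ Ω(v, ·)` is injective on every tangent space. -/
structure IsSymplecticForm (Ω : TwoFormField I M) : Prop where
  smooth : ∀ x : M, ContDiffOn ℝ ∞ (TwoFormField.inChart I Ω x) (extChartAt I x).target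
  closed : ∀ x : M, ∀ y ∈ (extChartAt I x).target,
    extDerivWithin (TwoFormField.inChart I Ω x) (Set.range I) y = 0
  nondegenerate : ∀ (x : M) (v : TangentSpace I x),
    (∀ w : TangentSpace I x, Ω x ![v, w] = 0) → v = 0

end Forms

/-! ### Groupoids, Lie groupoids, symplectic groupoids -/

/-- A groupoid with set of arrows `𝒢` and set of objects `M`; the arrows `g`, `h` are composable
when `src g = tgt h`, and `comp g h _` is then the arrow `g h`. -/
structure GroupoidData (𝒢 M : Type*) where
  src : 𝒢 → M
  tgt : 𝒢 → M
  unit : M → 𝒢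
  inv : 𝒢 → 𝒢
  comp : (g h : 𝒢) → src g = tgt h → 𝒢
  src_unit : ∀ x, src (unit x) = x
  tgt_unit : ∀ x, tgt (unit x) = x
  src_inv : ∀ g, src (inv g) = tgt g
  tgt_inv : ∀ g, tgt (inv g) = src g
  src_comp : ∀ g h (hc : src g = tgt h), src (comp g h hc) = src h
  tgt_comp : ∀ g h (hc : src g = tgt h), tgt (comp g h hc) = tgt g
  assoc : ∀ g h k (hgh : src g = tgt h) (hhk : src h = tgt k),
    comp (comp g h hgh) k ((src_comp g h hgh).trans hhk) =
      comp g (comp h k hhk) (hgh.trans (tgt_comp h k hhk).symm)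
  unit_comp : ∀ g, comp (unit (tgt g)) g (src_unit _) = g
  comp_unit : ∀ g, comp g (unit (src g)) (tgt_unit _).symm = g
  inv_comp : ∀ g, comp (inv g) g (src_inv g) = unit (src g)
  comp_inv : ∀ g, comp g (inv g) (tgt_inv g).symm = unit (tgt g)

/-- The action (transformation) groupoid `K × X ⇉ X` of a left action of `K` on `X`:
`s(g, x) = x`, `t(g, x) = g • x`, `(g, h • y)(h, y) = (g h, y)`. -/
def actionGroupoid (K X : Type*) [Group K] [MulAction K X] : GroupoidData (K × X) X where
  src p := p.2
  tgt p := p.1 • p.2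
  unit x := (1, x)
  inv p := (p.1⁻¹, p.1 • p.2)
  comp p q _ := (p.1 * q.1, q.2)
  src_unit _ := rfl
  tgt_unit x := one_smul K x
  src_inv _ := rfl
  tgt_inv p := inv_smul_smul p.1 p.2
  src_comp _ _ _ := rfl
  tgt_comp p q h := by
    change (p.1 * q.1) • q.2 = p.1 • p.2
    rw [mul_smul]; exact congrArg _ (Eq.symm h)
  assoc p q r _ _ := by simp [mul_assoc]
  unit_comp p := by simp
  comp_unit p := by simp
  inv_comp p := by simp
  comp_inv p := by simp

section LieGroupoids

variable {E : Type*} [NormedAddCommGroup E] [NormedSpace ℝ E]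
  {H : Type*} [TopologicalSpace H] (I : ModelWithCorners ℝ E H)
  {E' : Type*} [NormedAddCommGroup E'] [NormedSpace ℝ E']
  {H' : Type*} [TopologicalSpace H'] (J : ModelWithCorners ℝ E' H')
  {𝒢 : Type*} [TopologicalSpace 𝒢] [ChartedSpace H 𝒢]
  {M : Type*} [TopologicalSpace M] [ChartedSpace H' M]

/-- `m` is a smooth extension, near the composable pair `p`, of the composition map from the
submanifold `𝒢₂ = {(g, h) | s(g) = t(h)}` to a neighbourhood of `p` in `𝒢 × 𝒢`. -/
structure IsLocalCompExtension (Γ : GroupoidData 𝒢 M) (m : 𝒢 × 𝒢 → 𝒢) (p : 𝒢 × 𝒢) : Prop where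
  smooth : ContMDiffAt (I.prod I) I ∞ m p
  extends_comp : ∀ᶠ q in 𝓝 p, ∀ hc : Γ.src q.1 = Γ.tgt q.2, m q = Γ.comp q.1 q.2 hc

/-- A Lie groupoid: arrows and objects are smooth (Hausdorff) manifolds, all structure maps are
smooth, and source and target are submersions.  Smoothness of the composition on the submanifold
`𝒢₂ ⊆ 𝒢 × 𝒢` means that it locally extends to smooth maps on `𝒢 × 𝒢`. -/
structure IsLieGroupoid (Γ : GroupoidData 𝒢 M) : Prop where
  isManifold_arrows : IsManifold I ∞ 𝒢
  isManifold_objects : IsManifold J ∞ M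
  t2_arrows : T2Space 𝒢
  t2_objects : T2Space M
  contMDiff_src : ContMDiff I J ∞ Γ.src
  contMDiff_tgt : ContMDiff I J ∞ Γ.tgt
  contMDiff_unit : ContMDiff J I ∞ Γ.unit
  contMDiff_inv : ContMDiff I I ∞ Γ.inv
  contMDiff_comp : ∀ g h, Γ.src g = Γ.tgt h → ∃ m, IsLocalCompExtension I Γ m (g, h)
  isSubmersion_src : Manifold.IsSubmersion I J ∞ Γ.src
  isSubmersion_tgt : Manifold.IsSubmersion I J ∞ Γ.tgt

/-- Multiplicativity `pr₁^* Ω + pr₂^* Ω = m^* Ω` on `𝒢₂`.  The tangent space of `𝒢₂` at `(g, h)`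
consists of the pairs `(X, Y)` with `ds(X) = dt(Y)`, and the differential of the composition at
`(g, h)` is the restriction to it of the differential of any local smooth extension. -/
def IsMultiplicative (Γ : GroupoidData 𝒢 M) (Ω : TwoFormField I 𝒢) : Prop :=
  ∀ (g h : 𝒢), Γ.src g = Γ.tgt h → ∀ m : 𝒢 × 𝒢 → 𝒢, IsLocalCompExtension I Γ m (g, h) →
    ∀ (X₁ X₂ : TangentSpace I g) (Y₁ Y₂ : TangentSpace I h),
      (mfderiv I J Γ.src g X₁ : E') = (mfderiv I J Γ.tgt h Y₁ : E') →
      (mfderiv I J Γ.src g X₂ : E') = (mfderiv I J Γ.tgt h Y₂ : E') →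
      Ω g ![X₁, X₂] + Ω h ![Y₁, Y₂] =
        Ω (m (g, h)) ![mfderiv (I.prod I) I m (g, h) (X₁, Y₁),
          mfderiv (I.prod I) I m (g, h) (X₂, Y₂)]

/-- A symplectic groupoid: a Lie groupoid with a multiplicative symplectic form on its manifold
of arrows. -/
structure IsSymplecticGroupoid (Γ : GroupoidData 𝒢 M) (Ω : TwoFormField I 𝒢) : Prop where
  isLieGroupoid : IsLieGroupoid I J Γ
  isSymplecticForm : IsSymplecticForm I Ω
  isMultiplicative : IsMultiplicative I J Γ Ω

end LieGroupoids

/-! ### Sobolev spaces of `ℝⁿ`-valued distributions on the circle `ℝ/ℤ`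

A periodic distribution with values in `ℝⁿ` is identified with its sequence of Fourier
coefficients `û(k) ∈ ℂⁿ`, `k ∈ ℤ`, which satisfies `û(-k) = conj û(k)`. -/

/-- Sequences of (complex) vector-valued Fourier coefficients. -/
abbrev FourierSeq (n : ℕ) : Type := ℤ → EuclideanSpace ℂ (Fin n)

/-- The weight `(1 + k²)^{σ/2}` of the Sobolev norm. -/
def sobolevWeight (σ : ℝ) (k : ℤ) : ℝ := (1 + (k : ℝ) ^ 2) ^ (σ / 2)

/-- The real subspace of all sequences of Fourier coefficients of real-valued distributions of
Sobolev class `σ`: those with `û(-k) = conj û(k)` and `∑ (1 + k²)^σ ‖û(k)‖² < ∞`. -/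
def sobolevSubmodule (σ : ℝ) (n : ℕ) : Submodule ℝ (FourierSeq n) where
  carrier := {c | (∀ k i, c (-k) i = (starRingEnd ℂ) (c k i)) ∧
    Memℓp (fun k => sobolevWeight σ k • c k) 2}
  zero_mem' := ⟨by simp, by
    convert (zero_memℓp : Memℓp (0 : FourierSeq n) 2) using 1
    funext k
    simp⟩
  add_mem' {a b} ha hb :=
    ⟨fun k i => by simp [ha.1 k i, hb.1 k i], by
      convert ha.2.add hb.2 using 1
      funext k
      simp⟩
  smul_mem' r a ha := ⟨fun k i => by simp [ha.1 k i], by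
    have := ha.2.const_smul r
    convert this using 2 with k
    simp [smul_comm r]⟩

/-- The Sobolev space `H^σ(S¹, ℝⁿ)`, `σ ∈ ℝ`. -/
def SobolevSpace (σ : ℝ) (n : ℕ) : Type := sobolevSubmodule σ n

namespace SobolevSpace

variable {σ : ℝ} {n : ℕ}

instance : AddCommGroup (SobolevSpace σ n) := inferInstanceAs (AddCommGroup (sobolevSubmodule σ n))
instance : Module ℝ (SobolevSpace σ n) := inferInstanceAs (Module ℝ (sobolevSubmodule σ n))

/-- The sequence of Fourier coefficients of `u ∈ H^σ(S¹, ℝⁿ)`. -/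
def coeff (u : SobolevSpace σ n) : FourierSeq n := u.1

/-- The embedding `u ↦ ((1 + k²)^{σ/2} û(k))ₖ` of `H^σ` into `ℓ²`. -/
def toLp : SobolevSpace σ n →ₗ[ℝ] lp (fun _ : ℤ => EuclideanSpace ℂ (Fin n)) 2 where
  toFun u := ⟨fun k => sobolevWeight σ k • u.1 k, u.2.2⟩
  map_add' u v := by
    ext k : 2
    exact smul_add _ _ _
  map_smul' r u := by
    ext k : 2
    exact smul_comm (sobolevWeight σ k) r (u.1 k)

theorem toLp_injective : Function.Injective (toLp : SobolevSpace σ n →ₗ[ℝ] _) := by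
  intro u v h
  apply Subtype.ext
  funext k
  have hk : sobolevWeight σ k • u.1 k = sobolevWeight σ k • v.1 k :=
    congrFun (congrArg Subtype.val h) k
  have hw : sobolevWeight σ k ≠ 0 := (Real.rpow_pos_of_pos (by positivity) _).ne'
  exact smul_right_injective _ hw hk

/-- The norm `‖u‖² = ∑ (1 + k²)^σ ‖û(k)‖²`. -/
instance : NormedAddCommGroup (SobolevSpace σ n) :=
  NormedAddCommGroup.induced _ _ (toLp : SobolevSpace σ n →ₗ[ℝ] _) toLp_injective

instance : NormedSpace ℝ (SobolevSpace σ n) :=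
  NormedSpace.induced ℝ _ _ (toLp : SobolevSpace σ n →ₗ[ℝ] _)

/-- The function on `S¹` with Fourier series `u`; the series converges absolutely
when `σ > 1/2`. -/
def eval (u : SobolevSpace σ n) (s : UnitAddCircle) : EuclideanSpace ℝ (Fin n) :=
  WithLp.toLp 2 fun i => (∑' k : ℤ, u.coeff k i * fourier k s).re

end SobolevSpace

/-- The Fourier coefficients of a real-valued function on the circle. -/
def realFourierCoeff (f : UnitAddCircle → ℝ) (k : ℤ) : ℂ :=
  fourierCoeff (fun s => (f s : ℂ)) k

/-- The Fourier coefficients of the product of the function `f` with the (scalar) distribution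
with Fourier coefficients `c`: the convolution of the two sequences. -/
def mulFourier (f : UnitAddCircle → ℝ) (c : ℤ → ℂ) (k : ℤ) : ℂ :=
  ∑' m : ℤ, realFourierCoeff f (k - m) * c m

/-- The Fourier coefficients `2πi k û(k)` of the derivative with respect to the coordinate
`s ∈ ℝ/ℤ`. -/
def derivFourier {n : ℕ} (c : FourierSeq n) : FourierSeq n :=
  fun k => (2 * (Real.pi : ℂ) * Complex.I * (k : ℂ)) • c k

/-! ### Loop groups -/

section Loops

variable {n : ℕ}

/-- The loops `γ : S¹ → G` which are continuous and of Sobolev class `α`: for every smooth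
function `f` on `G` the function `f ∘ γ` lies in `H^α(S¹, ℝ)`. -/
structure SobolevLoop (α : ℝ) (n : ℕ) (G : Type*) [TopologicalSpace G]
    [ChartedSpace (EuclideanSpace ℝ (Fin n)) G] where
  toMap : C(UnitAddCircle, G)
  sobolev : ∀ f : G → ℝ, ContMDiff (𝓡 n) 𝓘(ℝ, ℝ) ∞ f →
    Summable fun k : ℤ =>
      (1 + (k : ℝ) ^ 2) ^ α * ‖realFourierCoeff (fun s => f (toMap s)) k‖ ^ 2

variable {G : Type*} [TopologicalSpace G] [ChartedSpace (EuclideanSpace ℝ (Fin n)) G] [Group G]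

/-- The `j`-th standard basis vector of the Lie algebra `𝔤 = T₁G = ℝⁿ`. -/
def lieBasis (n : ℕ) (G : Type*) [TopologicalSpace G]
    [ChartedSpace (EuclideanSpace ℝ (Fin n)) G] [Group G] (j : Fin n) :
    GroupLieAlgebra (𝓡 n) G :=
  (EuclideanSpace.single j (1 : ℝ) : EuclideanSpace ℝ (Fin n))

/-- The adjoint action of `g` on `𝔤 = T₁G`: the derivative at `1` of `x ↦ g x g⁻¹`. -/
def adjointMap (n : ℕ) {G : Type*} [TopologicalSpace G]
    [ChartedSpace (EuclideanSpace ℝ (Fin n)) G] [Group G] (g : G) :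
    EuclideanSpace ℝ (Fin n) →L[ℝ] EuclideanSpace ℝ (Fin n) :=
  mfderiv (𝓡 n) (𝓡 n) (fun x : G => g * x * g⁻¹) 1

/-- The derivative of `f : G → ℝ` at `g` along the right-invariant vector field of `v ∈ 𝔤`. -/
def rightInvariantDeriv (f : G → ℝ) (v : GroupLieAlgebra (𝓡 n) G) (g : G) : ℝ :=
  mfderiv (𝓡 n) 𝓘(ℝ, ℝ) (fun x : G => f (x * g)) 1 v

/-- `R ds` is the right logarithmic derivative `(dγ) γ⁻¹` of the loop `γ`, in the sense of
distributions: for every smooth function `f` on `G`, with `E_j` the right-invariant vector field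
of the `j`-th basis vector of `𝔤`, one has `d(f ∘ γ)/ds = ∑_j (E_j f ∘ γ) R_j`. -/
def IsRightLogDeriv {α : ℝ} (γ : SobolevLoop α n G) (R : SobolevSpace (α - 1) n) : Prop :=
  ∀ f : G → ℝ, ContMDiff (𝓡 n) 𝓘(ℝ, ℝ) ∞ f → ∀ k : ℤ,
    2 * (Real.pi : ℂ) * Complex.I * (k : ℂ) * realFourierCoeff (fun s => f (γ.toMap s)) k =
      ∑ j, mulFourier (fun s => rightInvariantDeriv f (lieBasis n G j) (γ.toMap s))
        (fun m => R.coeff m j) k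

/-- The Fourier coefficients of `Ad_γ A`, where `A` is a `𝔤`-valued distribution on `S¹`. -/
def adFourier {α : ℝ} (γ : SobolevLoop α n G) (A : FourierSeq n) : FourierSeq n :=
  fun k => WithLp.toLp 2 fun i =>
    ∑ j, mulFourier (fun s => adjointMap n (γ.toMap s) (EuclideanSpace.single j 1) i)
      (fun m => A m j) k

/-- `A'` is the gauge transform `Ad_γ A + (dγ) γ⁻¹` of `A ∈ L𝔤^*` by `γ ∈ LG`. -/
def IsGaugeTransform {α : ℝ} (γ : SobolevLoop α n G) (A A' : SobolevSpace (α - 1) n) : Prop :=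
  ∃ R : SobolevSpace (α - 1) n, IsRightLogDeriv γ R ∧
    ∀ k, A'.coeff k = adFourier γ A.coeff k + R.coeff k

/-- `e` is the chart of `LG` around the constant loop `1` induced by the preferred chart `φ` of
`G` at `1`: it is defined on all loops with values in the domain of `φ`, and sends such a loop
`γ` to `φ ∘ γ ∈ H^α(S¹, ℝⁿ)`. -/
structure IsLoopChart {α : ℝ} [TopologicalSpace (SobolevLoop α n G)]
    (e : OpenPartialHomeomorph (SobolevLoop α n G) (SobolevSpace α n)) : Prop where
  source_eq : e.source = {γ | ∀ s, γ.toMap s ∈ (chartAt (EuclideanSpace ℝ (Fin n)) (1 : G)).source}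
  coeff_apply : ∀ γ ∈ e.source, ∀ k i, (e γ).coeff k i =
    realFourierCoeff (fun s => chartAt (EuclideanSpace ℝ (Fin n)) (1 : G) (γ.toMap s) i) k

/-- The given structures on the set of loops of Sobolev class `α` are those of the loop group
`LG`: multiplication is pointwise, `LG` is a Lie group modelled on `H^α(S¹, ℝⁿ)`, and `e` is the
smooth chart around the unit induced by a chart of `G`. -/
structure IsLoopLieGroup {α : ℝ} [Group (SobolevLoop α n G)]
    [TopologicalSpace (SobolevLoop α n G)]
    [ChartedSpace (SobolevSpace α n) (SobolevLoop α n G)]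
    (e : OpenPartialHomeomorph (SobolevLoop α n G) (SobolevSpace α n)) : Prop where
  mul_apply : ∀ (γ δ : SobolevLoop α n G) s, (γ * δ).toMap s = γ.toMap s * δ.toMap s
  lieGroup : LieGroup 𝓘(ℝ, SobolevSpace α n) ∞ (SobolevLoop α n G)
  chart_mem : e ∈ IsManifold.maximalAtlas 𝓘(ℝ, SobolevSpace α n) ∞ (SobolevLoop α n G)
  isLoopChart : IsLoopChart e

/-- The identification `T_γ LG ≅ L𝔤 = H^α(S¹, 𝔤)` by left translations: `X ∈ T_γ LG` is first
translated to the unit, and `T₁ LG` is identified with `H^α(S¹, T₁G)` by means of the chart `e`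
induced by the chart of `G` at `1` (through which `T₁G` is identified with `ℝⁿ`). -/
def leftTrivialization {α : ℝ} [Group (SobolevLoop α n G)] [TopologicalSpace (SobolevLoop α n G)]
    [ChartedSpace (SobolevSpace α n) (SobolevLoop α n G)]
    (e : OpenPartialHomeomorph (SobolevLoop α n G) (SobolevSpace α n)) (γ : SobolevLoop α n G)
    (X : TangentSpace 𝓘(ℝ, SobolevSpace α n) γ) : SobolevSpace α n :=
  mfderiv 𝓘(ℝ, SobolevSpace α n) 𝓘(ℝ, SobolevSpace α n) (fun δ => e (γ⁻¹ * δ)) γ X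

/-- The integral `∫_{S¹} (a, b)` of the pairing of two `𝔤`-valued distributions, in terms of
their Fourier coefficients: `∑_k ∑_{i,j} B(E_i, E_j) a_i(-k) b_j(k)`. -/
def loopPairing (B : LinearMap.BilinForm ℝ (GroupLieAlgebra (𝓡 n) G)) (a b : FourierSeq n) : ℝ :=
  (∑' k : ℤ, ∑ i, ∑ j, (B (lieBasis n G i) (lieBasis n G j) : ℂ) * a (-k) i * b k j).re

/-- The Lie bracket of `𝔤 = T₁G = ℝⁿ`. -/
def lieAlgBracket (n : ℕ) (G : Type*) [TopologicalSpace G]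
    [ChartedSpace (EuclideanSpace ℝ (Fin n)) G] [Group G] (u v : GroupLieAlgebra (𝓡 n) G) :
    EuclideanSpace ℝ (Fin n) :=
  (⁅u, v⁆ : GroupLieAlgebra (𝓡 n) G)

/-- The Fourier coefficients of the pointwise Lie bracket `s ↦ [v₁(s), v₂(s)]` of two loops in
`𝔤`. -/
def loopBracket {α : ℝ} (n : ℕ) (G : Type*) [TopologicalSpace G]
    [ChartedSpace (EuclideanSpace ℝ (Fin n)) G] [Group G] (v₁ v₂ : SobolevSpace α n) :
    FourierSeq n :=
  fun k => WithLp.toLp 2 fun i =>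
    realFourierCoeff (fun s => lieAlgBracket n G (v₁.eval s) (v₂.eval s) i) k

/-- `∫_{S¹} (A₁, v₂) - (A₂, v₁) - (A, [v₁, v₂]) - (v₁, dv₂)`. -/
def loopOmega {α : ℝ} (B : LinearMap.BilinForm ℝ (GroupLieAlgebra (𝓡 n) G))
    (A : SobolevSpace (α - 1) n) (v₁ : SobolevSpace α n) (A₁ : SobolevSpace (α - 1) n)
    (v₂ : SobolevSpace α n) (A₂ : SobolevSpace (α - 1) n) : ℝ :=
  loopPairing B A₁.coeff v₂.coeff - loopPairing B A₂.coeff v₁.coeff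
    - loopPairing B A.coeff (loopBracket n G v₁ v₂)
    - loopPairing B v₁.coeff (derivFourier v₂.coeff)

end Loops

end

/-! All the analysis is reduced to scalar Fourier series. For α > 1/2 a weighted convolution
estimate (`sobolevENorm_conv_le`) makes H^α(S¹) an algebra of continuous functions that acts on H^β
whenever |β| ≤ α. Since |α - 1| ≤ α, it acts on H^{α-1}. Thus Ad_γ A and the pairing ∫(A, v) are
module products, the derivative maps H^α to H^{α-1}, and the Leibniz rule and integration by parts
hold on coefficients.

The analytic core is that u ↦ F ∘ u is a smooth map on H^α for every smooth F (`contDiff_nem`). For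
1/2 < α < 1, dyadic L² differences are equivalent to the H^α norm, and a Lipschitz function does not
increase them by more than a constant. Larger α are reached through the chain rule: F ∘ u lies in
H^α if its derivative ∑ (∂ᵢF ∘ u) uᵢ' lies in H^{α-1} (`of_sub_one_le`). Hadamard's lemma F(y) -
F(x) = ∑ gᵢ(x, y)(yᵢ - xᵢ) then turns local boundedness of all superposition operators into
continuity, differentiability and, by induction, smoothness.

The group G is embedded in some ℝᴺ with smooth local retractions, so that smooth functions on G and
G × G extend to the ambient space. Loops become N-tuples in H^α, and multiplication, inversion and
the chart at 1 become superposition operators; a map into LG is smooth as soon as its ambient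
coordinates are (`contMDiffAt_of_embL`). All charts of LG are left translates of the one at 1. Hence
the tangent spaces, read in preferred charts, are already left-trivialized: left translations have
derivative the identity, right translation by δ has derivative Ad_{δ⁻¹}, and inverse charts have the
Maurer–Cartan form θ as derivative. Such identities are checked by evaluating at each point of the
circle, which reduces them to G.

The logarithmic derivative (dγ)γ⁻¹ is the ambient derivative of γ multiplied by a smooth left
inverse of the differential of the embedding. That nothing is lost, although the derivative is only
a distribution, is `deriv_embL`. The chain rule then yields the cocycle identity R(γδ) = Ad_γ R(δ) +
R(γ), which is what makes the gauge formula an action.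

In a chart the 2-form is ω_A(θ·, θ·). Its exterior derivative vanishes by the Maurer–Cartan
equation, the Jacobi identity, invariance and integration by parts (`extDeriv_localForm`). It is
weakly nondegenerate because H^{α-1} and H^α separate each other under the pairing. The target map
is the second projection composed with the diffeomorphism (γ, A) ↦ (γ, γ·A), hence a submersion.
Multiplicativity is an algebraic identity (`omegaBilin_gauge_add`) once the derivatives of the
action and of the composition are known; it rests on Ad-invariance of the bilinear form, which
follows from infinitesimal invariance and connectedness of G. -/

noncomputable section

set_option linter.unusedSectionVars false

/-! ### Sobolev weights and their comparison under addition of frequencies -/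

section Weights

theorem one_add_sq_int_pos (k : ℤ) : (0 : ℝ) < 1 + (k : ℝ) ^ 2 := by positivity

theorem sobolevWeight_pos (σ : ℝ) (k : ℤ) : 0 < sobolevWeight σ k :=
  Real.rpow_pos_of_pos (one_add_sq_int_pos k) _

theorem sobolevWeight_add (σ τ : ℝ) (k : ℤ) :
    sobolevWeight (σ + τ) k = sobolevWeight σ k * sobolevWeight τ k := by
  simp only [sobolevWeight]
  rw [← Real.rpow_add (one_add_sq_int_pos k)]; congr 1; ring

theorem sobolevWeight_zero (k : ℤ) : sobolevWeight 0 k = 1 := by simp [sobolevWeight]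

theorem sobolevWeight_mul_neg (σ : ℝ) (k : ℤ) :
    sobolevWeight σ k * sobolevWeight (-σ) k = 1 := by
  rw [← sobolevWeight_add]; simp [sobolevWeight_zero]

theorem sobolevWeight_sq (σ : ℝ) (k : ℤ) :
    sobolevWeight σ k ^ 2 = (1 + (k : ℝ) ^ 2) ^ σ := by
  rw [sobolevWeight, ← Real.rpow_natCast, ← Real.rpow_mul (one_add_sq_int_pos k).le]
  congr 1; push_cast; ring

theorem sobolevWeight_neg_arg (σ : ℝ) (k : ℤ) : sobolevWeight σ (-k) = sobolevWeight σ k := by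
  simp [sobolevWeight]

theorem sobolevWeight_sub_comm (σ : ℝ) (k m : ℤ) :
    sobolevWeight σ (k - m) = sobolevWeight σ (m - k) := by
  rw [← sobolevWeight_neg_arg, neg_sub]

theorem sobolevWeight_mono {σ τ : ℝ} (h : σ ≤ τ) (k : ℤ) :
    sobolevWeight σ k ≤ sobolevWeight τ k := by
  apply Real.rpow_le_rpow_of_exponent_le
  · nlinarith [sq_nonneg (k : ℝ)]
  · linarith

/-- Since |k| ≤ 2 max(|m|, |k - m|), the base 1 + k² is at most four times the larger of the other
two bases; the constant is 4^{α/2} = 2^α. -/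
theorem sobolevWeight_le_add {α : ℝ} (hα : 0 ≤ α) (k m : ℤ) :
    sobolevWeight α k ≤ 2 ^ α * (sobolevWeight α m + sobolevWeight α (k - m)) := by
  have hX : (0 : ℝ) < 1 + (m : ℝ) ^ 2 := one_add_sq_int_pos m
  have hY : (0 : ℝ) < 1 + ((k - m : ℤ) : ℝ) ^ 2 := one_add_sq_int_pos (k - m)
  have h4 : ((4 : ℝ)) ^ (α / 2) = 2 ^ α := by
    rw [show (4 : ℝ) = 2 ^ (2 : ℝ) by norm_num, ← Real.rpow_mul (by norm_num)]
    congr 1; ring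
  have key : 1 + (k : ℝ) ^ 2 ≤ 4 * max (1 + (m : ℝ) ^ 2) (1 + ((k - m : ℤ) : ℝ) ^ 2) := by
    have h1 := le_max_left (1 + (m : ℝ) ^ 2) (1 + ((k - m : ℤ) : ℝ) ^ 2)
    have h2 := le_max_right (1 + (m : ℝ) ^ 2) (1 + ((k - m : ℤ) : ℝ) ^ 2)
    push_cast at *
    nlinarith [sq_nonneg ((k : ℝ) - 2 * m)]
  have h0 : (0 : ℝ) ≤ max (1 + (m : ℝ) ^ 2) (1 + ((k - m : ℤ) : ℝ) ^ 2) :=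
    hX.le.trans (le_max_left _ _)
  calc sobolevWeight α k
      ≤ (4 * max (1 + (m : ℝ) ^ 2) (1 + ((k - m : ℤ) : ℝ) ^ 2)) ^ (α / 2) :=
        Real.rpow_le_rpow (one_add_sq_int_pos k).le key (by linarith)
    _ = 2 ^ α * (max (1 + (m : ℝ) ^ 2) (1 + ((k - m : ℤ) : ℝ) ^ 2)) ^ (α / 2) := by
        rw [Real.mul_rpow (by norm_num) h0, h4]
    _ ≤ _ := by
        gcongr
        rcases max_cases (1 + (m : ℝ) ^ 2) (1 + ((k - m : ℤ) : ℝ) ^ 2) with h | h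
        · rw [h.1]; exact le_add_of_nonneg_right (sobolevWeight_pos _ _).le
        · rw [h.1]; exact le_add_of_nonneg_left (sobolevWeight_pos _ _).le

/-- With ⟨k⟩ = (1 + k²)^{1/2}, the ratio (⟨k⟩/⟨m⟩)^β is at most (⟨k⟩/⟨m⟩)^α or (⟨m⟩/⟨k⟩)^α,
according to which quotient is at least 1; this covers both signs of β. Each of these is expanded
with `sobolevWeight_le_add`. The three resulting terms are tailored to three different bounds for a
convolution. -/
theorem sobolevWeight_le_mul {α β : ℝ} (hβ : |β| ≤ α) (k m : ℤ) :
    sobolevWeight β k ≤ 2 ^ α * (sobolevWeight β m *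
      (2 + sobolevWeight α (k - m) * (sobolevWeight (-α) m + sobolevWeight (-α) k))) := by
  have hα : 0 ≤ α := (abs_nonneg β).trans hβ
  obtain ⟨hβ1, hβ2⟩ := abs_le.mp hβ
  have hX := one_add_sq_int_pos k
  have hY := one_add_sq_int_pos m
  have ratio : sobolevWeight β k * sobolevWeight (-β) m ≤
      sobolevWeight α k * sobolevWeight (-α) m + sobolevWeight α m * sobolevWeight (-α) k := by
    have e : ∀ (σ : ℝ) (a b : ℤ), sobolevWeight σ a * sobolevWeight (-σ) b =
        ((1 + (a : ℝ) ^ 2) / (1 + (b : ℝ) ^ 2)) ^ (σ / 2) := by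
      intro σ a b
      rw [Real.div_rpow (one_add_sq_int_pos a).le (one_add_sq_int_pos b).le, div_eq_mul_inv,
        ← Real.rpow_neg (one_add_sq_int_pos b).le, sobolevWeight, sobolevWeight, neg_div]
    rw [e, e, e]
    rcases le_total (1 + (m : ℝ) ^ 2) (1 + (k : ℝ) ^ 2) with h | h
    · refine le_add_of_le_of_nonneg ?_ (by positivity)
      exact Real.rpow_le_rpow_of_exponent_le ((one_le_div hY).2 h) (by linarith)
    · refine le_add_of_nonneg_of_le (by positivity) ?_
      rw [show ((1 + (k : ℝ) ^ 2) / (1 + (m : ℝ) ^ 2)) ^ (β / 2) =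
        ((1 + (m : ℝ) ^ 2) / (1 + (k : ℝ) ^ 2)) ^ (-β / 2) by
          rw [← inv_div (1 + (m : ℝ) ^ 2), Real.inv_rpow (by positivity), neg_div,
            Real.rpow_neg (by positivity)]]
      exact Real.rpow_le_rpow_of_exponent_le ((one_le_div hX).2 h) (by linarith)
  have h1 := sobolevWeight_le_add hα k m
  have h2 := sobolevWeight_le_add hα m k
  rw [sobolevWeight_sub_comm α m k] at h2
  have p1 := sobolevWeight_pos (-α) m
  have p2 := sobolevWeight_pos (-α) k
  have q1 := sobolevWeight_mul_neg α m
  have q2 := sobolevWeight_mul_neg α k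
  have e1 : sobolevWeight β k = sobolevWeight β m * (sobolevWeight β k * sobolevWeight (-β) m) := by
    have := sobolevWeight_mul_neg β m
    linear_combination (-sobolevWeight β k) * this
  have p3 := sobolevWeight_pos β m
  rw [e1, mul_left_comm ((2 : ℝ) ^ α)]
  refine mul_le_mul_of_nonneg_left (ratio.trans ?_) p3.le
  have h1' := mul_le_mul_of_nonneg_right h1 p1.le
  have h2' := mul_le_mul_of_nonneg_right h2 p2.le
  have : (2 : ℝ) ^ α * (2 + sobolevWeight α (k - m) * (sobolevWeight (-α) m + sobolevWeight (-α) k))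
      = 2 ^ α * (sobolevWeight α m + sobolevWeight α (k - m)) * sobolevWeight (-α) m
       + 2 ^ α * (sobolevWeight α k + sobolevWeight α (k - m)) * sobolevWeight (-α) k := by
    linear_combination (-(2 : ℝ) ^ α) * (q1 + q2)
  linarith

theorem summable_sobolevWeight_neg_sq {α : ℝ} (hα : 1 / 2 < α) :
    Summable fun k : ℤ => sobolevWeight (-α) k ^ 2 := by
  have h := Real.summable_abs_int_rpow (b := 2 * α) (by linarith)
  -- The comparison series |k|^{-2α} has the value 0 at k = 0, so a unit mass is added there to
  -- dominate the weight.
  have h' := h.add (hasSum_ite_eq (0 : ℤ) (1 : ℝ)).summable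
  refine Summable.of_nonneg_of_le (fun k => by positivity) (fun k => ?_) h'
  rw [sobolevWeight_sq]
  by_cases hk : k = 0
  · subst hk
    have : (0 : ℝ) ≤ |((0 : ℤ) : ℝ)| ^ (-(2 * α)) := by positivity
    simp only [Int.cast_zero, if_true]
    simp
    positivity
  · simp only [hk, if_false, add_zero]
    rw [show -(2 * α) = 2 * (-α) by ring, Real.rpow_mul (abs_nonneg _)]
    refine Real.rpow_le_rpow_of_nonpos ?_ ?_ (by linarith)
    · have : (k : ℝ) ≠ 0 := by exact_mod_cast hk
      positivity
    · rw [Real.rpow_two, sq_abs]; linarith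

end Weights

/-! ### Convolution inequalities in [0, ∞] -/

section ConvolutionBounds

open scoped ENNReal

theorem ENNReal.two_mul_mul_le_sq_add_sq (x y : ℝ≥0∞) : 2 * (x * y) ≤ x ^ 2 + y ^ 2 := by
  rcases eq_or_ne x ⊤ with rfl | hx
  · simp
  rcases eq_or_ne y ⊤ with rfl | hy
  · simp
  lift x to NNReal using hx
  lift y to NNReal using hy
  norm_cast
  have := two_mul_le_add_sq x y
  rw [← mul_assoc]; exact this

/-- Cauchy–Schwarz, by summing 2(x_m y_l)(x_l y_m) ≤ (x_m y_l)² + (x_l y_m)² over all pairs. Working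
in [0, ∞] removes every summability condition. -/
theorem ENNReal.tsum_mul_sq_le {ι : Type*} (x y : ι → ℝ≥0∞) :
    (∑' m, x m * y m) ^ 2 ≤ (∑' m, x m ^ 2) * ∑' m, y m ^ 2 := by
  have h : 2 * (∑' m, x m * y m) ^ 2 ≤ 2 * ((∑' m, x m ^ 2) * ∑' m, y m ^ 2) := by
    calc 2 * (∑' m, x m * y m) ^ 2
        = ∑' m, ∑' l, 2 * ((x m * y l) * (x l * y m)) := by
          rw [sq, ← ENNReal.tsum_mul_right, ← ENNReal.tsum_mul_left]
          refine tsum_congr fun m => ?_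
          rw [← ENNReal.tsum_mul_left, ← ENNReal.tsum_mul_left]
          refine tsum_congr fun l => ?_
          ring
      _ ≤ ∑' m, ∑' l, ((x m * y l) ^ 2 + (x l * y m) ^ 2) :=
          ENNReal.tsum_le_tsum fun m => ENNReal.tsum_le_tsum fun l =>
            ENNReal.two_mul_mul_le_sq_add_sq _ _
      _ = (∑' m, ∑' l, x m ^ 2 * y l ^ 2) + ∑' m, ∑' l, x l ^ 2 * y m ^ 2 := by
          simp only [ENNReal.tsum_add, mul_pow]
      _ = _ := by
          rw [ENNReal.tsum_comm (f := fun m l => x l ^ 2 * y m ^ 2), ← two_mul]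
          simp only [ENNReal.tsum_mul_left, ENNReal.tsum_mul_right]
  exact (ENNReal.mul_le_mul_iff_right (by simp) (by simp)).1 h

/-- Cauchy–Schwarz for the measure with masses x m, applied to the functions y and 1. -/
theorem ENNReal.tsum_mul_sq_le' {ι : Type*} (x y : ι → ℝ≥0∞) :
    (∑' m, x m * y m) ^ 2 ≤ (∑' m, x m) * ∑' m, x m * y m ^ 2 := by
  have h : 2 * (∑' m, x m * y m) ^ 2 ≤ 2 * ((∑' m, x m) * ∑' m, x m * y m ^ 2) := by
    calc 2 * (∑' m, x m * y m) ^ 2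
        = ∑' m, ∑' l, x m * x l * (2 * (y m * y l)) := by
          rw [sq, ← ENNReal.tsum_mul_right, ← ENNReal.tsum_mul_left]
          refine tsum_congr fun m => ?_
          rw [← ENNReal.tsum_mul_left, ← ENNReal.tsum_mul_left]
          refine tsum_congr fun l => ?_
          ring
      _ ≤ ∑' m, ∑' l, x m * x l * (y m ^ 2 + y l ^ 2) :=
          ENNReal.tsum_le_tsum fun m => ENNReal.tsum_le_tsum fun l => by
            gcongr; exact ENNReal.two_mul_mul_le_sq_add_sq _ _
      _ = (∑' m, ∑' l, x l * (x m * y m ^ 2)) + ∑' m, ∑' l, x m * (x l * y l ^ 2) := by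
          rw [← ENNReal.tsum_add]
          refine tsum_congr fun m => ?_
          rw [← ENNReal.tsum_add]
          refine tsum_congr fun l => ?_
          ring
      _ = _ := by
          rw [ENNReal.tsum_comm (f := fun m l => x l * (x m * y m ^ 2)), ← two_mul]
          simp only [ENNReal.tsum_mul_left, ENNReal.tsum_mul_right]
  exact (ENNReal.mul_le_mul_iff_right (by simp) (by simp)).1 h

theorem ENNReal.tsum_int_sub_left (f : ℤ → ℝ≥0∞) (k : ℤ) : ∑' m, f (k - m) = ∑' m, f m :=
  (Equiv.subLeft k).tsum_eq f

theorem ENNReal.tsum_int_sub_right (f : ℤ → ℝ≥0∞) (m : ℤ) : ∑' k, f (k - m) = ∑' k, f k :=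
  (Equiv.subRight m).tsum_eq f

/-- Young's inequality ℓ¹ ∗ ℓ² ⊆ ℓ²: weighted Cauchy–Schwarz with weights a (k - m), followed by
Tonelli. -/
theorem ENNReal.tsum_conv_sq_le (a b : ℤ → ℝ≥0∞) :
    ∑' k, (∑' m, a (k - m) * b m) ^ 2 ≤ (∑' k, a k) ^ 2 * ∑' k, b k ^ 2 := by
  calc ∑' k, (∑' m, a (k - m) * b m) ^ 2
      ≤ ∑' k, (∑' m, a m) * ∑' m, a (k - m) * b m ^ 2 :=
        ENNReal.tsum_le_tsum fun k => by
          have := ENNReal.tsum_mul_sq_le' (fun m => a (k - m)) b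
          rwa [ENNReal.tsum_int_sub_left] at this
    _ = (∑' m, a m) * ∑' m, ∑' k, a (k - m) * b m ^ 2 := by
        rw [ENNReal.tsum_mul_left, ENNReal.tsum_comm]
    _ = _ := by
        simp only [ENNReal.tsum_mul_right, ENNReal.tsum_int_sub_right]
        rw [ENNReal.tsum_mul_left]; ring

theorem ENNReal.conv_comm (a b : ℤ → ℝ≥0∞) (k : ℤ) :
    ∑' m, a (k - m) * b m = ∑' m, b (k - m) * a m := by
  rw [← ENNReal.tsum_int_sub_left _ k]
  refine tsum_congr fun m => ?_
  simp only [_root_.sub_sub_cancel, mul_comm]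

theorem ENNReal.add_add_sq_le (x y z : ℝ≥0∞) : (x + y + z) ^ 2 ≤ 3 * (x ^ 2 + y ^ 2 + z ^ 2) := by
  have h1 := ENNReal.two_mul_mul_le_sq_add_sq x y
  have h2 := ENNReal.two_mul_mul_le_sq_add_sq y z
  have h3 := ENNReal.two_mul_mul_le_sq_add_sq x z
  calc (x + y + z) ^ 2 = x ^ 2 + y ^ 2 + z ^ 2 + (2 * (x * y) + 2 * (y * z) + 2 * (x * z)) := by ring
    _ ≤ x ^ 2 + y ^ 2 + z ^ 2 + ((x ^ 2 + y ^ 2) + (y ^ 2 + z ^ 2) + (x ^ 2 + z ^ 2)) := by gcongr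
    _ = _ := by ring

/-- The square of the Sobolev norm of a sequence of Fourier coefficients, in `[0, ∞]`. -/
def sobolevENorm (σ : ℝ) (c : ℤ → ℂ) : ℝ≥0∞ :=
  ∑' k, (ENNReal.ofReal (sobolevWeight σ k) * ‖c k‖ₑ) ^ 2

theorem ENNReal.ofReal_sobolevWeight_mul_neg (σ : ℝ) (k : ℤ) :
    ENNReal.ofReal (sobolevWeight (-σ) k) * ENNReal.ofReal (sobolevWeight σ k) = 1 := by
  rw [← ENNReal.ofReal_mul (sobolevWeight_pos _ _).le, mul_comm, sobolevWeight_mul_neg]; simp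

/-- `∑ (1 + k²)^{-α}`. -/
def weightSum (α : ℝ) : ℝ≥0∞ := ∑' k, ENNReal.ofReal (sobolevWeight (-α) k) ^ 2

theorem weightSum_ne_top {α : ℝ} (hα : 1 / 2 < α) : weightSum α ≠ ⊤ := by
  have := (summable_sobolevWeight_neg_sq hα).tsum_ofReal_ne_top
  simpa only [weightSum, ENNReal.ofReal_pow (sobolevWeight_pos _ _).le] using this

/-- Cauchy–Schwarz after inserting 1 = ⟨k⟩^{-α}⟨k⟩^α. The weight sum is finite for α > 1/2, so the
Fourier series of H^α functions converge absolutely. -/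
theorem tsum_enorm_sq_le (α : ℝ) (c : ℤ → ℂ) :
    (∑' k, ‖c k‖ₑ) ^ 2 ≤ weightSum α * sobolevENorm α c := by
  refine le_trans (le_of_eq ?_) (ENNReal.tsum_mul_sq_le _ _)
  congr 1
  refine tsum_congr fun k => ?_
  rw [← mul_assoc, ENNReal.ofReal_sobolevWeight_mul_neg, one_mul]

/-- The product estimate H^α · H^β ⊆ H^β. `sobolevWeight_le_mul` splits the weighted convolution
into three sums: in the first a is in ℓ¹, in the second the weighted b times ⟨m⟩^{-α} is in ℓ¹, so
Young's inequality applies to both; in the third the convolution is bounded uniformly by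
Cauchy–Schwarz and the outer factor ⟨k⟩^{-α} is square summable. The constant 18 is 3 · (4 + 1 + 1).
-/
theorem sobolevENorm_conv_le {α β : ℝ} (hβ : |β| ≤ α) (a b : ℤ → ℂ) :
    ∑' k, (ENNReal.ofReal (sobolevWeight β k) * ∑' m, ‖a (k - m)‖ₑ * ‖b m‖ₑ) ^ 2 ≤
      ENNReal.ofReal (2 ^ α) ^ 2 * 18 * weightSum α * sobolevENorm α a * sobolevENorm β b := by
  set w : ℝ → ℤ → ℝ≥0∞ := fun σ k => ENNReal.ofReal (sobolevWeight σ k) with hw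
  set A : ℤ → ℝ≥0∞ := fun k => w α k * ‖a k‖ₑ
  set B : ℤ → ℝ≥0∞ := fun k => w β k * ‖b k‖ₑ
  set K := weightSum α
  have hwle : ∀ k m, w β k ≤ ENNReal.ofReal (2 ^ α) *
      (w β m * (2 + w α (k - m) * (w (-α) m + w (-α) k))) := by
    intro k m
    have p := sobolevWeight_pos
    have := ENNReal.ofReal_le_ofReal (sobolevWeight_le_mul hβ k m)
    rwa [ENNReal.ofReal_mul (by positivity), ENNReal.ofReal_mul (p _ _).le,
      ENNReal.ofReal_add (by norm_num) (mul_nonneg (p _ _).le (add_pos (p _ _) (p _ _)).le),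
      ENNReal.ofReal_mul (p _ _).le, ENNReal.ofReal_add (p _ _).le (p _ _).le,
      ENNReal.ofReal_ofNat] at this
  have step : ∀ k, w β k * ∑' m, ‖a (k - m)‖ₑ * ‖b m‖ₑ ≤ ENNReal.ofReal (2 ^ α) *
      (2 * (∑' m, ‖a (k - m)‖ₑ * B m) + (∑' m, A (k - m) * (w (-α) m * B m)) +
        w (-α) k * ∑' m, A (k - m) * B m) := by
    intro k
    simp only [← ENNReal.tsum_mul_left, ← ENNReal.tsum_add]
    refine ENNReal.tsum_le_tsum fun m => ?_
    calc w β k * (‖a (k - m)‖ₑ * ‖b m‖ₑ) ≤ (ENNReal.ofReal (2 ^ α) *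
          (w β m * (2 + w α (k - m) * (w (-α) m + w (-α) k)))) * (‖a (k - m)‖ₑ * ‖b m‖ₑ) := by
          gcongr; exact hwle k m
      _ = _ := by simp only [A, B]; ring
  have hA : ∑' k, A k ^ 2 = sobolevENorm α a := rfl
  have hB : ∑' k, B k ^ 2 = sobolevENorm β b := rfl
  have t1 : ∑' k, (∑' m, ‖a (k - m)‖ₑ * B m) ^ 2 ≤ K * sobolevENorm α a * sobolevENorm β b := by
    refine (ENNReal.tsum_conv_sq_le (fun k => ‖a k‖ₑ) B).trans ?_
    rw [hB]; gcongr; exact tsum_enorm_sq_le α a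
  have t2 : ∑' k, (∑' m, A (k - m) * (w (-α) m * B m)) ^ 2 ≤
      K * sobolevENorm α a * sobolevENorm β b := by
    have : ∀ k, ∑' m, A (k - m) * (w (-α) m * B m) = ∑' m, (w (-α) (k - m) * B (k - m)) * A m :=
      fun k => ENNReal.conv_comm A (fun m => w (-α) m * B m) k
    simp only [this]
    refine (ENNReal.tsum_conv_sq_le (fun m => w (-α) m * B m) A).trans ?_
    rw [hA, mul_right_comm K]; gcongr
    exact (ENNReal.tsum_mul_sq_le _ _)
  have t3 : ∑' k, (w (-α) k * ∑' m, A (k - m) * B m) ^ 2 ≤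
      K * sobolevENorm α a * sobolevENorm β b := by
    have : ∀ k, (w (-α) k * ∑' m, A (k - m) * B m) ^ 2 ≤
        w (-α) k ^ 2 * (sobolevENorm α a * sobolevENorm β b) := by
      intro k
      rw [mul_pow]; gcongr
      refine (ENNReal.tsum_mul_sq_le _ _).trans ?_
      rw [hB, ENNReal.tsum_int_sub_left (fun m => A m ^ 2), hA]
    refine (ENNReal.tsum_le_tsum this).trans ?_
    rw [ENNReal.tsum_mul_right, mul_assoc]; rfl
  calc _ ≤ ∑' k, ENNReal.ofReal (2 ^ α) ^ 2 * (3 * ((2 * (∑' m, ‖a (k - m)‖ₑ * B m)) ^ 2 +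
        (∑' m, A (k - m) * (w (-α) m * B m)) ^ 2 + (w (-α) k * ∑' m, A (k - m) * B m) ^ 2)) := by
        refine ENNReal.tsum_le_tsum fun k => ?_
        calc _ ≤ _ := pow_le_pow_left' (step k) 2
          _ ≤ _ := by rw [mul_pow]; gcongr; exact ENNReal.add_add_sq_le _ _ _
    _ = ENNReal.ofReal (2 ^ α) ^ 2 * (3 * (4 * (∑' k, (∑' m, ‖a (k - m)‖ₑ * B m) ^ 2) +
        (∑' k, (∑' m, A (k - m) * (w (-α) m * B m)) ^ 2) +
          ∑' k, (w (-α) k * ∑' m, A (k - m) * B m) ^ 2)) := by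
        have e4 : ∀ x : ℝ≥0∞, (2 * x) ^ 2 = 4 * x ^ 2 := fun x => by ring
        simp only [ENNReal.tsum_mul_left, ENNReal.tsum_add, e4]
    _ ≤ ENNReal.ofReal (2 ^ α) ^ 2 * (3 * (4 * (K * sobolevENorm α a * sobolevENorm β b) +
        (K * sobolevENorm α a * sobolevENorm β b) + K * sobolevENorm α a * sobolevENorm β b)) := by
        gcongr
    _ = _ := by ring

end ConvolutionBounds

/-! ### Scalar distributions: norms, algebra structure, derivative -/

section Scalars

open scoped ENNReal

variable {σ α β : ℝ} {n : ℕ}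

namespace SobolevSpace

theorem ext_coeff {u v : SobolevSpace σ n} (h : ∀ k i, u.coeff k i = v.coeff k i) : u = v := by
  apply Subtype.ext
  funext k
  ext i
  exact h k i

@[simp] theorem coeff_add (u v : SobolevSpace σ n) : (u + v).coeff = u.coeff + v.coeff := rfl
@[simp] theorem coeff_zero : (0 : SobolevSpace σ n).coeff = 0 := rfl
@[simp] theorem coeff_smul (r : ℝ) (u : SobolevSpace σ n) : (r • u).coeff = r • u.coeff := rfl

theorem coeff_conj (u : SobolevSpace σ n) (k : ℤ) (i : Fin n) :
    u.coeff (-k) i = (starRingEnd ℂ) (u.coeff k i) := u.2.1 k i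

theorem hasSum_norm_sq (u : SobolevSpace σ n) :
    HasSum (fun k => (sobolevWeight σ k * ‖u.coeff k‖) ^ 2) (‖u‖ ^ 2) := by
  have h := lp.hasSum_norm (p := 2) (by norm_num) (toLp u)
  simp only [ENNReal.toReal_ofNat, Real.rpow_two] at h
  have e : ∀ k, ‖(toLp u : ∀ _ : ℤ, EuclideanSpace ℂ (Fin n)) k‖ =
      sobolevWeight σ k * ‖u.coeff k‖ := by
    intro k
    change ‖sobolevWeight σ k • u.1 k‖ = _
    rw [norm_smul, Real.norm_of_nonneg (sobolevWeight_pos σ k).le]; rfl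
  simp only [e] at h
  exact h

/-- The element of the Sobolev space with the given Fourier coefficients. -/
def ofCoeff (c : FourierSeq n) (hc : ∀ k i, c (-k) i = (starRingEnd ℂ) (c k i))
    (h : Summable fun k => (sobolevWeight σ k * ‖c k‖) ^ 2) : SobolevSpace σ n :=
  ⟨c, hc, by
    rw [memℓp_gen_iff (by norm_num)]
    simpa only [norm_smul, Real.norm_of_nonneg (sobolevWeight_pos σ _).le, ENNReal.toReal_ofNat,
      Real.rpow_two] using h⟩

@[simp] theorem coeff_ofCoeff (c : FourierSeq n) (hc) (h) :
    (ofCoeff (σ := σ) c hc h).coeff = c := rfl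

end SobolevSpace

/-- The Sobolev space of scalar distributions on the circle. -/
abbrev Sc (σ : ℝ) : Type := SobolevSpace σ 1

namespace Sc

/-- The Fourier coefficients of a scalar distribution. -/
def c (a : Sc σ) (k : ℤ) : ℂ := a.coeff k 0

@[simp] theorem c_add (a b : Sc σ) (k : ℤ) : (a + b).c k = a.c k + b.c k := rfl
@[simp] theorem c_sub (a b : Sc σ) (k : ℤ) : (a - b).c k = a.c k - b.c k := rfl
@[simp] theorem c_zero (k : ℤ) : (0 : Sc σ).c k = 0 := rfl
@[simp] theorem c_smul (r : ℝ) (a : Sc σ) (k : ℤ) : (r • a).c k = r * a.c k := by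
  simp [c]

theorem ext_c {a b : Sc σ} (h : ∀ k, a.c k = b.c k) : a = b :=
  SobolevSpace.ext_coeff fun k i => by rw [Subsingleton.elim i 0]; exact h k

theorem c_conj (a : Sc σ) (k : ℤ) : a.c (-k) = (starRingEnd ℂ) (a.c k) := a.coeff_conj k 0

theorem norm_coeff_eq (x : EuclideanSpace ℂ (Fin 1)) : ‖x‖ = ‖x 0‖ := by
  rw [EuclideanSpace.norm_eq]; simp

theorem hasSum_norm_sq (a : Sc σ) :
    HasSum (fun k => (sobolevWeight σ k * ‖a.c k‖) ^ 2) (‖a‖ ^ 2) := by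
  have := SobolevSpace.hasSum_norm_sq a
  simp only [norm_coeff_eq] at this
  exact this

theorem ofReal_mul_enorm (σ : ℝ) (k : ℤ) (z : ℂ) :
    (ENNReal.ofReal (sobolevWeight σ k) * ‖z‖ₑ) ^ 2 =
      ENNReal.ofReal ((sobolevWeight σ k * ‖z‖) ^ 2) := by
  rw [ENNReal.ofReal_pow (by have := sobolevWeight_pos σ k; positivity),
    ENNReal.ofReal_mul (sobolevWeight_pos σ k).le, ofReal_norm]

theorem sobolevENorm_eq (a : Sc σ) : sobolevENorm σ a.c = ENNReal.ofReal (‖a‖ ^ 2) := by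
  simp only [sobolevENorm, ofReal_mul_enorm]
  rw [← ENNReal.ofReal_tsum_of_nonneg (fun k => sq_nonneg _) a.hasSum_norm_sq.summable,
    a.hasSum_norm_sq.tsum_eq]

theorem sobolevENorm_ne_top (a : Sc σ) : sobolevENorm σ a.c ≠ ⊤ := by
  rw [sobolevENorm_eq]; exact ENNReal.ofReal_ne_top

/-- The scalar distribution with the given Fourier coefficients. -/
def ofC (c : ℤ → ℂ) (hc : ∀ k, c (-k) = (starRingEnd ℂ) (c k)) (h : sobolevENorm σ c ≠ ⊤) : Sc σ :=
  SobolevSpace.ofCoeff (fun k => WithLp.toLp 2 fun _ => c k) (fun k _ => hc k) (by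
    simp only [norm_coeff_eq]
    have h' : (∑' k, ENNReal.ofReal ((sobolevWeight σ k * ‖c k‖) ^ 2)) ≠ ⊤ := by
      simpa only [sobolevENorm, ofReal_mul_enorm] using h
    have := ENNReal.summable_toReal h'
    simpa only [ENNReal.toReal_ofReal (sq_nonneg _)] using this)

@[simp] theorem c_ofC (c : ℤ → ℂ) (hc) (h : sobolevENorm σ c ≠ ⊤) (k : ℤ) :
    (ofC c hc h).c k = c k := rfl

theorem norm_le_of_sobolevENorm_le (a : Sc σ) {C : ℝ} (hC : 0 ≤ C)
    (h : sobolevENorm σ a.c ≤ ENNReal.ofReal (C ^ 2)) : ‖a‖ ≤ C := by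
  rw [sobolevENorm_eq, ENNReal.ofReal_le_ofReal_iff (sq_nonneg C)] at h
  exact (sq_le_sq₀ (norm_nonneg a) hC).1 h

theorem norm_c_le (a : Sc σ) (k : ℤ) : ‖a.c k‖ ≤ sobolevWeight (-σ) k * ‖a‖ := by
  have h := le_hasSum a.hasSum_norm_sq k (fun j _ => sq_nonneg _)
  have h1 := (sq_le_sq₀ (mul_nonneg (sobolevWeight_pos σ k).le (norm_nonneg _)) (norm_nonneg a)).1 h
  have h2 := mul_le_mul_of_nonneg_left h1 (sobolevWeight_pos (-σ) k).le
  rwa [← mul_assoc, mul_comm (sobolevWeight (-σ) k), sobolevWeight_mul_neg, one_mul] at h2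

/-- The `k`-th Fourier coefficient as a continuous linear functional. -/
def cL (k : ℤ) : Sc σ →L[ℝ] ℂ :=
  LinearMap.mkContinuous ⟨⟨fun a => a.c k, fun a b => c_add a b k⟩, fun r a => by simp⟩
    (sobolevWeight (-σ) k) fun a => a.norm_c_le k

@[simp] theorem cL_apply (k : ℤ) (a : Sc σ) : cL k a = a.c k := rfl

/-- The integral over the circle. -/
def int : Sc σ →L[ℝ] ℝ := Complex.reCLM.comp (cL 0)

theorem int_apply (a : Sc σ) : int a = (a.c 0).re := rfl

theorem c_zero_eq_int (a : Sc σ) : a.c 0 = (int a : ℂ) := by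
  have := a.c_conj 0
  rw [neg_zero] at this
  exact ((Complex.conj_eq_iff_re).1 this.symm).symm

end Sc

/-! ### Products -/

namespace Sc

/-- A finite weighted ℓ² sum has finite terms, and the weights are positive; so the convolution
series converge absolutely, even when b is only a distribution. -/
theorem tsum_enorm_conv_ne_top (hα : 1 / 2 < α) (hβ : |β| ≤ α) (a : Sc α) (b : Sc β) (k : ℤ) :
    ∑' m, ‖a.c (k - m)‖ₑ * ‖b.c m‖ₑ ≠ ⊤ := by
  have h := sobolevENorm_conv_le hβ a.c b.c
  have h2 : ∑' k, (ENNReal.ofReal (sobolevWeight β k) * ∑' m, ‖a.c (k - m)‖ₑ * ‖b.c m‖ₑ) ^ 2 ≠ ⊤ := by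
    refine ne_top_of_le_ne_top ?_ h
    have := weightSum_ne_top hα
    have := a.sobolevENorm_ne_top
    have := b.sobolevENorm_ne_top
    finiteness
  have h3 := ENNReal.ne_top_of_tsum_ne_top h2 k
  intro htop
  rw [htop, ENNReal.mul_top] at h3
  · simp at h3
  · simpa using sobolevWeight_pos β k

theorem summable_conv (hα : 1 / 2 < α) (hβ : |β| ≤ α) (a : Sc α) (b : Sc β) (k : ℤ) :
    Summable fun m => a.c (k - m) * b.c m := by
  have := tsum_enorm_conv_ne_top hα hβ a b k
  apply Summable.of_norm
  have := ENNReal.summable_toReal this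
  simpa using this

/-- The square root of the constant in the estimate for products. -/
def mulConst (α : ℝ) : ℝ := Real.sqrt (ENNReal.ofReal (2 ^ α) ^ 2 * 18 * weightSum α).toReal

theorem sobolevENorm_mul_le (hα : 1 / 2 < α) (hβ : |β| ≤ α) (a : Sc α) (b : Sc β) :
    sobolevENorm β (fun k => ∑' m, a.c (k - m) * b.c m) ≤
      ENNReal.ofReal ((mulConst α * ‖a‖ * ‖b‖) ^ 2) := by
  have h := sobolevENorm_conv_le hβ a.c b.c
  have hK : ENNReal.ofReal (2 ^ α) ^ 2 * 18 * weightSum α ≠ ⊤ := by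
    have := weightSum_ne_top hα
    finiteness
  calc _ ≤ ∑' k, (ENNReal.ofReal (sobolevWeight β k) * ∑' m, ‖a.c (k - m)‖ₑ * ‖b.c m‖ₑ) ^ 2 := by
        refine ENNReal.tsum_le_tsum fun k => ?_
        gcongr
        refine enorm_tsum_le_tsum_enorm.trans (le_of_eq ?_)
        simp
    _ ≤ _ := h
    _ = _ := by
        rw [sobolevENorm_eq, sobolevENorm_eq, mul_pow, mul_pow, mulConst,
          Real.sq_sqrt ENNReal.toReal_nonneg, ENNReal.ofReal_mul (by positivity),
          ENNReal.ofReal_mul (by positivity), ENNReal.ofReal_toReal hK]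

/-- The product of a function of class `α > 1/2` and a distribution of class `β`, `|β| ≤ α`. -/
def mulFun (hα : 1 / 2 < α) (hβ : |β| ≤ α) (a : Sc α) (b : Sc β) : Sc β :=
  ofC (fun k => ∑' m, a.c (k - m) * b.c m) (fun k => by
    rw [Complex.conj_tsum, ← (Equiv.neg ℤ).tsum_eq]
    refine tsum_congr fun m => ?_
    rw [map_mul, ← c_conj, ← c_conj]
    simp only [Equiv.neg_apply]
    congr 2; ring)
    (ne_top_of_le_ne_top ENNReal.ofReal_ne_top (sobolevENorm_mul_le hα hβ a b))

theorem c_mulFun (hα : 1 / 2 < α) (hβ : |β| ≤ α) (a : Sc α) (b : Sc β) (k : ℤ) :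
    (mulFun hα hβ a b).c k = ∑' m, a.c (k - m) * b.c m := rfl

/-- Multiplication as a continuous bilinear map. -/
def mulL (hα : 1 / 2 < α) (hβ : |β| ≤ α) : Sc α →L[ℝ] Sc β →L[ℝ] Sc β :=
  LinearMap.mkContinuous₂
    (LinearMap.mk₂ ℝ (mulFun hα hβ)
      (fun a a' b => ext_c fun k => by
        simp only [c_add, c_mulFun, add_mul]
        exact (summable_conv hα hβ a b k).tsum_add (summable_conv hα hβ a' b k))
      (fun r a b => ext_c fun k => by
        simp only [c_smul, c_mulFun, mul_assoc, tsum_mul_left])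
      (fun a b b' => ext_c fun k => by
        simp only [c_add, c_mulFun, mul_add]
        exact (summable_conv hα hβ a b k).tsum_add (summable_conv hα hβ a b' k))
      (fun r a b => ext_c fun k => by
        simp only [c_smul, c_mulFun, mul_left_comm _ (r : ℂ), tsum_mul_left]))
    (mulConst α) fun a b => norm_le_of_sobolevENorm_le _
      (mul_nonneg (mul_nonneg (Real.sqrt_nonneg _) (norm_nonneg _)) (norm_nonneg _))
      (sobolevENorm_mul_le hα hβ a b)

theorem c_mulL (hα : 1 / 2 < α) (hβ : |β| ≤ α) (a : Sc α) (b : Sc β) (k : ℤ) :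
    (mulL hα hβ a b).c k = ∑' m, a.c (k - m) * b.c m := rfl

theorem mulL_comm (hα : 1 / 2 < α) (a b : Sc α) (h : |α| ≤ α) : mulL hα h a b = mulL hα h b a :=
  ext_c fun k => by
    rw [c_mulL, c_mulL, ← (Equiv.subLeft k).tsum_eq]
    refine tsum_congr fun m => ?_
    simp only [Equiv.subLeft_apply, sub_sub_cancel, mul_comm]

/-- The distribution whose Fourier coefficients are the absolute values of those of `a`. -/
def absC (a : Sc σ) : Sc σ := ofC (fun k => (‖a.c k‖ : ℂ)) (fun k => by simp [c_conj])
  (by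
    have := a.sobolevENorm_ne_top
    have e : ∀ z : ℂ, ‖((‖z‖ : ℝ) : ℂ)‖ₑ = ‖z‖ₑ := fun z => by
      rw [← ofReal_norm, Complex.norm_real, norm_norm, ofReal_norm]
    simpa only [sobolevENorm, e] using this)

theorem c_absC (a : Sc σ) (k : ℤ) : a.absC.c k = ‖a.c k‖ := rfl

theorem enorm_c_mulL_absC (hα : 1 / 2 < α) (hβ : |β| ≤ α) (b : Sc α) (d : Sc β) (m : ℤ) :
    ‖(mulL hα hβ b.absC d.absC).c m‖ₑ = ∑' l, ‖b.c (m - l)‖ₑ * ‖d.c l‖ₑ := by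
  rw [c_mulL]
  have e1 : ∀ l, b.absC.c (m - l) * d.absC.c l = ((‖b.c (m - l)‖ * ‖d.c l‖ : ℝ) : ℂ) := by
    intro l; rw [c_absC, c_absC, Complex.ofReal_mul]
  have hs : Summable fun l => ‖b.c (m - l)‖ * ‖d.c l‖ := by
    have := (summable_conv hα hβ b d m).norm
    simpa only [norm_mul] using this
  simp only [e1]
  rw [← Complex.ofReal_tsum, ← ofReal_norm, Complex.norm_real,
    Real.norm_of_nonneg (tsum_nonneg fun l => by positivity),
    ENNReal.ofReal_tsum_of_nonneg (fun l => by positivity) hs]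
  refine tsum_congr fun l => ?_
  rw [ENNReal.ofReal_mul (norm_nonneg _), ofReal_norm, ofReal_norm]

/-- The product of `absC b` and `absC d` lies in H^β again, and its coefficients are the inner sums
of norms. One more application of the single-convolution bound gives the absolute convergence of the
double series that Fubini needs for associativity. -/
theorem tsum_enorm_conv_conv_ne_top (hα : 1 / 2 < α) (hβ : |β| ≤ α) (a b : Sc α) (d : Sc β)
    (k : ℤ) : ∑' m, ∑' l, ‖a.c (k - m)‖ₑ * (‖b.c (m - l)‖ₑ * ‖d.c l‖ₑ) ≠ ⊤ := by
  have := tsum_enorm_conv_ne_top hα hβ a (mulL hα hβ b.absC d.absC) k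
  simpa only [enorm_c_mulL_absC, ← ENNReal.tsum_mul_left] using this

theorem summable_of_tsum_enorm_ne_top {f : ℤ → ℤ → ℂ} (h : ∑' m, ∑' l, ‖f m l‖ₑ ≠ ⊤) :
    Summable fun p : ℤ × ℤ => f p.1 p.2 := by
  apply Summable.of_norm
  rw [← ENNReal.tsum_prod' (f := fun p : ℤ × ℤ => ‖f p.1 p.2‖ₑ)] at h
  exact ENNReal.summable_toReal h

theorem tsum_conv_assoc {a b d : ℤ → ℂ} (k : ℤ)
    (h : ∑' m, ∑' l, ‖a (k - m)‖ₑ * (‖b (m - l)‖ₑ * ‖d l‖ₑ) ≠ ⊤) :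
    ∑' m, (∑' l, a (k - m - l) * b l) * d m = ∑' m, a (k - m) * ∑' l, b (m - l) * d l := by
  have hsum : Summable fun p : ℤ × ℤ => a (k - p.1) * (b (p.1 - p.2) * d p.2) :=
    summable_of_tsum_enorm_ne_top (f := fun m l => a (k - m) * (b (m - l) * d l))
      (by simpa only [enorm_mul] using h)
  have e1 : ∀ m, a (k - m) * ∑' l, b (m - l) * d l =
      ∑' l, a (k - m) * (b (m - l) * d l) := fun m => by rw [tsum_mul_left]
  have e2 : ∀ l, (∑' m, a (k - l - m) * b m) * d l =
      ∑' m, a (k - m) * (b (m - l) * d l) := fun l => by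
    rw [← tsum_mul_right, ← (Equiv.subRight l).tsum_eq (fun m => a (k - l - m) * b m * d l)]
    refine tsum_congr fun m => ?_
    rw [Equiv.subRight_apply, show k - l - (m - l) = k - m by ring, mul_assoc]
  rw [tsum_congr e1, tsum_congr e2]
  exact Summable.tsum_comm (f := fun m l => a (k - m) * (b (m - l) * d l)) hsum

theorem mulL_assoc (hα : 1 / 2 < α) (hβ : |β| ≤ α) (h : |α| ≤ α) (a b : Sc α) (d : Sc β) :
    mulL hα hβ (mulL hα h a b) d = mulL hα hβ a (mulL hα hβ b d) := by
  refine ext_c fun k => ?_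
  rw [c_mulL, c_mulL]
  simp_rw [c_mulL]
  exact tsum_conv_assoc k (tsum_enorm_conv_conv_ne_top hα hβ a b d k)

/-- The constant function `1`. -/
def one : Sc σ := ofC (fun k => if k = 0 then 1 else 0) (fun k => by
    by_cases h : k = 0 <;> simp [h]) (by
    rw [sobolevENorm, tsum_eq_single 0 (fun k hk => by simp [hk])]
    finiteness)

theorem one_mulL (hα : 1 / 2 < α) (hβ : |β| ≤ α) (a : Sc β) : mulL hα hβ one a = a :=
  ext_c fun k => by
    rw [c_mulL, tsum_eq_single k (fun m hm => by
      have : k - m ≠ 0 := sub_ne_zero.2 hm.symm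
      simp [one, this])]
    simp [one]

theorem abs_self_le (hα : 1 / 2 < α) : |α| ≤ α := (abs_of_pos (by linarith)).le

theorem abs_sub_one_le (hα : 1 / 2 < α) : |α - 1| ≤ α := abs_le.2 ⟨by linarith, by linarith⟩

variable [hF : Fact (1 / 2 < α)]

instance : Mul (Sc α) := ⟨fun a b => mulL hF.out (abs_self_le hF.out) a b⟩
instance : One (Sc α) := ⟨one⟩

theorem mul_def (a b : Sc α) : a * b = mulL hF.out (abs_self_le hF.out) a b := rfl

instance : CommRing (Sc α) :=
  { (inferInstance : AddCommGroup (Sc α)), (inferInstance : Mul (Sc α)),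
    (inferInstance : One (Sc α)) with
    left_distrib := fun a b d => by simp [mul_def]
    right_distrib := fun a b d => by simp [mul_def]
    zero_mul := fun a => by simp [mul_def]
    mul_zero := fun a => by simp [mul_def]
    mul_assoc := fun a b d => mulL_assoc _ _ _ a b d
    one_mul := fun a => one_mulL _ _ a
    mul_one := fun a => (mulL_comm _ _ _ _).trans (one_mulL _ _ a)
    mul_comm := fun a b => mulL_comm _ _ _ _
    natCast := fun n => n • (1 : Sc α)
    natCast_zero := zero_smul ℕ (1 : Sc α)
    natCast_succ := fun n => succ_nsmul (1 : Sc α) n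
    intCast := fun n => n • (1 : Sc α)
    intCast_ofNat := fun n => natCast_zsmul (1 : Sc α) n
    intCast_negSucc := fun n => negSucc_zsmul (1 : Sc α) n }

/-- The inequality |α - 1| ≤ α, equivalent to α ≥ 1/2, is what allows functions of class α to
multiply derivatives of such functions. -/
instance : Module (Sc α) (Sc (α - 1)) where
  smul a b := mulL hF.out (abs_sub_one_le hF.out) a b
  one_smul b := one_mulL _ _ b
  mul_smul a b d := mulL_assoc _ _ _ a b d
  smul_zero a := map_zero _
  smul_add a b d := map_add _ _ _
  add_smul a b d := by
    change mulL _ _ (a + b) d = _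
    rw [map_add]; rfl
  zero_smul b := by
    change mulL _ _ 0 b = _
    rw [map_zero]; rfl

theorem smul_def (a : Sc α) (b : Sc (α - 1)) :
    a • b = mulL hF.out (abs_sub_one_le hF.out) a b := rfl

theorem c_mul (a b : Sc α) (k : ℤ) : (a * b).c k = ∑' m, a.c (k - m) * b.c m := rfl
theorem c_smul' (a : Sc α) (b : Sc (α - 1)) (k : ℤ) :
    (a • b).c k = ∑' m, a.c (k - m) * b.c m := rfl

instance : IsScalarTower ℝ (Sc α) (Sc (α - 1)) := ⟨fun r a b => by
  change mulL _ _ (r • a) b = r • mulL _ _ a b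
  rw [map_smul]; rfl⟩
instance : SMulCommClass ℝ (Sc α) (Sc (α - 1)) := ⟨fun r a b => by
  change r • mulL _ _ a b = mulL _ _ a (r • b)
  rw [map_smul]⟩

end Sc

/-! ### Derivative -/

namespace Sc

theorem sobolevENorm_deriv_le (a : Sc σ) :
    sobolevENorm (σ - 1) (fun k => 2 * (Real.pi : ℂ) * Complex.I * (k : ℂ) * a.c k) ≤
      ENNReal.ofReal ((2 * Real.pi * ‖a‖) ^ 2) := by
  rw [mul_pow, ENNReal.ofReal_mul (by positivity), ← sobolevENorm_eq, sobolevENorm, sobolevENorm,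
    ← ENNReal.tsum_mul_left]
  refine ENNReal.tsum_le_tsum fun k => ?_
  rw [ofReal_mul_enorm, ofReal_mul_enorm, ← ENNReal.ofReal_mul (by positivity)]
  apply ENNReal.ofReal_le_ofReal
  rw [← mul_pow]
  have hk : |(k : ℝ)| ≤ sobolevWeight 1 k := by
    rw [sobolevWeight, ← Real.sqrt_eq_rpow, ← Real.sqrt_sq_eq_abs]
    exact Real.sqrt_le_sqrt (by linarith)
  have hw : sobolevWeight σ k = sobolevWeight (σ - 1) k * sobolevWeight 1 k := by
    rw [← sobolevWeight_add]; congr 1; ring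
  have p := sobolevWeight_pos (σ - 1) k
  have : ‖2 * (Real.pi : ℂ) * Complex.I * (k : ℂ) * a.c k‖ = 2 * Real.pi * |(k : ℝ)| * ‖a.c k‖ := by
    simp [abs_of_pos Real.pi_pos]
  rw [this, hw]
  have hpi := Real.pi_pos
  gcongr ?_ ^ 2
  calc sobolevWeight (σ - 1) k * (2 * Real.pi * |(k : ℝ)| * ‖a.c k‖)
      ≤ sobolevWeight (σ - 1) k * (2 * Real.pi * sobolevWeight 1 k * ‖a.c k‖) := by gcongr
    _ = _ := by ring

/-- The derivative of a distribution on the circle. -/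
def deriv : Sc σ →L[ℝ] Sc (σ - 1) :=
  LinearMap.mkContinuous
    ⟨⟨fun a => ofC (fun k => 2 * (Real.pi : ℂ) * Complex.I * (k : ℂ) * a.c k) (fun k => by
        simp only [c_conj, map_mul, Complex.conj_ofReal, Complex.conj_I, Int.cast_neg,
          map_intCast, map_ofNat]
        ring)
        (ne_top_of_le_ne_top ENNReal.ofReal_ne_top a.sobolevENorm_deriv_le),
      fun a b => ext_c fun k => by simp [mul_add]⟩,
      fun r a => ext_c fun k => by simp; ring⟩
    (2 * Real.pi) fun a => norm_le_of_sobolevENorm_le _ (by positivity) a.sobolevENorm_deriv_le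

theorem c_deriv (a : Sc σ) (k : ℤ) :
    (deriv a).c k = 2 * (Real.pi : ℂ) * Complex.I * (k : ℂ) * a.c k := rfl

theorem int_deriv (a : Sc σ) : int (deriv a) = 0 := by simp [int_apply, c_deriv]

theorem deriv_one : deriv (one : Sc σ) = 0 := ext_c fun k => by
  by_cases h : k = 0 <;> simp [c_deriv, one, h]

/-- On coefficients this is k = (k - m) + m under the convolution sum; the second product is
reindexed by m ↦ k - m so that both have the same summand indices. -/
theorem deriv_mul [hF : Fact (1 / 2 < α)] (a b : Sc α) :
    deriv (a * b) = a • deriv b + b • deriv a := by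
  refine ext_c fun k => ?_
  have h1 := summable_conv hF.out (abs_sub_one_le hF.out) a (deriv b) k
  have h2 := summable_conv hF.out (abs_sub_one_le hF.out) b (deriv a) k
  rw [c_add, c_smul', c_smul', c_deriv, c_mul, ← tsum_mul_left]
  have h3 := (Equiv.subLeft k).summable_iff.2 h2
  rw [← (Equiv.subLeft k).tsum_eq (fun m => b.c (k - m) * (deriv a).c m)]
  refine Eq.trans ?_ (h1.tsum_add h3)
  refine tsum_congr fun m => ?_
  simp only [Equiv.subLeft_apply, c_deriv, sub_sub_cancel]
  push_cast
  ring

theorem sobolevENorm_incl_le (h : σ ≤ α) (a : Sc α) :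
    sobolevENorm σ a.c ≤ ENNReal.ofReal (‖a‖ ^ 2) := by
  rw [← sobolevENorm_eq]
  refine ENNReal.tsum_le_tsum fun k => ?_
  gcongr
  exact sobolevWeight_mono h k

/-- The inclusion of Sobolev spaces, as a function. -/
def inclFun (h : σ ≤ α) (a : Sc α) : Sc σ :=
  ofC a.c a.c_conj (ne_top_of_le_ne_top ENNReal.ofReal_ne_top (sobolevENorm_incl_le h a))

theorem c_inclFun (h : σ ≤ α) (a : Sc α) : (inclFun h a).c = a.c :=
  funext fun k => c_ofC (σ := σ) a.c _ _ k

theorem norm_inclFun_le (h : σ ≤ α) (a : Sc α) : ‖inclFun h a‖ ≤ 1 * ‖a‖ := by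
  rw [one_mul]
  refine norm_le_of_sobolevENorm_le _ (norm_nonneg _) ?_
  rw [c_inclFun]
  exact sobolevENorm_incl_le h a

/-- The inclusion of Sobolev spaces. -/
def incl (h : σ ≤ α) : Sc α →L[ℝ] Sc σ :=
  LinearMap.mkContinuous
    ⟨⟨inclFun h, fun a b => ext_c fun k => by rw [c_add, c_inclFun, c_inclFun, c_inclFun, c_add]⟩,
      fun r a => ext_c fun k => by rw [RingHom.id_apply, c_smul, c_inclFun, c_inclFun, c_smul]⟩
    1 (norm_inclFun_le h)

@[simp] theorem c_incl (h : σ ≤ α) (a : Sc α) (k : ℤ) : (incl h a).c k = a.c k :=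
  congrFun (c_inclFun h a) k

end Sc

end Scalars

/-! ### Vector-valued distributions as tuples of scalar ones -/

section Coordinates

variable {σ α : ℝ} {n : ℕ}

namespace SobolevSpace

/-- The `i`-th component of a vector-valued distribution. -/
def comp (i : Fin n) : SobolevSpace σ n →L[ℝ] Sc σ :=
  have key : ∀ u : SobolevSpace σ n, sobolevENorm σ (fun k => u.coeff k i) ≤
      ENNReal.ofReal (‖u‖ ^ 2) := fun u => by
    rw [← u.hasSum_norm_sq.tsum_eq, ENNReal.ofReal_tsum_of_nonneg (fun k => sq_nonneg _)
      u.hasSum_norm_sq.summable, sobolevENorm]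
    refine ENNReal.tsum_le_tsum fun k => ?_
    rw [Sc.ofReal_mul_enorm]
    apply ENNReal.ofReal_le_ofReal
    have := sobolevWeight_pos σ k
    gcongr
    exact PiLp.norm_apply_le _ _
  LinearMap.mkContinuous
    ⟨⟨fun u => Sc.ofC (fun k => u.coeff k i) (fun k => u.coeff_conj k i)
      (ne_top_of_le_ne_top ENNReal.ofReal_ne_top (key u)),
      fun u v => Sc.ext_c fun k => rfl⟩, fun r u => Sc.ext_c fun k => by simp⟩
    1 fun u => Sc.norm_le_of_sobolevENorm_le _ (by positivity) (by
      rw [one_mul]; exact key u)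

@[simp] theorem c_comp (i : Fin n) (u : SobolevSpace σ n) (k : ℤ) :
    (comp i u).c k = u.coeff k i := rfl

theorem norm_single_coeff (i : Fin n) (z : ℂ) :
    ‖(EuclideanSpace.single i z : EuclideanSpace ℂ (Fin n))‖ = ‖z‖ := by simp

/-- The vector-valued distribution with one given component, all others being zero. -/
def single (i : Fin n) : Sc σ →L[ℝ] SobolevSpace σ n :=
  LinearMap.mkContinuous
    ⟨⟨fun a => ofCoeff (fun k => EuclideanSpace.single i (a.c k)) (fun k j => by
        by_cases h : j = i <;> simp [h, Sc.c_conj]) (by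
          simpa only [norm_single_coeff] using a.hasSum_norm_sq.summable),
      fun a b => ext_coeff fun k j => by
        by_cases h : j = i <;> simp [h]⟩,
      fun r a => ext_coeff fun k j => by
        by_cases h : j = i <;> simp [h]⟩
    1 fun a => by
      rw [one_mul]
      refine le_of_eq ?_
      have h1 := hasSum_norm_sq (ofCoeff (σ := σ) (fun k => EuclideanSpace.single i (a.c k))
        (fun k j => by by_cases h : j = i <;> simp [h, Sc.c_conj]) (by
          simpa only [norm_single_coeff] using a.hasSum_norm_sq.summable))
      simp only [coeff_ofCoeff, norm_single_coeff] at h1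
      have h2 := h1.unique a.hasSum_norm_sq
      exact (sq_eq_sq₀ (norm_nonneg _) (norm_nonneg _)).1 h2

theorem coeff_single (i : Fin n) (a : Sc σ) (k : ℤ) :
    (single i a).coeff k = EuclideanSpace.single i (a.c k) := rfl

/-- A vector-valued distribution is the family of its components. -/
def coords (σ : ℝ) (n : ℕ) : SobolevSpace σ n ≃L[ℝ] (Fin n → Sc σ) :=
  ContinuousLinearEquiv.equivOfInverse
    (ContinuousLinearMap.pi fun i => comp i)
    (∑ i, (single i).comp (ContinuousLinearMap.proj i))
    (fun u => ext_coeff fun k j => by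
      have : ∀ s : Finset (Fin n), (∑ i ∈ s, single i (comp i u)).coeff k j =
          if j ∈ s then u.coeff k j else 0 := by
        intro s
        induction s using Finset.induction_on with
        | empty => simp
        | insert i s hi ih =>
          rw [Finset.sum_insert hi, coeff_add, Pi.add_apply, PiLp.add_apply, ih, coeff_single]
          by_cases hji : j = i
          · subst hji; simp [hi]
          · simp [hji]
      simpa [_root_.sum_apply] using this Finset.univ)
    (fun f => by
      funext j
      refine Sc.ext_c fun k => ?_
      have : ∀ s : Finset (Fin n), (comp j (∑ i ∈ s, single i (f i))).c k =
          if j ∈ s then (f j).c k else 0 := by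
        intro s
        induction s using Finset.induction_on with
        | empty => simp
        | insert i s hi ih =>
          rw [Finset.sum_insert hi, map_add, Sc.c_add, ih, c_comp, coeff_single]
          by_cases hji : j = i
          · subst hji; simp [hi]
          · simp [hji]
      simpa [_root_.sum_apply] using this Finset.univ)

@[simp] theorem coords_apply (u : SobolevSpace σ n) (i : Fin n) : coords σ n u i = comp i u := rfl

@[simp] theorem comp_coords_symm (f : Fin n → Sc σ) (i : Fin n) :
    comp i ((coords σ n).symm f) = f i := by
  rw [← coords_apply, ContinuousLinearEquiv.apply_symm_apply]

theorem ext_comp {u v : SobolevSpace σ n} (h : ∀ i, comp i u = comp i v) : u = v :=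
  (coords σ n).injective (funext h)

end SobolevSpace

end Coordinates

/-! ### Evaluation -/

section Eval

open scoped ENNReal

variable {α : ℝ}

theorem realFourierCoeff_neg (f : UnitAddCircle → ℝ) (k : ℤ) :
    realFourierCoeff f (-k) = (starRingEnd ℂ) (realFourierCoeff f k) := by
  rw [realFourierCoeff, realFourierCoeff, fourierCoeff, fourierCoeff, ← integral_conj]
  refine MeasureTheory.integral_congr_ae (Filter.Eventually.of_forall fun s => ?_)
  simp only [smul_eq_mul, map_mul, Complex.conj_ofReal, neg_neg]
  rw [← fourier_neg, neg_neg]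

namespace Sc

theorem summable_norm_c (hα : 1 / 2 < α) (a : Sc α) : Summable fun k => ‖a.c k‖ := by
  have h := tsum_enorm_sq_le α a.c
  have h2 : (∑' k, ‖a.c k‖ₑ) ≠ ⊤ := by
    intro htop
    rw [htop] at h
    have h3 := ENNReal.mul_ne_top (weightSum_ne_top hα) a.sobolevENorm_ne_top
    simp at h
    exact h3 h
  have := ENNReal.summable_toReal h2
  simpa using this

theorem tsum_norm_c_le (hα : 1 / 2 < α) (a : Sc α) :
    ∑' k, ‖a.c k‖ ≤ Real.sqrt (weightSum α).toReal * ‖a‖ := by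
  have h := tsum_enorm_sq_le α a.c
  have hs := a.summable_norm_c hα
  have e : (∑' k, ‖a.c k‖ₑ) = ENNReal.ofReal (∑' k, ‖a.c k‖) := by
    rw [ENNReal.ofReal_tsum_of_nonneg (fun k => norm_nonneg _) hs]
    exact tsum_congr fun k => (ofReal_norm _).symm
  have h0 : 0 ≤ ∑' k, ‖a.c k‖ := tsum_nonneg fun k => norm_nonneg _
  rw [e, sobolevENorm_eq, ← ENNReal.ofReal_pow h0, ← ENNReal.ofReal_toReal (weightSum_ne_top hα),
    ← ENNReal.ofReal_mul ENNReal.toReal_nonneg,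
    ENNReal.ofReal_le_ofReal_iff (by positivity)] at h
  have := Real.sqrt_le_sqrt h
  rwa [Real.sqrt_sq h0, Real.sqrt_mul ENNReal.toReal_nonneg, Real.sqrt_sq (norm_nonneg _)] at this

/-- The sum of the Fourier series. -/
def fourierSum (_hα : 1 / 2 < α) (a : Sc α) : C(UnitAddCircle, ℂ) := ∑' k, a.c k • fourier k

theorem hasSum_fourierSum (hα : 1 / 2 < α) (a : Sc α) :
    HasSum (fun k => a.c k • (fourier k : C(UnitAddCircle, ℂ))) (fourierSum hα a) := by
  apply Summable.hasSum
  apply Summable.of_norm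
  simpa only [norm_smul, fourier_norm, mul_one] using a.summable_norm_c hα

theorem hasSum_fourierSum_apply (hα : 1 / 2 < α) (a : Sc α) (s : UnitAddCircle) :
    HasSum (fun k => a.c k * fourier k s) (fourierSum hα a s) :=
  ContinuousMap.hasSum_apply (a.hasSum_fourierSum hα) s

theorem fourierSum_conj (hα : 1 / 2 < α) (a : Sc α) (s : UnitAddCircle) :
    (starRingEnd ℂ) (fourierSum hα a s) = fourierSum hα a s := by
  have h1 := Complex.hasSum_conj'.2 (a.hasSum_fourierSum_apply hα s)
  have h2 := (Equiv.neg ℤ).hasSum_iff.2 (a.hasSum_fourierSum_apply hα s)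
  refine (HasSum.unique ?_ h2)
  convert h1 using 2 with k
  simp only [Function.comp_apply, Equiv.neg_apply, map_mul, a.c_conj, fourier_neg]

/-- The series converges uniformly, hence in L², where the inner product with the k-th character is
continuous and orthonormality leaves a single term. -/
theorem fourierCoeff_fourierSum (hα : 1 / 2 < α) (a : Sc α) (k : ℤ) :
    fourierCoeff (fourierSum hα a) k = a.c k := by
  have h1 := (ContinuousMap.toLp (E := ℂ) 2 (AddCircle.haarAddCircle (T := 1)) ℂ).hasSum
    (a.hasSum_fourierSum hα)
  have h2 := (innerSL ℂ (fourierLp (T := 1) 2 k)).hasSum h1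
  have h3 : fourierCoeff (fourierSum hα a) k = innerSL ℂ (fourierLp (T := 1) 2 k)
      (ContinuousMap.toLp (E := ℂ) 2 (AddCircle.haarAddCircle (T := 1)) ℂ (fourierSum hα a)) := by
    rw [← fourierCoeff_toLp, ← fourierBasis_repr, HilbertBasis.repr_apply_apply, coe_fourierBasis]
    rfl
  rw [h3, ← h2.tsum_eq, tsum_eq_single k]
  · have := (orthonormal_iff_ite.1 (orthonormal_fourier (T := 1))) k k
    simp only [if_true] at this
    simp only [map_smul]
    change a.c k • inner ℂ (fourierLp (T := 1) 2 k) (fourierLp (T := 1) 2 k) = _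
    rw [this]; simp
  · intro j hj
    have := (orthonormal_iff_ite.1 (orthonormal_fourier (T := 1))) k j
    rw [if_neg hj.symm] at this
    simp only [map_smul]
    change a.c j • inner ℂ (fourierLp (T := 1) 2 k) (fourierLp (T := 1) 2 j) = _
    rw [this]; simp

variable [hF : Fact (1 / 2 < α)]

/-- The continuous function with the given Fourier series. -/
def ev (a : Sc α) : C(UnitAddCircle, ℝ) :=
  ⟨fun s => (fourierSum hF.out a s).re, by fun_prop⟩

theorem ev_eq_fourierSum (a : Sc α) (s : UnitAddCircle) :
    ((ev a s : ℝ) : ℂ) = fourierSum hF.out a s :=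
  Complex.conj_eq_iff_re.1 (a.fourierSum_conj hF.out s)

theorem hasSum_ev (a : Sc α) (s : UnitAddCircle) :
    HasSum (fun k => a.c k * fourier k s) (ev a s : ℂ) := by
  rw [ev_eq_fourierSum]; exact a.hasSum_fourierSum_apply _ s

theorem ev_eq_of_hasSum (a : Sc α) (s : UnitAddCircle) {x : ℝ}
    (h : HasSum (fun k => a.c k * fourier k s) (x : ℂ)) : ev a s = x := by
  exact_mod_cast (a.hasSum_ev s).unique h

theorem realFourierCoeff_ev (a : Sc α) (k : ℤ) : realFourierCoeff (ev a) k = a.c k := by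
  rw [realFourierCoeff]
  simp only [ev_eq_fourierSum]
  exact a.fourierCoeff_fourierSum _ k

theorem ev_injective : Function.Injective (ev : Sc α → C(UnitAddCircle, ℝ)) := fun a b h =>
  ext_c fun k => by rw [← realFourierCoeff_ev, h, realFourierCoeff_ev]

theorem ext_ev {a b : Sc α} (h : ∀ s, ev a s = ev b s) : a = b :=
  ev_injective (ContinuousMap.ext h)

@[simp] theorem ev_add (a b : Sc α) (s : UnitAddCircle) : ev (a + b) s = ev a s + ev b s :=
  ev_eq_of_hasSum _ _ (by
    have := (a.hasSum_ev s).add (b.hasSum_ev s)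
    simpa [add_mul] using this)

@[simp] theorem ev_smul (r : ℝ) (a : Sc α) (s : UnitAddCircle) : ev (r • a) s = r * ev a s :=
  ev_eq_of_hasSum _ _ (by
    have := (a.hasSum_ev s).mul_left (r : ℂ)
    simpa [mul_assoc] using this)

theorem abs_ev_le (a : Sc α) (s : UnitAddCircle) :
    |ev a s| ≤ Real.sqrt (weightSum α).toReal * ‖a‖ := by
  refine le_trans ?_ (a.tsum_norm_c_le hF.out)
  have h := a.hasSum_ev s
  have hn : ∀ k, ‖a.c k * fourier k s‖ = ‖a.c k‖ := fun k => by
    rw [norm_mul, fourier_apply, Circle.norm_coe, mul_one]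
  have := norm_tsum_le_tsum_norm (f := fun k => a.c k * fourier k s)
    (by simpa only [hn] using a.summable_norm_c hF.out)
  rw [h.tsum_eq, Complex.norm_real] at this
  simp only [hn] at this
  exact this

/-- Evaluation at a point as a continuous linear functional. -/
def evL (s : UnitAddCircle) : Sc α →L[ℝ] ℝ :=
  LinearMap.mkContinuous ⟨⟨fun a => ev a s, fun a b => ev_add a b s⟩, fun r a => ev_smul r a s⟩
    (Real.sqrt (weightSum α).toReal) fun a => a.abs_ev_le s

@[simp] theorem evL_apply (s : UnitAddCircle) (a : Sc α) : evL s a = ev a s := rfl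

@[simp] theorem ev_neg (a : Sc α) (s : UnitAddCircle) : ev (-a) s = -ev a s := map_neg (evL s) a
@[simp] theorem ev_sub (a b : Sc α) (s : UnitAddCircle) : ev (a - b) s = ev a s - ev b s :=
  map_sub (evL s) a b
@[simp] theorem ev_zero (s : UnitAddCircle) : ev (0 : Sc α) s = 0 := map_zero (evL s)
@[simp] theorem ev_sum {ι : Type*} (t : Finset ι) (a : ι → Sc α) (s : UnitAddCircle) :
    ev (∑ i ∈ t, a i) s = ∑ i ∈ t, ev (a i) s := map_sum (evL s) a t

@[simp] theorem ev_one (s : UnitAddCircle) : ev (1 : Sc α) s = 1 :=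
  ev_eq_of_hasSum _ _ (by
    convert hasSum_ite_eq (0 : ℤ) (1 : ℂ) using 2 with k
    · change (if k = 0 then (1 : ℂ) else 0) * _ = _
      by_cases h : k = 0 <;> simp [h]
    · simp)

@[simp] theorem ev_mul (a b : Sc α) (s : UnitAddCircle) : ev (a * b) s = ev a s * ev b s :=
  ev_eq_of_hasSum _ _ (by
    have hn : ∀ (a : Sc α) k, ‖a.c k * fourier k s‖ = ‖a.c k‖ := fun a k => by
      rw [norm_mul, fourier_apply, Circle.norm_coe, mul_one]
    have ha : Summable fun k => ‖a.c k * fourier k s‖ := by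
      simpa only [hn] using a.summable_norm_c hF.out
    have hb : Summable fun k => ‖b.c k * fourier k s‖ := by
      simpa only [hn] using b.summable_norm_c hF.out
    have hs := summable_mul_of_summable_norm ha hb
    have hp := (a.hasSum_ev s).mul (b.hasSum_ev s) hs
    -- The shear (k, m) ↦ (k - m, m) regroups the absolutely convergent product of the two series by
    -- total frequency, which produces the convolution.
    let e : ℤ × ℤ ≃ ℤ × ℤ :=
      ⟨fun p => (p.1 - p.2, p.2), fun p => (p.1 + p.2, p.2), fun p => by simp, fun p => by simp⟩
    have hp' := e.hasSum_iff.2 hp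
    have hp2 := hp'.prod_fiberwise (g := fun k => (a * b).c k * fourier k s) (fun k => by
      rw [c_mul]
      have := ((summable_conv hF.out (abs_self_le hF.out) a b k).hasSum).mul_right
        ((fourier k s : ℂ))
      convert this using 2 with m
      simp only [Function.comp_apply, e, Equiv.coe_fn_mk]
      have : (fourier k s : ℂ) = fourier (k - m) s * fourier m s := by
        rw [← fourier_add, sub_add_cancel]
      rw [this]; ring)
    simpa using hp2)

/-- A continuous function whose Fourier coefficients satisfy the Sobolev condition. -/
theorem exists_ev_eq {f : UnitAddCircle → ℝ} (hf : Continuous f)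
    (h : sobolevENorm α (realFourierCoeff f) ≠ ⊤) : ∃ a : Sc α, (∀ s, ev a s = f s) ∧
      a.c = realFourierCoeff f := by
  let a : Sc α := ofC (realFourierCoeff f) (realFourierCoeff_neg f) h
  refine ⟨a, fun s => ev_eq_of_hasSum a s ?_, funext fun k => c_ofC _ _ _ k⟩
  let g : C(UnitAddCircle, ℂ) := ⟨fun s => (f s : ℂ), by fun_prop⟩
  have hg : Summable (fourierCoeff g) := (a.summable_norm_c hF.out).of_norm
  exact has_pointwise_sum_fourier_series_of_summable hg s

end Sc

theorem SobolevSpace.eval_apply [hF : Fact (1 / 2 < α)] {n : ℕ} (u : SobolevSpace α n)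
    (s : UnitAddCircle) (i : Fin n) : u.eval s i = Sc.ev (comp i u) s := by
  have := ((comp i u).hasSum_ev s).tsum_eq
  change (∑' k : ℤ, u.coeff k i * fourier k s).re = _
  simp only [c_comp] at this
  rw [this, Complex.ofReal_re]

end Eval

/-! ### Dyadic differences -/

section Dyadic

open scoped ENNReal

theorem hasSum_sq_norm_fourierCoeff (g : C(UnitAddCircle, ℂ)) :
    HasSum (fun k => ‖fourierCoeff g k‖ ^ 2) (∫ s, ‖g s‖ ^ 2 ∂AddCircle.haarAddCircle) := by
  have h := hasSum_sq_fourierCoeff (T := 1) (ContinuousMap.toLp (E := ℂ) 2 _ ℂ g)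
  simp only [fourierCoeff_toLp] at h
  convert h using 1
  refine MeasureTheory.integral_congr_ae ?_
  filter_upwards [ContinuousMap.coeFn_toLp (E := ℂ) (p := 2) (𝕜 := ℂ)
    (AddCircle.haarAddCircle (T := 1)) g] with s hs
  rw [hs]

theorem fourierCoeff_comp_add (g : C(UnitAddCircle, ℂ)) (h : UnitAddCircle) (k : ℤ) :
    fourierCoeff (fun s => g (s + h)) k = fourier k h * fourierCoeff g k := by
  rw [fourierCoeff, fourierCoeff, ← MeasureTheory.integral_const_mul,
    ← MeasureTheory.integral_add_right_eq_self
      (fun s => (fourier k h : ℂ) * ((fourier (-k) s : ℂ) • g s)) h]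
  refine MeasureTheory.integral_congr_ae (Filter.Eventually.of_forall fun s => ?_)
  simp only [smul_eq_mul]
  rw [← mul_assoc]
  congr 1
  have h1 : (fourier (-k) (s + h) : ℂ) = fourier (-k) s * fourier (-k) h := by
    simp [fourier_apply, smul_add, AddCircle.toCircle_add]
  have h2 : (fourier k h : ℂ) * fourier (-k) h = 1 := by
    rw [← fourier_add, add_neg_cancel, fourier_zero]
  rw [h1]; linear_combination (-(fourier (-k) s : ℂ)) * h2

theorem integrable_of_continuous_circle {f : UnitAddCircle → ℝ} (hf : Continuous f) :
    MeasureTheory.Integrable f AddCircle.haarAddCircle :=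
  hf.integrable_of_hasCompactSupport (HasCompactSupport.of_compactSpace f)

/-- Parseval for the difference f(· + h) - f, whose k-th coefficient is (e_k(h) - 1) times that of
f. -/
theorem hasSum_sq_translate {f : UnitAddCircle → ℝ} (hf : Continuous f) (h : UnitAddCircle) :
    HasSum (fun k => (‖(fourier k h : ℂ) - 1‖ * ‖realFourierCoeff f k‖) ^ 2)
      (∫ s, (f (s + h) - f s) ^ 2 ∂AddCircle.haarAddCircle) := by
  let g : C(UnitAddCircle, ℂ) := ⟨fun s => (f s : ℂ), by fun_prop⟩
  let d : C(UnitAddCircle, ℂ) := ⟨fun s => g (s + h) - g s, by fun_prop⟩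
  have hd := hasSum_sq_norm_fourierCoeff d
  have e1 : ∀ k, fourierCoeff d k = ((fourier k h : ℂ) - 1) * realFourierCoeff f k := by
    intro k
    have hi : ∀ g' : C(UnitAddCircle, ℂ), MeasureTheory.Integrable
        (fun s => (fourier (-k) s : ℂ) • g' s) AddCircle.haarAddCircle := fun g' =>
      Continuous.integrable_of_hasCompactSupport (by fun_prop) (HasCompactSupport.of_compactSpace _)
    have h2 := fourierCoeff_comp_add g h k
    have h3 := MeasureTheory.integral_sub (hi ⟨fun s => g (s + h), by fun_prop⟩) (hi g)
    have h4 : fourierCoeff d k = fourierCoeff (fun s => g (s + h)) k - fourierCoeff g k := by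
      rw [fourierCoeff, fourierCoeff, fourierCoeff]
      refine Eq.trans ?_ h3
      simp [d, mul_sub]
    rw [h4, h2]
    change _ = (_ - 1) * fourierCoeff g k
    ring
  simp only [e1, norm_mul] at hd
  convert hd using 1
  refine MeasureTheory.integral_congr_ae (Filter.Eventually.of_forall fun s => ?_)
  simp only [d, g, ContinuousMap.coe_mk]
  rw [← Complex.ofReal_sub, Complex.norm_real, Real.norm_eq_abs, sq_abs]

/-- The points `2^{-j}` of the circle. -/
def dyadicPoint (j : ℕ) : UnitAddCircle := (((2 : ℝ) ^ j)⁻¹ : ℝ)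

theorem norm_fourier_dyadicPoint_sub_one (k : ℤ) (j : ℕ) :
    ‖(fourier k (dyadicPoint j) : ℂ) - 1‖ = 2 * |Real.sin (Real.pi * (k * ((2 : ℝ) ^ j)⁻¹))| := by
  have := Complex.norm_exp_I_mul_ofReal_sub_one (2 * Real.pi * (k * ((2 : ℝ) ^ j)⁻¹))
  rw [dyadicPoint, fourier_coe_apply]
  convert this using 3
  · push_cast; congr 1; ring
  · rw [norm_mul, Real.norm_eq_abs, Real.norm_eq_abs, abs_two]; congr 3; ring

variable (α : ℝ)

/-- The weight on the `k`-th Fourier coefficient of the sum of the dyadic differences. -/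
def dyadicWeight (k : ℤ) : ℝ≥0∞ :=
  ∑' j : ℕ, ENNReal.ofReal (((4 : ℝ) ^ α) ^ j * ‖(fourier k (dyadicPoint j) : ℂ) - 1‖ ^ 2)

variable {α}

/-- One term of the series suffices. With 2^J ≤ |k| ≤ 2^{J+1} and j = J + 2 the angle πk2^{-j} has
modulus in [π/4, π/2], where |sin x| ≥ 2|x|/π gives |sin x| ≥ 1/2; so the character differs from 1
by at least 1, and 4^{αj} dominates |k|^{2α}. -/
theorem le_dyadicWeight (hα : 0 ≤ α) {k : ℤ} (hk : k ≠ 0) :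
    ENNReal.ofReal (((k : ℝ) ^ 2) ^ α) ≤ dyadicWeight α k := by
  set J := Nat.log 2 k.natAbs
  refine le_trans ?_ (ENNReal.le_tsum (J + 2))
  apply ENNReal.ofReal_le_ofReal
  have hk0 : k.natAbs ≠ 0 := Int.natAbs_ne_zero.2 hk
  have h1 : (2 : ℝ) ^ J ≤ |(k : ℝ)| := by
    have := Nat.pow_log_le_self 2 hk0
    rw [← Int.cast_abs, Int.abs_eq_natAbs]; exact_mod_cast this
  have h2 : |(k : ℝ)| ≤ 2 ^ (J + 1) := by
    have := (Nat.lt_pow_succ_log_self (b := 2) (by norm_num) k.natAbs).le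
    rw [← Int.cast_abs, Int.abs_eq_natAbs]; exact_mod_cast this
  have hs : 1 ≤ ‖(fourier k (dyadicPoint (J + 2)) : ℂ) - 1‖ := by
    rw [norm_fourier_dyadicPoint_sub_one]
    set x := Real.pi * (k * ((2 : ℝ) ^ (J + 2))⁻¹)
    have hx : |x| = Real.pi * (|(k : ℝ)| / (2 ^ J * 4)) := by
      simp only [x]; rw [abs_mul, abs_mul, abs_of_pos Real.pi_pos, abs_inv,
        abs_of_pos (by positivity : (0 : ℝ) < 2 ^ (J + 2)), pow_add]; norm_num [div_eq_mul_inv]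
    have hp : (0 : ℝ) < 2 ^ J := by positivity
    have hx1 : Real.pi / 4 ≤ |x| := by
      rw [hx, div_eq_mul_inv]
      refine mul_le_mul_of_nonneg_left ?_ Real.pi_pos.le
      rw [le_div_iff₀ (by positivity)]; linarith
    have hx2 : |x| ≤ Real.pi / 2 := by
      rw [hx, div_eq_mul_inv Real.pi]
      refine mul_le_mul_of_nonneg_left ?_ Real.pi_pos.le
      rw [div_le_iff₀ (by positivity)]; rw [pow_succ] at h2; linarith
    have := Real.mul_abs_le_abs_sin hx2
    have h3 : 2 / Real.pi * (Real.pi / 4) ≤ 2 / Real.pi * |x| := by gcongr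
    have h4 : 2 / Real.pi * (Real.pi / 4) = 1 / 2 := by field_simp; norm_num
    linarith
  calc ((k : ℝ) ^ 2) ^ α ≤ ((4 : ℝ) ^ (J + 2)) ^ α := by
        apply Real.rpow_le_rpow (sq_nonneg _) _ hα
        rw [← sq_abs, show (4 : ℝ) = 2 ^ 2 by norm_num, ← pow_mul, mul_comm, pow_mul]
        gcongr
        exact h2.trans (pow_le_pow_right₀ (by norm_num) (by omega))
    _ = ((4 : ℝ) ^ α) ^ (J + 2) * 1 ^ 2 := by
        rw [← Real.rpow_natCast, ← Real.rpow_natCast, ← Real.rpow_mul (by norm_num),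
          ← Real.rpow_mul (by norm_num), mul_comm α]; simp
    _ ≤ _ := by gcongr

/-- The constant in the upper bound for the dyadic weight. -/
def dyadicConst (α : ℝ) : ℝ≥0∞ :=
  ∑' i : ℤ, ENNReal.ofReal (((4 : ℝ) ^ α) ^ i * min 4 (16 * Real.pi ^ 2 * (4 : ℝ) ^ (-i)))

/-- The terms with i ≥ 0 are dominated by a geometric series of ratio 4^α/4, those with i ≤ 0 by one
of ratio 4^{-α}. Both converge exactly because 0 < α < 1. -/
theorem dyadicConst_ne_top (h0 : 0 < α) (h1 : α < 1) : dyadicConst α ≠ ⊤ := by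
  have hq1 : 1 < (4 : ℝ) ^ α := Real.one_lt_rpow (by norm_num) h0
  have hq4 : (4 : ℝ) ^ α < 4 := by
    conv_rhs => rw [← Real.rpow_one 4]
    exact Real.rpow_lt_rpow_of_exponent_lt (by norm_num) h1
  set q := (4 : ℝ) ^ α
  apply Summable.tsum_ofReal_ne_top
  rw [summable_int_iff_summable_nat_and_neg]
  constructor
  · refine Summable.of_nonneg_of_le (fun n => by positivity) (fun n => ?_)
      ((summable_geometric_of_lt_one (r := q / 4) (by positivity) (by linarith)).mul_left
        (16 * Real.pi ^ 2))
    calc _ ≤ q ^ (n : ℤ) * (16 * Real.pi ^ 2 * (4 : ℝ) ^ (-(n : ℤ))) := by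
          gcongr; exact min_le_right _ _
      _ = _ := by rw [zpow_neg, zpow_natCast, zpow_natCast, div_pow]; ring
  · refine Summable.of_nonneg_of_le (fun n => by positivity) (fun n => ?_)
      ((summable_geometric_of_lt_one (r := q⁻¹) (by positivity) (inv_lt_one_of_one_lt₀ hq1)).mul_left
        4)
    calc _ ≤ q ^ (-(n : ℤ)) * 4 := by
          gcongr; exact min_le_left _ _
      _ = _ := by rw [zpow_neg, zpow_natCast, inv_pow]; ring

/-- For 2^J ≤ |k| ≤ 2^{J+1} the squared difference |e_k(2^{-j}) - 1|² is bounded by 4 trivially and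
by 16π²·4^{J-j} from |sin x| ≤ |x|. Factoring out 4^{αJ}, which is at most (1 + k²)^α, leaves a
series in i = j - J, enlarged to all integers so as not to depend on k. -/
theorem dyadicWeight_le (hα : 0 ≤ α) (k : ℤ) :
    dyadicWeight α k ≤ dyadicConst α * ENNReal.ofReal (sobolevWeight α k) ^ 2 := by
  rcases eq_or_ne k 0 with rfl | hk
  · simp [dyadicWeight]
  set J := Nat.log 2 k.natAbs
  have hk0 : k.natAbs ≠ 0 := Int.natAbs_ne_zero.2 hk
  have h1 : (2 : ℝ) ^ J ≤ |(k : ℝ)| := by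
    have := Nat.pow_log_le_self 2 hk0
    rw [← Int.cast_abs, Int.abs_eq_natAbs]; exact_mod_cast this
  have h2 : |(k : ℝ)| ≤ 2 ^ (J + 1) := by
    have := (Nat.lt_pow_succ_log_self (b := 2) (by norm_num) k.natAbs).le
    rw [← Int.cast_abs, Int.abs_eq_natAbs]; exact_mod_cast this
  set q := (4 : ℝ) ^ α with hq
  have hq0 : 0 < q := by positivity
  have hqJ : q ^ J ≤ sobolevWeight α k ^ 2 := by
    rw [sobolevWeight_sq, hq, ← Real.rpow_natCast, ← Real.rpow_mul (by norm_num), mul_comm,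
      Real.rpow_mul (by norm_num), Real.rpow_natCast]
    apply Real.rpow_le_rpow (by positivity) _ hα
    have : (2 : ℝ) ^ J * 2 ^ J ≤ |(k : ℝ)| * |(k : ℝ)| := by gcongr
    rw [abs_mul_abs_self, ← mul_pow] at this
    norm_num at this
    linarith [sq (k : ℝ)]
  have term : ∀ j : ℕ, ENNReal.ofReal (q ^ j * ‖(fourier k (dyadicPoint j) : ℂ) - 1‖ ^ 2) ≤
      ENNReal.ofReal (sobolevWeight α k) ^ 2 * ENNReal.ofReal (q ^ ((j : ℤ) - J) *
        min 4 (16 * Real.pi ^ 2 * (4 : ℝ) ^ (-((j : ℤ) - J)))) := by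
    intro j
    rw [← ENNReal.ofReal_pow (sobolevWeight_pos _ _).le, ← ENNReal.ofReal_mul (by positivity)]
    apply ENNReal.ofReal_le_ofReal
    have hm : ‖(fourier k (dyadicPoint j) : ℂ) - 1‖ ^ 2 ≤
        min 4 (16 * Real.pi ^ 2 * (4 : ℝ) ^ (-((j : ℤ) - J))) := by
      rw [norm_fourier_dyadicPoint_sub_one, mul_pow, sq_abs]
      set x := Real.pi * (k * ((2 : ℝ) ^ j)⁻¹) with hx
      apply le_min
      · nlinarith [Real.sin_sq_le_one x]
      · have hs : Real.sin x ^ 2 ≤ x ^ 2 := by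
          rw [← sq_abs, ← sq_abs x]
          gcongr ?_ ^ 2
          exact Real.abs_sin_le_abs
        have e4 : (4 : ℝ) ^ (-((j : ℤ) - J)) = (2 ^ J) ^ 2 * (((2 : ℝ) ^ j)⁻¹) ^ 2 := by
          rw [neg_sub, zpow_sub₀ (by norm_num), zpow_natCast, zpow_natCast, ← pow_mul, inv_pow,
            ← pow_mul, mul_comm J, mul_comm j, pow_mul, pow_mul, div_eq_mul_inv]
          norm_num
        have hk2 : (k : ℝ) ^ 2 ≤ 4 * (2 ^ J) ^ 2 := by
          rw [← sq_abs]
          calc |(k : ℝ)| ^ 2 ≤ (2 ^ (J + 1)) ^ 2 := by gcongr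
            _ = _ := by ring
        rw [e4]
        calc 2 ^ 2 * Real.sin x ^ 2 ≤ 2 ^ 2 * x ^ 2 := by gcongr
          _ = 4 * Real.pi ^ 2 * ((k : ℝ) ^ 2 * (((2 : ℝ) ^ j)⁻¹) ^ 2) := by rw [hx]; ring
          _ ≤ 4 * Real.pi ^ 2 * ((4 * (2 ^ J) ^ 2) * (((2 : ℝ) ^ j)⁻¹) ^ 2) := by gcongr
          _ = _ := by ring
    have hqj : q ^ j = q ^ J * q ^ ((j : ℤ) - J) := by
      rw [← zpow_natCast, ← zpow_natCast, ← zpow_add₀ hq0.ne']; congr 1; ring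
    rw [hqj, mul_assoc]
    gcongr
  calc dyadicWeight α k ≤ ∑' j : ℕ, ENNReal.ofReal (sobolevWeight α k) ^ 2 *
        ENNReal.ofReal (q ^ ((j : ℤ) - J) *
          min 4 (16 * Real.pi ^ 2 * (4 : ℝ) ^ (-((j : ℤ) - J)))) := ENNReal.tsum_le_tsum term
    _ ≤ ENNReal.ofReal (sobolevWeight α k) ^ 2 * dyadicConst α := by
        rw [ENNReal.tsum_mul_left]
        gcongr
        exact ENNReal.tsum_comp_le_tsum_of_injective (f := fun j : ℕ => (j : ℤ) - J)
          (fun a b h => by simpa using h) (fun i : ℤ => ENNReal.ofReal (q ^ i *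
            min 4 (16 * Real.pi ^ 2 * (4 : ℝ) ^ (-i))))
    _ = _ := mul_comm _ _

/-- By `hasSum_sq_translate` the inner sum on the right is a squared L² norm of a translation
difference, so the dyadic weight is read as a sum of 4^{αj}‖f(· + 2^{-j}) - f‖². -/
theorem tsum_dyadicWeight (f : ℤ → ℂ) : ∑' k, dyadicWeight α k * ‖f k‖ₑ ^ 2 =
    ∑' j : ℕ, ENNReal.ofReal (((4 : ℝ) ^ α) ^ j) *
      ∑' k, ENNReal.ofReal ((‖(fourier k (dyadicPoint j) : ℂ) - 1‖ * ‖f k‖) ^ 2) := by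
  simp only [dyadicWeight, ← ENNReal.tsum_mul_right, ← ENNReal.tsum_mul_left]
  rw [ENNReal.tsum_comm]
  refine tsum_congr fun j => tsum_congr fun k => ?_
  rw [ENNReal.ofReal_mul (by positivity), mul_pow, ENNReal.ofReal_mul (by positivity), mul_assoc,
    ENNReal.ofReal_pow (norm_nonneg (f k)), ofReal_norm]

/-- The pointwise Lipschitz bound is integrated over the circle; Parseval translates both sides into
Fourier coefficients. -/
theorem tsum_translate_le {ι : Type*} [Fintype ι] {f : UnitAddCircle → ℝ} (hf : Continuous f)
    {v : ι → UnitAddCircle → ℝ} (hv : ∀ i, Continuous (v i)) {L : ℝ}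
    (h : ∀ s t, (f s - f t) ^ 2 ≤ L * ∑ i, (v i s - v i t) ^ 2) (hL : 0 ≤ L) (t : UnitAddCircle) :
    ∑' k, ENNReal.ofReal ((‖(fourier k t : ℂ) - 1‖ * ‖realFourierCoeff f k‖) ^ 2) ≤
      ENNReal.ofReal L * ∑ i, ∑' k,
        ENNReal.ofReal ((‖(fourier k t : ℂ) - 1‖ * ‖realFourierCoeff (v i) k‖) ^ 2) := by
  have e : ∀ {g : UnitAddCircle → ℝ}, Continuous g →
      ∑' k, ENNReal.ofReal ((‖(fourier k t : ℂ) - 1‖ * ‖realFourierCoeff g k‖) ^ 2) =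
        ENNReal.ofReal (∫ s, (g (s + t) - g s) ^ 2 ∂AddCircle.haarAddCircle) := fun hg => by
    rw [← (hasSum_sq_translate hg t).tsum_eq, ENNReal.ofReal_tsum_of_nonneg (fun k => sq_nonneg _)
      (hasSum_sq_translate hg t).summable]
  rw [e hf, Finset.sum_congr rfl fun i _ => e (hv i), ← ENNReal.ofReal_sum_of_nonneg
    (fun i _ => MeasureTheory.integral_nonneg fun s => sq_nonneg _), ← ENNReal.ofReal_mul hL]
  apply ENNReal.ofReal_le_ofReal
  have hc : ∀ {g : UnitAddCircle → ℝ}, Continuous g → Continuous fun s => (g (s + t) - g s) ^ 2 :=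
    fun hg => ((hg.comp (continuous_add_const t)).sub hg).pow 2
  rw [← MeasureTheory.integral_finsetSum _ (fun i _ => integrable_of_continuous_circle (hc (hv i))), ← MeasureTheory.integral_const_mul]
  refine MeasureTheory.integral_mono (integrable_of_continuous_circle (hc hf))
    (integrable_of_continuous_circle (continuous_const.mul (continuous_finsetSum _ fun i _ => hc (hv i))))
    fun s => h (s + t) s

/-- The dyadic weight is comparable to |k|^{2α} from both sides, and a Lipschitz bound passes to
every dyadic difference. The coefficient at 0 is invisible to differences and is kept separately;
the factor 2^α comes from 1 + k² ≤ 2k² for k ≠ 0. -/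
theorem sobolevENorm_le_of_lipschitz (h0 : 1 / 2 < α) (h1 : α < 1) {ι : Type*} [Fintype ι]
    {f : UnitAddCircle → ℝ} (hf : Continuous f) {v : ι → UnitAddCircle → ℝ}
    (hv : ∀ i, Continuous (v i)) {L : ℝ} (hL : 0 ≤ L)
    (h : ∀ s t, (f s - f t) ^ 2 ≤ L * ∑ i, (v i s - v i t) ^ 2) :
    sobolevENorm α (realFourierCoeff f) ≤ ‖realFourierCoeff f 0‖ₑ ^ 2 +
      ENNReal.ofReal (2 ^ α) * ENNReal.ofReal L * dyadicConst α *
        ∑ i, sobolevENorm α (realFourierCoeff (v i)) := by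
  have hα : 0 ≤ α := by linarith
  have step1 : sobolevENorm α (realFourierCoeff f) ≤ ‖realFourierCoeff f 0‖ₑ ^ 2 +
      ENNReal.ofReal (2 ^ α) * ∑' k, dyadicWeight α k * ‖realFourierCoeff f k‖ₑ ^ 2 := by
    have e0 : ‖realFourierCoeff f 0‖ₑ ^ 2 =
        ∑' k : ℤ, if k = 0 then ‖realFourierCoeff f 0‖ₑ ^ 2 else 0 := by
      rw [tsum_ite_eq]
    rw [e0, ← ENNReal.tsum_mul_left, ← ENNReal.tsum_add]
    refine ENNReal.tsum_le_tsum fun k => ?_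
    by_cases hk : k = 0
    · subst hk; simp [sobolevWeight]
    · rw [if_neg hk, zero_add, mul_pow, ← mul_assoc]
      gcongr
      refine le_trans ?_ (mul_le_mul_right (le_dyadicWeight hα hk) _)
      rw [← ENNReal.ofReal_pow (sobolevWeight_pos _ _).le, sobolevWeight_sq,
        ← ENNReal.ofReal_mul (by positivity), ← Real.mul_rpow (by norm_num) (sq_nonneg _)]
      apply ENNReal.ofReal_le_ofReal
      apply Real.rpow_le_rpow (by positivity) _ hα
      have : (1 : ℝ) ≤ (k : ℝ) ^ 2 := by
        have : 1 ≤ k ^ 2 := Int.add_one_le_iff.2 ((sq_nonneg k).lt_of_ne' (pow_ne_zero 2 hk))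
        exact_mod_cast this
      linarith
  have step2 : ∑' k, dyadicWeight α k * ‖realFourierCoeff f k‖ₑ ^ 2 ≤
      ENNReal.ofReal L * ∑ i, ∑' k, dyadicWeight α k * ‖realFourierCoeff (v i) k‖ₑ ^ 2 := by
    simp only [tsum_dyadicWeight]
    rw [← Summable.tsum_finsetSum (fun i _ => ENNReal.summable), ← ENNReal.tsum_mul_left]
    refine ENNReal.tsum_le_tsum fun j => ?_
    rw [← Finset.mul_sum, mul_left_comm]
    gcongr
    exact tsum_translate_le hf hv h hL _
  have step3 : ∀ i, ∑' k, dyadicWeight α k * ‖realFourierCoeff (v i) k‖ₑ ^ 2 ≤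
      dyadicConst α * sobolevENorm α (realFourierCoeff (v i)) := fun i => by
    rw [sobolevENorm, ← ENNReal.tsum_mul_left]
    refine ENNReal.tsum_le_tsum fun k => ?_
    rw [mul_pow, ← mul_assoc]
    gcongr
    exact dyadicWeight_le hα k
  calc _ ≤ _ := step1
    _ ≤ ‖realFourierCoeff f 0‖ₑ ^ 2 + ENNReal.ofReal (2 ^ α) * (ENNReal.ofReal L *
        ∑ i, dyadicConst α * sobolevENorm α (realFourierCoeff (v i))) := by
        gcongr
        refine step2.trans ?_
        gcongr with i
        exact step3 i
    _ = _ := by rw [← Finset.mul_sum]; ring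

end Dyadic

/-! ### Hadamard's lemma -/

section Hadamard

/-- The integral is the value at 0 of the convolution of the indicator of (0, 1] with y ↦ χ(y) h(p,
-y), where the bump χ equals 1 on [-1, 1] and provides the compact support under which convolutions
are smooth in a parameter. -/
theorem contDiff_integral_unitInterval {P : Type*} [NormedAddCommGroup P] [NormedSpace ℝ P]
    {h : P → ℝ → ℝ} (hh : ContDiff ℝ ∞ (fun q : P × ℝ => h q.1 q.2)) :
    ContDiff ℝ ∞ fun p => ∫ t in (0 : ℝ)..1, h p t := by
  let χ : ContDiffBump (0 : ℝ) := ⟨1, 2, by norm_num, by norm_num⟩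
  have h1 := MeasureTheory.contDiffOn_convolution_right_with_param_comp (𝕜 := ℝ) (n := ⊤)
    (μ := MeasureTheory.volume) (f := Set.indicator (Set.Ioc (0 : ℝ) 1) fun _ => (1 : ℝ))
    (g := fun (p : P) (y : ℝ) => χ y * h p (-y)) (s := Set.univ) (k := Metric.closedBall 0 2)
    (v := fun _ : P => (0 : ℝ)) (ContinuousLinearMap.mul ℝ ℝ) contDiffOn_const isOpen_univ
    (isCompact_closedBall 0 2) (fun p x _ hx => by
      have : χ x = 0 := χ.zero_of_le_dist (le_of_lt (by simpa using hx))
      simp [this])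
    ((MeasureTheory.integrable_indicator_iff measurableSet_Ioc).2 (by simp)).locallyIntegrable
    (by
      apply ContDiff.contDiffOn
      apply ContDiff.mul
      · exact χ.contDiff.comp contDiff_snd
      · exact hh.comp (contDiff_fst.prodMk contDiff_snd.neg))
  rw [contDiffOn_univ] at h1
  convert h1 using 1
  funext p
  rw [MeasureTheory.convolution, intervalIntegral.integral_of_le zero_le_one,
    ← MeasureTheory.integral_indicator measurableSet_Ioc]
  refine MeasureTheory.integral_congr_ae (Filter.Eventually.of_forall fun t => ?_)
  by_cases ht : t ∈ Set.Ioc (0 : ℝ) 1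
  · have : χ (0 - t) = 1 := χ.one_of_mem_closedBall (by
      simp only [zero_sub, Metric.mem_closedBall, dist_zero_right, norm_neg, Real.norm_eq_abs]
      change |t| ≤ 1
      rw [abs_of_pos ht.1]; exact ht.2)
    simp only [Set.indicator_of_mem ht, ContinuousLinearMap.mul_apply', this]
    simp
  · simp [Set.indicator_of_notMem ht]

variable {ι : Type*} [Fintype ι] [DecidableEq ι]

/-- The gᵢ are the averages of ∂ᵢF over the segment from x to y, and the identity is the fundamental
theorem of calculus. It expresses increments of superposition operators as sums of products in the
algebra H^α; the diagonal values identify the derivative. -/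
theorem exists_hadamard {F : (ι → ℝ) → ℝ} (hF : ContDiff ℝ ∞ F) :
    ∃ g : ι → (ι ⊕ ι → ℝ) → ℝ, (∀ i, ContDiff ℝ ∞ (g i)) ∧
      (∀ x y, F y - F x = ∑ i, g i (Sum.elim x y) * (y i - x i)) ∧
      ∀ i x, g i (Sum.elim x x) = fderiv ℝ F x (Pi.single i 1) := by
  let l : (ι ⊕ ι → ℝ) → ℝ → ι → ℝ := fun z t i => z (Sum.inl i) + t * (z (Sum.inr i) - z (Sum.inl i))
  have hl : ContDiff ℝ ∞ (fun q : (ι ⊕ ι → ℝ) × ℝ => l q.1 q.2) := by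
    rw [contDiff_pi]; intro i; simp only [l]; fun_prop
  have hd : ∀ w, ContDiff ℝ ∞ fun x => fderiv ℝ F x w := fun w =>
    (hF.fderiv_right (m := ∞) (by simp)).clm_apply contDiff_const
  refine ⟨fun i z => ∫ t in (0 : ℝ)..1, fderiv ℝ F (l z t) (Pi.single i 1), fun i => ?_, ?_, ?_⟩
  · exact contDiff_integral_unitInterval ((hd _).comp hl)
  · intro x y
    have hderiv : ∀ t ∈ Set.uIcc (0 : ℝ) 1, HasDerivAt (fun t => F (l (Sum.elim x y) t))
        (fderiv ℝ F (l (Sum.elim x y) t) (y - x)) t := by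
      intro t _
      have h1 : HasDerivAt (l (Sum.elim x y)) (y - x) t := by
        rw [hasDerivAt_pi]
        intro i
        simp only [l, Sum.elim_inl, Sum.elim_inr]
        have := ((hasDerivAt_id t).mul_const (y i - x i)).const_add (x i)
        simpa using this
      exact ((hF.differentiable (by simp)) _).hasFDerivAt.comp_hasDerivAt t h1
    have hcont : ∀ w, Continuous fun t => fderiv ℝ F (l (Sum.elim x y) t) w := fun w => by
      have := ((hd w).comp hl).continuous.comp (Continuous.prodMk_right (Sum.elim x y))
      exact this
    have h := intervalIntegral.integral_eq_sub_of_hasDerivAt hderiv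
      ((hcont _).intervalIntegrable _ _)
    have e1 : l (Sum.elim x y) 1 = y := by funext i; simp [l]
    have e0 : l (Sum.elim x y) 0 = x := by funext i; simp [l]
    rw [e1, e0] at h
    rw [← h]
    have e2 : ∀ t, fderiv ℝ F (l (Sum.elim x y) t) (y - x) =
        ∑ i, fderiv ℝ F (l (Sum.elim x y) t) (Pi.single i 1) * (y i - x i) := by
      intro t
      conv_lhs => rw [pi_eq_sum_univ' (y - x)]
      rw [map_sum]
      refine Finset.sum_congr rfl fun i _ => ?_
      rw [map_smul, smul_eq_mul, mul_comm, Pi.sub_apply]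
    simp only [e2]
    rw [intervalIntegral.integral_finsetSum (f := fun i t =>
      fderiv ℝ F (l (Sum.elim x y) t) (Pi.single i 1) * (y i - x i)) fun i _ =>
      ((hcont _).mul continuous_const).intervalIntegrable _ _]
    refine Finset.sum_congr rfl fun i _ => ?_
    rw [intervalIntegral.integral_mul_const]
  · intro i x
    have e : ∀ t, l (Sum.elim x x) t = x := fun t => by funext i; simp [l]
    simp [e]

end Hadamard

/-! ### Superposition operators -/

section Superposition

open scoped ENNReal
open Sc

variable {α : ℝ} [hF : Fact (1 / 2 < α)] {ι : Type} [Fintype ι]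

/-- The values of a family of functions at a point of the circle. -/
def evFam (u : ι → Sc α) (s : UnitAddCircle) (i : ι) : ℝ := ev (u i) s

theorem continuous_evFam (u : ι → Sc α) : Continuous (evFam u) :=
  continuous_pi fun i => (ev (u i)).continuous

/-- The constant in the embedding of the Sobolev space into the continuous functions. -/
def evConst (α : ℝ) : ℝ := Real.sqrt (weightSum α).toReal

theorem evConst_nonneg : 0 ≤ evConst α := Real.sqrt_nonneg _

theorem norm_evFam_le (u : ι → Sc α) (s : UnitAddCircle) : ‖evFam u s‖ ≤ evConst α * ‖u‖ := by
  refine (pi_norm_le_iff_of_nonneg (by have := evConst_nonneg (α := α); positivity)).2 fun i => ?_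
  exact ((u i).abs_ev_le s).trans
    (mul_le_mul_of_nonneg_left (norm_le_pi_norm u i) (Real.sqrt_nonneg _))

theorem Sc.norm_mul_le' (a b : Sc α) : ‖a * b‖ ≤ mulConst α * ‖a‖ * ‖b‖ :=
  norm_le_of_sobolevENorm_le _
    (mul_nonneg (mul_nonneg (Real.sqrt_nonneg _) (norm_nonneg _)) (norm_nonneg _))
    (sobolevENorm_mul_le hF.out (abs_self_le hF.out) a b)

variable (α) in
/-- Composition with smooth functions preserves the Sobolev class, and is locally bounded. -/
def IsLocallyBoundedSuperposition : Prop :=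
  ∀ (ι : Type) [Fintype ι] (F : (ι → ℝ) → ℝ), ContDiff ℝ ∞ F → ∀ R : ℝ, ∃ C : ℝ,
    ∀ u : ι → Sc α, ‖u‖ ≤ R → ∃ a : Sc α, (∀ s, ev a s = F (evFam u s)) ∧ ‖a‖ ≤ C

theorem norm_realFourierCoeff_le {f : UnitAddCircle → ℝ} {M : ℝ} (h : ∀ s, |f s| ≤ M) (k : ℤ) :
    ‖realFourierCoeff f k‖ ≤ M := by
  rw [realFourierCoeff, fourierCoeff]
  refine (MeasureTheory.norm_integral_le_of_norm_le_const (C := M)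
    (Filter.Eventually.of_forall fun s => ?_)).trans (by simp)
  rw [norm_smul, fourier_apply, Circle.norm_coe, one_mul, Complex.norm_real]
  exact h s

/-- A norm bound on u confines its values to a fixed ball, by the embedding into continuous
functions. On this ball F is bounded and Lipschitz, so `sobolevENorm_le_of_lipschitz` gives a bound
depending only on R. -/
theorem isLocallyBoundedSuperposition_of_lt_one (h1 : α < 1) :
    IsLocallyBoundedSuperposition α := by
  intro ι _ F hFs R
  obtain hR | hR := lt_or_ge R 0
  · exact ⟨0, fun u hu => absurd ((norm_nonneg u).trans hu) (not_le.2 hR)⟩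
  set r := evConst α * R
  have hr : 0 ≤ r := mul_nonneg evConst_nonneg hR
  obtain ⟨L, hL⟩ := (isCompact_closedBall (0 : ι → ℝ) r).exists_bound_of_continuousOn
    (hFs.continuous_fderiv (by simp)).continuousOn
  obtain ⟨M, hM⟩ := (isCompact_closedBall (0 : ι → ℝ) r).exists_bound_of_continuousOn
    hFs.continuous.continuousOn
  have hlip : ∀ x ∈ Metric.closedBall (0 : ι → ℝ) r, ∀ y ∈ Metric.closedBall (0 : ι → ℝ) r,
      ‖F x - F y‖ ≤ L * ‖x - y‖ := fun x hx y hy =>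
    (convex_closedBall (0 : ι → ℝ) r).norm_image_sub_le_of_norm_fderiv_le
      (fun z _ => hFs.differentiable (by simp) z) hL hy hx
  set D : ℝ≥0∞ := ENNReal.ofReal M ^ 2 + ENNReal.ofReal (2 ^ α) * ENNReal.ofReal (L ^ 2) *
    dyadicConst α * ∑ _i : ι, ENNReal.ofReal (R ^ 2) with hD
  have hDtop : D ≠ ⊤ := by
    have := dyadicConst_ne_top (α := α) (by linarith [hF.out]) h1
    have : ∑ _i : ι, ENNReal.ofReal (R ^ 2) ≠ ⊤ :=
      ENNReal.sum_ne_top.2 fun _ _ => ENNReal.ofReal_ne_top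
    finiteness
  refine ⟨Real.sqrt D.toReal, fun u hu => ?_⟩
  have hmem : ∀ s, evFam u s ∈ Metric.closedBall (0 : ι → ℝ) r := fun s => by
    rw [mem_closedBall_zero_iff]
    exact (norm_evFam_le u s).trans (mul_le_mul_of_nonneg_left hu evConst_nonneg)
  have hcont : Continuous fun s => F (evFam u s) := hFs.continuous.comp (continuous_evFam u)
  have key : sobolevENorm α (realFourierCoeff fun s => F (evFam u s)) ≤ D := by
    refine (sobolevENorm_le_of_lipschitz hF.out h1 hcont (v := fun i s => ev (u i) s)
      (fun i => (ev (u i)).continuous) (L := L ^ 2) (sq_nonneg L) fun s t => ?_).trans ?_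
    · have h2 := hlip _ (hmem s) _ (hmem t)
      have h3 : ‖evFam u s - evFam u t‖ ^ 2 ≤ ∑ i, (ev (u i) s - ev (u i) t) ^ 2 := by
        have h0 : 0 ≤ ∑ i, (ev (u i) s - ev (u i) t) ^ 2 := Finset.sum_nonneg fun i _ => sq_nonneg _
        rw [← Real.sqrt_le_sqrt_iff h0, Real.sqrt_sq (norm_nonneg _)]
        refine (pi_norm_le_iff_of_nonneg (Real.sqrt_nonneg _)).2 fun i => ?_
        rw [Real.norm_eq_abs, ← Real.sqrt_sq_eq_abs]
        exact Real.sqrt_le_sqrt (Finset.single_le_sum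
          (f := fun i => (ev (u i) s - ev (u i) t) ^ 2) (fun i _ => sq_nonneg _) (Finset.mem_univ i))
      calc (F (evFam u s) - F (evFam u t)) ^ 2 = ‖F (evFam u s) - F (evFam u t)‖ ^ 2 := by
            rw [Real.norm_eq_abs, sq_abs]
        _ ≤ (L * ‖evFam u s - evFam u t‖) ^ 2 := by gcongr
        _ ≤ _ := by rw [mul_pow]; gcongr
    · rw [hD]
      gcongr with i
      · rw [← ofReal_norm]
        exact ENNReal.ofReal_le_ofReal (norm_realFourierCoeff_le (fun s => hM _ (hmem s)) 0)
      · have : realFourierCoeff (fun s => ev (u i) s) = (u i).c :=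
          funext fun k => (u i).realFourierCoeff_ev k
        rw [this, sobolevENorm_eq]
        exact ENNReal.ofReal_le_ofReal
          (pow_le_pow_left₀ (norm_nonneg _) ((norm_le_pi_norm u i).trans hu) 2)
  obtain ⟨a, ha, hac⟩ := exists_ev_eq hcont (ne_top_of_le_ne_top hDtop key)
  refine ⟨a, ha, a.norm_le_of_sobolevENorm_le (Real.sqrt_nonneg _) ?_⟩
  rw [hac, Real.sq_sqrt ENNReal.toReal_nonneg, ENNReal.ofReal_toReal hDtop]
  exact key

open Classical in
/-- The superposition operator `u ↦ F ∘ u` on families of functions of Sobolev class `α`. -/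
def nem (F : (ι → ℝ) → ℝ) (u : ι → Sc α) : Sc α :=
  if h : ∃ a : Sc α, ∀ s, ev a s = F (evFam u s) then h.choose else 0

theorem nem_eq {F : (ι → ℝ) → ℝ} {u : ι → Sc α} {a : Sc α} (h : ∀ s, ev a s = F (evFam u s)) :
    nem F u = a := by
  have h' : ∃ a : Sc α, ∀ s, ev a s = F (evFam u s) := ⟨a, h⟩
  rw [nem, dif_pos h']
  exact ext_ev fun s => by rw [h'.choose_spec, h]

theorem ev_nem_of_exists {F : (ι → ℝ) → ℝ} {u : ι → Sc α}
    (h : ∃ a : Sc α, ∀ s, ev a s = F (evFam u s)) (s : UnitAddCircle) :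
    ev (nem F u) s = F (evFam u s) := by
  obtain ⟨a, ha⟩ := h
  rw [nem_eq ha, ha]

namespace IsLocallyBoundedSuperposition

variable (hLB : IsLocallyBoundedSuperposition α)
include hLB

theorem ev_nem {F : (ι → ℝ) → ℝ} (hFs : ContDiff ℝ ∞ F) (u : ι → Sc α) (s : UnitAddCircle) :
    ev (nem F u) s = F (evFam u s) := by
  obtain ⟨C, hC⟩ := hLB ι F hFs ‖u‖
  obtain ⟨a, ha, -⟩ := hC u le_rfl
  exact ev_nem_of_exists ⟨a, ha⟩ s

theorem exists_norm_nem_le {F : (ι → ℝ) → ℝ} (hFs : ContDiff ℝ ∞ F) (R : ℝ) :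
    ∃ C, 0 ≤ C ∧ ∀ u : ι → Sc α, ‖u‖ ≤ R → ‖nem F u‖ ≤ C := by
  obtain ⟨C, hC⟩ := hLB ι F hFs R
  refine ⟨max C 0, le_max_right _ _, fun u hu => ?_⟩
  obtain ⟨a, ha, haC⟩ := hC u hu
  rw [nem_eq ha]; exact haC.trans (le_max_left _ _)

theorem nem_sub {F : (ι → ℝ) → ℝ} (hFs : ContDiff ℝ ∞ F) {g : ι → (ι ⊕ ι → ℝ) → ℝ}
    (hg : ∀ i, ContDiff ℝ ∞ (g i)) (h : ∀ x y, F y - F x = ∑ i, g i (Sum.elim x y) * (y i - x i))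
    (u v : ι → Sc α) : nem F v - nem F u = ∑ i, nem (g i) (Sum.elim u v) * (v i - u i) := by
  have e : ∀ s, evFam (Sum.elim u v) s = Sum.elim (evFam u s) (evFam v s) := fun s => by
    funext j; cases j <;> rfl
  refine ext_ev fun s => ?_
  simp only [ev_sub, ev_sum, ev_mul, hLB.ev_nem hFs, fun i => hLB.ev_nem (hg i), e, h]
  rfl

/-- By Hadamard's identity the increment is a sum of products whose first factors are bounded on the
unit ball around u and whose second factors are components of v - u. -/
theorem continuous_nem {F : (ι → ℝ) → ℝ} (hFs : ContDiff ℝ ∞ F) :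
    Continuous (nem F : (ι → Sc α) → Sc α) := by
  classical
  obtain ⟨g, hg, h, -⟩ := exists_hadamard hFs
  rw [continuous_iff_continuousAt]
  intro u
  choose C hC0 hC using fun i => hLB.exists_norm_nem_le (hg i) (‖u‖ + 1)
  rw [ContinuousAt, tendsto_iff_norm_sub_tendsto_zero]
  have hb : ∀ᶠ v in 𝓝 u, ‖nem F v - nem F u‖ ≤ ∑ i, mulConst α * C i * ‖v - u‖ := by
    filter_upwards [Metric.ball_mem_nhds u one_pos] with v hv
    have hv' : ‖v‖ ≤ ‖u‖ + 1 := by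
      have h1 : ‖v - u‖ < 1 := by rwa [← dist_eq_norm]
      have h2 := norm_le_norm_add_norm_sub' v u
      linarith
    rw [hLB.nem_sub hFs hg h]
    refine (norm_sum_le _ _).trans (Finset.sum_le_sum fun i _ => (Sc.norm_mul_le' _ _).trans ?_)
    have hm : 0 ≤ mulConst α := Real.sqrt_nonneg _
    gcongr
    · exact mul_nonneg hm (hC0 i)
    · refine hC i _ ((pi_norm_le_iff_of_nonneg (by positivity)).2 fun j => ?_)
      rcases j with j | j
      · exact (norm_le_pi_norm u j).trans (by linarith)
      · exact (norm_le_pi_norm v j).trans hv'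
    · exact norm_le_pi_norm (v - u) i
  refine squeeze_zero' (Filter.Eventually.of_forall fun v => norm_nonneg _) hb ?_
  have : Filter.Tendsto (fun v => ∑ i, mulConst α * C i * ‖v - u‖) (𝓝 u)
      (𝓝 (∑ i, mulConst α * C i * ‖u - u‖)) := by
    apply Continuous.tendsto
    fun_prop
  simpa using this

/-- The derivative of a superposition operator. -/
theorem hasFDerivAt_nem [DecidableEq ι] {F : (ι → ℝ) → ℝ} (hFs : ContDiff ℝ ∞ F) (u : ι → Sc α) :
    HasFDerivAt (nem F : (ι → Sc α) → Sc α)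
      (∑ i, (mulL hF.out (abs_self_le hF.out)
        (nem (fun x => fderiv ℝ F x (Pi.single i 1)) u)).comp (ContinuousLinearMap.proj i)) u := by
  obtain ⟨g, hg, h, hdiag⟩ := exists_hadamard hFs
  have hcont : Filter.Tendsto (fun v => ∑ i, mulConst α *
      ‖nem (g i) (Sum.elim u v) - nem (g i) (Sum.elim u u)‖) (𝓝 u) (𝓝 0) := by
    have hc : Continuous fun v => ∑ i, mulConst α *
      ‖nem (g i) (Sum.elim u v) - nem (g i) (Sum.elim u u)‖ := by
      refine continuous_finsetSum _ fun i _ => continuous_const.mul (Continuous.norm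
        (Continuous.sub ((hLB.continuous_nem (hg i)).comp ?_) continuous_const))
      refine continuous_pi fun j => ?_
      rcases j with j | j
      · exact continuous_const
      · exact continuous_apply j
    simpa using hc.tendsto u
  rw [hasFDerivAt_iff_isLittleO, Asymptotics.isLittleO_iff]
  intro c hc
  filter_upwards [hcont.eventually (gt_mem_nhds hc)] with v hv
  -- The remainder has coefficients gᵢ(u, v) - gᵢ(u, u), which tend to 0 by the continuity already
  -- proved; multiplied by v - u they are of smaller order.
  have e : nem F v - nem F u - (∑ i, (mulL hF.out (abs_self_le hF.out)
        (nem (fun x => fderiv ℝ F x (Pi.single i 1)) u)).comp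
          (ContinuousLinearMap.proj (R := ℝ) (φ := fun _ : ι => Sc α) i)) (v - u) =
      ∑ i, (nem (g i) (Sum.elim u v) - nem (g i) (Sum.elim u u)) * (v i - u i) := by
    rw [hLB.nem_sub hFs hg h, _root_.sum_apply, ← Finset.sum_sub_distrib]
    refine Finset.sum_congr rfl fun i _ => ?_
    have e2 : nem (fun x => fderiv ℝ F x (Pi.single i 1)) u = nem (g i) (Sum.elim u u) := by
      refine nem_eq fun s => ?_
      rw [hLB.ev_nem (hg i), ← hdiag]
      congr 1
      funext j; cases j <;> rfl
    rw [e2, sub_mul]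
    rfl
  rw [e]
  calc _ ≤ ∑ i, mulConst α * ‖nem (g i) (Sum.elim u v) - nem (g i) (Sum.elim u u)‖ * ‖v - u‖ := by
        refine (norm_sum_le _ _).trans (Finset.sum_le_sum fun i _ => (Sc.norm_mul_le' _ _).trans ?_)
        have hm : 0 ≤ mulConst α := Real.sqrt_nonneg _
        gcongr
        exact norm_le_pi_norm (v - u) i
    _ = (∑ i, mulConst α * ‖nem (g i) (Sum.elim u v) - nem (g i) (Sum.elim u u)‖) * ‖v - u‖ := by
        rw [Finset.sum_mul]
    _ ≤ _ := by gcongr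

/-- The derivative is built linearly from the superposition operators of the ∂ᵢF, which are again
smooth functions; so one order of differentiability is gained at a time. -/
theorem contDiff_nem {F : (ι → ℝ) → ℝ} (hFs : ContDiff ℝ ∞ F) :
    ContDiff ℝ ∞ (nem F : (ι → Sc α) → Sc α) := by
  classical
  rw [contDiff_infty]
  intro m
  induction m generalizing F with
  | zero => exact contDiff_zero.2 (hLB.continuous_nem hFs)
  | succ m ih =>
    refine contDiff_succ_iff_hasFDerivAt.2 ⟨_, ?_, fun u => hLB.hasFDerivAt_nem hFs u⟩
    refine ContDiff.sum fun i _ => ?_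
    refine ContDiff.clm_comp ?_ contDiff_const
    exact (mulL hF.out (abs_self_le hF.out)).contDiff.comp
      (ih ((hFs.fderiv_right (m := ∞) (by simp)).clm_apply contDiff_const))

end IsLocallyBoundedSuperposition

end Superposition

/-! ### Trigonometric truncation and pointwise derivatives -/

section Truncation

open scoped ENNReal

variable {σ : ℝ}

namespace Sc

open Classical in
/-- The truncation of a Fourier series. -/
def trunc (N : ℕ) (a : Sc σ) : Sc σ :=
  ofC (fun k => if k.natAbs ≤ N then a.c k else 0) (fun k => by
      simp only [Int.natAbs_neg]
      split_ifs <;> simp [c_conj])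
    (ne_top_of_le_ne_top a.sobolevENorm_ne_top (ENNReal.tsum_le_tsum fun k => by
      gcongr
      dsimp only
      split_ifs <;> simp))

theorem c_trunc (N : ℕ) (a : Sc σ) (k : ℤ) :
    (trunc N a).c k = if k.natAbs ≤ N then a.c k else 0 := rfl

theorem tendsto_trunc (a : Sc σ) : Filter.Tendsto (fun N => trunc N a) Filter.atTop (𝓝 a) := by
  rw [tendsto_iff_norm_sub_tendsto_zero]
  have h : Filter.Tendsto (fun N => ‖trunc N a - a‖ ^ 2) Filter.atTop (𝓝 0) := by
    have e : ∀ N, ‖trunc N a - a‖ ^ 2 =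
        ∑' k, (sobolevWeight σ k * ‖(trunc N a - a).c k‖) ^ 2 :=
      fun N => (hasSum_norm_sq _).tsum_eq.symm
    simp only [e]
    rw [show (0 : ℝ) = ∑' _k : ℤ, (0 : ℝ) by simp]
    refine tendsto_tsum_of_dominated_convergence (hasSum_norm_sq a).summable (fun k => ?_)
      (Filter.Eventually.of_forall fun N k => ?_)
    · refine tendsto_const_nhds.congr' ?_
      filter_upwards [Filter.eventually_ge_atTop k.natAbs] with N hN
      simp [c_trunc, hN]
    · rw [Real.norm_of_nonneg (sq_nonneg _)]
      have := sobolevWeight_pos σ k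
      gcongr
      rw [c_sub, c_trunc]
      split_ifs <;> simp
  have := h.sqrt
  simpa [Real.sqrt_sq (norm_nonneg _)] using this

variable [hF : Fact (1 / 2 < σ)]

theorem hasDerivAt_ev {a d : Sc σ}
    (h : ∀ k, d.c k = 2 * (Real.pi : ℂ) * Complex.I * (k : ℂ) * a.c k) (x : ℝ) :
    HasDerivAt (fun y : ℝ => ev a (y : UnitAddCircle)) (ev d (x : UnitAddCircle)) x := by
  have hder : ∀ (k : ℤ) (y : ℝ), HasDerivAt (fun y : ℝ => a.c k * fourier k (y : UnitAddCircle))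
      (d.c k * fourier k (y : UnitAddCircle)) y := fun k y => by
    refine ((hasDerivAt_fourier 1 k y).const_mul (a.c k)).congr_deriv ?_
    rw [h]; push_cast; ring
  have key := hasDerivAt_tsum (d.summable_norm_c hF.out) hder
    (fun k y => by rw [norm_mul, fourier_apply, Circle.norm_coe, mul_one])
    ((a.hasSum_ev (0 : ℝ)).summable) x
  simp only [fun y : ℝ => (a.hasSum_ev (y : UnitAddCircle)).tsum_eq,
    (d.hasSum_ev (x : UnitAddCircle)).tsum_eq] at key
  have := Complex.reCLM.hasFDerivAt.comp_hasDerivAt x key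
  simpa [Function.comp_def] using this

/-- Integration of the derivative of e_{-k} · a over one period; the boundary terms cancel by
periodicity. -/
theorem c_eq_of_hasDerivAt_ev {a d : Sc σ}
    (h : ∀ x : ℝ, HasDerivAt (fun y : ℝ => ev a (y : UnitAddCircle)) (ev d (x : UnitAddCircle)) x)
    (k : ℤ) : d.c k = 2 * (Real.pi : ℂ) * Complex.I * (k : ℂ) * a.c k := by
  have hq : Continuous fun x : ℝ => (x : UnitAddCircle) := AddCircle.continuous_mk' 1
  have hcoef : ∀ b : Sc σ, b.c k = ∫ x in (0 : ℝ)..1,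
      (fourier (-k) (x : UnitAddCircle) : ℂ) * (ev b (x : UnitAddCircle) : ℂ) := fun b => by
    rw [← realFourierCoeff_ev, realFourierCoeff, fourierCoeff_eq_intervalIntegral _ _ 0]
    simp
  have hci : ∀ b : Sc σ, IntervalIntegrable (fun x : ℝ =>
      (fourier (-k) (x : UnitAddCircle) : ℂ) * (ev b (x : UnitAddCircle) : ℂ))
      MeasureTheory.volume 0 1 := fun b => Continuous.intervalIntegrable
    (((fourier (-k)).continuous.comp hq).mul
      (Complex.continuous_ofReal.comp ((ev b).continuous.comp hq))) _ _
  have hd : ∀ x ∈ Set.uIcc (0 : ℝ) 1, HasDerivAt (fun x : ℝ =>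
      (fourier (-k) (x : UnitAddCircle) : ℂ) * (ev a (x : UnitAddCircle) : ℂ))
      (-(2 * (Real.pi : ℂ) * Complex.I * (k : ℂ)) *
        ((fourier (-k) (x : UnitAddCircle) : ℂ) * (ev a (x : UnitAddCircle) : ℂ)) +
        (fourier (-k) (x : UnitAddCircle) : ℂ) * (ev d (x : UnitAddCircle) : ℂ)) x := fun x _ => by
    refine ((hasDerivAt_fourier 1 (-k) x).mul (h x).ofReal_comp).congr_deriv ?_
    push_cast; ring
  have := intervalIntegral.integral_eq_sub_of_hasDerivAt hd
    (((hci a).const_mul _).add (hci d))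
  rw [intervalIntegral.integral_add ((hci a).const_mul _) (hci d),
    intervalIntegral.integral_const_mul, ← hcoef, ← hcoef] at this
  have e1 : ((1 : ℝ) : UnitAddCircle) = ((0 : ℝ) : UnitAddCircle) := by
    rw [AddCircle.coe_period]; rfl
  rw [e1, sub_self] at this
  linear_combination this

/-- Only finitely many coefficients are nonzero, so no regularity is lost and the derivative of a
truncation has pointwise values. -/
theorem exists_deriv_trunc (N : ℕ) (a : Sc σ) : ∃ d : Sc σ,
    ∀ k, d.c k = 2 * (Real.pi : ℂ) * Complex.I * (k : ℂ) * (trunc N a).c k := by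
  refine ⟨ofC (fun k => 2 * (Real.pi : ℂ) * Complex.I * (k : ℂ) * (trunc N a).c k) (fun k => ?_) ?_,
    fun k => c_ofC _ _ _ k⟩
  · simp only [c_conj, map_mul, Complex.conj_ofReal, Complex.conj_I, Int.cast_neg,
      map_intCast, map_ofNat]
    ring
  · rw [sobolevENorm, tsum_eq_sum (s := Finset.Icc (-(N : ℤ)) N) fun k hk => by
      have : ¬ k.natAbs ≤ N := fun h => hk (Finset.mem_Icc.2 (by omega))
      simp [c_trunc, this]]
    exact ENNReal.sum_ne_top.2 fun k _ => by finiteness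

theorem ev_incl {τ : ℝ} [Fact (1 / 2 < τ)] (h : σ ≤ τ) (a : Sc τ) (s : UnitAddCircle) :
    ev (incl h a) s = ev a s :=
  ev_eq_of_hasSum _ _ (by simpa using a.hasSum_ev s)

end Sc

end Truncation

/-! ### The chain rule and superposition operators for every α > 1/2 -/

section ChainRule

open Sc

variable {α : ℝ} [hF : Fact (1 / 2 < α)] {ι : Type} [Fintype ι]

namespace IsLocallyBoundedSuperposition

/-- The chain rule. -/
theorem deriv_nem [DecidableEq ι] (hLB : IsLocallyBoundedSuperposition α) {F : (ι → ℝ) → ℝ}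
    (hFs : ContDiff ℝ ∞ F) (u : ι → Sc α) :
    deriv (nem F u) = ∑ i, nem (fun x => fderiv ℝ F x (Pi.single i 1)) u • deriv (u i) := by
  have hd : ∀ i, ContDiff ℝ ∞ fun x => fderiv ℝ F x (Pi.single i 1) := fun i =>
    (hFs.fderiv_right (m := ∞) (by simp)).clm_apply contDiff_const
  -- Both sides are continuous in u, and truncations converge to u. On trigonometric polynomials all
  -- derivatives are functions and the classical chain rule applies pointwise.
  have hc1 : Continuous fun u : ι → Sc α => deriv (nem F u) :=
    deriv.continuous.comp (hLB.continuous_nem hFs)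
  have hc2 : Continuous fun u : ι → Sc α =>
      ∑ i, nem (fun x => fderiv ℝ F x (Pi.single i 1)) u • deriv (u i) := by
    refine continuous_finsetSum _ fun i _ => ?_
    exact ((mulL hF.out (abs_sub_one_le hF.out)).continuous₂.comp
      ((hLB.continuous_nem (hd i)).prodMk (deriv.continuous.comp (continuous_apply i))))
  have hlim : Filter.Tendsto (fun N => fun i => trunc N (u i)) Filter.atTop (𝓝 u) :=
    tendsto_pi_nhds.2 fun i => tendsto_trunc (u i)
  refine tendsto_nhds_unique ((hc1.tendsto u).comp hlim)
    (((hc2.tendsto u).comp hlim).congr fun N => ?_)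
  simp only [Function.comp_apply]
  set v : ι → Sc α := fun i => trunc N (u i)
  choose d hdc using fun i => exists_deriv_trunc N (u i)
  have hder := c_eq_of_hasDerivAt_ev (a := nem F v)
    (d := ∑ i, nem (fun x => fderiv ℝ F x (Pi.single i 1)) v * d i) (fun x => by
      have h1 : HasDerivAt (fun y : ℝ => evFam v (y : UnitAddCircle))
          (fun i => ev (d i) (x : UnitAddCircle)) x := by
        rw [hasDerivAt_pi]
        exact fun i => hasDerivAt_ev (hdc i) x
      have h2 := (hFs.differentiable (by simp) (evFam v x)).hasFDerivAt.comp_hasDerivAt x h1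
      simp only [ev_sum, ev_mul, fun i => hLB.ev_nem (hd i)]
      refine (h2.congr_deriv ?_).congr_of_eventuallyEq
        (Filter.Eventually.of_forall fun y => hLB.ev_nem hFs v y)
      · rw [pi_eq_sum_univ' (fun i => ev (d i) (x : UnitAddCircle)), map_sum]
        refine Finset.sum_congr rfl fun i _ => ?_
        rw [map_smul, smul_eq_mul, mul_comm])
  refine (ext_c fun k => ?_).symm
  have e1 : (deriv (nem F v)).c k =
      (∑ i, nem (fun x => fderiv ℝ F x (Pi.single i 1)) v * d i).c k := (hder k).symm
  rw [e1, ← cL_apply, ← cL_apply, map_sum, map_sum]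
  refine Finset.sum_congr rfl fun i _ => ?_
  rw [cL_apply, cL_apply, c_mul, c_smul']
  refine tsum_congr fun m => ?_
  rw [hdc, c_deriv]

/-- For k ≠ 0 one has (1 + k²)^{1/2} ≤ 2π|k|, so each weighted coefficient is controlled by that of
the derivative; k = 0 contributes the extra term. -/
theorem _root_.sobolevENorm_le_of_deriv {σ : ℝ} {c d : ℤ → ℂ}
    (h : ∀ k, d k = 2 * (Real.pi : ℂ) * Complex.I * (k : ℂ) * c k) :
    sobolevENorm σ c ≤ ENNReal.ofReal (‖c 0‖ ^ 2) + sobolevENorm (σ - 1) d := by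
  have e0 : ENNReal.ofReal (‖c 0‖ ^ 2) =
      ∑' k : ℤ, if k = 0 then ENNReal.ofReal (‖c 0‖ ^ 2) else 0 := by rw [tsum_ite_eq]
  rw [e0, sobolevENorm, sobolevENorm, ← ENNReal.tsum_add]
  refine ENNReal.tsum_le_tsum fun k => ?_
  rw [ofReal_mul_enorm, ofReal_mul_enorm]
  by_cases hk : k = 0
  · subst hk; simp [sobolevWeight]
  · rw [if_neg hk, zero_add]
    apply ENNReal.ofReal_le_ofReal
    have hk1 : (1 : ℝ) ≤ (k : ℝ) ^ 2 := by
      have : 1 ≤ k ^ 2 := Int.add_one_le_iff.2 ((sq_nonneg k).lt_of_ne' (pow_ne_zero 2 hk))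
      exact_mod_cast this
    have hw1 : sobolevWeight 1 k ≤ 2 * Real.pi * |(k : ℝ)| := by
      rw [sobolevWeight, ← Real.sqrt_eq_rpow, Real.sqrt_le_left (by positivity), mul_pow,
        sq_abs]
      have : (36 : ℝ) ≤ (2 * Real.pi) ^ 2 := by nlinarith [Real.pi_gt_three]
      nlinarith
    have hwα : sobolevWeight σ k = sobolevWeight (σ - 1) k * sobolevWeight 1 k := by
      rw [← sobolevWeight_add]; congr 1; ring
    have hn : ‖d k‖ = 2 * Real.pi * |(k : ℝ)| * ‖c k‖ := by
      rw [h]; simp [abs_of_pos Real.pi_pos]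
    have p1 := sobolevWeight_pos (σ - 1) k
    have p2 := sobolevWeight_pos 1 k
    rw [hwα, hn, mul_assoc]
    gcongr

theorem _root_.Sc.exists_incl_eq {σ β : ℝ} (h : β ≤ σ) (f : Sc β) (hf : sobolevENorm σ f.c ≠ ⊤) :
    ∃ a : Sc σ, incl h a = f ∧ a.c = f.c := by
  have hc : (ofC f.c f.c_conj hf : Sc σ).c = f.c := funext fun k => c_ofC _ _ _ k
  exact ⟨ofC f.c f.c_conj hf, ext_c fun k => by rw [c_incl, hc], hc⟩

theorem _root_.evFam_incl {β : ℝ} [Fact (1 / 2 < β)] (h : β ≤ α) {ι : Type} [Fintype ι]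
    (u : ι → Sc α) (s : UnitAddCircle) : evFam (fun i => incl h (u i)) s = evFam u s :=
  funext fun i => ev_incl h (u i) s

/-- Bootstrapping: F ∘ u is known to be of class β, and its derivative ∑ (∂ᵢF ∘ u) uᵢ' is a product
of class β functions with class α - 1 distributions. Since |α - 1| ≤ β, this product is of class α -
1, so F ∘ u is of class α, with bounds at every stage. -/
theorem of_sub_one_le {β : ℝ} [hβ : Fact (1 / 2 < β)] (hLB : IsLocallyBoundedSuperposition β)
    (hα1 : 1 ≤ α) (hle : α - 1 ≤ β) (hle' : β ≤ α) : IsLocallyBoundedSuperposition α := by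
  classical
  intro ι _ F hFs R
  obtain hR | hR := lt_or_ge R 0
  · exact ⟨0, fun u hu => absurd ((norm_nonneg u).trans hu) (not_le.2 hR)⟩
  have hd : ∀ i, ContDiff ℝ ∞ fun x => fderiv ℝ F x (Pi.single i 1) := fun i =>
    (hFs.fderiv_right (m := ∞) (by simp)).clm_apply contDiff_const
  have hab : |α - 1| ≤ β := by rwa [abs_of_nonneg (by linarith)]
  set I : Sc α →L[ℝ] Sc β := incl hle' with hI
  obtain ⟨C0, hC00, hC0⟩ := hLB.exists_norm_nem_le hFs (‖I‖ * R)
  choose C hCn hC using fun i => hLB.exists_norm_nem_le (hd i) (‖I‖ * R)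
  set M := ‖mulL hβ.out hab‖
  set E : ℝ := ∑ i, M * C i * (‖(deriv : Sc α →L[ℝ] _)‖ * R) with hE
  have hE0 : 0 ≤ E := Finset.sum_nonneg fun i _ => by have := hCn i; positivity
  refine ⟨Real.sqrt (C0 ^ 2 + E ^ 2), fun u hu => ?_⟩
  set u' : ι → Sc β := fun i => I (u i)
  have hu' : ‖u'‖ ≤ ‖I‖ * R := (pi_norm_le_iff_of_nonneg (by positivity)).2 fun i =>
    (I.le_opNorm _).trans (by gcongr; exact (norm_le_pi_norm u i).trans hu)
  set f := nem F u' with hf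
  set e : Sc (α - 1) := ∑ i, mulL hβ.out hab (nem (fun x => fderiv ℝ F x (Pi.single i 1)) u')
    (deriv (u i)) with he
  have heE : ‖e‖ ≤ E := by
    refine (norm_sum_le _ _).trans (Finset.sum_le_sum fun i _ => ?_)
    refine (ContinuousLinearMap.le_opNorm₂ _ _ _).trans ?_
    have := hCn i
    gcongr
    · exact hC i _ hu'
    · exact (ContinuousLinearMap.le_opNorm _ _).trans (by
        gcongr; exact (norm_le_pi_norm u i).trans hu)
  have hec : ∀ k, e.c k = 2 * (Real.pi : ℂ) * Complex.I * (k : ℂ) * f.c k := by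
    intro k
    have h1 := hLB.deriv_nem hFs u'
    rw [← c_deriv, hf, h1, he, ← cL_apply, ← cL_apply, map_sum, map_sum]
    refine Finset.sum_congr rfl fun i _ => ?_
    rw [cL_apply, cL_apply, c_mulL, c_smul']
    refine tsum_congr fun m => ?_
    rw [c_deriv, c_deriv, c_incl]
  have hbound : sobolevENorm α f.c ≤ ENNReal.ofReal (C0 ^ 2 + E ^ 2) := by
    rw [ENNReal.ofReal_add (sq_nonneg _) (sq_nonneg _)]
    refine (sobolevENorm_le_of_deriv hec).trans (add_le_add ?_ ?_)
    · apply ENNReal.ofReal_le_ofReal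
      have h0 := f.norm_c_le 0
      have h1 : sobolevWeight (-β) 0 = 1 := by simp [sobolevWeight]
      rw [h1, one_mul] at h0
      exact pow_le_pow_left₀ (norm_nonneg _) (h0.trans (hC0 _ hu')) 2
    · rw [sobolevENorm_eq]
      exact ENNReal.ofReal_le_ofReal (pow_le_pow_left₀ (norm_nonneg _) heE 2)
  obtain ⟨a, hIa, hac⟩ := exists_incl_eq hle' f (ne_top_of_le_ne_top ENNReal.ofReal_ne_top hbound)
  refine ⟨a, fun s => ?_, a.norm_le_of_sobolevENorm_le (Real.sqrt_nonneg _) ?_⟩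
  · rw [← ev_incl hle' a, hIa, hf, hLB.ev_nem hFs, evFam_incl hle' u s]
  · rw [Real.sq_sqrt (by positivity), hac]
    exact hbound

end IsLocallyBoundedSuperposition

theorem isLocallyBoundedSuperposition_aux (n : ℕ) : ∀ (α : ℝ) [Fact (1 / 2 < α)],
    α < 1 + n / 4 → IsLocallyBoundedSuperposition α := by
  induction n with
  | zero => exact fun α _ h => isLocallyBoundedSuperposition_of_lt_one (by simpa using h)
  | succ n ih =>
    intro α hα h
    push_cast at h
    rcases lt_or_ge α 1 with h1 | h1
    · exact isLocallyBoundedSuperposition_of_lt_one h1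
    · have : Fact (1 / 2 < max (α - 1) (3 / 4)) := ⟨lt_max_of_lt_right (by norm_num)⟩
      -- The lower class must satisfy α - 1 ≤ β ≤ α and exceed 1/2, while α - 1 alone may be as
      -- small as 0; hence the maximum with 3/4.
      have hn : (0 : ℝ) ≤ n := n.cast_nonneg
      exact (ih (max (α - 1) (3 / 4)) (max_lt (by linarith) (by linarith))).of_sub_one_le h1
        (le_max_left _ _) (max_le (by linarith) (by linarith))

variable (α) in
theorem isLocallyBoundedSuperposition : IsLocallyBoundedSuperposition α := by
  obtain ⟨n, hn⟩ := exists_nat_gt (4 * (α - 1))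
  exact isLocallyBoundedSuperposition_aux n α (by linarith)

end ChainRule

/-! ### Superposition with functions defined on an open set -/

section LocalSuperposition

open Sc

variable {α : ℝ} [hF : Fact (1 / 2 < α)] {ι : Type} [Fintype ι]

/-- The image of the circle is compact, so a uniform neighbourhood of it lies in U, and the Sobolev
norm controls the uniform norm. -/
theorem eventually_evFam_mem {U : Set (ι → ℝ)} (hU : IsOpen U) {u : ι → Sc α}
    (hu : ∀ s, evFam u s ∈ U) : ∀ᶠ v in 𝓝 u, ∀ s, evFam v s ∈ U := by
  have hK : IsCompact (Set.range (evFam u)) := isCompact_range (continuous_evFam u)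
  obtain ⟨δ, hδ, hsub⟩ := hK.exists_thickening_subset_open hU (by rintro _ ⟨s, rfl⟩; exact hu s)
  have hc : Filter.Tendsto (fun v => evConst α * ‖v - u‖) (𝓝 u) (𝓝 0) := by
    have : Continuous fun v : ι → Sc α => evConst α * ‖v - u‖ := by fun_prop
    simpa using this.tendsto u
  filter_upwards [hc.eventually (gt_mem_nhds hδ)] with v hv s
  refine hsub (Metric.mem_thickening_iff.2 ⟨evFam u s, ⟨s, rfl⟩, ?_⟩)
  rw [dist_eq_norm]
  have : evFam v s - evFam u s = evFam (v - u) s := by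
    funext i; simp [evFam]
  rw [this]
  exact (norm_evFam_le _ s).trans_lt hv

theorem isOpen_evFam_mem {U : Set (ι → ℝ)} (hU : IsOpen U) :
    IsOpen {u : ι → Sc α | ∀ s, evFam u s ∈ U} :=
  isOpen_iff_mem_nhds.2 fun _ hu => eventually_evFam_mem hU hu

/-- Multiplication by a cutoff. Agreement on a neighbourhood of K, not only on K, is what keeps
nearby loops and derivatives unaffected. -/
theorem exists_contDiff_extension {U K : Set (ι → ℝ)} (hU : IsOpen U) (hK : IsCompact K)
    (hKU : K ⊆ U) {F : (ι → ℝ) → ℝ} (hFs : ContDiffOn ℝ ∞ F U) :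
    ∃ (F' : (ι → ℝ) → ℝ) (V : Set (ι → ℝ)), ContDiff ℝ ∞ F' ∧ IsOpen V ∧ K ⊆ V ∧ V ⊆ U ∧
      Set.EqOn F' F V := by
  obtain ⟨L, hL, hKL, hLU⟩ := exists_compact_between hK hU hKU
  obtain ⟨χ, hχ1, hχ0, -⟩ := exists_contMDiffMap_one_nhds_of_subset_interior (n := ⊤)
    𝓘(ℝ, ι → ℝ) hK.isClosed hKL
  obtain ⟨V, hV, hKV, hV1⟩ := eventually_nhdsSet_iff_exists.1 hχ1
  refine ⟨fun x => χ x * F x, V ∩ U, ?_, hV.inter hU, Set.subset_inter hKV hKU,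
    Set.inter_subset_right, fun x hx => by simp [hV1 x hx.1]⟩
  rw [contDiff_iff_contDiffAt]
  intro x
  by_cases hx : x ∈ U
  · exact (χ.contMDiff.contDiff.contDiffAt).mul (hFs.contDiffAt (hU.mem_nhds hx))
  · have : (fun x => χ x * F x) =ᶠ[𝓝 x] fun _ => 0 := by
      filter_upwards [hL.isClosed.isOpen_compl.mem_nhds fun h => hx (hLU h)] with y hy
      simp [hχ0 y hy]
    exact contDiffAt_const.congr_of_eventuallyEq this

variable {U : Set (ι → ℝ)} (hU : IsOpen U) {F : (ι → ℝ) → ℝ} (hFs : ContDiffOn ℝ ∞ F U)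
include hU hFs

theorem exists_nem_eventuallyEq {u : ι → Sc α} (hu : ∀ s, evFam u s ∈ U) :
    ∃ F' : (ι → ℝ) → ℝ, ContDiff ℝ ∞ F' ∧ (∀ s, F' =ᶠ[𝓝 (evFam u s)] F) ∧
      ∀ᶠ v in 𝓝 u, ∀ s, F' (evFam v s) = F (evFam v s) := by
  obtain ⟨F', V, hF', hV, hKV, -, heq⟩ := exists_contDiff_extension hU
    (isCompact_range (continuous_evFam u)) (by rintro _ ⟨s, rfl⟩; exact hu s) hFs
  have hs : ∀ s, evFam u s ∈ V := fun s => hKV ⟨s, rfl⟩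
  refine ⟨F', hF', fun s => ?_, ?_⟩
  · filter_upwards [hV.mem_nhds (hs s)] with y hy using heq hy
  · filter_upwards [eventually_evFam_mem hV hs] with v hv s using heq (hv s)

theorem ev_nem {u : ι → Sc α} (hu : ∀ s, evFam u s ∈ U) (s : UnitAddCircle) :
    ev (nem F u) s = F (evFam u s) := by
  obtain ⟨F', hF', -, h⟩ := exists_nem_eventuallyEq hU hFs hu
  refine ev_nem_of_exists ⟨nem F' u, fun s => ?_⟩ s
  rw [(isLocallyBoundedSuperposition α).ev_nem hF', h.self_of_nhds]

theorem contDiffAt_nem {u : ι → Sc α} (hu : ∀ s, evFam u s ∈ U) :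
    ContDiffAt ℝ ∞ (nem F : (ι → Sc α) → Sc α) u := by
  obtain ⟨F', hF', -, h⟩ := exists_nem_eventuallyEq hU hFs hu
  refine ((isLocallyBoundedSuperposition α).contDiff_nem hF').contDiffAt.congr_of_eventuallyEq ?_
  filter_upwards [h] with v hv
  exact nem_eq fun s => by rw [(isLocallyBoundedSuperposition α).ev_nem hF', hv]

end LocalSuperposition

/-! ### Lie groups in the preferred chart at the unit -/

section LieGroupCharts

/-- The derivative of a map depending smoothly on a parameter depends smoothly on it. -/
theorem ContMDiffAt.fderiv_param {EN HN N : Type*} [NormedAddCommGroup EN] [NormedSpace ℝ EN]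
    [TopologicalSpace HN] {J : ModelWithCorners ℝ EN HN} [TopologicalSpace N] [ChartedSpace HN N]
    [IsManifold J ∞ N]
    {X F : Type*} [NormedAddCommGroup X] [NormedSpace ℝ X] [NormedAddCommGroup F] [NormedSpace ℝ F]
    {f : N → X → F} {k : N → X} {x : N}
    (hf : ContMDiffAt (J.prod 𝓘(ℝ, X)) 𝓘(ℝ, F) ∞ (Function.uncurry f) (x, k x))
    (hk : ContMDiffAt J 𝓘(ℝ, X) ∞ k x) :
    ContMDiffAt J 𝓘(ℝ, X →L[ℝ] F) ∞ (fun y => fderiv ℝ (f y) (k y)) x := by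
  have := ContMDiffAt.mfderiv (m := ∞) f k hf hk (by simp)
  have e : inTangentCoordinates 𝓘(ℝ, X) 𝓘(ℝ, F) k (fun x => f x (k x))
      (fun x => mfderiv 𝓘(ℝ, X) 𝓘(ℝ, F) (f x) (k x)) x = fun x => fderiv ℝ (f x) (k x) :=
    (inTangentCoordinates_model_space k (fun x => f x (k x)) _ x).trans
      (funext fun _ => mfderiv_eq_fderiv)
  exact e ▸ this

/-- The derivative of a map between manifolds without boundary, in the preferred charts. -/
theorem MDifferentiableAt.mfderiv_eq_fderiv {E E' M M' : Type*} [NormedAddCommGroup E]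
    [NormedSpace ℝ E] [NormedAddCommGroup E'] [NormedSpace ℝ E'] [TopologicalSpace M]
    [ChartedSpace E M] [TopologicalSpace M'] [ChartedSpace E' M'] {f : M → M'} {x : M}
    (h : MDifferentiableAt 𝓘(ℝ, E) 𝓘(ℝ, E') f x) :
    mfderiv 𝓘(ℝ, E) 𝓘(ℝ, E') f x =
      (fderiv ℝ (fun y => chartAt E' (f x) (f ((chartAt E x).symm y))) (chartAt E x x) :
        E →L[ℝ] E') := by
  refine h.mfderiv.trans ?_
  rw [ModelWithCorners.range_eq_univ, fderivWithin_univ]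
  rfl

variable (n : ℕ) (G : Type*) [TopologicalSpace G] [ChartedSpace (EuclideanSpace ℝ (Fin n)) G]
  [Group G]

/-- The preferred chart at the unit. -/
abbrev unitChart : OpenPartialHomeomorph G (EuclideanSpace ℝ (Fin n)) := chartAt _ (1 : G)

/-- The image of the unit in its preferred chart. -/
abbrev unitPt : EuclideanSpace ℝ (Fin n) := unitChart n G 1

theorem one_mem_unitChart : (1 : G) ∈ (unitChart n G).source := mem_chart_source _ _

theorem unitPt_mem : unitPt n G ∈ (unitChart n G).target := mem_chart_target _ _

@[simp]
theorem unitChart_symm_unitPt : (unitChart n G).symm (unitPt n G) = 1 :=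
  (unitChart n G).left_inv (one_mem_unitChart n G)

variable {G} {F : Type*} [NormedAddCommGroup F] [NormedSpace ℝ F]

/-- The derivatives of `f` at `g` along the right-invariant vector fields. -/
def rightD (f : G → F) (g : G) : EuclideanSpace ℝ (Fin n) →L[ℝ] F :=
  fderiv ℝ (fun y => f ((unitChart n G).symm y * g)) (unitPt n G)

/-- The derivatives of `f` at `g` along the left-invariant vector fields. -/
def leftD (f : G → F) (g : G) : EuclideanSpace ℝ (Fin n) →L[ℝ] F :=
  fderiv ℝ (fun y => f (g * (unitChart n G).symm y)) (unitPt n G)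

variable [LieGroup (𝓡 n) ∞ G] {n}

theorem contMDiffAt_unitChart_symm {y : EuclideanSpace ℝ (Fin n)}
    (hy : y ∈ (unitChart n G).target) :
    ContMDiffAt (𝓡 n) (𝓡 n) ∞ (unitChart n G).symm y :=
  (contMDiffOn_chart_symm (I := 𝓡 n) (n := ∞) (x := (1 : G))).contMDiffAt
    ((unitChart n G).open_target.mem_nhds hy)

theorem contMDiffAt_unitChart {g : G} (hg : g ∈ (unitChart n G).source) :
    ContMDiffAt (𝓡 n) (𝓡 n) ∞ (unitChart n G) g :=
  (contMDiffOn_chart (I := 𝓡 n) (n := ∞) (x := (1 : G))).contMDiffAt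
    ((unitChart n G).open_source.mem_nhds hg)

variable {X : Type*} [NormedAddCommGroup X] [NormedSpace ℝ X]

theorem differentiableAt_comp_unitChart_symm {f : G → F} {g : G} (hg : g ∈ (unitChart n G).source)
    (hf : ContMDiffAt (𝓡 n) 𝓘(ℝ, F) ∞ f g) :
    DifferentiableAt ℝ (fun y => f ((unitChart n G).symm y)) (unitChart n G g) := by
  have h1 := contMDiffAt_unitChart_symm ((unitChart n G).map_source hg)
  have h2 := ContMDiffAt.comp (I' := 𝓡 n) (unitChart n G g)
    (by rwa [(unitChart n G).left_inv hg]) h1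
  exact h2.contDiffAt.differentiableAt (by simp)

/-- The chain rule for curves through the domain of the chart at the unit. -/
theorem fderiv_comp_unitChart {f : G → F} {k : X → G} {x : X}
    (hx : k x ∈ (unitChart n G).source) (hf : ContMDiffAt (𝓡 n) 𝓘(ℝ, F) ∞ f (k x))
    (hk : ContMDiffAt 𝓘(ℝ, X) (𝓡 n) ∞ k x) :
    fderiv ℝ (fun t => f (k t)) x =
      (fderiv ℝ (fun y => f ((unitChart n G).symm y)) (unitChart n G (k x))).comp
        (fderiv ℝ (fun t => unitChart n G (k t)) x) := by
  have h1 : DifferentiableAt ℝ (fun t => unitChart n G (k t)) x :=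
    (ContMDiffAt.comp (I' := 𝓡 n) (g := unitChart n G) (f := k) x
      (contMDiffAt_unitChart hx) hk).contDiffAt.differentiableAt
      (by simp)
  have h2 := differentiableAt_comp_unitChart_symm hx hf
  rw [← fderiv_comp (g := fun y => f ((unitChart n G).symm y)) x h2 h1]
  refine Filter.EventuallyEq.fderiv_eq ?_
  filter_upwards [hk.continuousAt.preimage_mem_nhds ((unitChart n G).open_source.mem_nhds hx)]
    with t ht
  simp [(unitChart n G).left_inv ht]

variable (n) in
theorem contMDiffAt_mul_unitChart_symm_mul (g h : G) {y : EuclideanSpace ℝ (Fin n)}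
    (hy : y ∈ (unitChart n G).target) :
    ContMDiffAt (𝓡 n) (𝓡 n) ∞ (fun y => g * (unitChart n G).symm y * h) y :=
  (contMDiffAt_const.mul (contMDiffAt_unitChart_symm hy)).mul contMDiffAt_const

theorem rightInvariantDeriv_eq {f : G → ℝ} (hf : ContMDiff (𝓡 n) 𝓘(ℝ, ℝ) ∞ f)
    (v : GroupLieAlgebra (𝓡 n) G) (g : G) : rightInvariantDeriv f v g = rightD n f g v := by
  have h : MDifferentiableAt (𝓡 n) 𝓘(ℝ, ℝ) (fun x : G => f (x * g)) 1 :=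
    ((hf.comp (contMDiff_mul_right (I := 𝓡 n) (a := g))).contMDiffAt).mdifferentiableAt (by simp)
  exact congrArg (fun L : EuclideanSpace ℝ (Fin n) →L[ℝ] ℝ => L v) h.mfderiv_eq_fderiv

theorem adjointMap_eq (g : G) : adjointMap n g =
    fderiv ℝ (fun y => unitChart n G (g * (unitChart n G).symm y * g⁻¹)) (unitPt n G) := by
  have h : MDifferentiableAt (𝓡 n) (𝓡 n) (fun x : G => g * x * g⁻¹) 1 :=
    (((contMDiff_mul_right (I := 𝓡 n) (n := ∞) (a := g⁻¹)).comp
      (contMDiff_mul_left (I := 𝓡 n) (a := g))).contMDiffAt).mdifferentiableAt (by simp)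
  refine h.mfderiv_eq_fderiv.trans ?_
  rw [mul_one, mul_inv_cancel]

/-- Differentiate g x = (g x g⁻¹) g at x = 1. -/
theorem ContMDiffAt.leftD_eq {f : G → F} {g : G} (hf : ContMDiffAt (𝓡 n) 𝓘(ℝ, F) ∞ f g) :
    leftD n f g = (rightD n f g).comp (adjointMap n g) := by
  have h := fderiv_comp_unitChart (f := fun x => f (x * g)) (x := unitPt n G)
    (k := fun y => g * (unitChart n G).symm y * g⁻¹)
    (by simp) ?_ (contMDiffAt_mul_unitChart_symm_mul (G := G) n g g⁻¹ (unitPt_mem n G))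
  · simp only [inv_mul_cancel_right, unitChart_symm_unitPt, mul_one, mul_inv_cancel] at h
    rw [leftD, h, adjointMap_eq]
    rfl
  · refine ContMDiffAt.comp (I' := 𝓡 n) (f := fun x => x * g) _ ?_
      (contMDiff_mul_right (I := 𝓡 n) (a := g)).contMDiffAt
    simpa using hf

theorem leftD_eq {f : G → F} (hf : ContMDiff (𝓡 n) 𝓘(ℝ, F) ∞ f) (g : G) :
    leftD n f g = (rightD n f g).comp (adjointMap n g) :=
  hf.contMDiffAt.leftD_eq

theorem adjointMap_one : adjointMap n (1 : G) = ContinuousLinearMap.id ℝ _ := by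
  rw [adjointMap_eq]
  simp only [one_mul, inv_one, mul_one]
  rw [← fderiv_id (𝕜 := ℝ) (x := unitPt n G)]
  refine Filter.EventuallyEq.fderiv_eq ?_
  filter_upwards [(unitChart n G).open_target.mem_nhds (unitPt_mem n G)] with y hy
  simp [(unitChart n G).right_inv hy]

theorem adjointMap_mul (g h : G) :
    adjointMap n (g * h) = (adjointMap n g).comp (adjointMap n h) := by
  have h1 : (fun y => unitChart n G (h * (unitChart n G).symm y * h⁻¹)) (unitPt n G) =
      unitPt n G := by simp
  have h := fderiv_comp_unitChart (f := fun x => unitChart n G (g * x * g⁻¹)) (x := unitPt n G)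
    (k := fun y => h * (unitChart n G).symm y * h⁻¹)
    (by simp) ?_
    (contMDiffAt_mul_unitChart_symm_mul (G := G) n h h⁻¹ (unitPt_mem n G))
  · simp only [unitChart_symm_unitPt, mul_one, mul_inv_cancel] at h
    rw [adjointMap_eq, adjointMap_eq, adjointMap_eq, ← h]
    simp only [mul_inv_rev, mul_assoc]
  · have : g * (h * (unitChart n G).symm (unitPt n G) * h⁻¹) * g⁻¹ ∈ (unitChart n G).source := by
      simp
    exact ContMDiffAt.comp (I' := 𝓡 n) _ (contMDiffAt_unitChart this)
      ((contMDiffAt_const.mul contMDiffAt_id).mul contMDiffAt_const)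

theorem adjointMap_apply_adjointMap_inv (g : G) (v : EuclideanSpace ℝ (Fin n)) :
    adjointMap n g (adjointMap n g⁻¹ v) = v := by
  have := adjointMap_mul (n := n) g g⁻¹
  rw [mul_inv_cancel, adjointMap_one] at this
  exact (congrArg (fun L : EuclideanSpace ℝ (Fin n) →L[ℝ] _ => L v) this).symm

theorem contMDiff_adjointMap : ContMDiff (𝓡 n) 𝓘(ℝ, EuclideanSpace ℝ (Fin n) →L[ℝ]
    EuclideanSpace ℝ (Fin n)) ∞ (fun g : G => adjointMap n g) := by
  intro g
  simp only [adjointMap_eq]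
  refine ContMDiffAt.fderiv_param (k := fun _ => unitPt n G) ?_ contMDiffAt_const
  have h1 : g * (unitChart n G).symm (unitPt n G) * g⁻¹ ∈ (unitChart n G).source := by
    simp
  refine ContMDiffAt.comp (I' := 𝓡 n) (g, unitPt n G) (contMDiffAt_unitChart h1) ?_
  exact (contMDiffAt_fst.mul (ContMDiffAt.comp (I' := 𝓡 n) (g, unitPt n G)
    (contMDiffAt_unitChart_symm (n := n) (G := G) (unitPt_mem n G)) contMDiffAt_snd)).mul contMDiffAt_fst.inv

theorem contMDiff_rightD {f : G → F} (hf : ContMDiff (𝓡 n) 𝓘(ℝ, F) ∞ f) :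
    ContMDiff (𝓡 n) 𝓘(ℝ, EuclideanSpace ℝ (Fin n) →L[ℝ] F) ∞ (rightD n f) := by
  intro g
  refine ContMDiffAt.fderiv_param (k := fun _ => unitPt n G) ?_ contMDiffAt_const
  exact ContMDiffAt.comp (I' := 𝓡 n) (g, unitPt n G) hf.contMDiffAt
    ((ContMDiffAt.comp (I' := 𝓡 n) (g, unitPt n G)
    (contMDiffAt_unitChart_symm (n := n) (G := G) (unitPt_mem n G)) contMDiffAt_snd).mul contMDiffAt_fst)

/-! ### The Maurer–Cartan form in the chart at the unit -/

variable (n G) in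
/-- The left-invariant frame in the chart at the unit. -/
def leftFrame (x : EuclideanSpace ℝ (Fin n)) :
    EuclideanSpace ℝ (Fin n) →L[ℝ] EuclideanSpace ℝ (Fin n) :=
  fderiv ℝ (fun z => unitChart n G ((unitChart n G).symm x * (unitChart n G).symm z)) (unitPt n G)

variable (n G) in
/-- The left-invariant Maurer–Cartan form in the chart at the unit. -/
def maurerCartan (x : EuclideanSpace ℝ (Fin n)) :
    EuclideanSpace ℝ (Fin n) →L[ℝ] EuclideanSpace ℝ (Fin n) :=
  fderiv ℝ (fun y => unitChart n G (((unitChart n G).symm x)⁻¹ * (unitChart n G).symm y)) x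

variable {x : EuclideanSpace ℝ (Fin n)}

theorem leftFrame_unitPt : leftFrame n G (unitPt n G) = ContinuousLinearMap.id ℝ _ := by
  rw [← adjointMap_one (G := G), adjointMap_eq, leftFrame]
  simp

/-- These are the derivatives, in the chart, of z ↦ x z at 1 and of y ↦ x⁻¹ y at x, whose composite
is the identity. -/
theorem maurerCartan_leftFrame (hx : x ∈ (unitChart n G).target) :
    (maurerCartan n G x).comp (leftFrame n G x) = ContinuousLinearMap.id ℝ _ := by
  have h := fderiv_comp_unitChart (n := n) (x := unitPt n G)
    (f := fun g => unitChart n G (((unitChart n G).symm x)⁻¹ * g))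
    (k := fun y => (unitChart n G).symm x * (unitChart n G).symm y)
    (by simp [hx]) ?_ ?_
  · simp only [unitChart_symm_unitPt, mul_one, (unitChart n G).right_inv hx,
      inv_mul_cancel_left] at h
    rw [maurerCartan, leftFrame, ← h, ← adjointMap_one (G := G), adjointMap_eq]
    simp
  · refine ContMDiffAt.comp (I' := 𝓡 n) _ (contMDiffAt_unitChart (n := n) (G := G) ?_)
      (contMDiffAt_const.mul contMDiffAt_id)
    simp
  · exact contMDiffAt_const.mul (contMDiffAt_unitChart_symm (n := n) (G := G) (unitPt_mem n G))

theorem leftFrame_maurerCartan (hx : x ∈ (unitChart n G).target) :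
    (leftFrame n G x).comp (maurerCartan n G x) = ContinuousLinearMap.id ℝ _ := by
  have h := fderiv_comp_unitChart (n := n) (x := x)
    (f := fun g => unitChart n G ((unitChart n G).symm x * g))
    (k := fun y => ((unitChart n G).symm x)⁻¹ * (unitChart n G).symm y)
    (by simp) ?_ ?_
  · simp only [inv_mul_cancel, mul_inv_cancel_left] at h
    rw [maurerCartan, leftFrame, ← h, ← fderiv_id (𝕜 := ℝ) (x := x)]
    refine Filter.EventuallyEq.fderiv_eq ?_
    filter_upwards [(unitChart n G).open_target.mem_nhds hx] with y hy
    simp [(unitChart n G).right_inv hy]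
  · refine ContMDiffAt.comp (I' := 𝓡 n) _ (contMDiffAt_unitChart (n := n) (G := G) ?_)
      (contMDiffAt_const.mul contMDiffAt_id)
    simp [hx]
  · exact contMDiffAt_const.mul (contMDiffAt_unitChart_symm (n := n) (G := G) hx)

theorem contDiffAt_leftFrame (hx : x ∈ (unitChart n G).target) :
    ContDiffAt ℝ ∞ (leftFrame n G) x := by
  refine ContMDiffAt.contDiffAt (ContMDiffAt.fderiv_param (k := fun _ => unitPt n G) ?_
    contMDiffAt_const)
  refine ContMDiffAt.comp (I' := 𝓡 n) (x, unitPt n G) (contMDiffAt_unitChart ?_)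
    ((ContMDiffAt.comp (I' := 𝓡 n) (x, unitPt n G) (contMDiffAt_unitChart_symm (n := n) (G := G) hx)
      contMDiffAt_fst).mul (ContMDiffAt.comp (I' := 𝓡 n) (x, unitPt n G)
      (contMDiffAt_unitChart_symm (n := n) (G := G) (unitPt_mem n G)) contMDiffAt_snd))
  simp [hx]

theorem contDiffAt_maurerCartan (hx : x ∈ (unitChart n G).target) :
    ContDiffAt ℝ ∞ (maurerCartan n G) x := by
  refine ContMDiffAt.contDiffAt (ContMDiffAt.fderiv_param (k := fun y => y) ?_ contMDiffAt_id)
  refine ContMDiffAt.comp (I' := 𝓡 n) (x, x) (contMDiffAt_unitChart ?_)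
    ((ContMDiffAt.comp (I' := 𝓡 n) (x, x) (contMDiffAt_unitChart_symm (n := n) (G := G) hx)
      contMDiffAt_fst).inv.mul (ContMDiffAt.comp (I' := 𝓡 n) (x, x)
      (contMDiffAt_unitChart_symm (n := n) (G := G) hx) contMDiffAt_snd))
  simp

end LieGroupCharts

/-! ### Left-invariant fields in the chart and the Maurer–Cartan equation -/

section LieBracketCharts

open VectorField

variable {n : ℕ} {G : Type*} [TopologicalSpace G] [ChartedSpace (EuclideanSpace ℝ (Fin n)) G]
  [Group G] [LieGroup (𝓡 n) ∞ G]

variable (n G) in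
-- The Lie algebra axioms for the bracket of left-invariant fields are available under this
-- regularity.
theorem lieGroup_minSmoothness : LieGroup (𝓡 n) (minSmoothness ℝ 3) G :=
  LieGroup.of_le (n := ∞) (by
    rw [minSmoothness_of_isRCLikeNormedField]
    exact WithTop.coe_le_coe.2 (le_top : (3 : ℕ∞) ≤ ⊤))

/-- The inverse of the differential of the inverse chart is the differential of the chart, and the
chain rule combines it with that of left translation. This passes from abstract invariant fields to
the concrete frame. -/
theorem mpullback_mulInvariantVectorField_unitChart {x : EuclideanSpace ℝ (Fin n)}
    (hx : x ∈ (unitChart n G).target) (v : GroupLieAlgebra (𝓡 n) G) :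
    mpullback (𝓡 n) (𝓡 n) (unitChart n G).symm (mulInvariantVectorField v) x =
      leftFrame n G x v := by
  set g : G := (unitChart n G).symm x with hg
  have hgs : g ∈ (unitChart n G).source := (unitChart n G).map_target hx
  have hm := mdifferentiable_chart (I := 𝓡 n) (1 : G)
  have hinv : (mfderiv (𝓡 n) (𝓡 n) (unitChart n G).symm x).inverse =
      mfderiv (𝓡 n) (𝓡 n) (unitChart n G) g := by
    refine ContinuousLinearMap.inverse_eq ?_ ?_
    · have h := hm.symm_comp_deriv hgs
      rwa [show (unitChart n G) g = x from (unitChart n G).right_inv hx] at h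
    · exact hm.comp_symm_deriv hx
  have hmul : MDifferentiableAt (𝓡 n) (𝓡 n) (fun h : G => g * h) 1 :=
    (contMDiff_mul_left (I := 𝓡 n) (n := ∞) (a := g)).contMDiffAt.mdifferentiableAt (by simp)
  have hg1 : g * 1 ∈ (unitChart n G).source := by rwa [mul_one]
  have hch : MDifferentiableAt (𝓡 n) (𝓡 n) (unitChart n G) (g * 1) :=
    hm.mdifferentiableAt hg1
  have hcomp := mfderiv_comp (1 : G) hch hmul
  have hd := (hch.comp (1 : G) hmul).mfderiv_eq_fderiv
  have e1 : ∀ h : G, h = g → (mfderiv (𝓡 n) (𝓡 n) (unitChart n G) h :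
      EuclideanSpace ℝ (Fin n) →L[ℝ] EuclideanSpace ℝ (Fin n)) =
      mfderiv (𝓡 n) (𝓡 n) (unitChart n G) g := by rintro h rfl; rfl
  rw [mpullback_apply, hinv, mulInvariantVectorField, leftFrame]
  have e2 := congrArg (fun L : EuclideanSpace ℝ (Fin n) →L[ℝ] EuclideanSpace ℝ (Fin n) => L v)
    (hcomp.symm.trans hd)
  refine Eq.trans ?_ e2
  exact (congrArg (fun L : EuclideanSpace ℝ (Fin n) →L[ℝ] EuclideanSpace ℝ (Fin n) =>
    L (mfderiv (𝓡 n) (𝓡 n) (fun h : G => g * h) 1 v)) (e1 (g * 1) (mul_one g))).symm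

/-- Pullback commutes with brackets of vector fields, and the bracket of left-invariant fields is
the left-invariant field of the bracket. -/
theorem lieBracket_leftFrame {x : EuclideanSpace ℝ (Fin n)}
    (hx : x ∈ (unitChart n G).target) (v w : EuclideanSpace ℝ (Fin n)) :
    lieBracket ℝ (fun y => leftFrame n G y v) (fun y => leftFrame n G y w) x =
      leftFrame n G x (lieAlgBracket n G v w) := by
  have := lieGroup_minSmoothness n G
  have h := mpullback_mlieBracket (n := ∞) (x₀ := x)
    (V := mulInvariantVectorField (I := 𝓡 n) (G := G) v)
    (W := mulInvariantVectorField (I := 𝓡 n) (G := G) w)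
    (mdifferentiableAt_mulInvariantVectorField _)
    (mdifferentiableAt_mulInvariantVectorField _) (contMDiffAt_unitChart_symm hx)
    (by
      rw [minSmoothness_of_isRCLikeNormedField]
      exact WithTop.coe_le_coe.2 (le_top : (2 : ℕ∞) ≤ ⊤))
  have hev : ∀ v : EuclideanSpace ℝ (Fin n),
      mpullback (𝓡 n) (𝓡 n) (unitChart n G).symm (mulInvariantVectorField v) =ᶠ[𝓝 x]
      fun y => leftFrame n G y v := fun v => by
    filter_upwards [(unitChart n G).open_target.mem_nhds hx] with y hy
    exact mpullback_mulInvariantVectorField_unitChart hy v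
  have h' := (congrArg (fun V => mpullback (𝓡 n) (𝓡 n) (unitChart n G).symm V x)
    (mulInvariantVector_mlieBracket (I := 𝓡 n) (G := G) v w)).trans h
  have h'' := (mpullback_mulInvariantVectorField_unitChart hx _).symm.trans h'
  rw [← (hev v).lieBracket_vectorField_eq (hev w)]
  have e : ∀ V W : EuclideanSpace ℝ (Fin n) → EuclideanSpace ℝ (Fin n),
      mlieBracket (𝓡 n) V W = lieBracket ℝ V W := fun V W =>
    (mlieBracketWithin_univ (I := 𝓡 n)).symm.trans
      ((mlieBracketWithin_eq_lieBracketWithin (s := Set.univ)).trans lieBracketWithin_univ)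
  exact ((congrFun (e _ _) x).symm.trans h''.symm)

theorem fderiv_leftFrame_apply {x : EuclideanSpace ℝ (Fin n)}
    (hx : x ∈ (unitChart n G).target) (v h : EuclideanSpace ℝ (Fin n)) :
    fderiv ℝ (fun y => leftFrame n G y v) x h = fderiv ℝ (leftFrame n G) x h v := by
  have hd := (contDiffAt_leftFrame hx).differentiableAt (by simp)
  rw [fderiv_clm_apply hd (differentiableAt_const _)]
  simp

/-- The Maurer–Cartan equation. -/
theorem fderiv_maurerCartan {x : EuclideanSpace ℝ (Fin n)}
    (hx : x ∈ (unitChart n G).target) (h k : EuclideanSpace ℝ (Fin n)) :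
    fderiv ℝ (maurerCartan n G) x h k - fderiv ℝ (maurerCartan n G) x k h =
      -lieAlgBracket n G (maurerCartan n G x h) (maurerCartan n G x k) := by
  have hdl := (contDiffAt_leftFrame hx).differentiableAt (by simp)
  have hdm := (contDiffAt_maurerCartan hx).differentiableAt (by simp)
  have hinv : ∀ h, leftFrame n G x (maurerCartan n G x h) = h := fun h =>
    DFunLike.congr_fun (leftFrame_maurerCartan hx) h
  have hinv' : ∀ h, maurerCartan n G x (leftFrame n G x h) = h := fun h =>
    DFunLike.congr_fun (maurerCartan_leftFrame hx) h
  -- Differentiating θ(y) ∘ L(y) = id, with L the left frame, moves the derivative from θ to L. The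
  -- antisymmetrization of the latter is the bracket of frame fields.
  have hprod : ∀ h v, fderiv ℝ (maurerCartan n G) x h (leftFrame n G x v) =
      -maurerCartan n G x (fderiv ℝ (leftFrame n G) x h v) := by
    intro h v
    have e : (fun y => (maurerCartan n G y).comp (leftFrame n G y)) =ᶠ[𝓝 x]
        fun _ => ContinuousLinearMap.id ℝ _ := by
      filter_upwards [(unitChart n G).open_target.mem_nhds hx] with y hy
      exact maurerCartan_leftFrame hy
    have e2 := e.fderiv_eq (𝕜 := ℝ)
    rw [fderiv_clm_comp hdm hdl, fderiv_fun_const] at e2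
    have e3 := DFunLike.congr_fun (DFunLike.congr_fun e2 h) v
    simp only [_root_.add_apply, ContinuousLinearMap.comp_apply] at e3
    simpa [eq_neg_iff_add_eq_zero, add_comm] using e3
  have key := lieBracket_leftFrame hx (maurerCartan n G x h) (maurerCartan n G x k)
  rw [lieBracket_eq] at key
  simp only [fderiv_leftFrame_apply hx, hinv] at key
  have h1 := hprod h (maurerCartan n G x k)
  have h2 := hprod k (maurerCartan n G x h)
  rw [hinv] at h1 h2
  rw [h1, h2, ← hinv' (lieAlgBracket n G (maurerCartan n G x h) (maurerCartan n G x k)), ← key,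
    map_sub]
  abel

end LieBracketCharts

/-! ### The adjoint representation and its derivative -/

section AdjointRepresentation

variable {n : ℕ} {G : Type*} [TopologicalSpace G] [ChartedSpace (EuclideanSpace ℝ (Fin n)) G]
  [Group G] [LieGroup (𝓡 n) ∞ G]

variable (n G) in
/-- The bracket of the Lie algebra as a continuous bilinear map. -/
def bracketCLM :
    EuclideanSpace ℝ (Fin n) →L[ℝ] EuclideanSpace ℝ (Fin n) →L[ℝ] EuclideanSpace ℝ (Fin n) :=
  have := lieGroup_minSmoothness n G
  LinearMap.toContinuousBilinearMap (LinearMap.mk₂ ℝ (lieAlgBracket n G)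
    (fun u v w => add_lie (L := GroupLieAlgebra (𝓡 n) G) (M := GroupLieAlgebra (𝓡 n) G) u v w)
    (fun c u v => smul_lie (R := ℝ) (L := GroupLieAlgebra (𝓡 n) G)
      (M := GroupLieAlgebra (𝓡 n) G) c u v)
    (fun u v w => lie_add (L := GroupLieAlgebra (𝓡 n) G) (M := GroupLieAlgebra (𝓡 n) G) u v w)
    (fun c u v => lie_smul (R := ℝ) (L := GroupLieAlgebra (𝓡 n) G)
      (M := GroupLieAlgebra (𝓡 n) G) c u v))

theorem bracketCLM_apply (u v : EuclideanSpace ℝ (Fin n)) :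
    bracketCLM n G u v = lieAlgBracket n G u v := rfl

variable (G) in
theorem bracketCLM_swap (u v : EuclideanSpace ℝ (Fin n)) :
    bracketCLM n G u v = -bracketCLM n G v u :=
  have := lieGroup_minSmoothness n G
  (lie_skew (L := GroupLieAlgebra (𝓡 n) G) u v).symm

variable (G) in
theorem bracketCLM_jacobi (u v w : EuclideanSpace ℝ (Fin n)) :
    bracketCLM n G u (bracketCLM n G v w) =
      bracketCLM n G (bracketCLM n G u v) w + bracketCLM n G v (bracketCLM n G u w) :=
  have := lieGroup_minSmoothness n G
  leibniz_lie (L₁ := GroupLieAlgebra (𝓡 n) G) (L₂ := GroupLieAlgebra (𝓡 n) G)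
    (M := GroupLieAlgebra (𝓡 n) G) u v w

/-- The bracket formula for frame fields at the unit, where the frame is the identity. -/
theorem fderiv_leftFrame_unitPt (v w : EuclideanSpace ℝ (Fin n)) :
    fderiv ℝ (leftFrame n G) (unitPt n G) w v - fderiv ℝ (leftFrame n G) (unitPt n G) v w =
      bracketCLM n G w v := by
  have h := lieBracket_leftFrame (unitPt_mem n G) w v
  rw [VectorField.lieBracket_eq] at h
  simpa only [fderiv_leftFrame_apply (unitPt_mem n G), leftFrame_unitPt,
    ContinuousLinearMap.id_apply, ← bracketCLM_apply] using h

theorem contDiffAt_adjointMap_unitChart_symm :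
    ContDiffAt ℝ ∞ (fun y => adjointMap n ((unitChart n G).symm y)) (unitPt n G) :=
  (ContMDiffAt.comp (I' := 𝓡 n) (unitPt n G) contMDiff_adjointMap.contMDiffAt
    (contMDiffAt_unitChart_symm (unitPt_mem n G))).contDiffAt

variable (n G) in
/-- The multiplication in the chart at the unit. -/
def chartMul (p : EuclideanSpace ℝ (Fin n) × EuclideanSpace ℝ (Fin n)) :
    EuclideanSpace ℝ (Fin n) :=
  unitChart n G ((unitChart n G).symm p.1 * (unitChart n G).symm p.2)

theorem contDiffAt_chartMul : ContDiffAt ℝ ∞ (chartMul n G) (unitPt n G, unitPt n G) := by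
  refine ContMDiffAt.contDiffAt (ContMDiffAt.comp (I' := 𝓡 n) _
    (contMDiffAt_unitChart (n := n) (G := G) ?_) ?_)
  · simp
  · rw [modelWithCornersSelf_prod, ← chartedSpaceSelf_prod]
    exact (ContMDiffAt.comp (I' := 𝓡 n) (unitPt n G, unitPt n G)
      (contMDiffAt_unitChart_symm (n := n) (G := G) (unitPt_mem n G)) contMDiffAt_fst).mul
      (ContMDiffAt.comp (I' := 𝓡 n) (unitPt n G, unitPt n G)
      (contMDiffAt_unitChart_symm (n := n) (G := G) (unitPt_mem n G)) contMDiffAt_snd)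

/-- If μ is the multiplication in the chart and c the image of the unit, the left frame at y is
∂₂μ(y, c) and the right one is ∂₁μ(c, y). Differentiated at c, both give mixed second derivatives of
μ at (c, c), which agree by symmetry. -/
theorem fderiv_rightD_unitChart (v w : EuclideanSpace ℝ (Fin n)) :
    fderiv ℝ (fun y => rightD n (unitChart n G) ((unitChart n G).symm y)) (unitPt n G) w v =
      fderiv ℝ (leftFrame n G) (unitPt n G) v w := by
  set c := unitPt n G
  have hμ := contDiffAt_chartMul (n := n) (G := G)
  have hev : ∀ᶠ p in 𝓝 (c, c), DifferentiableAt ℝ (chartMul n G) p :=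
    ((hμ.of_le (m := 1) (by simp)).eventually
      (ne_of_lt (WithTop.coe_lt_coe.2 (ENat.natCast_lt_top 1)))).mono fun p hp =>
      hp.differentiableAt (by simp)
  have hD : DifferentiableAt ℝ (fderiv ℝ (chartMul n G)) (c, c) :=
    (hμ.fderiv_right (m := ∞) (by simp)).differentiableAt (by simp)
  have hc1 : Filter.Tendsto (fun y : EuclideanSpace ℝ (Fin n) => (y, c)) (𝓝 c) (𝓝 (c, c)) :=
    (Continuous.prodMk_left c).tendsto c
  have hc2 : Filter.Tendsto (fun y : EuclideanSpace ℝ (Fin n) => (c, y)) (𝓝 c) (𝓝 (c, c)) :=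
    (Continuous.prodMk_right c).tendsto c
  have e1 : leftFrame n G =ᶠ[𝓝 c] fun y => (fderiv ℝ (chartMul n G) (y, c)).comp
      (ContinuousLinearMap.inr ℝ _ _) := by
    filter_upwards [hc1.eventually hev] with y hy
    exact (HasFDerivAt.comp (g := chartMul n G) (f := fun e => (y, e)) c hy.hasFDerivAt
      (hasFDerivAt_prodMk_right y c)).fderiv
  have e2 : (fun y => rightD n (unitChart n G) ((unitChart n G).symm y)) =ᶠ[𝓝 c]
      fun y => (fderiv ℝ (chartMul n G) (c, y)).comp (ContinuousLinearMap.inl ℝ _ _) := by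
    filter_upwards [hc2.eventually hev] with y hy
    exact (HasFDerivAt.comp (g := chartMul n G) (f := fun e => (e, y)) c hy.hasFDerivAt
      (hasFDerivAt_prodMk_left c y)).fderiv
  have d1 := (HasFDerivAt.comp (g := fderiv ℝ (chartMul n G)) (f := fun e => (e, c)) c
    hD.hasFDerivAt (hasFDerivAt_prodMk_left c c)).clm_comp
    (hasFDerivAt_const (ContinuousLinearMap.inr ℝ (EuclideanSpace ℝ (Fin n))
      (EuclideanSpace ℝ (Fin n))) c)
  have d2 := (HasFDerivAt.comp (g := fderiv ℝ (chartMul n G)) (f := fun e => (c, e)) c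
    hD.hasFDerivAt (hasFDerivAt_prodMk_right c c)).clm_comp
    (hasFDerivAt_const (ContinuousLinearMap.inl ℝ (EuclideanSpace ℝ (Fin n))
      (EuclideanSpace ℝ (Fin n))) c)
  rw [e1.fderiv_eq, e2.fderiv_eq]
  have d1' := d1.fderiv
  have d2' := d2.fderiv
  simp only [Function.comp_def] at d1' d2'
  rw [d1', d2']
  have hs := hμ.isSymmSndFDerivAt (by
    rw [minSmoothness_of_isRCLikeNormedField]
    exact WithTop.coe_le_coe.2 (le_top : (2 : ℕ∞) ≤ ⊤))
  simpa using hs.eq (0, w) (v, 0)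

/-- The derivative of the adjoint representation is the bracket. -/
theorem fderiv_adjointMap (w : EuclideanSpace ℝ (Fin n)) :
    fderiv ℝ (fun y => adjointMap n ((unitChart n G).symm y)) (unitPt n G) w =
      bracketCLM n G w := by
  have hA := (contDiffAt_adjointMap_unitChart_symm (n := n) (G := G)).differentiableAt (by simp)
  -- Differentiate L(y) = R(y) ∘ Ad(y), for the left and right frames, at the unit, where all
  -- factors are the identity. The derivative of Ad is the difference of the derivatives of the two
  -- frames, and by symmetry of second derivatives this is the bracket.
  have hev : leftFrame n G =ᶠ[𝓝 (unitPt n G)] fun y =>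
      (rightD n (unitChart n G) ((unitChart n G).symm y)).comp
        (adjointMap n ((unitChart n G).symm y)) := by
    filter_upwards [(unitChart n G).open_target.mem_nhds (unitPt_mem n G)] with y hy
    exact (contMDiffAt_unitChart ((unitChart n G).map_target hy)).leftD_eq
  have hR : DifferentiableAt ℝ (fun y => rightD n (unitChart n G) ((unitChart n G).symm y))
      (unitPt n G) := by
    refine (ContMDiffAt.contDiffAt (n := ∞) (ContMDiffAt.fderiv_param (k := fun _ => unitPt n G)
      ?_ contMDiffAt_const)).differentiableAt (by simp)
    refine ContMDiffAt.comp (I' := 𝓡 n) (unitPt n G, unitPt n G)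
      (contMDiffAt_unitChart (n := n) (G := G) (by simp)) ?_
    exact (ContMDiffAt.comp (I' := 𝓡 n) (unitPt n G, unitPt n G)
      (contMDiffAt_unitChart_symm (n := n) (G := G) (unitPt_mem n G)) contMDiffAt_snd).mul
      (ContMDiffAt.comp (I' := 𝓡 n) (unitPt n G, unitPt n G)
      (contMDiffAt_unitChart_symm (n := n) (G := G) (unitPt_mem n G)) contMDiffAt_fst)
  have h1 := hev.fderiv_eq (𝕜 := ℝ)
  rw [fderiv_clm_comp hR hA] at h1
  ext1 v
  have h2 := DFunLike.congr_fun (DFunLike.congr_fun h1 w) v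
  have hr1 : rightD n (unitChart n G) 1 = ContinuousLinearMap.id ℝ _ := by
    have := (contMDiffAt_unitChart (one_mem_unitChart n G)).leftD_eq
    rw [adjointMap_one] at this
    rw [← leftFrame_unitPt (G := G)]
    simpa [leftFrame, leftD] using this.symm
  simp only [_root_.add_apply, ContinuousLinearMap.comp_apply, unitChart_symm_unitPt,
    adjointMap_one, ContinuousLinearMap.compL_apply, ContinuousLinearMap.flip_apply, hr1,
    ContinuousLinearMap.id_apply, fderiv_rightD_unitChart] at h2
  rw [← fderiv_leftFrame_unitPt, h2]
  simp

theorem rightD_adjointMap (g : G) (w : EuclideanSpace ℝ (Fin n)) :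
    rightD n (adjointMap n) g w = (bracketCLM n G w).comp (adjointMap n g) := by
  have hA := (contDiffAt_adjointMap_unitChart_symm (n := n) (G := G)).differentiableAt (by simp)
  simp only [rightD, adjointMap_mul]
  rw [fderiv_clm_comp hA (differentiableAt_const _)]
  simp [fderiv_adjointMap]

theorem leftD_adjointMap (g : G) (w : EuclideanSpace ℝ (Fin n)) :
    leftD n (adjointMap n) g w = (adjointMap n g).comp (bracketCLM n G w) := by
  have hA := (contDiffAt_adjointMap_unitChart_symm (n := n) (G := G)).differentiableAt (by simp)
  simp only [leftD, adjointMap_mul]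
  rw [fderiv_clm_comp (differentiableAt_const _) hA]
  simp [fderiv_adjointMap]

/-- The adjoint representation acts by automorphisms of the Lie algebra. -/
theorem bracketCLM_adjointMap (g : G) (v w : EuclideanSpace ℝ (Fin n)) :
    bracketCLM n G (adjointMap n g v) (adjointMap n g w) = adjointMap n g (bracketCLM n G v w) := by
  have h1 := leftD_adjointMap g v
  -- The left derivative of Ad at g along v is computed in two ways, as Ad_g ∘ ad_v and as ad_{Ad_g
  -- v} ∘ Ad_g.
  rw [leftD_eq contMDiff_adjointMap, ContinuousLinearMap.comp_apply, rightD_adjointMap] at h1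
  exact DFunLike.congr_fun h1 w

variable {F : Type*} [NormedAddCommGroup F] [NormedSpace ℝ F]

/-- Writing y' = (y' y⁻¹) y expresses the derivative at any point of the translated chart through a
right derivative, which is zero. So f is constant on small balls, hence locally constant, hence
constant by connectedness. -/
theorem eq_of_rightD_eq_zero [PreconnectedSpace G] {f : G → F}
    (hf : ContMDiff (𝓡 n) 𝓘(ℝ, F) ∞ f) (h0 : ∀ g, rightD n f g = 0) (g h : G) : f g = f h := by
  refine IsLocallyConstant.apply_eq_of_preconnectedSpace
    ((IsLocallyConstant.iff_eventually_eq f).2 fun g₀ => ?_) g h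
  have hz : ∀ y ∈ (unitChart n G).target,
      HasFDerivAt (fun y => f ((unitChart n G).symm y * g₀)) (0 : _ →L[ℝ] F) y := by
    intro y hy
    have hs := contMDiffAt_unitChart_symm hy
    have hd : DifferentiableAt ℝ (fun y => f ((unitChart n G).symm y * g₀)) y :=
      (ContMDiffAt.comp (I' := 𝓡 n) (f := fun y => (unitChart n G).symm y * g₀) y hf.contMDiffAt
        (hs.mul contMDiffAt_const)).contDiffAt.differentiableAt (by simp)
    have h := fderiv_comp_unitChart (n := n) (x := y)
      (f := fun x => f (x * ((unitChart n G).symm y * g₀)))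
      (k := fun y' => (unitChart n G).symm y' * ((unitChart n G).symm y)⁻¹)
      (by simp) (hf.comp (contMDiff_mul_right (I := 𝓡 n)
        (a := (unitChart n G).symm y * g₀))).contMDiffAt (hs.mul contMDiffAt_const)
    simp only [mul_inv_cancel, mul_assoc, inv_mul_cancel_left] at h
    have h0' := h0 ((unitChart n G).symm y * g₀)
    rw [rightD] at h0'
    rw [h0', ContinuousLinearMap.zero_comp] at h
    exact h ▸ hd.hasFDerivAt
  obtain ⟨ε, hε, hball⟩ := Metric.isOpen_iff.1 (unitChart n G).open_target _ (unitPt_mem n G)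
  have hmul : ContinuousAt (fun x : G => x * g₀⁻¹) g₀ :=
    (contMDiff_mul_right (I := 𝓡 n) (n := ∞) (a := g₀⁻¹)).continuous.continuousAt
  have hmem : Filter.Tendsto (fun x : G => unitChart n G (x * g₀⁻¹)) (𝓝 g₀) (𝓝 (unitPt n G)) := by
    have : ContinuousAt (fun x : G => unitChart n G (x * g₀⁻¹)) g₀ := by
      refine ContinuousAt.comp (g := unitChart n G) ?_ hmul
      exact (unitChart n G).continuousAt (by simp)
    simpa [ContinuousAt] using this
  have hsrc : ∀ᶠ x in 𝓝 g₀, x * g₀⁻¹ ∈ (unitChart n G).source := by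
    refine hmul.preimage_mem_nhds ((unitChart n G).open_source.mem_nhds ?_)
    simp
  filter_upwards [hmem.eventually (Metric.ball_mem_nhds _ hε), hsrc] with x hx hxs
  have hconst := (convex_ball (unitPt n G) ε).is_const_of_fderivWithin_eq_zero (𝕜 := ℝ)
    (f := fun y => f ((unitChart n G).symm y * g₀))
    (fun y hy => (hz y (hball hy)).differentiableAt.differentiableWithinAt)
    (fun y hy => (hz y (hball hy)).hasFDerivWithinAt.fderivWithin
      (Metric.isOpen_ball.uniqueDiffWithinAt hy)) hx (Metric.mem_ball_self hε)
  simpa [(unitChart n G).left_inv hxs] using hconst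

/-- An invariant bilinear form is invariant under the adjoint representation. -/
theorem apply_adjointMap_adjointMap [PreconnectedSpace G]
    (B : EuclideanSpace ℝ (Fin n) →L[ℝ] EuclideanSpace ℝ (Fin n) →L[ℝ] ℝ)
    (hB : ∀ u v w, B (bracketCLM n G u v) w = -B v (bracketCLM n G u w))
    (g : G) (v w : EuclideanSpace ℝ (Fin n)) :
    B (adjointMap n g v) (adjointMap n g w) = B v w := by
  have hA : ∀ v, ContMDiff (𝓡 n) 𝓘(ℝ, EuclideanSpace ℝ (Fin n)) ∞ fun g : G => adjointMap n g v :=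
    fun v => contMDiff_adjointMap.clm_apply contMDiff_const
  have hf : ContMDiff (𝓡 n) 𝓘(ℝ, ℝ) ∞
      fun g : G => B (adjointMap n g v) (adjointMap n g w) :=
    ((contMDiff_const (c := B)).clm_apply (hA v)).clm_apply (hA w)
  -- Connectedness of G enters here: infinitesimal invariance says that g ↦ B(Ad_g v, Ad_g w) has
  -- vanishing right derivatives, so it takes its value at the unit everywhere.
  have h := eq_of_rightD_eq_zero hf (fun g => ?_) g 1
  · simpa [adjointMap_one] using h
  ext u
  have hd := (contDiffAt_adjointMap_unitChart_symm (n := n) (G := G)).differentiableAt (by simp)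
  have h1 : ∀ v, HasFDerivAt (fun y => adjointMap n ((unitChart n G).symm y) (adjointMap n g v))
      ((bracketCLM n G).flip (adjointMap n g v)) (unitPt n G) := fun v => by
    refine (hd.hasFDerivAt.clm_apply (hasFDerivAt_const (adjointMap n g v) _)).congr_fderiv ?_
    ext1 u
    simp [fderiv_adjointMap]
  have h2 := ((hasFDerivAt_const B (unitPt n G)).clm_apply (h1 v)).clm_apply (h1 w)
  simp only [rightD, adjointMap_mul, ContinuousLinearMap.comp_apply]
  rw [h2.fderiv]
  simp [adjointMap_one, hB]

end AdjointRepresentation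

/-! ### Smooth functions on embedded compact manifolds -/

section Retractions

variable {E H X : Type*} [NormedAddCommGroup E] [NormedSpace ℝ E] [TopologicalSpace H]
  {I : ModelWithCorners ℝ E H} [TopologicalSpace X] [ChartedSpace H X]
  {V : Type*} [NormedAddCommGroup V] [NormedSpace ℝ V]

variable (I) in
/-- Near `j x` the map `j` has a smooth left inverse. -/
def HasLocalRetraction (j : X → V) (x : X) : Prop :=
  ∃ W ∈ 𝓝 (j x), ∃ l : V → X, ContMDiffOn 𝓘(ℝ, V) I ∞ l W ∧ ∀ y, j y ∈ W → l (j y) = y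

variable (I) in
/-- A smooth closed embedding with local smooth retractions onto its image. -/
structure IsRetractEmbedding (j : X → V) : Prop where
  contMDiff : ContMDiff I 𝓘(ℝ, V) ∞ j
  isClosedEmbedding : Topology.IsClosedEmbedding j
  hasLocalRetraction : ∀ x, HasLocalRetraction I j x

/-- Near the image the local extensions f ∘ l serve, away from it 0 does. The condition on the value
at w is either a single prescribed number or vacuous, hence convex, so a partition of unity glues
the pieces. -/
theorem IsRetractEmbedding.exists_contDiff_eq [FiniteDimensional ℝ V] {j : X → V}
    (hj : IsRetractEmbedding I j) {f : X → ℝ} (hf : ContMDiff I 𝓘(ℝ, ℝ) ∞ f) :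
    ∃ F : V → ℝ, ContDiff ℝ ∞ F ∧ ∀ x, F (j x) = f x := by
  have hconv : ∀ w : V, Convex ℝ {a : ℝ | ∀ x, j x = w → a = f x} := by
    intro w a ha b hb s t _ _ hst x hx
    simp only [Set.mem_ofPred_eq] at ha hb
    rw [ha x hx, hb x hx, ← add_smul, hst, one_smul]
  obtain ⟨F, hF⟩ := exists_contMDiffMap_forall_mem_convex_of_local (n := ⊤) 𝓘(ℝ, V) hconv
    fun w => by
      by_cases hw : w ∈ Set.range j
      · obtain ⟨x, rfl⟩ := hw
        obtain ⟨W, hW, l, hl, hlj⟩ := hj.hasLocalRetraction x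
        refine ⟨W, hW, fun v => f (l v), hf.comp_contMDiffOn hl, ?_⟩
        rintro y hy x' rfl
        simp only [hlj x' hy]
      · refine ⟨(Set.range j)ᶜ, hj.isClosedEmbedding.isClosed_range.isOpen_compl.mem_nhds hw,
          fun _ => 0, contMDiffOn_const, ?_⟩
        rintro y hy x' rfl
        exact absurd ⟨x', rfl⟩ hy
  exact ⟨F, F.contMDiff.contDiff, fun x => hF (j x) x rfl⟩

variable {E' H' X' V' : Type*} [NormedAddCommGroup E'] [NormedSpace ℝ E'] [TopologicalSpace H']
  {I' : ModelWithCorners ℝ E' H'} [TopologicalSpace X'] [ChartedSpace H' X']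
  [NormedAddCommGroup V'] [NormedSpace ℝ V']

theorem IsRetractEmbedding.prodMap {j : X → V} (hj : IsRetractEmbedding I j) {j' : X' → V'}
    (hj' : IsRetractEmbedding I' j') : IsRetractEmbedding (I.prod I') (Prod.map j j') where
  contMDiff := by
    rw [modelWithCornersSelf_prod, ← chartedSpaceSelf_prod]
    exact hj.contMDiff.prodMap hj'.contMDiff
  isClosedEmbedding := hj.isClosedEmbedding.prodMap hj'.isClosedEmbedding
  hasLocalRetraction := by
    rintro ⟨x, x'⟩
    obtain ⟨W, hW, l, hl, hlj⟩ := hj.hasLocalRetraction x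
    obtain ⟨W', hW', l', hl', hlj'⟩ := hj'.hasLocalRetraction x'
    refine ⟨W ×ˢ W', prod_mem_nhds hW hW', Prod.map l l', ?_, ?_⟩
    · rw [modelWithCornersSelf_prod, ← chartedSpaceSelf_prod]
      exact hl.prodMap hl'
    · rintro ⟨y, y'⟩ hy
      exact Prod.ext (hlj y hy.1) (hlj' y' hy.2)

theorem IsRetractEmbedding.continuousLinearEquiv_comp {j : X → V} (hj : IsRetractEmbedding I j)
    (L : V ≃L[ℝ] V') : IsRetractEmbedding I fun x => L (j x) where
  contMDiff := L.contDiff.contMDiff.comp hj.contMDiff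
  isClosedEmbedding := L.toHomeomorph.isClosedEmbedding.comp hj.isClosedEmbedding
  hasLocalRetraction x := by
    obtain ⟨W, hW, l, hl, hlj⟩ := hj.hasLocalRetraction x
    refine ⟨L.symm ⁻¹' W, L.symm.continuous.continuousAt.preimage_mem_nhds (by simpa using hW),
      fun v => l (L.symm v),
      hl.comp L.symm.contDiff.contMDiff.contMDiffOn fun _ h => h, fun y hy => ?_⟩
    simp only [L.symm_apply_apply]
    exact hlj y (by simpa using hy)

end Retractions

/-! ### Embeddings with local retractions, and extension of functions -/

section ExistsEmbedding

variable {n : ℕ} {X : Type*} [TopologicalSpace X] [ChartedSpace (EuclideanSpace ℝ (Fin n)) X]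
  {V : Type*} [NormedAddCommGroup V] [NormedSpace ℝ V]

/-- With L a linear left inverse of the differential at x, the map k = L ∘ j in the chart ψ has
derivative the identity, so the inverse function theorem applies. The retraction is ψ⁻¹ ∘ k⁻¹ ∘ L.
-/
theorem hasLocalRetraction_of_injective_mfderiv [IsManifold (𝓡 n) ∞ X] [FiniteDimensional ℝ V]
    {j : X → V} (hj : ContMDiff (𝓡 n) 𝓘(ℝ, V) ∞ j) (hemb : Topology.IsEmbedding j) {x : X}
    (hinj : Function.Injective (mfderiv (𝓡 n) 𝓘(ℝ, V) j x)) : HasLocalRetraction (𝓡 n) j x := by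
  set ψ := chartAt (EuclideanSpace ℝ (Fin n)) x
  have hψ : ∀ y ∈ ψ.target, ContMDiffAt (𝓡 n) (𝓡 n) ∞ ψ.symm y := fun y hy =>
    (contMDiffOn_chart_symm (I := 𝓡 n)).contMDiffAt (ψ.open_target.mem_nhds hy)
  set h : EuclideanSpace ℝ (Fin n) → V := fun y => j (ψ.symm y)
  have hh : ∀ y ∈ ψ.target, ContDiffAt ℝ ∞ h y := fun y hy =>
    (ContMDiffAt.comp (I' := 𝓡 n) y hj.contMDiffAt (hψ y hy)).contDiffAt
  have hx := mem_chart_target (EuclideanSpace ℝ (Fin n)) x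
  have hD : Function.Injective (fderiv ℝ h (ψ x)) := by
    have e := (hj.contMDiffAt (x := x)).mdifferentiableAt (by simp) |>.mfderiv_eq_fderiv
    intro v w hvw
    refine hinj ((DFunLike.congr_fun e v).trans (Eq.trans hvw (DFunLike.congr_fun e w).symm))
  obtain ⟨L₀, hL₀⟩ := LinearMap.exists_leftInverse_of_injective
    (fderiv ℝ h (ψ x)).toLinearMap (LinearMap.ker_eq_bot.2 hD)
  set L : V →L[ℝ] EuclideanSpace ℝ (Fin n) := L₀.toContinuousLinearMap
  set k : EuclideanSpace ℝ (Fin n) → EuclideanSpace ℝ (Fin n) := fun y => L (h y)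
  have hk : ∀ y ∈ ψ.target, ContDiffAt ℝ ∞ k y := fun y hy =>
    L.contDiff.contDiffAt.comp y (hh y hy)
  have hkx : HasFDerivAt k ((ContinuousLinearEquiv.refl ℝ (EuclideanSpace ℝ (Fin n)) :
      EuclideanSpace ℝ (Fin n) ≃L[ℝ] _) : EuclideanSpace ℝ (Fin n) →L[ℝ] _) (ψ x) := by
    refine (L.hasFDerivAt.comp (ψ x)
      ((hh _ hx).differentiableAt (by simp)).hasFDerivAt).congr_fderiv ?_
    ext1 v
    exact LinearMap.congr_fun hL₀ v
  set e := (hk _ hx).toOpenPartialHomeomorph k hkx (by simp)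
  have hxe : ψ x ∈ e.source := (hk _ hx).mem_toOpenPartialHomeomorph_source hkx (by simp)
  -- The local inverse of k is needed to be smooth on a whole neighbourhood, so it is restricted to
  -- points where the derivative of k stays invertible.
  obtain ⟨S, hS, hSo, hxS⟩ : ∃ S ⊆ {y | y ∈ ψ.target ∧ ∃ A : EuclideanSpace ℝ (Fin n) ≃L[ℝ]
      EuclideanSpace ℝ (Fin n), (A : _ →L[ℝ] EuclideanSpace ℝ (Fin n)) = fderiv ℝ k y},
      IsOpen S ∧ ψ x ∈ S := by
    refine mem_nhds_iff.1 (Filter.inter_mem (ψ.open_target.mem_nhds hx) ?_)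
    have hc : ContinuousAt (fderiv ℝ k) (ψ x) :=
      ((hk _ hx).fderiv_right (m := ∞) (by simp)).continuousAt
    have hA : {A : EuclideanSpace ℝ (Fin n) →L[ℝ] EuclideanSpace ℝ (Fin n) |
        ∃ e : EuclideanSpace ℝ (Fin n) ≃L[ℝ] EuclideanSpace ℝ (Fin n), (e : _ →L[ℝ] _) = A} ∈
        𝓝 (fderiv ℝ k (ψ x)) := by
      rw [hkx.fderiv]
      exact ContinuousLinearEquiv.nhds _
    exact hc.preimage_mem_nhds hA
  have hW1 : (e.symm : _ → _) ⁻¹' S ∩ e.target ∈ 𝓝 (L (j x)) := by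
    have hjx : L (j x) = e (ψ x) := by
      change L (j x) = L (j (ψ.symm (ψ x)))
      rw [ψ.left_inv (mem_chart_source _ x)]
    rw [hjx]
    refine Filter.inter_mem ((e.symm.continuousAt (e.map_source hxe)).preimage_mem_nhds ?_)
      (e.open_target.mem_nhds (e.map_source hxe))
    rw [e.left_inv hxe]
    exact hSo.mem_nhds hxS
  have hO : ψ.source ∩ ψ ⁻¹' e.source ∈ 𝓝 x := Filter.inter_mem (chart_source_mem_nhds _ x)
    ((ψ.continuousAt (mem_chart_source _ x)).preimage_mem_nhds (e.open_source.mem_nhds hxe))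
  -- Here j must be a topological embedding: points y with j y near j x have to be near x, so that
  -- they lie in the chart domain and in the source of the local inverse.
  rw [hemb.isInducing.nhds_eq_comap] at hO
  obtain ⟨W2, hW2, hW2O⟩ := hO
  refine ⟨L ⁻¹' ((e.symm : _ → _) ⁻¹' S ∩ e.target) ∩ W2,
    Filter.inter_mem (L.continuous.continuousAt.preimage_mem_nhds hW1) hW2,
    fun w => ψ.symm (e.symm (L w)), ?_, ?_⟩
  · rintro w ⟨⟨hwS, hwt⟩, -⟩
    obtain ⟨hmem, A, hA⟩ := hS hwS
    have he : ContDiffAt ℝ ∞ e.symm (L w) := by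
      refine e.contDiffAt_symm hwt (f₀' := A) ?_ (hk _ hmem)
      rw [hA]
      exact ((hk _ hmem).differentiableAt (by simp)).hasFDerivAt
    exact (ContMDiffAt.comp (I' := 𝓡 n) (g := ψ.symm) (f := fun w => e.symm (L w)) w (hψ _ hmem)
      (he.comp w L.contDiff.contDiffAt).contMDiffAt).contMDiffWithinAt
  · rintro y ⟨-, hy⟩
    obtain ⟨hys, hye⟩ := hW2O hy
    have : L (j y) = e (ψ y) := by
      change L (j y) = L (j (ψ.symm (ψ y)))
      rw [ψ.left_inv hys]
    simp only [this, e.left_inv hye, ψ.left_inv hys]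

variable (n X) in
theorem exists_isRetractEmbedding [IsManifold (𝓡 n) ∞ X] [CompactSpace X] [T2Space X] :
    ∃ (N : ℕ) (j : X → Fin N → ℝ), IsRetractEmbedding (𝓡 n) j := by
  obtain ⟨N, j, hj, hemb, hinj⟩ := exists_embedding_euclidean_of_compact (M := X) (I := 𝓡 n)
  exact ⟨N, _, IsRetractEmbedding.continuousLinearEquiv_comp (I := 𝓡 n) ⟨hj, hemb, fun x =>
    hasLocalRetraction_of_injective_mfderiv hj hemb.isEmbedding (hinj x)⟩
    (EuclideanSpace.equiv (Fin N) ℝ)⟩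

/-- Functions which are smooth near a closed set can be extended without changing them near that
set. -/
theorem exists_contMDiff_eventuallyEq [IsManifold (𝓡 n) ∞ X] [CompactSpace X] [T2Space X]
    {O K : Set X} (hO : IsOpen O) (hK : IsClosed K) (hKO : K ⊆ O) {f : X → ℝ}
    (hf : ContMDiffOn (𝓡 n) 𝓘(ℝ, ℝ) ∞ f O) :
    ∃ f' : X → ℝ, ContMDiff (𝓡 n) 𝓘(ℝ, ℝ) ∞ f' ∧ ∃ U, IsOpen U ∧ K ⊆ U ∧ Set.EqOn f' f U := by
  obtain ⟨χ, hχ0, hχ1, -⟩ := exists_contMDiffMap_zero_one_nhds_of_isClosed (n := ⊤) (𝓡 n)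
    hO.isClosed_compl hK (Set.disjoint_left.2 fun x hx hxK => hx (hKO hxK))
  obtain ⟨U, hU, hKU, hU1⟩ := eventually_nhdsSet_iff_exists.1 hχ1
  refine ⟨fun x => χ x * f x, fun x => ?_, U, hU, hKU, fun x hx => by simp [hU1 x hx]⟩
  by_cases hx : x ∈ O
  · exact χ.contMDiff.contMDiffAt.mul (hf.contMDiffAt (hO.mem_nhds hx))
  · have h0 : ∀ᶠ y in 𝓝 x, χ y = 0 := Filter.Eventually.filter_mono (nhds_le_nhdsSet hx) hχ0
    refine (contMDiffAt_const (c := (0 : ℝ))).congr_of_eventuallyEq ?_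
    filter_upwards [h0] with y hy
    simp [hy]

end ExistsEmbedding

/-! ### Left inverses of the derivative of an embedding of a Lie group -/

section EmbeddedGroup

variable {n : ℕ} {G : Type*} [TopologicalSpace G] [ChartedSpace (EuclideanSpace ℝ (Fin n)) G]
  [Group G] [LieGroup (𝓡 n) ∞ G] [CompactSpace G] [T2Space G]
  {V : Type*} [NormedAddCommGroup V] [NormedSpace ℝ V] [FiniteDimensional ℝ V] {j : G → V}

/-- A local retraction, followed by right translation by g⁻¹ and the chart, is a left inverse of y ↦
j(y g) near the unit; the derivatives compose to the identity. -/
theorem IsRetractEmbedding.injective_rightD (hj : IsRetractEmbedding (𝓡 n) j) (g : G) :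
    Function.Injective (rightD n j g) := by
  obtain ⟨W, hW, l, hl, hlj⟩ := hj.hasLocalRetraction g
  have h1 : ContMDiffAt (𝓡 n) (𝓡 n) ∞ (fun y => (unitChart n G).symm y * g) (unitPt n G) :=
    (contMDiffAt_unitChart_symm (unitPt_mem n G)).mul contMDiffAt_const
  have hd1 : DifferentiableAt ℝ (fun y => j ((unitChart n G).symm y * g)) (unitPt n G) :=
    (ContMDiffAt.comp (I' := 𝓡 n) (f := fun y => (unitChart n G).symm y * g) _ hj.contMDiff.contMDiffAt
      h1).contDiffAt.differentiableAt (by simp)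
  have hlW := hl.contMDiffAt hW
  have hd2 : DifferentiableAt ℝ (fun w => unitChart n G (l w * g⁻¹)) (j g) := by
    refine ContDiffAt.differentiableAt (n := ∞) (ContMDiffAt.contDiffAt ?_) (by simp)
    refine ContMDiffAt.comp (I' := 𝓡 n) (f := fun w => l w * g⁻¹) _
      (contMDiffAt_unitChart (n := n) (G := G) ?_) (hlW.mul contMDiffAt_const)
    rw [hlj g (mem_of_mem_nhds hW)]
    simp
  have hjg : j ((unitChart n G).symm (unitPt n G) * g) = j g := by simp
  have hcomp := fderiv_comp (g := fun w => unitChart n G (l w * g⁻¹)) (unitPt n G)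
    (by rw [hjg]; exact hd2) hd1
  have hid : (fun w => unitChart n G (l w * g⁻¹)) ∘ (fun y => j ((unitChart n G).symm y * g))
      =ᶠ[𝓝 (unitPt n G)] id := by
    have hc := (hj.contMDiff.continuous.continuousAt (x := (unitChart n G).symm (unitPt n G) * g)).comp
      (f := fun y => (unitChart n G).symm y * g) h1.continuousAt
    filter_upwards [(unitChart n G).open_target.mem_nhds (unitPt_mem n G),
      hc.preimage_mem_nhds (by simpa [Function.comp_def] using hW)] with y hy hyW
    simp only [Function.comp_apply]
    rw [hlj _ hyW, mul_inv_cancel_right, (unitChart n G).right_inv hy, id]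
  rw [hid.fderiv_eq, fderiv_id, hjg] at hcomp
  intro v w hvw
  have := fun v => DFunLike.congr_fun hcomp v
  simp only [ContinuousLinearMap.id_apply, ContinuousLinearMap.comp_apply] at this
  rw [this v, this w]
  exact congrArg _ hvw

/-- Left inverses of a fixed linear map form a convex set, so smooth local choices can be averaged.
Locally one takes (L J)⁻¹ L, where J is the differential and L a left inverse at one point. -/
theorem IsRetractEmbedding.exists_leftInverse_rightD (hj : IsRetractEmbedding (𝓡 n) j) :
    ∃ M : G → V →L[ℝ] EuclideanSpace ℝ (Fin n),
      ContMDiff (𝓡 n) 𝓘(ℝ, V →L[ℝ] EuclideanSpace ℝ (Fin n)) ∞ M ∧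
      ∀ g v, M g (rightD n j g v) = v := by
  have hJ := contMDiff_rightD hj.contMDiff
  have hconv : ∀ g, Convex ℝ {M : V →L[ℝ] EuclideanSpace ℝ (Fin n) |
      M.comp (rightD n j g) = ContinuousLinearMap.id ℝ _} := by
    intro g a ha b hb s t _ _ hst
    simp only [Set.mem_ofPred_eq] at ha hb ⊢
    rw [ContinuousLinearMap.add_comp, ContinuousLinearMap.smul_comp,
      ContinuousLinearMap.smul_comp, ha, hb]
    ext1 v
    change s • v + t • v = v
    rw [← add_smul, hst, one_smul]
  have hloc : ∀ g, ∃ U ∈ 𝓝 g, ∃ M : G → V →L[ℝ] EuclideanSpace ℝ (Fin n),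
      ContMDiffOn (𝓡 n) 𝓘(ℝ, V →L[ℝ] EuclideanSpace ℝ (Fin n)) ∞ M U ∧
      ∀ h ∈ U, M h ∈ {M | M.comp (rightD n j h) = ContinuousLinearMap.id ℝ _} := by
    intro g
    obtain ⟨L₀, hL₀⟩ := LinearMap.exists_leftInverse_of_injective
      (rightD n j g).toLinearMap (LinearMap.ker_eq_bot.2 (hj.injective_rightD g))
    set L : V →L[ℝ] EuclideanSpace ℝ (Fin n) := L₀.toContinuousLinearMap
    have hA : ContMDiff (𝓡 n) 𝓘(ℝ, EuclideanSpace ℝ (Fin n) →L[ℝ] EuclideanSpace ℝ (Fin n)) ∞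
        fun h => L.comp (rightD n j h) := contMDiff_const.clm_comp hJ
    have hAg : L.comp (rightD n j g) = ((ContinuousLinearEquiv.refl ℝ (EuclideanSpace ℝ (Fin n)) :
        EuclideanSpace ℝ (Fin n) ≃L[ℝ] _) : EuclideanSpace ℝ (Fin n) →L[ℝ] _) := by
      ext1 v
      exact LinearMap.congr_fun hL₀ v
    refine ⟨{h | ∃ A : EuclideanSpace ℝ (Fin n) ≃L[ℝ] EuclideanSpace ℝ (Fin n),
      (A : _ →L[ℝ] EuclideanSpace ℝ (Fin n)) = L.comp (rightD n j h)},
      hA.continuous.continuousAt.preimage_mem_nhds (t := {B | ∃ A : EuclideanSpace ℝ (Fin n) ≃L[ℝ]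
        EuclideanSpace ℝ (Fin n), (A : _ →L[ℝ] EuclideanSpace ℝ (Fin n)) = B}) ?_,
      fun h => (L.comp (rightD n j h)).inverse.comp L, ?_, ?_⟩
    · rw [hAg]
      exact ContinuousLinearEquiv.nhds _
    · rintro h ⟨A, hA'⟩
      have hi : ContDiffAt ℝ ∞ (ContinuousLinearMap.inverse : (EuclideanSpace ℝ (Fin n) →L[ℝ]
          EuclideanSpace ℝ (Fin n)) → _) (L.comp (rightD n j h)) := by
        rw [← hA']; exact contDiffAt_map_inverse A
      have h1 : ContMDiffAt (𝓡 n) 𝓘(ℝ, EuclideanSpace ℝ (Fin n) →L[ℝ] EuclideanSpace ℝ (Fin n)) ∞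
          (fun h => (L.comp (rightD n j h)).inverse) h := hi.contMDiffAt.comp h hA.contMDiffAt
      exact (h1.clm_comp (contMDiffAt_const (c := L))).contMDiffWithinAt
    · rintro h ⟨A, hA'⟩
      simp only [Set.mem_ofPred_eq]
      rw [ContinuousLinearMap.comp_assoc, ← hA', ContinuousLinearMap.inverse_equiv]
      ext1 v
      simp
  obtain ⟨M, hM⟩ := exists_contMDiffMap_forall_mem_convex_of_local (n := ⊤) (𝓡 n) hconv hloc
  exact ⟨M, M.contMDiff, fun g v => DFunLike.congr_fun (hM g) v⟩

/-- Near every point, the inclusion of the embedded group coincides on the group with a smooth map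
whose derivative takes values in the tangent spaces of the group. -/
theorem IsRetractEmbedding.exists_tangent_extension {ι : Type} [Fintype ι] {j : G → ι → ℝ}
    (hj : IsRetractEmbedding (𝓡 n) j) {M : G → (ι → ℝ) →L[ℝ] EuclideanSpace ℝ (Fin n)}
    (hM : ∀ g v, M g (rightD n j g v) = v) (g : G) :
    ∃ (χ : (ι → ℝ) → ℝ) (r : (ι → ℝ) → ι → ℝ), ContDiff ℝ ∞ χ ∧ (∀ i, ContDiff ℝ ∞ fun x => r x i) ∧
      χ (j g) ≠ 0 ∧ (∀ h, χ (j h) ≠ 0 → r (j h) = j h) ∧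
      ∀ h v, χ (j h) ≠ 0 → rightD n j h (M h fun i => fderiv ℝ (fun x => r x i) (j h) v) =
        fun i => fderiv ℝ (fun x => r x i) (j h) v := by
  obtain ⟨W₀, hW₀, l, hl₀, hlj₀⟩ := hj.hasLocalRetraction g
  obtain ⟨W, hWW, hWo, hgW⟩ := mem_nhds_iff.1 hW₀
  have hl := hl₀.mono hWW
  have hlj : ∀ y, j y ∈ W → l (j y) = y := fun y hy => hlj₀ y (hWW hy)
  obtain ⟨ε, hε, hball⟩ := Metric.nhds_basis_closedBall.mem_iff.1 (hWo.mem_nhds hgW)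
  have hjl : ContDiffOn ℝ ∞ (fun w => j (l w)) W := (hj.contMDiff.comp_contMDiffOn hl).contDiffOn
  have hjli : ∀ i, ContDiffOn ℝ ∞ (fun w => j (l w) i) W := fun i => contDiffOn_pi.1 hjl i
  -- The components of j ∘ l are extended off a closed ball on a neighbourhood of it. The bump χ
  -- lives in that ball, so where χ does not vanish both values and derivatives of r are those of j
  -- ∘ l.
  choose r U hr hU hKU hUW hrU using fun i => exists_contDiff_extension hWo
    (isCompact_closedBall (j g) ε) hball (hjli i)
  let χ : ContDiffBump (j g) := ⟨ε / 2, ε, by positivity, by linarith⟩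
  have hχ : ∀ w, χ w ≠ 0 → w ∈ Metric.closedBall (j g) ε := fun w hw => by
    have : w ∈ Function.support χ := hw
    rw [χ.support_eq] at this
    exact Metric.ball_subset_closedBall this
  refine ⟨χ, fun x i => r i x, χ.contDiff, hr, ?_, ?_, ?_⟩
  · exact (χ.pos_of_mem_ball (Metric.mem_ball_self hε)).ne'
  · intro h hh
    funext i
    have hb := hχ _ hh
    simpa only [hlj h (hball hb)] using hrU i (hKU i hb)
  · intro h v hh
    have hb := hχ _ hh
    have hd : DifferentiableAt ℝ (fun w => j (l w)) (j h) :=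
      (hjl.contDiffAt (hWo.mem_nhds (hball hb))).differentiableAt (by simp)
    have e : (fun i => fderiv ℝ (fun x => r i x) (j h) v) = fderiv ℝ (fun w => j (l w)) (j h) v := by
      funext i
      have h1 : (fun x => r i x) =ᶠ[𝓝 (j h)] fun w => j (l w) i := by
        filter_upwards [(hU i).mem_nhds (hKU i hb)] with w hw using hrU i hw
      rw [h1.fderiv_eq, fderiv_apply hd]
      rfl
    -- Writing l w = (l w · h⁻¹) h shows that the derivative of j ∘ l at j h factors through the
    -- differential of j, on whose image M h followed by that differential is the identity.
    have h2 := fderiv_comp_unitChart (n := n) (x := j h) (f := fun x => j (x * h))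
      (k := fun w => l w * h⁻¹) ?_ (hj.contMDiff.comp (contMDiff_mul_right (I := 𝓡 n)
        (a := h))).contMDiffAt ((hl.contMDiffAt (hWo.mem_nhds (hball hb))).mul contMDiffAt_const)
    · simp only [hlj h (hball hb), inv_mul_cancel_right, mul_inv_cancel] at h2
      have h3 := DFunLike.congr_fun h2 v
      rw [ContinuousLinearMap.comp_apply] at h3
      simp only [e, h3]
      exact congrArg _ (hM h _)
    · simp [hlj h (hball hb)]

end EmbeddedGroup

/-! ### The group of loops of Sobolev class -/

section OfFun

variable {α : ℝ} [hF : Fact (1 / 2 < α)]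

open Classical in
/-- The element of `H^α` with the given values; zero if there is none. -/
def Sc.ofFun (f : UnitAddCircle → ℝ) : Sc α :=
  if h : ∃ a : Sc α, ∀ s, Sc.ev a s = f s then h.choose else 0

theorem Sc.ofFun_eq {f : UnitAddCircle → ℝ} {a : Sc α} (h : ∀ s, Sc.ev a s = f s) :
    Sc.ofFun f = a := by
  have h' : ∃ a : Sc α, ∀ s, Sc.ev a s = f s := ⟨a, h⟩
  rw [ofFun, dif_pos h']
  exact ext_ev fun s => by rw [h'.choose_spec, h]

theorem Sc.ev_ofFun {f : UnitAddCircle → ℝ} (h : ∃ a : Sc α, ∀ s, Sc.ev a s = f s)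
    (s : UnitAddCircle) : Sc.ev (Sc.ofFun f : Sc α) s = f s := by
  obtain ⟨a, ha⟩ := h
  rw [ofFun_eq ha, ha]

theorem summable_sobolev_iff {c : ℤ → ℂ} :
    (Summable fun k : ℤ => (1 + (k : ℝ) ^ 2) ^ α * ‖c k‖ ^ 2) ↔ sobolevENorm α c ≠ ⊤ := by
  have e : sobolevENorm α c =
      ∑' k : ℤ, ENNReal.ofReal ((1 + (k : ℝ) ^ 2) ^ α * ‖c k‖ ^ 2) := by
    refine tsum_congr fun k => ?_
    rw [Sc.ofReal_mul_enorm, mul_pow, sobolevWeight, ← Real.rpow_natCast, ← Real.rpow_mul (by positivity)]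
    norm_num
  rw [e]
  exact ⟨fun h => h.tsum_ofReal_ne_top, fun h => by
    simpa [ENNReal.toReal_ofReal, show ∀ k : ℤ, 0 ≤ (1 + (k : ℝ) ^ 2) ^ α * ‖c k‖ ^ 2 from
      fun k => by positivity] using ENNReal.summable_toReal h⟩

theorem evFam_sumElim {ι κ : Type} [Fintype ι] [Fintype κ] (u : ι → Sc α) (v : κ → Sc α)
    (s : UnitAddCircle) : evFam (Sum.elim u v) s = Sum.elim (evFam u s) (evFam v s) := by
  funext i
  cases i <;> rfl

end OfFun

/-! ### A fixed embedding of the group -/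

section Embedding

variable (n : ℕ) (G : Type*) [TopologicalSpace G] [ChartedSpace (EuclideanSpace ℝ (Fin n)) G]
  [Group G] [LieGroup (𝓡 n) ∞ G] [CompactSpace G] [T2Space G]

/-- The dimension of a space in which the group is embedded. -/
def embDim : ℕ := (exists_isRetractEmbedding n G).choose

/-- An embedding of the group. -/
def emb : G → Fin (embDim n G) → ℝ := (exists_isRetractEmbedding n G).choose_spec.choose

theorem isRetractEmbedding_emb : IsRetractEmbedding (𝓡 n) (emb n G) :=
  (exists_isRetractEmbedding n G).choose_spec.choose_spec

theorem emb_injective : Function.Injective (emb n G) :=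
  (isRetractEmbedding_emb n G).isClosedEmbedding.injective

theorem contMDiff_emb (i : Fin (embDim n G)) : ContMDiff (𝓡 n) 𝓘(ℝ, ℝ) ∞ fun g => emb n G g i :=
  (contMDiff_pi_space.1 (isRetractEmbedding_emb n G).contMDiff) i

variable {n G}

theorem exists_contDiff_emb {f : G → ℝ} (hf : ContMDiff (𝓡 n) 𝓘(ℝ, ℝ) ∞ f) :
    ∃ F : (Fin (embDim n G) → ℝ) → ℝ, ContDiff ℝ ∞ F ∧ ∀ x, F (emb n G x) = f x :=
  (isRetractEmbedding_emb n G).exists_contDiff_eq hf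

/-- The product of two embeddings with local retractions is of the same kind; a linear isomorphism
makes its ambient space a space of functions on the sum of the index types. -/
theorem exists_contDiff_emb₂ {f : G × G → ℝ}
    (hf : ContMDiff ((𝓡 n).prod (𝓡 n)) 𝓘(ℝ, ℝ) ∞ f) :
    ∃ F : (Fin (embDim n G) ⊕ Fin (embDim n G) → ℝ) → ℝ, ContDiff ℝ ∞ F ∧
      ∀ x y, F (Sum.elim (emb n G x) (emb n G y)) = f (x, y) := by
  let L := (LinearEquiv.sumArrowLequivProdArrow (Fin (embDim n G)) (Fin (embDim n G)) ℝ ℝ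
    ).symm.toContinuousLinearEquiv
  obtain ⟨F, hF, h⟩ := (((isRetractEmbedding_emb n G).prodMap
    (isRetractEmbedding_emb n G)).continuousLinearEquiv_comp L).exists_contDiff_eq hf
  exact ⟨F, hF, fun x y => h (x, y)⟩

end Embedding

theorem isTopologicalGroup_of_lieGroup (n : ℕ) (G : Type*) [TopologicalSpace G]
    [ChartedSpace (EuclideanSpace ℝ (Fin n)) G] [Group G] [h : LieGroup (𝓡 n) ∞ G] :
    IsTopologicalGroup G :=
  have := h
  topologicalGroup_of_lieGroup (𝓡 n) ∞

namespace SobolevLoop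

variable {α : ℝ} [hF : Fact (1 / 2 < α)] {n : ℕ} {G : Type*} [TopologicalSpace G]
  [ChartedSpace (EuclideanSpace ℝ (Fin n)) G]

theorem ext' {γ δ : SobolevLoop α n G} (h : ∀ s, γ.toMap s = δ.toMap s) : γ = δ := by
  cases γ; cases δ
  congr 1
  exact ContinuousMap.ext h

/-- The composition of a loop with a function. -/
def fn (f : G → ℝ) (γ : SobolevLoop α n G) : Sc α := Sc.ofFun fun s => f (γ.toMap s)

theorem exists_ev_eq {f : G → ℝ} (hf : ContMDiff (𝓡 n) 𝓘(ℝ, ℝ) ∞ f) (γ : SobolevLoop α n G) :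
    ∃ a : Sc α, ∀ s, Sc.ev a s = f (γ.toMap s) := by
  obtain ⟨a, ha, -⟩ := Sc.exists_ev_eq (hf.continuous.comp γ.toMap.continuous)
    (summable_sobolev_iff.1 (γ.sobolev f hf))
  exact ⟨a, ha⟩

theorem ev_fn {f : G → ℝ} (hf : ContMDiff (𝓡 n) 𝓘(ℝ, ℝ) ∞ f) (γ : SobolevLoop α n G)
    (s : UnitAddCircle) : Sc.ev (fn f γ) s = f (γ.toMap s) :=
  Sc.ev_ofFun (exists_ev_eq hf γ) s

/-- A continuous loop all of whose compositions with smooth functions are in `H^α`. -/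
def ofMap (g : C(UnitAddCircle, G))
    (h : ∀ f : G → ℝ, ContMDiff (𝓡 n) 𝓘(ℝ, ℝ) ∞ f → ∃ a : Sc α, ∀ s, Sc.ev a s = f (g s)) :
    SobolevLoop α n G where
  toMap := g
  sobolev f hf := by
    obtain ⟨a, ha⟩ := h f hf
    have e : realFourierCoeff (fun s => f (g s)) = a.c := by
      rw [show (fun s => f (g s)) = Sc.ev a from funext fun s => (ha s).symm]
      exact funext a.realFourierCoeff_ev
    rw [summable_sobolev_iff, e]
    exact a.sobolevENorm_ne_top

variable [Group G] [LieGroup (𝓡 n) ∞ G] [CompactSpace G] [T2Space G]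

/-- The coordinates of a loop in the ambient space of the embedding. -/
def embL (γ : SobolevLoop α n G) : Fin (embDim n G) → Sc α := fun i => fn (fun g => emb n G g i) γ

theorem evFam_embL (γ : SobolevLoop α n G) (s : UnitAddCircle) :
    evFam (embL γ) s = emb n G (γ.toMap s) :=
  funext fun i => ev_fn (contMDiff_emb n G i) γ s

theorem evFam_sumElim_embL (γ δ : SobolevLoop α n G) (s : UnitAddCircle) :
    evFam (Sum.elim (embL γ) (embL δ)) s =
      Sum.elim (emb n G (γ.toMap s)) (emb n G (δ.toMap s)) := by
  rw [evFam_sumElim, evFam_embL, evFam_embL]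

theorem embL_injective : Function.Injective (embL : SobolevLoop α n G → _) := fun γ δ h =>
  ext' fun s => emb_injective n G (by rw [← evFam_embL, ← evFam_embL, h])

theorem exists_nem_eq {f : G → ℝ} (hf : ContMDiff (𝓡 n) 𝓘(ℝ, ℝ) ∞ f) :
    ∃ F : (Fin (embDim n G) → ℝ) → ℝ, ContDiff ℝ ∞ F ∧ (∀ x, F (emb n G x) = f x) ∧
      ∀ γ : SobolevLoop α n G, nem F (embL γ) = fn f γ := by
  obtain ⟨F, hFs, h⟩ := exists_contDiff_emb hf
  exact ⟨F, hFs, h, fun γ => nem_eq fun s => by rw [ev_fn hf, evFam_embL, h]⟩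

/-- A smooth function of two loops is a superposition operator in their ambient coordinates, hence
of class α. Pointwise multiplication is thereby an operation on Sobolev loops. -/
theorem exists_ev_eq₂ {f : G × G → ℝ} (hf : ContMDiff ((𝓡 n).prod (𝓡 n)) 𝓘(ℝ, ℝ) ∞ f)
    (γ δ : SobolevLoop α n G) : ∃ a : Sc α, ∀ s, Sc.ev a s = f (γ.toMap s, δ.toMap s) := by
  obtain ⟨F, hFs, h⟩ := exists_contDiff_emb₂ hf
  exact ⟨nem F (Sum.elim (embL γ) (embL δ)), fun s => by
    rw [(isLocallyBoundedSuperposition α).ev_nem hFs, evFam_sumElim_embL, h]⟩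

instance : Mul (SobolevLoop α n G) where
  mul γ δ :=
    have := isTopologicalGroup_of_lieGroup n G
    ofMap (γ.toMap * δ.toMap) fun _ hf => exists_ev_eq₂ (hf.comp (contMDiff_mul (𝓡 n) ∞)) γ δ

instance : Inv (SobolevLoop α n G) where
  inv γ :=
    have := isTopologicalGroup_of_lieGroup n G
    ofMap γ.toMap⁻¹ fun _ hf => exists_ev_eq (hf.comp (contMDiff_inv (𝓡 n) ∞)) γ

instance : One (SobolevLoop α n G) where
  one := ofMap 1 fun f _ => ⟨f 1 • 1, fun s => by simp⟩

@[simp]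
theorem mul_toMap (γ δ : SobolevLoop α n G) (s : UnitAddCircle) :
    (γ * δ).toMap s = γ.toMap s * δ.toMap s := rfl

@[simp]
theorem inv_toMap (γ : SobolevLoop α n G) (s : UnitAddCircle) :
    γ⁻¹.toMap s = (γ.toMap s)⁻¹ := rfl

@[simp]
theorem one_toMap (s : UnitAddCircle) : (1 : SobolevLoop α n G).toMap s = 1 := rfl

instance : Group (SobolevLoop α n G) where
  mul_assoc _ _ _ := ext' fun _ => mul_assoc _ _ _
  one_mul _ := ext' fun _ => one_mul _
  mul_one _ := ext' fun _ => mul_one _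
  inv_mul_cancel _ := ext' fun _ => inv_mul_cancel _

/-- With the topology induced from the ambient coordinates, continuity into the loop group is tested
in a normed space. -/
instance : TopologicalSpace (SobolevLoop α n G) := TopologicalSpace.induced embL inferInstance

theorem isEmbedding_embL : Topology.IsEmbedding (embL : SobolevLoop α n G → _) :=
  ⟨⟨rfl⟩, embL_injective⟩

instance : T2Space (SobolevLoop α n G) := isEmbedding_embL.t2Space

theorem continuous_embL : Continuous (embL : SobolevLoop α n G → _) :=
  isEmbedding_embL.continuous

variable (α) in
-- In ambient coordinates multiplication is a superposition operator, so its continuity and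
-- smoothness are those of such operators.
theorem exists_embL_mul : ∃ F : Fin (embDim n G) → (Fin (embDim n G) ⊕ Fin (embDim n G) → ℝ) → ℝ,
    (∀ i, ContDiff ℝ ∞ (F i)) ∧
    ∀ γ δ : SobolevLoop α n G, embL (γ * δ) = fun i => nem (F i) (Sum.elim (embL γ) (embL δ)) := by
  choose F hFs hF' using fun i => exists_contDiff_emb₂
    ((contMDiff_emb n G i).comp (contMDiff_mul (𝓡 n) ∞))
  refine ⟨F, hFs, fun γ δ => funext fun i => (nem_eq fun s => ?_).symm⟩
  rw [evFam_sumElim_embL, hF', embL, ev_fn (contMDiff_emb n G i)]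
  rfl

variable (α) in
theorem exists_embL_inv : ∃ F : Fin (embDim n G) → (Fin (embDim n G) → ℝ) → ℝ,
    (∀ i, ContDiff ℝ ∞ (F i)) ∧
    ∀ γ : SobolevLoop α n G, embL γ⁻¹ = fun i => nem (F i) (embL γ) := by
  choose F hFs hF' using fun i => exists_contDiff_emb
    ((contMDiff_emb n G i).comp (contMDiff_inv (𝓡 n) ∞))
  refine ⟨F, hFs, fun γ => funext fun i => (nem_eq fun s => ?_).symm⟩
  rw [evFam_embL, hF', embL, ev_fn (contMDiff_emb n G i)]
  rfl

/-- The map `Sum.elim` as a continuous linear map. -/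
def _root_.sumElimCLM (A : Type*) [NormedAddCommGroup A] [NormedSpace ℝ A] (ι κ : Type*)
    [Fintype ι] [Fintype κ] : ((ι → A) × (κ → A)) →L[ℝ] (ι ⊕ κ → A) :=
  ContinuousLinearMap.pi fun i => i.rec
    (fun i => (ContinuousLinearMap.proj i).comp (ContinuousLinearMap.fst ℝ _ _))
    (fun i => (ContinuousLinearMap.proj i).comp (ContinuousLinearMap.snd ℝ _ _))

theorem _root_.sumElimCLM_apply {A : Type*} [NormedAddCommGroup A] [NormedSpace ℝ A] {ι κ : Type*}
    [Fintype ι] [Fintype κ] (u : ι → A) (v : κ → A) :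
    sumElimCLM A ι κ (u, v) = Sum.elim u v := by
  funext i
  cases i <;> rfl

theorem continuous_mul_left (γ : SobolevLoop α n G) : Continuous fun δ => γ * δ := by
  refine isEmbedding_embL.continuous_iff.2 ?_
  obtain ⟨F, hFs, h⟩ := exists_embL_mul (n := n) (G := G) α
  simp only [Function.comp_def, h]
  refine continuous_pi fun i =>
    ((isLocallyBoundedSuperposition α).continuous_nem (hFs i)).comp ?_
  simp only [← sumElimCLM_apply]
  exact (sumElimCLM _ _ _).continuous.comp (continuous_const.prodMk continuous_embL)

/-- Left multiplication as a homeomorphism. -/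
def mulLeftHomeomorph (γ : SobolevLoop α n G) : SobolevLoop α n G ≃ₜ SobolevLoop α n G where
  toFun δ := γ * δ
  invFun δ := γ⁻¹ * δ
  left_inv δ := inv_mul_cancel_left γ δ
  right_inv δ := mul_inv_cancel_left γ δ
  continuous_toFun := continuous_mul_left γ
  continuous_invFun := continuous_mul_left γ⁻¹

theorem isOpen_setOf_mem {O : Set G} (hO : IsOpen O) :
    IsOpen {γ : SobolevLoop α n G | ∀ s, γ.toMap s ∈ O} := by
  obtain ⟨W, hW, rfl⟩ := (isRetractEmbedding_emb n G).isClosedEmbedding.isInducing.isOpen_iff.1 hO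
  have := (isOpen_evFam_mem (α := α) hW).preimage (continuous_embL (n := n) (G := G))
  simpa [Set.preimage, evFam_embL] using this

end SobolevLoop

/-! ### The smooth structure of the loop group -/

section ChartDomain

variable (n : ℕ) (G : Type*) [TopologicalSpace G] [ChartedSpace (EuclideanSpace ℝ (Fin n)) G]
  [Group G]

/-- The image of the chart at the unit, in `Fin n → ℝ`. -/
def chartDom : Set (Fin n → ℝ) := WithLp.toLp 2 ⁻¹' (unitChart n G).target

theorem isOpen_chartDom : IsOpen (chartDom n G) :=
  (unitChart n G).open_target.preimage (PiLp.continuous_toLp 2 _)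

variable {n G}

theorem contDiffOn_comp_toLp {F : Type*} [NormedAddCommGroup F] [NormedSpace ℝ F]
    {f : EuclideanSpace ℝ (Fin n) → F}
    (hf : ∀ y ∈ (unitChart n G).target, ContDiffAt ℝ ∞ f y) :
    ContDiffOn ℝ ∞ (fun x => f (WithLp.toLp 2 x)) (chartDom n G) := fun x hx =>
  ((hf _ hx).comp x (EuclideanSpace.equiv (Fin n) ℝ).symm.contDiff.contDiffAt).contDiffWithinAt

theorem contDiffOn_comp_unitChart_symm [LieGroup (𝓡 n) ∞ G] {f : G → ℝ}
    (hf : ContMDiff (𝓡 n) 𝓘(ℝ, ℝ) ∞ f) :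
    ContDiffOn ℝ ∞ (fun x => f ((unitChart n G).symm (WithLp.toLp 2 x))) (chartDom n G) :=
  contDiffOn_comp_toLp fun y hy => (ContMDiffAt.comp (I' := 𝓡 n) y hf.contMDiffAt
    (contMDiffAt_unitChart_symm hy)).contDiffAt

end ChartDomain

section EvalCoords

variable {α : ℝ} [hF : Fact (1 / 2 < α)] {n : ℕ}

theorem SobolevSpace.eval_eq_toLp (u : SobolevSpace α n) (s : UnitAddCircle) :
    u.eval s = WithLp.toLp 2 (evFam (coords α n u) s) := by
  ext i
  rw [eval_apply]
  rfl

theorem SobolevSpace.continuous_eval (u : SobolevSpace α n) : Continuous u.eval := by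
  have : u.eval = fun s => WithLp.toLp 2 (evFam (coords α n u) s) := funext u.eval_eq_toLp
  rw [this]
  exact (PiLp.continuous_toLp 2 _).comp (continuous_evFam _)

theorem SobolevSpace.ext_eval {u v : SobolevSpace α n} (h : ∀ s, u.eval s = v.eval s) : u = v := by
  refine (coords α n).injective (funext fun i => Sc.ext_ev fun s => ?_)
  have := congrArg (fun y => y.ofLp i) (h s)
  simp only [eval_eq_toLp] at this
  exact this

end EvalCoords

namespace SobolevLoop

variable {α : ℝ} [hF : Fact (1 / 2 < α)] {n : ℕ} {G : Type*} [TopologicalSpace G]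
  [ChartedSpace (EuclideanSpace ℝ (Fin n)) G]
  [Group G] [LieGroup (𝓡 n) ∞ G] [CompactSpace G] [T2Space G]

open Classical in
/-- The loop with the given coordinates in the chart at the unit. -/
def ofCoords (u : SobolevSpace α n) : SobolevLoop α n G :=
  if h : ∀ s, u.eval s ∈ (unitChart n G).target then
    ofMap ⟨fun s => (unitChart n G).symm (u.eval s),
      (unitChart n G).continuousOn_symm.comp_continuous u.continuous_eval h⟩ fun f hf =>
      ⟨nem (fun x => f ((unitChart n G).symm (WithLp.toLp 2 x))) (SobolevSpace.coords α n u),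
        fun s => by
          rw [ev_nem (isOpen_chartDom n G) (contDiffOn_comp_unitChart_symm hf)
            (fun s => by simpa only [chartDom, Set.mem_preimage, ← SobolevSpace.eval_eq_toLp]
              using h s), ← SobolevSpace.eval_eq_toLp]
          rfl⟩
  else 1

theorem mem_chartDom {u : SobolevSpace α n} {s : UnitAddCircle} :
    evFam (SobolevSpace.coords α n u) s ∈ chartDom n G ↔ u.eval s ∈ (unitChart n G).target := by
  rw [chartDom, Set.mem_preimage, ← SobolevSpace.eval_eq_toLp]

theorem ofCoords_toMap {u : SobolevSpace α n} (h : ∀ s, u.eval s ∈ (unitChart n G).target)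
    (s : UnitAddCircle) :
    (ofCoords u : SobolevLoop α n G).toMap s = (unitChart n G).symm (u.eval s) := by
  rw [ofCoords, dif_pos h]
  rfl

theorem fn_ofCoords {u : SobolevSpace α n} (h : ∀ s, u.eval s ∈ (unitChart n G).target)
    {f : G → ℝ} (hf : ContMDiff (𝓡 n) 𝓘(ℝ, ℝ) ∞ f) :
    fn f (ofCoords u : SobolevLoop α n G) =
      nem (fun x => f ((unitChart n G).symm (WithLp.toLp 2 x))) (SobolevSpace.coords α n u) := by
  refine Sc.ext_ev fun s => ?_
  rw [ev_nem (isOpen_chartDom n G) (contDiffOn_comp_unitChart_symm hf)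
    (fun s => mem_chartDom.2 (h s)), ev_fn hf, ofCoords_toMap h, SobolevSpace.eval_eq_toLp]

/-- The coordinates of a loop in the chart at the unit. -/
def toCoords (γ : SobolevLoop α n G) : SobolevSpace α n :=
  (SobolevSpace.coords α n).symm fun i => Sc.ofFun fun s => unitChart n G (γ.toMap s) i

theorem isOpen_setOf_eval_mem :
    IsOpen {u : SobolevSpace α n | ∀ s, u.eval s ∈ (unitChart n G).target} := by
  have := (isOpen_evFam_mem (α := α) (isOpen_chartDom n G)).preimage
    (SobolevSpace.coords α n).continuous
  simpa only [Set.preimage_ofPred_eq, mem_chartDom] using this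

/-- Near a loop in the domain of the chart, the coordinates are given by superposition operators
on the ambient space. -/
theorem exists_toCoords_eq {γ₀ : SobolevLoop α n G}
    (h : ∀ s, γ₀.toMap s ∈ (unitChart n G).source) :
    ∃ Φ : Fin n → (Fin (embDim n G) → ℝ) → ℝ, (∀ i, ContDiff ℝ ∞ (Φ i)) ∧
      ∃ U : Set G, IsOpen U ∧ (∀ s, γ₀.toMap s ∈ U) ∧
      (∀ i, ∀ x ∈ U, Φ i (emb n G x) = unitChart n G x i) ∧
      ∀ γ : SobolevLoop α n G, (∀ s, γ.toMap s ∈ U) →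
        toCoords γ = (SobolevSpace.coords α n).symm fun i => nem (Φ i) (embL γ) := by
  have hφ : ∀ i, ContMDiffOn (𝓡 n) 𝓘(ℝ, ℝ) ∞ (fun x => unitChart n G x i)
      (unitChart n G).source := fun i x hx => by
    have := (contMDiffAt_unitChart hx)
    exact (ContMDiffAt.comp (I' := 𝓡 n) (g := fun y : EuclideanSpace ℝ (Fin n) => y i) x
      (EuclideanSpace.proj (𝕜 := ℝ) i).contDiff.contMDiff.contMDiffAt this).contMDiffWithinAt
  -- The chart components are defined only on the chart domain; they are changed away from the
  -- compact image of the given loop so as to become smooth on all of G, and then extended to the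
  -- ambient space.
  choose f hf U hU hKU hfU using fun i => exists_contMDiff_eventuallyEq
    (unitChart n G).open_source (isCompact_range γ₀.toMap.continuous).isClosed
    (by rintro _ ⟨s, rfl⟩; exact h s) (hφ i)
  choose Φ hΦ hΦf hnem using fun i => exists_nem_eq (α := α) (hf i)
  refine ⟨Φ, hΦ, ⋂ i, U i, isOpen_iInter_of_finite hU,
    fun s => Set.mem_iInter.2 fun i => hKU i ⟨s, rfl⟩, fun i x hx => ?_, fun γ hγ => ?_⟩
  · rw [hΦf, hfU i (Set.mem_iInter.1 hx i)]
  · refine congrArg _ (funext fun i => Sc.ofFun_eq fun s => ?_)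
    rw [hnem, ev_fn (hf i), hfU i (Set.mem_iInter.1 (hγ s) i)]

theorem eval_toCoords {γ : SobolevLoop α n G}
    (h : ∀ s, γ.toMap s ∈ (unitChart n G).source) (s : UnitAddCircle) :
    (toCoords γ).eval s = unitChart n G (γ.toMap s) := by
  obtain ⟨Φ, hΦ, U, -, hγU, hΦU, he⟩ := exists_toCoords_eq h
  rw [he γ hγU, SobolevSpace.eval_eq_toLp]
  ext i
  change Sc.ev _ s = _
  rw [ContinuousLinearEquiv.apply_symm_apply, (isLocallyBoundedSuperposition α).ev_nem (hΦ i),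
    evFam_embL, hΦU i _ (hγU s)]

theorem embL_ofCoords {u : SobolevSpace α n} (h : ∀ s, u.eval s ∈ (unitChart n G).target) :
    embL (ofCoords u : SobolevLoop α n G) = fun i =>
      nem (fun x => emb n G ((unitChart n G).symm (WithLp.toLp 2 x)) i)
        (SobolevSpace.coords α n u) :=
  funext fun i => fn_ofCoords h (contMDiff_emb n G i)

theorem contDiffAt_embL_ofCoords {u : SobolevSpace α n}
    (h : ∀ s, u.eval s ∈ (unitChart n G).target) :
    ContDiffAt ℝ ∞ (fun u => embL (ofCoords u : SobolevLoop α n G)) u := by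
  have e : (fun u => embL (ofCoords u : SobolevLoop α n G)) =ᶠ[𝓝 u] fun u i =>
      nem (fun x => emb n G ((unitChart n G).symm (WithLp.toLp 2 x)) i)
        (SobolevSpace.coords α n u) := by
    filter_upwards [isOpen_setOf_eval_mem.mem_nhds h] with v hv using embL_ofCoords hv
  refine ContDiffAt.congr_of_eventuallyEq (contDiffAt_pi.2 fun i => ?_) e
  exact (contDiffAt_nem (isOpen_chartDom n G)
    (contDiffOn_comp_unitChart_symm (contMDiff_emb n G i)) fun s => mem_chartDom.2 (h s)).comp u
    (SobolevSpace.coords α n).contDiff.contDiffAt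

variable {EM HM M : Type*} [NormedAddCommGroup EM] [NormedSpace ℝ EM] [TopologicalSpace HM]
  {J : ModelWithCorners ℝ EM HM} [TopologicalSpace M] [ChartedSpace HM M]

theorem continuousAt_of_embL {k : M → SobolevLoop α n G} {x : M}
    (hk : ContMDiffAt J 𝓘(ℝ, Fin (embDim n G) → Sc α) ∞ (fun y => embL (k y)) x) :
    ContinuousAt k x :=
  isEmbedding_embL.isInducing.continuousAt_iff.2 hk.continuousAt

theorem contMDiffAt_nem {ι κ : Type} [Fintype ι] [Fintype κ] {Φ : κ → (ι → ℝ) → ℝ}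
    (hΦ : ∀ i, ContDiff ℝ ∞ (Φ i)) {k : M → ι → Sc α} {x : M}
    (hk : ContMDiffAt J 𝓘(ℝ, ι → Sc α) ∞ k x) :
    ContMDiffAt J 𝓘(ℝ, κ → Sc α) ∞ (fun y i => nem (Φ i) (k y)) x :=
  (contDiff_pi.2 fun i => (isLocallyBoundedSuperposition α).contDiff_nem
    (hΦ i)).contMDiff.contMDiffAt.comp x hk

theorem contMDiffAt_toCoords {k : M → SobolevLoop α n G} {x : M}
    (hk : ContMDiffAt J 𝓘(ℝ, Fin (embDim n G) → Sc α) ∞ (fun y => embL (k y)) x)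
    (h : ∀ s, (k x).toMap s ∈ (unitChart n G).source) :
    ContMDiffAt J 𝓘(ℝ, SobolevSpace α n) ∞ (fun y => toCoords (k y)) x := by
  obtain ⟨Φ, hΦ, U, hU, hγU, -, he⟩ := exists_toCoords_eq h
  have e : (fun y => toCoords (k y)) =ᶠ[𝓝 x] fun y =>
      (SobolevSpace.coords α n).symm fun i => nem (Φ i) (embL (k y)) := by
    filter_upwards [(continuousAt_of_embL hk).preimage_mem_nhds
      ((isOpen_setOf_mem hU).mem_nhds hγU)] with y hy using he _ hy
  refine ContMDiffAt.congr_of_eventuallyEq ?_ e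
  exact (SobolevSpace.coords α n).symm.contDiff.contMDiff.contMDiffAt.comp x (contMDiffAt_nem hΦ hk)

theorem contMDiffAt_embL_mul {k k' : M → SobolevLoop α n G} {x : M}
    (hk : ContMDiffAt J 𝓘(ℝ, Fin (embDim n G) → Sc α) ∞ (fun y => embL (k y)) x)
    (hk' : ContMDiffAt J 𝓘(ℝ, Fin (embDim n G) → Sc α) ∞ (fun y => embL (k' y)) x) :
    ContMDiffAt J 𝓘(ℝ, Fin (embDim n G) → Sc α) ∞ (fun y => embL (k y * k' y)) x := by
  obtain ⟨F, hFs, h⟩ := exists_embL_mul (n := n) (G := G) α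
  simp only [h, ← sumElimCLM_apply]
  exact contMDiffAt_nem hFs ((sumElimCLM _ _ _).contDiff.contMDiff.contMDiffAt.comp x
    (hk.prodMk_space hk'))

theorem contMDiffAt_embL_inv {k : M → SobolevLoop α n G} {x : M}
    (hk : ContMDiffAt J 𝓘(ℝ, Fin (embDim n G) → Sc α) ∞ (fun y => embL (k y)) x) :
    ContMDiffAt J 𝓘(ℝ, Fin (embDim n G) → Sc α) ∞ (fun y => embL (k y)⁻¹) x := by
  obtain ⟨F, hFs, h⟩ := exists_embL_inv (n := n) (G := G) α
  simp only [h]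
  exact contMDiffAt_nem hFs hk

variable (α n G) in
/-- The chart of the loop group induced by the chart of the group at the unit. -/
def loopChart : OpenPartialHomeomorph (SobolevLoop α n G) (SobolevSpace α n) where
  toFun := toCoords
  invFun := ofCoords
  source := {γ | ∀ s, γ.toMap s ∈ (unitChart n G).source}
  target := {u | ∀ s, u.eval s ∈ (unitChart n G).target}
  map_source' γ h s := by
    rw [eval_toCoords h]
    exact (unitChart n G).map_source (h s)
  map_target' u h s := by
    rw [ofCoords_toMap h]
    exact (unitChart n G).map_target (h s)
  left_inv' γ h := ext' fun s => by
    have h' : ∀ s, (toCoords γ).eval s ∈ (unitChart n G).target := fun s => by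
      rw [eval_toCoords h]
      exact (unitChart n G).map_source (h s)
    rw [ofCoords_toMap h', eval_toCoords h, (unitChart n G).left_inv (h s)]
  right_inv' u h := SobolevSpace.ext_eval fun s => by
    have h' : ∀ s, (ofCoords u : SobolevLoop α n G).toMap s ∈ (unitChart n G).source := fun s => by
      rw [ofCoords_toMap h]
      exact (unitChart n G).map_target (h s)
    rw [eval_toCoords h', ofCoords_toMap h, (unitChart n G).right_inv (h s)]
  open_source := isOpen_setOf_mem (unitChart n G).open_source
  open_target := isOpen_setOf_eval_mem
  continuousOn_toFun γ h := by
    obtain ⟨Φ, hΦ, U, hU, hγU, -, he⟩ := exists_toCoords_eq h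
    have e : toCoords =ᶠ[𝓝 γ] fun γ =>
        (SobolevSpace.coords α n).symm fun i => nem (Φ i) (embL γ) := by
      filter_upwards [(isOpen_setOf_mem hU).mem_nhds hγU] with y hy using he _ hy
    refine ContinuousAt.continuousWithinAt (ContinuousAt.congr ?_ e.symm)
    exact ((SobolevSpace.coords α n).symm.continuous.comp (continuous_pi fun i =>
      ((isLocallyBoundedSuperposition α).continuous_nem (hΦ i)).comp continuous_embL)).continuousAt
  continuousOn_invFun u h := ContinuousAt.continuousWithinAt
    (isEmbedding_embL.isInducing.continuousAt_iff.2 (contDiffAt_embL_ofCoords h).continuousAt)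

/-- The chart of the loop group around a given loop. -/
def loopChartAt (γ : SobolevLoop α n G) :
    OpenPartialHomeomorph (SobolevLoop α n G) (SobolevSpace α n) :=
  (mulLeftHomeomorph γ⁻¹).toOpenPartialHomeomorph.trans (loopChart α n G)

theorem loopChartAt_apply (γ δ : SobolevLoop α n G) :
    loopChartAt γ δ = loopChart α n G (γ⁻¹ * δ) := rfl

theorem loopChartAt_symm_apply (γ : SobolevLoop α n G) (u : SobolevSpace α n) :
    (loopChartAt γ).symm u = γ * (loopChart α n G).symm u :=
  congrArg (· * (loopChart α n G).symm u) (inv_inv γ)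

theorem mem_loopChartAt_source {γ δ : SobolevLoop α n G} :
    δ ∈ (loopChartAt γ).source ↔ γ⁻¹ * δ ∈ (loopChart α n G).source := by
  simp only [loopChartAt, OpenPartialHomeomorph.trans_source,
    Homeomorph.toOpenPartialHomeomorph_source, Set.univ_inter]
  rfl

theorem one_mem_loopChart_source : (1 : SobolevLoop α n G) ∈ (loopChart α n G).source :=
  fun _ => one_mem_unitChart n G

theorem loopChartAt_target (γ : SobolevLoop α n G) :
    (loopChartAt γ).target = (loopChart α n G).target := by
  simp [loopChartAt]

theorem loopChartAt_one : loopChartAt (1 : SobolevLoop α n G) = loopChart α n G := by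
  refine OpenPartialHomeomorph.ext _ _ (fun γ => ?_) (fun u => ?_) ?_
  · rw [loopChartAt_apply, inv_one, one_mul]
  · rw [loopChartAt_symm_apply, one_mul]
  · ext γ
    rw [mem_loopChartAt_source, inv_one, one_mul]

/-- The preferred chart at γ is the chart at the unit composed with left translation by γ⁻¹. Tangent
vectors in preferred charts are therefore left-trivialized by construction. -/
instance : ChartedSpace (SobolevSpace α n) (SobolevLoop α n G) where
  atlas := Set.range loopChartAt
  chartAt := loopChartAt
  mem_chart_source γ := by
    rw [mem_loopChartAt_source, inv_mul_cancel]
    exact one_mem_loopChart_source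
  chart_mem_atlas γ := ⟨γ, rfl⟩

theorem chartAt_eq (γ : SobolevLoop α n G) : chartAt (SobolevSpace α n) γ = loopChartAt γ := rfl

theorem contDiffAt_embL_loopChartAt_symm (γ : SobolevLoop α n G) {u : SobolevSpace α n}
    (hu : u ∈ (loopChart α n G).target) :
    ContDiffAt ℝ ∞ (fun u => embL ((loopChartAt γ).symm u)) u := by
  simp only [loopChartAt_symm_apply]
  exact (contMDiffAt_embL_mul contMDiffAt_const (contDiffAt_embL_ofCoords hu).contMDiffAt).contDiffAt

instance : IsManifold 𝓘(ℝ, SobolevSpace α n) ∞ (SobolevLoop α n G) := by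
  refine isManifold_of_contDiffOn _ _ _ ?_
  rintro _ _ ⟨γ, rfl⟩ ⟨δ, rfl⟩ u hu
  simp only [modelWithCornersSelf_coe, modelWithCornersSelf_coe_symm, Set.preimage_id, id_eq,
    Set.range_id, Set.inter_univ, Function.comp_def, OpenPartialHomeomorph.trans_source,
    OpenPartialHomeomorph.symm_source, Set.mem_inter_iff, Set.mem_preimage] at hu ⊢
  rw [loopChartAt_target, mem_loopChartAt_source] at hu
  refine (ContMDiffAt.contDiffAt ?_).contDiffWithinAt
  exact contMDiffAt_toCoords (contMDiffAt_embL_mul contMDiffAt_const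
    (contDiffAt_embL_loopChartAt_symm γ hu.1).contMDiffAt) hu.2

theorem contMDiff_embL : ContMDiff 𝓘(ℝ, SobolevSpace α n) 𝓘(ℝ, Fin (embDim n G) → Sc α) ∞
    (embL : SobolevLoop α n G → _) := by
  intro γ
  have h1 : ContMDiffAt 𝓘(ℝ, SobolevSpace α n) 𝓘(ℝ, SobolevSpace α n) ∞
      (chartAt (SobolevSpace α n) γ) γ :=
    contMDiffOn_chart.contMDiffAt (chart_source_mem_nhds _ γ)
  have h2 : loopChartAt γ γ ∈ (loopChart α n G).target := by
    rw [← loopChartAt_target γ]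
    exact mem_chart_target (SobolevSpace α n) γ
  refine ((contDiffAt_embL_loopChartAt_symm γ h2).contMDiffAt.comp γ h1).congr_of_eventuallyEq ?_
  filter_upwards [chart_source_mem_nhds (SobolevSpace α n) γ] with δ hδ
  exact congrArg embL ((loopChartAt γ).left_inv hδ).symm

/-- Smoothness into the loop group is tested in ambient coordinates: translate the image point to
the unit, where the chart is a superposition operator in these coordinates. Together with
`contMDiff_embL` this gives the Lie group axioms. -/
theorem contMDiffAt_of_embL {k : M → SobolevLoop α n G} {x : M}
    (hk : ContMDiffAt J 𝓘(ℝ, Fin (embDim n G) → Sc α) ∞ (fun y => embL (k y)) x) :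
    ContMDiffAt J 𝓘(ℝ, SobolevSpace α n) ∞ k x := by
  rw [contMDiffAt_iff_target]
  refine ⟨continuousAt_of_embL hk, ?_⟩
  exact contMDiffAt_toCoords (contMDiffAt_embL_mul contMDiffAt_const hk)
    (mem_loopChartAt_source.1 (mem_chart_source (SobolevSpace α n) (k x)))

instance : LieGroup 𝓘(ℝ, SobolevSpace α n) ∞ (SobolevLoop α n G) where
  contMDiff_mul _ := contMDiffAt_of_embL (contMDiffAt_embL_mul
    (contMDiff_embL.contMDiffAt.comp _ contMDiffAt_fst)
    (contMDiff_embL.contMDiffAt.comp _ contMDiffAt_snd))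
  contMDiff_inv _ := contMDiffAt_of_embL (contMDiffAt_embL_inv contMDiff_embL.contMDiffAt)

theorem contMDiff_fn {f : G → ℝ} (hf : ContMDiff (𝓡 n) 𝓘(ℝ, ℝ) ∞ f) :
    ContMDiff 𝓘(ℝ, SobolevSpace α n) 𝓘(ℝ, Sc α) ∞ (fn f : SobolevLoop α n G → Sc α) := by
  obtain ⟨F, hFs, -, h⟩ := exists_nem_eq (α := α) hf
  have : (fn f : SobolevLoop α n G → Sc α) = fun γ => nem F (embL γ) := funext fun γ => (h γ).symm
  rw [this]
  exact ((isLocallyBoundedSuperposition α).contDiff_nem hFs).contMDiff.comp contMDiff_embL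

theorem isLoopChart_loopChart : IsLoopChart (loopChart α n G) where
  source_eq := rfl
  coeff_apply γ h k i := by
    have e : ∀ s, Sc.ev (SobolevSpace.comp i (toCoords γ)) s =
        chartAt (EuclideanSpace ℝ (Fin n)) (1 : G) (γ.toMap s) i := fun s => by
      rw [← SobolevSpace.eval_apply, eval_toCoords h]
    rw [show (fun s => chartAt (EuclideanSpace ℝ (Fin n)) (1 : G) (γ.toMap s) i) =
      Sc.ev (SobolevSpace.comp i (toCoords γ)) from funext fun s => (e s).symm,
      Sc.realFourierCoeff_ev, SobolevSpace.c_comp]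
    rfl

theorem isLoopLieGroup_loopChart : IsLoopLieGroup (loopChart α n G) where
  mul_apply := mul_toMap
  lieGroup := inferInstance
  chart_mem := IsManifold.subset_maximalAtlas ⟨1, loopChartAt_one⟩
  isLoopChart := isLoopChart_loopChart

end SobolevLoop

/-! ### The right logarithmic derivative -/

section LogDeriv

variable {n : ℕ} {G : Type*} [TopologicalSpace G] [ChartedSpace (EuclideanSpace ℝ (Fin n)) G]
  [Group G] [LieGroup (𝓡 n) ∞ G]

theorem rightD_comp {V W : Type*} [NormedAddCommGroup V] [NormedSpace ℝ V] [NormedAddCommGroup W]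
    [NormedSpace ℝ W] {Φ : V → W} {f : G → V} (hf : ContMDiff (𝓡 n) 𝓘(ℝ, V) ∞ f)
    (g : G) (hΦ : DifferentiableAt ℝ Φ (f g)) :
    rightD n (fun x => Φ (f x)) g = (fderiv ℝ Φ (f g)).comp (rightD n f g) := by
  have h1 : DifferentiableAt ℝ (fun x => f ((unitChart n G).symm x * g)) (unitPt n G) := by
    refine ContDiffAt.differentiableAt (n := ∞) (contMDiffAt_iff_contDiffAt.1 ?_) (by simp)
    refine ContMDiffAt.comp (I' := 𝓡 n) (g := fun x => f (x * g)) _ ?_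
      (contMDiffAt_unitChart_symm (unitPt_mem (n := n) (G := G)))
    exact (hf.comp (contMDiff_mul_right (I := 𝓡 n) (a := g))).contMDiffAt
  have h2 : f ((unitChart n G).symm (unitPt n G) * g) = f g := by
    rw [unitChart_symm_unitPt, one_mul]
  have h3 := fderiv_comp (𝕜 := ℝ) (g := Φ) (unitPt n G) (by rw [h2]; exact hΦ) h1
  rw [h2] at h3
  exact h3

variable [CompactSpace G] [T2Space G]

variable (n G) in
/-- A smooth family of left inverses of the differentials of the embedding of `G`. -/
def logM : G → (Fin (embDim n G) → ℝ) →L[ℝ] EuclideanSpace ℝ (Fin n) :=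
  (isRetractEmbedding_emb n G).exists_leftInverse_rightD.choose

variable (n G) in
theorem contMDiff_logM :
    ContMDiff (𝓡 n) 𝓘(ℝ, (Fin (embDim n G) → ℝ) →L[ℝ] EuclideanSpace ℝ (Fin n)) ∞ (logM n G) :=
  (isRetractEmbedding_emb n G).exists_leftInverse_rightD.choose_spec.1

theorem logM_rightD (g : G) (v : EuclideanSpace ℝ (Fin n)) :
    logM n G g (rightD n (emb n G) g v) = v :=
  (isRetractEmbedding_emb n G).exists_leftInverse_rightD.choose_spec.2 g v

theorem ContMDiff.clm_apply_coord {V : Type*} [NormedAddCommGroup V] [NormedSpace ℝ V]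
    {L : G → V →L[ℝ] EuclideanSpace ℝ (Fin n)}
    (hL : ContMDiff (𝓡 n) 𝓘(ℝ, V →L[ℝ] EuclideanSpace ℝ (Fin n)) ∞ L) (v : V) (i : Fin n) :
    ContMDiff (𝓡 n) 𝓘(ℝ, ℝ) ∞ fun g => L g v i :=
  ((EuclideanSpace.proj i).comp
    (ContinuousLinearMap.apply ℝ (EuclideanSpace ℝ (Fin n)) v)).contMDiff.comp hL

theorem contMDiff_rightD_emb (v : EuclideanSpace ℝ (Fin n)) (i : Fin (embDim n G)) :
    ContMDiff (𝓡 n) 𝓘(ℝ, ℝ) ∞ fun g => rightD n (emb n G) g v i :=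
  ((ContinuousLinearMap.proj i).comp (ContinuousLinearMap.apply ℝ
    (Fin (embDim n G) → ℝ) v)).contMDiff.comp
      (contMDiff_rightD (isRetractEmbedding_emb n G).contMDiff)

/-- The matrix entries of the adjoint representation. -/
def adEntry (i j : Fin n) (g : G) : ℝ := adjointMap n g (EuclideanSpace.single j 1) i

theorem contMDiff_adEntry (i j : Fin n) : ContMDiff (𝓡 n) 𝓘(ℝ, ℝ) ∞ (adEntry (G := G) i j) :=
  contMDiff_adjointMap.clm_apply_coord _ i

theorem EuclideanSpace.eq_sum_single (v : EuclideanSpace ℝ (Fin n)) :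
    v = ∑ j, v j • EuclideanSpace.single j (1 : ℝ) := by
  ext i
  simp [Finset.sum_apply, Pi.single_apply]

theorem adjointMap_apply_eq_sum (g : G) (v : EuclideanSpace ℝ (Fin n)) (i : Fin n) :
    adjointMap n g v i = ∑ j, adEntry i j g * v j := by
  conv_lhs => rw [EuclideanSpace.eq_sum_single v]
  simp [adEntry, mul_comm]

namespace SobolevLoop

variable {α : ℝ} [hF : Fact (1 / 2 < α)]

/-- Distributions on the circle which vanish locally along a loop vanish. -/
theorem eq_zero_of_forall_smul (γ : SobolevLoop α n G) {T : Sc (α - 1)}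
    (h : ∀ g : G, ∃ f : G → ℝ, ContMDiff (𝓡 n) 𝓘(ℝ, ℝ) ∞ f ∧ (∀ x, 0 ≤ f x) ∧ f g ≠ 0 ∧
      fn f γ • T = 0) : T = 0 := by
  choose f hf hf0 hfg hfT using h
  obtain ⟨t, ht⟩ := isCompact_univ.elim_finite_subcover (fun g => {x | f g x ≠ 0})
    (fun g => isOpen_ne_fun (hf g).continuous continuous_const)
    (fun x _ => Set.mem_iUnion.2 ⟨x, hfg x⟩)
  -- Compactness of G leaves finitely many of the functions with positive sum; dividing by the sum
  -- writes 1 as a combination of functions each annihilating T along the loop.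
  have hη : ContMDiff (𝓡 n) 𝓘(ℝ, ℝ) ∞ fun x => ∑ g ∈ t, f g x :=
    contMDiff_finsetSum fun g _ => hf g
  have hη0 : ∀ x, ∑ g ∈ t, f g x ≠ 0 := fun x => by
    obtain ⟨g, hg, hgx⟩ := Set.mem_iUnion₂.1 (ht (Set.mem_univ x))
    exact (Finset.sum_pos' (fun g _ => hf0 g x) ⟨g, hg, (hf0 g x).lt_of_ne' hgx⟩).ne'
  have hinv : ContMDiff (𝓡 n) 𝓘(ℝ, ℝ) ∞ fun x => (∑ g ∈ t, f g x)⁻¹ := fun x =>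
    (contDiffAt_inv ℝ (hη0 x)).contMDiffAt.comp (I' := 𝓘(ℝ, ℝ)) x (hη x)
  have e1 : fn (fun x => (∑ g ∈ t, f g x)⁻¹) γ * ∑ g ∈ t, fn (f g) γ = 1 := by
    refine Sc.ext_ev fun s => ?_
    simp only [Sc.ev_mul, ev_fn hinv, Sc.ev_sum, ev_fn (hf _), Sc.ev_one]
    exact inv_mul_cancel₀ (hη0 _)
  rw [← one_smul (Sc α) T, ← e1, mul_smul, Finset.sum_smul, Finset.sum_eq_zero fun g _ => hfT g,
    smul_zero]

/-- The right logarithmic derivative `(dγ)γ⁻¹` of a loop. -/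
def rightLog (γ : SobolevLoop α n G) : SobolevSpace (α - 1) n :=
  (SobolevSpace.coords (α - 1) n).symm fun j =>
    ∑ i, fn (fun g => logM n G g (Pi.single i 1) j) γ • Sc.deriv (embL γ i)

theorem comp_rightLog (γ : SobolevLoop α n G) (j : Fin n) : SobolevSpace.comp j (rightLog γ) =
    ∑ i, fn (fun g => logM n G g (Pi.single i 1) j) γ • Sc.deriv (embL γ i) :=
  SobolevSpace.comp_coords_symm _ _

theorem pi_eq_sum_single {ι : Type} [Fintype ι] [DecidableEq ι] (w : ι → ℝ) :
    w = ∑ k, w k • Pi.single k (1 : ℝ) := by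
  funext i
  simp [Finset.sum_apply, Pi.single_apply]

/-- The derivative of the ambient loop is tangent to G, so the projection P = J M onto the tangent
spaces, with J the differential of the embedding and M its left inverse, fixes it. For a
distribution this cannot be checked pointwise. Instead, near each point of G the loop equals r of
itself, so by the chain rule its derivative D equals r' D; as r' has tangential values, P r' = r'
and P D = D. Cutoffs localize the argument. -/
theorem deriv_embL (γ : SobolevLoop α n G) (i : Fin (embDim n G)) :
    Sc.deriv (embL γ i) = ∑ j, fn (fun g => rightD n (emb n G) g (EuclideanSpace.single j 1) i) γ •
      SobolevSpace.comp j (rightLog γ) := by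
  have hLB := isLocallyBoundedSuperposition α
  have hJ := fun j i => contMDiff_rightD_emb (n := n) (G := G) (EuclideanSpace.single j 1) i
  have hM := fun k j => (contMDiff_logM n G).clm_apply_coord (Pi.single k 1) j
  have hevE : ∀ s i, Sc.ev (embL γ i) s = emb n G (γ.toMap s) i := fun s i =>
    congrFun (evFam_embL γ s) i
  let D := fun k => Sc.deriv (embL γ k)
  let P : Fin (embDim n G) → Sc α := fun k => ∑ j,
    fn (fun g => rightD n (emb n G) g (EuclideanSpace.single j 1) i) γ *
      fn (fun g => logM n G g (Pi.single k 1) j) γ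
  have hP : ∀ s (w : Fin (embDim n G) → ℝ), ∑ k, Sc.ev (P k) s * w k =
      rightD n (emb n G) (γ.toMap s) (logM n G (γ.toMap s) w) i := by
    intro s w
    conv_rhs => rw [pi_eq_sum_single w, map_sum, map_sum, Finset.sum_apply]
    refine Finset.sum_congr rfl fun k _ => ?_
    rw [map_smul, map_smul, Pi.smul_apply, smul_eq_mul, mul_comm]
    congr 1
    conv_rhs => rw [EuclideanSpace.eq_sum_single (logM n G (γ.toMap s) (Pi.single k 1))]
    simp only [P, Sc.ev_sum, Sc.ev_mul, ev_fn (hJ _ _), ev_fn (hM _ _), map_sum, map_smul,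
      Finset.sum_apply, Pi.smul_apply, smul_eq_mul]
    exact Finset.sum_congr rfl fun j _ => mul_comm _ _
  have key : D i - ∑ k, P k • D k = 0 := by
    refine eq_zero_of_forall_smul γ fun g => ?_
    obtain ⟨χ, r, hχ, hr, hχg, hrj, htan⟩ :=
      (isRetractEmbedding_emb n G).exists_tangent_extension (logM_rightD (n := n) (G := G)) g
    have hχe : ContMDiff (𝓡 n) 𝓘(ℝ, ℝ) ∞ fun x => χ (emb n G x) * χ (emb n G x) :=
      (hχ.mul hχ).contMDiff.comp (isRetractEmbedding_emb n G).contMDiff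
    refine ⟨_, hχe, fun x => mul_self_nonneg _, mul_ne_zero hχg hχg, ?_⟩
    let a : Sc α := nem χ (embL γ)
    have ha : ∀ s, Sc.ev a s = χ (emb n G (γ.toMap s)) := fun s => by
      rw [hLB.ev_nem hχ, evFam_embL]
    have haa : fn (fun x => χ (emb n G x) * χ (emb n G x)) γ = a * a := by
      refine Sc.ext_ev fun s => ?_
      rw [ev_fn hχe, Sc.ev_mul, ha]
    let ρ := fun k => nem (fun x => r x k) (embL γ)
    -- Two factors of the cutoff are used: with b = ρ k - embL γ k one has a b = 0, and a (a b)' =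
    -- a² b' + (a b) a' reduces to a² b' = 0.
    have hρ : ∀ k, (a * a) • D k = (a * a) • Sc.deriv (ρ k) := by
      intro k
      have h0 : a * (ρ k - embL γ k) = 0 := by
        refine Sc.ext_ev fun s => ?_
        rw [Sc.ev_mul, ha, Sc.ev_sub, hLB.ev_nem (hr k), evFam_embL, hevE, Sc.ev_zero]
        by_cases h : χ (emb n G (γ.toMap s)) = 0
        · rw [h, zero_mul]
        · rw [hrj _ h, sub_self, mul_zero]
      have h1 : a • Sc.deriv (a * (ρ k - embL γ k)) = 0 := by rw [h0, map_zero, smul_zero]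
      rw [Sc.deriv_mul, smul_add, smul_smul, smul_smul, h0, zero_smul, add_zero, map_sub,
        smul_sub] at h1
      exact (sub_eq_zero.1 h1).symm
    let r' := fun k l => nem (fun x => fderiv ℝ (fun x => r x k) x (Pi.single l 1)) (embL γ)
    have hr' : ∀ k l s, Sc.ev (r' k l) s =
        fderiv ℝ (fun x => r x k) (emb n G (γ.toMap s)) (Pi.single l 1) := fun k l s => by
      have : ContDiff ℝ ∞ fun x => fderiv ℝ (fun x => r x k) x (Pi.single l 1) :=
        ((hr k).fderiv_right (m := ∞) (by simp)).clm_apply contDiff_const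
      rw [hLB.ev_nem this, evFam_embL]
    have hdρ : ∀ k, Sc.deriv (ρ k) = ∑ l, r' k l • D l := fun k => hLB.deriv_nem (hr k) _
    -- Both factors are functions, so tangency of r' can be verified at each point of the circle
    -- where the cutoff does not vanish.
    have hPr : ∀ l, a * ∑ k, P k * r' k l = a * r' i l := by
      intro l
      refine Sc.ext_ev fun s => ?_
      simp only [Sc.ev_mul, Sc.ev_sum, hr', ha]
      by_cases h : χ (emb n G (γ.toMap s)) = 0
      · rw [h, zero_mul, zero_mul]
      · rw [hP s fun k => fderiv ℝ (fun x => r x k) (emb n G (γ.toMap s)) (Pi.single l 1)]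
        rw [htan _ _ h]
    rw [haa, smul_sub, hρ i, hdρ, Finset.smul_sum, Finset.smul_sum]
    simp only [smul_smul, mul_assoc, ← hPr]
    rw [sub_eq_zero]
    have h2 : ∀ k, (a * (a * P k)) • D k = ∑ l, (a * (a * (P k * r' k l))) • D l := fun k => by
      calc (a * (a * P k)) • D k = P k • (a * a) • D k := by rw [smul_smul]; congr 1; ring
        _ = _ := by
          rw [hρ, hdρ, Finset.smul_sum, Finset.smul_sum]
          refine Finset.sum_congr rfl fun l _ => ?_
          rw [smul_smul, smul_smul]
          congr 1
          ring
    simp only [h2, Finset.mul_sum, Finset.sum_smul]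
    exact Finset.sum_comm
  rw [sub_eq_zero] at key
  refine key.trans ?_
  simp only [P, comp_rightLog, Finset.sum_smul, Finset.smul_sum, mul_smul]
  exact Finset.sum_comm

end SobolevLoop

end LogDeriv

/-! ### The cocycle of logarithmic derivatives and the gauge action -/

section GaugeAction

variable {n : ℕ} {G : Type*} [TopologicalSpace G] [ChartedSpace (EuclideanSpace ℝ (Fin n)) G]
  [Group G] [LieGroup (𝓡 n) ∞ G] [CompactSpace G] [T2Space G] {α : ℝ} [hF : Fact (1 / 2 < α)]

theorem Sc.c_sum {σ : ℝ} {ι : Type*} (t : Finset ι) (a : ι → Sc σ) (k : ℤ) :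
    (∑ i ∈ t, a i).c k = ∑ i ∈ t, (a i).c k :=
  map_sum (Sc.cL k) a t

namespace SobolevLoop

theorem sum_fderiv_single {ι : Type} [Fintype ι] [DecidableEq ι] (L : (ι → ℝ) →L[ℝ] ℝ)
    (w : ι → ℝ) : ∑ l, L (Pi.single l 1) * w l = L w := by
  conv_rhs => rw [pi_eq_sum_single w, map_sum]
  exact Finset.sum_congr rfl fun l _ => by rw [map_smul, smul_eq_mul, mul_comm]

/-- The derivative of a function of two loops in terms of their logarithmic derivatives. -/
theorem deriv_of_ev₂ {f : G × G → ℝ} (hf : ContMDiff ((𝓡 n).prod (𝓡 n)) 𝓘(ℝ, ℝ) ∞ f)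
    (γ δ : SobolevLoop α n G) {a : Sc α} {b c : Fin n → Sc α}
    (ha : ∀ s, Sc.ev a s = f (γ.toMap s, δ.toMap s))
    (hb : ∀ j s, Sc.ev (b j) s =
      rightD n (fun x => f (x, δ.toMap s)) (γ.toMap s) (EuclideanSpace.single j 1))
    (hc : ∀ j s, Sc.ev (c j) s =
      rightD n (fun y => f (γ.toMap s, y)) (δ.toMap s) (EuclideanSpace.single j 1)) :
    Sc.deriv a = ∑ j, b j • SobolevSpace.comp j (rightLog γ) +
      ∑ j, c j • SobolevSpace.comp j (rightLog δ) := by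
  classical
  have hLB := isLocallyBoundedSuperposition α
  obtain ⟨F, hFs, hFf⟩ := exists_contDiff_emb₂ hf
  have hJ := fun j i => contMDiff_rightD_emb (n := n) (G := G) (EuclideanSpace.single j 1) i
  have hemb := (isRetractEmbedding_emb n G).contMDiff
  have hFd : ∀ l, ContDiff ℝ ∞ fun x => fderiv ℝ F x (Pi.single l 1) := fun l =>
    (hFs.fderiv_right (m := ∞) (by simp)).clm_apply contDiff_const
  have haF : a = nem F (Sum.elim (embL γ) (embL δ)) := by
    refine Sc.ext_ev fun s => ?_
    rw [ha, hLB.ev_nem hFs, evFam_sumElim_embL, hFf]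
  have hFdiff : ∀ w, DifferentiableAt ℝ F w := fun w => hFs.contDiffAt.differentiableAt (by simp)
  have hl : ∀ y x : Fin (embDim n G) → ℝ, HasFDerivAt (fun v => F (Sum.elim v y))
      ((fderiv ℝ F (Sum.elim x y)).comp ((sumElimCLM ℝ _ _).comp
        (ContinuousLinearMap.inl ℝ _ _))) x := fun y x => by
    have h := (sumElimCLM ℝ (Fin (embDim n G)) (Fin (embDim n G))).hasFDerivAt.comp x
      (hasFDerivAt_prodMk_left (𝕜 := ℝ) x y)
    have h2 := HasFDerivAt.comp x (g := F) (by
      rw [Function.comp_apply, sumElimCLM_apply]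
      exact (hFdiff _).hasFDerivAt) h
    simpa only [Function.comp_def, sumElimCLM_apply] using h2
  have hr : ∀ x y : Fin (embDim n G) → ℝ, HasFDerivAt (fun v => F (Sum.elim x v))
      ((fderiv ℝ F (Sum.elim x y)).comp ((sumElimCLM ℝ _ _).comp
        (ContinuousLinearMap.inr ℝ _ _))) y := fun x y => by
    have h := (sumElimCLM ℝ (Fin (embDim n G)) (Fin (embDim n G))).hasFDerivAt.comp y
      (hasFDerivAt_prodMk_right (𝕜 := ℝ) x y)
    have h2 := HasFDerivAt.comp y (g := F) (by
      rw [Function.comp_apply, sumElimCLM_apply]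
      exact (hFdiff _).hasFDerivAt) h
    simpa only [Function.comp_def, sumElimCLM_apply] using h2
  have hb' : ∀ j, b j = ∑ l, nem (fun x => fderiv ℝ F x (Pi.single (Sum.inl l) 1))
      (Sum.elim (embL γ) (embL δ)) *
        fn (fun g => rightD n (emb n G) g (EuclideanSpace.single j 1) l) γ := by
    intro j
    refine Sc.ext_ev fun s => ?_
    have h := rightD_comp (Φ := fun v => F (Sum.elim v (emb n G (δ.toMap s)))) hemb (γ.toMap s)
      (hl _ _).differentiableAt
    simp only [hFf, (hl _ _).fderiv] at h
    simp only [hb, h, Sc.ev_sum, Sc.ev_mul, hLB.ev_nem (hFd _), evFam_sumElim_embL, ev_fn (hJ _ _)]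
    simp only [ContinuousLinearMap.comp_apply, ContinuousLinearMap.inl_apply, sumElimCLM_apply]
    rw [← sum_fderiv_single (fderiv ℝ F _), Fintype.sum_sum_type]
    simp
  have hc' : ∀ j, c j = ∑ l, nem (fun x => fderiv ℝ F x (Pi.single (Sum.inr l) 1))
      (Sum.elim (embL γ) (embL δ)) *
        fn (fun g => rightD n (emb n G) g (EuclideanSpace.single j 1) l) δ := by
    intro j
    refine Sc.ext_ev fun s => ?_
    have h := rightD_comp (Φ := fun v => F (Sum.elim (emb n G (γ.toMap s)) v)) hemb (δ.toMap s)
      (hr _ _).differentiableAt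
    simp only [hFf, (hr _ _).fderiv] at h
    simp only [hc, h, Sc.ev_sum, Sc.ev_mul, hLB.ev_nem (hFd _), evFam_sumElim_embL, ev_fn (hJ _ _)]
    simp only [ContinuousLinearMap.comp_apply, ContinuousLinearMap.inr_apply, sumElimCLM_apply]
    rw [← sum_fderiv_single (fderiv ℝ F _), Fintype.sum_sum_type]
    simp
  rw [haF, hLB.deriv_nem hFs, Fintype.sum_sum_type]
  simp only [Sum.elim_inl, Sum.elim_inr, deriv_embL γ, deriv_embL δ, hb', hc', Finset.sum_smul,
    Finset.smul_sum, mul_smul]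
  congr 1 <;> exact Finset.sum_comm

/-- The two-loop formula with a function that ignores the second argument, the second loop being
trivial. -/
theorem deriv_fn {f : G → ℝ} (hf : ContMDiff (𝓡 n) 𝓘(ℝ, ℝ) ∞ f) (γ : SobolevLoop α n G) :
    Sc.deriv (fn f γ) = ∑ j, fn (fun g => rightD n f g (EuclideanSpace.single j 1)) γ •
      SobolevSpace.comp j (rightLog γ) := by
  have hJ : ∀ v, ContMDiff (𝓡 n) 𝓘(ℝ, ℝ) ∞ fun g => rightD n f g v := fun v =>
    (ContinuousLinearMap.apply ℝ ℝ v).contMDiff.comp (contMDiff_rightD hf)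
  rw [deriv_of_ev₂ (hf.comp contMDiff_fst) γ 1 (c := fun _ => 0) (fun s => ev_fn hf γ s)
    (fun j s => ev_fn (hJ _) γ s)]
  · simp
  · intro j s
    simp [rightD, Sc.ev_zero]

theorem isRightLogDeriv_rightLog (γ : SobolevLoop α n G) : IsRightLogDeriv γ (rightLog γ) := by
  intro f hf k
  have hJ : ∀ v, ContMDiff (𝓡 n) 𝓘(ℝ, ℝ) ∞ fun g => rightD n f g v := fun v =>
    (ContinuousLinearMap.apply ℝ ℝ v).contMDiff.comp (contMDiff_rightD hf)
  have h := congrArg (fun T => Sc.c T k) (deriv_fn hf γ)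
  have h1 : (fun s => f (γ.toMap s)) = Sc.ev (fn f γ) := funext fun s => (ev_fn hf γ s).symm
  simp only [Sc.c_deriv, Sc.c_sum, Sc.c_smul', SobolevSpace.c_comp] at h
  rw [h1, Sc.realFourierCoeff_ev, h]
  refine Finset.sum_congr rfl fun j _ => ?_
  have h2 : (fun s => rightInvariantDeriv f (lieBasis n G j) (γ.toMap s)) =
      Sc.ev (fn (fun g => rightD n f g (EuclideanSpace.single j 1)) γ) := funext fun s => by
    rw [ev_fn (hJ _)]
    exact rightInvariantDeriv_eq hf _ _
  simp only [mulFourier, h2, Sc.realFourierCoeff_ev]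

/-- The cocycle identity for the right logarithmic derivative. -/
theorem comp_rightLog_mul (γ δ : SobolevLoop α n G) (i : Fin n) :
    SobolevSpace.comp i (rightLog (γ * δ)) = ∑ j, fn (adEntry i j) γ •
      SobolevSpace.comp j (rightLog δ) + SobolevSpace.comp i (rightLog γ) := by
  have hemb := fun l => contMDiff_emb n G l
  have hJ := fun j i => contMDiff_rightD_emb (n := n) (G := G) (EuclideanSpace.single j 1) i
  have hM := fun k j => (contMDiff_logM n G).clm_apply_coord (Pi.single k 1) j
  let J := fun l j => fn (fun g => rightD n (emb n G) g (EuclideanSpace.single j 1) l) (γ * δ)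
  -- Varying the second factor of x y by a right-invariant field amounts to varying x by a
  -- left-invariant one, which is the right-invariant one rotated by Ad_x; this is the source of
  -- Ad_γ in the cocycle.
  have hd : ∀ l, Sc.deriv (embL (γ * δ) l) = ∑ j, J l j • SobolevSpace.comp j (rightLog γ) +
      ∑ j, (∑ m, J l m * fn (adEntry m j) γ) • SobolevSpace.comp j (rightLog δ) := by
    intro l
    have hproj : ∀ g v, rightD n (fun x => emb n G x l) g v = rightD n (emb n G) g v l := by
      intro g v
      have h := rightD_comp (Φ := fun v : Fin (embDim n G) → ℝ => v l)
        (isRetractEmbedding_emb n G).contMDiff g (ContinuousLinearMap.proj (R := ℝ)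
          (φ := fun _ : Fin (embDim n G) => ℝ) l).differentiableAt
      rw [h, ContinuousLinearMap.comp_apply]
      exact DFunLike.congr_fun (ContinuousLinearMap.proj (R := ℝ)
        (φ := fun _ : Fin (embDim n G) => ℝ) l).fderiv _
    refine deriv_of_ev₂ (f := fun p => emb n G (p.1 * p.2) l) ((hemb l).comp
      (contMDiff_mul (𝓡 n) ∞)) γ δ ?_ ?_ ?_
    · intro s
      exact (congrFun (evFam_embL (γ * δ) s) l).trans (by rw [mul_toMap])
    · intro j s
      rw [ev_fn (hJ _ _), ← hproj, mul_toMap]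
      simp only [rightD, mul_assoc]
    · intro j s
      have h1 : rightD n (fun y => emb n G (γ.toMap s * y) l) (δ.toMap s) =
          leftD n (fun x => emb n G (x * δ.toMap s) l) (γ.toMap s) := by
        simp only [rightD, leftD, mul_assoc]
      have h2 := leftD_eq (f := fun x => emb n G (x * δ.toMap s) l) ((hemb l).comp
        (contMDiff_mul_right (I := 𝓡 n) (a := δ.toMap s))) (γ.toMap s)
      have h3 : rightD n (fun x => emb n G (x * δ.toMap s) l) (γ.toMap s) =
          rightD n (fun x => emb n G x l) (γ.toMap s * δ.toMap s) := by
        simp only [rightD, mul_assoc]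
      rw [h1, h2, h3, ContinuousLinearMap.comp_apply, hproj]
      conv_rhs => rw [EuclideanSpace.eq_sum_single (adjointMap n (γ.toMap s) _)]
      simp only [Sc.ev_sum, Sc.ev_mul, J, ev_fn (hJ _ _), ev_fn (contMDiff_adEntry _ _),
        map_sum, map_smul, Finset.sum_apply, Pi.smul_apply, smul_eq_mul, mul_toMap]
      exact Finset.sum_congr rfl fun m _ => mul_comm _ _
  -- The left inverse M evaluated along the product loop cancels the differential J, leaving the
  -- bare logarithmic derivatives.
  have hMJ : ∀ j, ∑ l, fn (fun g => logM n G g (Pi.single l 1) i) (γ * δ) * J l j =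
      if i = j then 1 else 0 := by
    intro j
    refine Sc.ext_ev fun s => ?_
    have h := congrArg (fun v => v i) (logM_rightD ((γ * δ).toMap s) (EuclideanSpace.single j 1))
    simp only at h
    rw [pi_eq_sum_single (rightD n (emb n G) _ _)] at h
    simp only [map_sum, map_smul, PiLp.smul_apply, WithLp.ofLp_sum, Finset.sum_apply,
      smul_eq_mul] at h
    simp only [Sc.ev_sum, Sc.ev_mul, J, ev_fn (hJ _ _), ev_fn (hM _ _)]
    refine (Finset.sum_congr rfl fun l _ => mul_comm _ _).trans (h.trans ?_)
    by_cases hij : i = j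
    · simp [hij, Sc.ev_one]
    · simp [hij, Sc.ev_zero]
  rw [comp_rightLog]
  simp only [hd, smul_add, Finset.smul_sum, Finset.sum_add_distrib, smul_smul, Finset.sum_smul]
  rw [add_comm]
  congr 1
  · rw [Finset.sum_comm]
    refine Finset.sum_congr rfl fun j _ => ?_
    rw [Finset.sum_comm]
    have : fn (adEntry i j) γ = ∑ m, (if i = m then (1 : Sc α) else 0) * fn (adEntry m j) γ := by
      simp
    rw [this, Finset.sum_smul]
    refine Finset.sum_congr rfl fun m _ => ?_
    rw [← hMJ, Finset.sum_mul, Finset.sum_smul]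
    simp only [mul_assoc]
  · rw [Finset.sum_comm]
    simp only [← Finset.sum_smul, hMJ]
    simp [ite_smul]

end SobolevLoop

end GaugeAction

/-! ### Matrices of functions acting on vectors of functions and distributions -/

section MatrixAction

variable {α : ℝ} [hF : Fact (1 / 2 < α)] {n : ℕ}

theorem Sc.contMDiff_smul {EM HM M : Type*} [NormedAddCommGroup EM] [NormedSpace ℝ EM]
    [TopologicalSpace HM] {I : ModelWithCorners ℝ EM HM} [TopologicalSpace M] [ChartedSpace HM M]
    {f : M → Sc α} {g : M → Sc (α - 1)} (hf : ContMDiff I 𝓘(ℝ, Sc α) ∞ f)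
    (hg : ContMDiff I 𝓘(ℝ, Sc (α - 1)) ∞ g) :
    ContMDiff I 𝓘(ℝ, Sc (α - 1)) ∞ fun x => f x • g x := by
  simp only [Sc.smul_def]
  exact ((Sc.mulL _ _).contMDiff.comp hf).clm_apply hg

/-- The product of a matrix of functions and a vector of distributions. -/
def matAct (T : Fin n → Fin n → Sc α) :
    SobolevSpace (α - 1) n →L[ℝ] SobolevSpace (α - 1) n :=
  (SobolevSpace.coords (α - 1) n).symm.toContinuousLinearMap.comp
    (ContinuousLinearMap.pi fun i => ∑ j,
      (Sc.mulL hF.out (Sc.abs_sub_one_le hF.out) (T i j)).comp (SobolevSpace.comp j))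

theorem comp_matAct (T : Fin n → Fin n → Sc α) (A : SobolevSpace (α - 1) n) (i : Fin n) :
    SobolevSpace.comp i (matAct T A) = ∑ j, T i j • SobolevSpace.comp j A := by
  refine (SobolevSpace.comp_coords_symm _ _).trans ?_
  simp [Sc.smul_def]

theorem matAct_matAct (T T' : Fin n → Fin n → Sc α) (A : SobolevSpace (α - 1) n) :
    matAct T (matAct T' A) = matAct (fun i j => ∑ k, T i k * T' k j) A := by
  refine SobolevSpace.ext_comp fun i => ?_
  simp only [comp_matAct, Finset.smul_sum, Finset.sum_smul, smul_smul]
  exact Finset.sum_comm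

theorem matAct_one (A : SobolevSpace (α - 1) n) :
    matAct (fun i j => if i = j then (1 : Sc α) else 0) A = A := by
  refine SobolevSpace.ext_comp fun i => ?_
  simp [comp_matAct, ite_smul]

end MatrixAction

/-! ### The gauge action and its smoothness -/

section GaugeAction

variable {n : ℕ} {G : Type*} [TopologicalSpace G] [ChartedSpace (EuclideanSpace ℝ (Fin n)) G]
  [Group G] [LieGroup (𝓡 n) ∞ G] [CompactSpace G] [T2Space G] {α : ℝ} [hF : Fact (1 / 2 < α)]

namespace SobolevLoop

/-- The matrix of the adjoint action of a loop. -/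
def adMat (γ : SobolevLoop α n G) (i j : Fin n) : Sc α := fn (adEntry i j) γ

theorem ev_adMat (γ : SobolevLoop α n G) (i j : Fin n) (s : UnitAddCircle) :
    Sc.ev (adMat γ i j) s = adjointMap n (γ.toMap s) (EuclideanSpace.single j 1) i :=
  ev_fn (contMDiff_adEntry i j) γ s

theorem adMat_one : adMat (1 : SobolevLoop α n G) = fun i j => if i = j then 1 else 0 := by
  funext i j
  refine Sc.ext_ev fun s => ?_
  rw [ev_adMat, one_toMap, adjointMap_one]
  by_cases h : i = j
  · simp [h, Sc.ev_one]
  · simp [h, Sc.ev_zero]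

theorem adMat_mul (γ δ : SobolevLoop α n G) :
    adMat (γ * δ) = fun i j => ∑ k, adMat γ i k * adMat δ k j := by
  funext i j
  refine Sc.ext_ev fun s => ?_
  rw [ev_adMat, mul_toMap, adjointMap_mul, ContinuousLinearMap.comp_apply,
    adjointMap_apply_eq_sum]
  simp only [Sc.ev_sum, Sc.ev_mul, ev_adMat]
  rfl

theorem rightLog_mul (γ δ : SobolevLoop α n G) :
    rightLog (γ * δ) = matAct (adMat γ) (rightLog δ) + rightLog γ :=
  SobolevSpace.ext_comp fun i => by
    rw [comp_rightLog_mul, map_add, comp_matAct]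
    rfl

/-- The cocycle identity at (1, 1) reads R = R + R. -/
theorem rightLog_one : rightLog (1 : SobolevLoop α n G) = 0 := by
  have h := rightLog_mul (1 : SobolevLoop α n G) 1
  rw [adMat_one, matAct_one, mul_one] at h
  exact left_eq_add.1 h

/-- The gauge action `γ · A = Ad_γ A + (dγ)γ⁻¹`. -/
instance : MulAction (SobolevLoop α n G) (SobolevSpace (α - 1) n) where
  smul γ A := matAct (adMat γ) A + rightLog γ
  one_smul A := by
    change matAct (adMat 1) A + rightLog 1 = A
    rw [adMat_one, matAct_one, rightLog_one, add_zero]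
  mul_smul γ δ A := by
    change matAct (adMat (γ * δ)) A + rightLog (γ * δ) =
      matAct (adMat γ) (matAct (adMat δ) A + rightLog δ) + rightLog γ
    rw [rightLog_mul, map_add, matAct_matAct, adMat_mul, add_assoc]

theorem gauge_smul_def (γ : SobolevLoop α n G) (A : SobolevSpace (α - 1) n) :
    γ • A = matAct (adMat γ) A + rightLog γ := rfl

theorem isGaugeTransform_smul (γ : SobolevLoop α n G) (A : SobolevSpace (α - 1) n) :
    IsGaugeTransform γ A (γ • A) := by
  refine ⟨rightLog γ, isRightLogDeriv_rightLog γ, fun k => ?_⟩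
  ext i
  rw [PiLp.add_apply, ← SobolevSpace.c_comp, ← SobolevSpace.c_comp, gauge_smul_def, map_add,
    Sc.c_add, comp_matAct, Sc.c_sum]
  congr 1
  refine Finset.sum_congr rfl fun j _ => ?_
  have h : (fun s => adjointMap n (γ.toMap s) (EuclideanSpace.single j 1) i) =
      Sc.ev (adMat γ i j) := funext fun s => (ev_adMat γ i j s).symm
  simp only [Sc.c_smul', mulFourier, h, Sc.realFourierCoeff_ev, SobolevSpace.c_comp]

theorem contMDiff_adMat (i j : Fin n) : ContMDiff 𝓘(ℝ, SobolevSpace α n) 𝓘(ℝ, Sc α) ∞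
    fun γ : SobolevLoop α n G => adMat γ i j :=
  contMDiff_fn (contMDiff_adEntry i j)

theorem contMDiff_rightLog : ContMDiff 𝓘(ℝ, SobolevSpace α n) 𝓘(ℝ, SobolevSpace (α - 1) n) ∞
    (rightLog : SobolevLoop α n G → SobolevSpace (α - 1) n) := by
  refine (SobolevSpace.coords (α - 1) n).symm.toContinuousLinearMap.contMDiff.comp (contMDiff_pi_space.2 fun j =>
    contMDiff_finsetSum fun i _ => Sc.contMDiff_smul
      (contMDiff_fn ((contMDiff_logM n G).clm_apply_coord _ j)) ?_)
  exact Sc.deriv.contMDiff.comp (contMDiff_pi_space.1 contMDiff_embL i)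

theorem contMDiff_gauge_smul : ContMDiff (𝓘(ℝ, SobolevSpace α n).prod 𝓘(ℝ, SobolevSpace (α - 1) n))
    𝓘(ℝ, SobolevSpace (α - 1) n) ∞
    fun p : SobolevLoop α n G × SobolevSpace (α - 1) n => p.1 • p.2 := by
  have e : (fun p : SobolevLoop α n G × SobolevSpace (α - 1) n => p.1 • p.2) = fun p =>
      (SobolevSpace.coords (α - 1) n).symm.toContinuousLinearMap
        (fun i => ∑ j, adMat p.1 i j • SobolevSpace.comp j p.2) + rightLog p.1 := by
    funext p
    rw [gauge_smul_def]
    congr 1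
    refine SobolevSpace.ext_comp fun i => ?_
    rw [comp_matAct]
    exact (SobolevSpace.comp_coords_symm (fun i => ∑ j, adMat p.1 i j • SobolevSpace.comp j p.2)
      i).symm
  rw [e]
  refine ContMDiff.add ((SobolevSpace.coords (α - 1) n).symm.toContinuousLinearMap.contMDiff.comp
    (contMDiff_pi_space.2 fun i => contMDiff_finsetSum fun j _ => Sc.contMDiff_smul
      ((contMDiff_adMat i j).comp contMDiff_fst) ?_)) (contMDiff_rightLog.comp contMDiff_fst)
  exact (SobolevSpace.comp j).contMDiff.comp contMDiff_snd

end SobolevLoop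

end GaugeAction

/-! ### Pointwise operations on vector valued functions and distributions -/

section PointwiseOperations

variable {α : ℝ} [hF : Fact (1 / 2 < α)] {n : ℕ}

theorem Sc.int_smul_smul (r : ℝ) (f : Sc α) (T : Sc (α - 1)) :
    Sc.int ((r • f) • T) = r * Sc.int (f • T) := by
  rw [smul_assoc, ContinuousLinearMap.map_smul, smul_eq_mul]

theorem Sc.int_smul_smul' (r : ℝ) (f : Sc α) (T : Sc (α - 1)) :
    Sc.int (f • r • T) = r * Sc.int (f • T) := by
  rw [← smul_comm r f T, ContinuousLinearMap.map_smul, smul_eq_mul]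

/-- The product of a matrix of functions and a vector of functions. -/
def matVec : (Fin n → Fin n → Sc α) →L[ℝ] SobolevSpace α n →L[ℝ] SobolevSpace α n :=
  ∑ i, ∑ j, (ContinuousLinearMap.compL ℝ (SobolevSpace α n) (Sc α) (SobolevSpace α n)
    ((SobolevSpace.coords α n).symm.toContinuousLinearMap.comp
      (ContinuousLinearMap.single ℝ (fun _ : Fin n => Sc α) i))).comp
    ((Sc.mulL hF.out (abs_of_pos (one_half_pos.trans hF.out)).le).bilinearComp
      ((ContinuousLinearMap.proj (R := ℝ) (φ := fun _ : Fin n => Sc α) j).comp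
        (ContinuousLinearMap.proj (R := ℝ) (φ := fun _ : Fin n => Fin n → Sc α) i))
      (SobolevSpace.comp j))

theorem comp_matVec (T : Fin n → Fin n → Sc α) (v : SobolevSpace α n) (i : Fin n) :
    SobolevSpace.comp i (matVec T v) = ∑ j, T i j * SobolevSpace.comp j v := by
  simp only [matVec, _root_.sum_apply, map_sum]
  simp only [ContinuousLinearMap.comp_apply, ContinuousLinearMap.compL_apply,
    ContinuousLinearMap.bilinearComp_apply, ContinuousLinearEquiv.coe_coe,
    SobolevSpace.comp_coords_symm, ContinuousLinearMap.single_apply]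
  rw [Finset.sum_comm]
  refine Finset.sum_congr rfl fun j _ => ?_
  rw [Finset.sum_eq_single i]
  · rw [Pi.single_eq_same, Sc.mul_def]
    rfl
  · intro b _ hb
    exact Pi.single_eq_of_ne hb.symm _
  · simp

theorem eval_matVec {T : Fin n → Fin n → Sc α} {L : UnitAddCircle → EuclideanSpace ℝ (Fin n) →L[ℝ] EuclideanSpace ℝ (Fin n)}
    (h : ∀ i j s, Sc.ev (T i j) s = L s (EuclideanSpace.single j 1) i) (v : SobolevSpace α n)
    (s : UnitAddCircle) : (matVec T v).eval s = L s (v.eval s) := by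
  ext i
  rw [SobolevSpace.eval_apply, comp_matVec]
  conv_rhs => rw [EuclideanSpace.eq_sum_single (v.eval s)]
  simp only [Sc.ev_sum, Sc.ev_mul, h, map_sum, map_smul, WithLp.ofLp_sum, Finset.sum_apply,
    PiLp.smul_apply, smul_eq_mul, SobolevSpace.eval_apply]
  exact Finset.sum_congr rfl fun j _ => mul_comm _ _

/-- The derivative of a vector valued function on the circle. -/
def SobolevSpace.deriv : SobolevSpace α n →L[ℝ] SobolevSpace (α - 1) n :=
  (SobolevSpace.coords (α - 1) n).symm.toContinuousLinearMap.comp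
    (ContinuousLinearMap.pi fun i => Sc.deriv.comp (SobolevSpace.comp i))

theorem SobolevSpace.comp_deriv (v : SobolevSpace α n) (i : Fin n) :
    SobolevSpace.comp i (SobolevSpace.deriv v) = Sc.deriv (SobolevSpace.comp i v) :=
  SobolevSpace.comp_coords_symm _ _

theorem comp_deriv_matVec (T : Fin n → Fin n → Sc α) (v : SobolevSpace α n) (i : Fin n) :
    SobolevSpace.comp i (SobolevSpace.deriv (matVec T v)) =
      SobolevSpace.comp i (matAct T (SobolevSpace.deriv v)) +
        ∑ j, SobolevSpace.comp j v • Sc.deriv (T i j) := by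
  simp only [SobolevSpace.comp_deriv, comp_matVec, comp_matAct, map_sum, Sc.deriv_mul,
    Finset.sum_add_distrib]

/-! ### The pairing -/

section Pairing

variable (B : EuclideanSpace ℝ (Fin n) →L[ℝ] EuclideanSpace ℝ (Fin n) →L[ℝ] ℝ)

/-- The integral of the pairing of a distribution with a function. -/
def pair : SobolevSpace (α - 1) n →L[ℝ] SobolevSpace α n →L[ℝ] ℝ :=
  ∑ i, ∑ j, B (EuclideanSpace.single i 1) (EuclideanSpace.single j 1) •
    (ContinuousLinearMap.compL ℝ (SobolevSpace α n) (Sc (α - 1)) ℝ Sc.int).comp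
      ((Sc.mulL hF.out (Sc.abs_sub_one_le hF.out)).flip.bilinearComp
        (SobolevSpace.comp i) (SobolevSpace.comp j))

theorem pair_eq (A : SobolevSpace (α - 1) n) (v : SobolevSpace α n) :
    pair B A v = ∑ i, ∑ j, B (EuclideanSpace.single i 1) (EuclideanSpace.single j 1) *
      Sc.int (SobolevSpace.comp j v • SobolevSpace.comp i A) := by
  simp only [pair, _root_.sum_apply, _root_.smul_apply]
  rfl

/-- The components of the functional `B(·, v)`. -/
def flat (v : SobolevSpace α n) (i : Fin n) : Sc α :=
  ∑ j, B (EuclideanSpace.single i 1) (EuclideanSpace.single j 1) • SobolevSpace.comp j v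

theorem ev_flat (v : SobolevSpace α n) (i : Fin n) (s : UnitAddCircle) :
    Sc.ev (flat B v i) s = B (EuclideanSpace.single i 1) (v.eval s) := by
  conv_rhs => rw [EuclideanSpace.eq_sum_single (v.eval s)]
  simp only [flat, Sc.ev_sum, Sc.ev_smul, map_sum, map_smul, SobolevSpace.eval_apply, smul_eq_mul]
  exact Finset.sum_congr rfl fun j _ => mul_comm _ _

theorem pair_eq_flat (A : SobolevSpace (α - 1) n) (v : SobolevSpace α n) :
    pair B A v = Sc.int (∑ i, flat B v i • SobolevSpace.comp i A) := by
  simp only [pair_eq, flat, Finset.sum_smul, map_sum, smul_assoc, map_smul, smul_eq_mul]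

/-- Adjointness at each point of the circle passes to the integrated pairing. Since A is a
distribution, only the function side is compared pointwise: B(·, T'v) has the components of the
transpose of T applied to B(·, v). -/
theorem pair_matAct {T T' : Fin n → Fin n → Sc α} {L L' : UnitAddCircle → EuclideanSpace ℝ (Fin n) →L[ℝ] EuclideanSpace ℝ (Fin n)}
    (h : ∀ i j s, Sc.ev (T i j) s = L s (EuclideanSpace.single j 1) i)
    (h' : ∀ i j s, Sc.ev (T' i j) s = L' s (EuclideanSpace.single j 1) i)
    (hB : ∀ s x y, B (L s x) y = B x (L' s y))
    (A : SobolevSpace (α - 1) n) (v : SobolevSpace α n) :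
    pair B (matAct T A) v = pair B A (matVec T' v) := by
  have hc : ∀ k, flat B (matVec T' v) k = ∑ i, flat B v i * T i k := by
    intro k
    refine Sc.ext_ev fun s => ?_
    rw [ev_flat, eval_matVec h', ← hB]
    conv_lhs => rw [EuclideanSpace.eq_sum_single (L s (EuclideanSpace.single k 1))]
    simp only [map_sum, map_smul, _root_.sum_apply, _root_.smul_apply, Sc.ev_sum,
      Sc.ev_mul, ev_flat, h, smul_eq_mul]
    exact Finset.sum_congr rfl fun j _ => mul_comm _ _
  rw [pair_eq_flat, pair_eq_flat]
  refine congrArg Sc.int ?_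
  simp only [hc, comp_matAct, Finset.smul_sum, Finset.sum_smul, smul_smul]
  exact Finset.sum_comm

variable {B}

/-- Integration by parts: the derivative of a product has vanishing mean. -/
theorem pair_deriv_swap (hB : ∀ u v, B u v = B v u) (a b : SobolevSpace α n) :
    pair B (SobolevSpace.deriv a) b = -pair B (SobolevSpace.deriv b) a := by
  rw [pair_eq, pair_eq, Finset.sum_comm, ← Finset.sum_neg_distrib]
  refine Finset.sum_congr rfl fun i _ => ?_
  rw [← Finset.sum_neg_distrib]
  refine Finset.sum_congr rfl fun j _ => ?_
  have h := Sc.int_deriv (SobolevSpace.comp i b * SobolevSpace.comp j a)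
  rw [Sc.deriv_mul, map_add] at h
  rw [hB, ← mul_neg, SobolevSpace.comp_deriv, SobolevSpace.comp_deriv, eq_neg_of_add_eq_zero_left h]

/-- The multiple of a constant vector by a function or distribution. -/
def constVec {σ : ℝ} (x : EuclideanSpace ℝ (Fin n)) (f : Sc σ) : SobolevSpace σ n :=
  (SobolevSpace.coords σ n).symm fun i => x i • f

theorem comp_constVec {σ : ℝ} (x : EuclideanSpace ℝ (Fin n)) (f : Sc σ) (i : Fin n) :
    SobolevSpace.comp i (constVec x f) = x i • f :=
  SobolevSpace.comp_coords_symm _ _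

theorem pair_constVec_right (A : SobolevSpace (α - 1) n) (x : EuclideanSpace ℝ (Fin n)) (f : Sc α) :
    pair B A (constVec x f) =
      ∑ i, B (EuclideanSpace.single i 1) x * Sc.int (f • SobolevSpace.comp i A) := by
  rw [pair_eq]
  refine Finset.sum_congr rfl fun i _ => ?_
  conv_rhs => rw [EuclideanSpace.eq_sum_single x]
  rw [map_sum, Finset.sum_mul]
  refine Finset.sum_congr rfl fun j _ => ?_
  rw [comp_constVec, Sc.int_smul_smul, ContinuousLinearMap.map_smul, smul_eq_mul]
  ring

theorem pair_constVec_left (T : Sc (α - 1)) (x : EuclideanSpace ℝ (Fin n)) (v : SobolevSpace α n) :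
    pair B (constVec x T) v =
      ∑ j, B x (EuclideanSpace.single j 1) * Sc.int (SobolevSpace.comp j v • T) := by
  rw [pair_eq, Finset.sum_comm]
  refine Finset.sum_congr rfl fun j _ => ?_
  conv_rhs => rw [EuclideanSpace.eq_sum_single x]
  rw [map_sum, _root_.sum_apply, Finset.sum_mul]
  refine Finset.sum_congr rfl fun i _ => ?_
  rw [comp_constVec, Sc.int_smul_smul', ContinuousLinearMap.map_smul, _root_.smul_apply,
    smul_eq_mul]
  ring

end Pairing

theorem Sc.int_smul_eq_tsum (f : Sc α) (T : Sc (α - 1)) :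
    ((Sc.int (f • T) : ℝ) : ℂ) = ∑' k : ℤ, f.c k * T.c (-k) := by
  rw [← Sc.c_zero_eq_int, Sc.c_smul', ← (Equiv.neg ℤ).tsum_eq]
  simp

theorem Sc.summable_int_smul (f : Sc α) (T : Sc (α - 1)) :
    Summable fun k : ℤ => f.c k * T.c (-k) := by
  have h := Sc.summable_conv hF.out (Sc.abs_sub_one_le hF.out) f T 0
  rw [← (Equiv.neg ℤ).summable_iff] at h
  simpa [Function.comp_def] using h

/-- By the reality condition the sum equals ∑ w(k)|T̂(k)|², and a vanishing sum of nonnegative terms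
has vanishing terms. -/
theorem Sc.eq_zero_of_tsum {σ τ : ℝ} {f : Sc σ} {T : Sc τ} {w : ℤ → ℝ} (hw : ∀ k, 0 < w k)
    (hf : ∀ k, f.c k = w k * T.c k) (hs : Summable fun k : ℤ => f.c k * T.c (-k))
    (h : ∑' k : ℤ, f.c k * T.c (-k) = 0) : T = 0 := by
  have e : ∀ k, f.c k * T.c (-k) = ((w k * ‖T.c k‖ ^ 2 : ℝ) : ℂ) := fun k => by
    rw [hf, Sc.c_conj, mul_assoc, Complex.mul_conj, Complex.normSq_eq_norm_sq]
    push_cast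
    rfl
  simp only [e] at h hs
  rw [← Complex.ofReal_tsum, Complex.ofReal_eq_zero] at h
  have hs' : Summable fun k : ℤ => w k * ‖T.c k‖ ^ 2 := Complex.summable_ofReal.1 hs
  have h0 := (hasSum_zero_iff_of_nonneg fun k => mul_nonneg (hw k).le (sq_nonneg _)).1
    (h ▸ hs'.hasSum)
  refine Sc.ext_c fun k => ?_
  have h1 := congrFun h0 k
  simp only [Pi.zero_apply, mul_eq_zero, (hw k).ne', false_or] at h1
  rw [Sc.c_zero]
  exact norm_eq_zero.1 (pow_eq_zero_iff two_ne_zero |>.1 h1)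

/-- Test f against itself, viewed in the larger space H^{α-1}. -/
theorem Sc.eq_zero_of_forall_int_smul_left {f : Sc α}
    (h : ∀ T : Sc (α - 1), Sc.int (f • T) = 0) : f = 0 := by
  have h1 := Sc.int_smul_eq_tsum f (Sc.incl (sub_one_lt α).le f)
  rw [h, Complex.ofReal_zero] at h1
  have hs := Sc.summable_int_smul f (Sc.incl (sub_one_lt α).le f)
  simp only [Sc.c_incl] at h1 hs
  exact Sc.eq_zero_of_tsum (w := fun _ => 1) (fun _ => one_pos) (by simp) hs h1.symm

/-- Test T against its smoothing with coefficients T̂(k)/(1 + k²); gaining two derivatives is more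
than enough to land in H^α. -/
theorem Sc.eq_zero_of_forall_int_smul_right {T : Sc (α - 1)}
    (h : ∀ f : Sc α, Sc.int (f • T) = 0) : T = 0 := by
  have hw : ∀ k : ℤ, sobolevWeight α k * sobolevWeight (-2) k ≤ sobolevWeight (α - 1) k := by
    intro k
    rw [sobolevWeight, sobolevWeight, sobolevWeight, ← Real.rpow_add (one_add_sq_int_pos k)]
    exact Real.rpow_le_rpow_of_exponent_le (by nlinarith [sq_nonneg (k : ℝ)]) (by linarith)
  let f : Sc α := Sc.ofC (fun k => sobolevWeight (-2) k * T.c k)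
    (fun k => by rw [Sc.c_conj, map_mul, Complex.conj_ofReal]; simp [sobolevWeight]) (by
      refine ne_top_of_le_ne_top T.sobolevENorm_ne_top (ENNReal.tsum_le_tsum fun k => ?_)
      rw [Sc.ofReal_mul_enorm, Sc.ofReal_mul_enorm, norm_mul, Complex.norm_real, Real.norm_of_nonneg
        (sobolevWeight_pos _ _).le, ← mul_assoc]
      have h1 := sobolevWeight_pos α k
      have h2 := sobolevWeight_pos (-2) k
      gcongr
      exact hw k)
  have h1 := Sc.int_smul_eq_tsum f T
  rw [h, Complex.ofReal_zero] at h1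
  exact Sc.eq_zero_of_tsum (fun k => sobolevWeight_pos (-2) k) (fun k => Sc.c_ofC _ _ _ k)
    (Sc.summable_int_smul f T) h1.symm

section Nondegenerate

variable {B : EuclideanSpace ℝ (Fin n) →L[ℝ] EuclideanSpace ℝ (Fin n) →L[ℝ] ℝ}

/-- The hypothesis expresses nondegeneracy: every coordinate functional is B(x, ·). Multiples of the
constant vector x by scalar distributions isolate one component. -/
theorem eq_zero_of_forall_pair_left (hB : ∀ i, ∃ x, ∀ y, B x y = y i) {v : SobolevSpace α n}
    (h : ∀ A : SobolevSpace (α - 1) n, pair B A v = 0) : v = 0 := by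
  refine SobolevSpace.ext_comp fun i => ?_
  obtain ⟨x, hx⟩ := hB i
  rw [map_zero]
  refine Sc.eq_zero_of_forall_int_smul_left fun T => ?_
  have := h (constVec x T)
  rw [pair_constVec_left] at this
  simpa [hx, Pi.single_apply] using this

theorem eq_zero_of_forall_pair_right (hB : ∀ i, ∃ x, ∀ y, B y x = y i)
    {A : SobolevSpace (α - 1) n} (h : ∀ v : SobolevSpace α n, pair B A v = 0) : A = 0 := by
  refine SobolevSpace.ext_comp fun i => ?_
  obtain ⟨x, hx⟩ := hB i
  rw [map_zero]
  refine Sc.eq_zero_of_forall_int_smul_right fun f => ?_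
  have := h (constVec x f)
  rw [pair_constVec_right] at this
  simpa [hx, Pi.single_apply] using this

end Nondegenerate

end PointwiseOperations

/-! ### The Lie algebra of loops -/

section LoopAlgebra

variable {n : ℕ} {G : Type*} [TopologicalSpace G] [ChartedSpace (EuclideanSpace ℝ (Fin n)) G]
  [Group G] [LieGroup (𝓡 n) ∞ G] {α : ℝ} [hF : Fact (1 / 2 < α)]

variable (G) in
/-- The matrix of `ad_v` for a loop `v` in the Lie algebra. -/
def adLie : SobolevSpace α n →L[ℝ] Fin n → Fin n → Sc α :=
  ContinuousLinearMap.pi fun i => ContinuousLinearMap.pi fun j =>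
    ∑ k, (bracketCLM n G (EuclideanSpace.single k 1) (EuclideanSpace.single j 1) i) •
      SobolevSpace.comp k

theorem adLie_apply (v : SobolevSpace α n) (i j : Fin n) : adLie G v i j =
    ∑ k, (bracketCLM n G (EuclideanSpace.single k 1) (EuclideanSpace.single j 1) i) •
      SobolevSpace.comp k v := by
  simp [adLie]

theorem ev_adLie (v : SobolevSpace α n) (i j : Fin n) (s : UnitAddCircle) :
    Sc.ev (adLie G v i j) s = bracketCLM n G (v.eval s) (EuclideanSpace.single j 1) i := by
  conv_rhs => rw [EuclideanSpace.eq_sum_single (v.eval s)]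
  simp only [adLie_apply, Sc.ev_sum, Sc.ev_smul, map_sum, map_smul, SobolevSpace.eval_apply,
    _root_.sum_apply, _root_.smul_apply, WithLp.ofLp_sum, Finset.sum_apply, PiLp.smul_apply,
    smul_eq_mul]
  exact Finset.sum_congr rfl fun j _ => mul_comm _ _

variable (G) in
/-- The pointwise Lie bracket. -/
def bracketLoop : SobolevSpace α n →L[ℝ] SobolevSpace α n →L[ℝ] SobolevSpace α n :=
  matVec.comp (adLie G)

theorem bracketLoop_apply (v w : SobolevSpace α n) :
    bracketLoop G v w = matVec (adLie G v) w := rfl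

theorem eval_bracketLoop (v w : SobolevSpace α n) (s : UnitAddCircle) :
    (bracketLoop G v w).eval s = bracketCLM n G (v.eval s) (w.eval s) :=
  eval_matVec (ev_adLie v) w s

theorem SobolevSpace.eval_add (v w : SobolevSpace α n) (s : UnitAddCircle) :
    (v + w).eval s = v.eval s + w.eval s := by
  ext i
  simp [SobolevSpace.eval_apply, Sc.ev_add]

theorem SobolevSpace.eval_neg (v : SobolevSpace α n) (s : UnitAddCircle) :
    (-v).eval s = -v.eval s := by
  ext i
  simp [SobolevSpace.eval_apply, Sc.ev_neg]

theorem bracketLoop_swap (v w : SobolevSpace α n) : bracketLoop G v w = -bracketLoop G w v :=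
  SobolevSpace.ext_eval fun s => by
    rw [SobolevSpace.eval_neg, eval_bracketLoop, eval_bracketLoop, bracketCLM_swap]

theorem bracketLoop_jacobi (u v w : SobolevSpace α n) :
    bracketLoop G u (bracketLoop G v w) =
      bracketLoop G (bracketLoop G u v) w + bracketLoop G v (bracketLoop G u w) :=
  SobolevSpace.ext_eval fun s => by
    simp only [SobolevSpace.eval_add, eval_bracketLoop]
    exact bracketCLM_jacobi G _ _ _

/-- The Leibniz rule ∂[v, w] = [v, ∂w] + [∂v, w], with the second term rewritten by antisymmetry so
that a matrix of functions acts on a distribution. -/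
theorem deriv_bracketLoop (v w : SobolevSpace α n) : SobolevSpace.deriv (bracketLoop G v w) =
    matAct (adLie G v) (SobolevSpace.deriv w) - matAct (adLie G w) (SobolevSpace.deriv v) := by
  refine SobolevSpace.ext_comp fun i => ?_
  rw [bracketLoop_apply, comp_deriv_matVec, map_sub]
  refine Eq.trans ?_ (sub_eq_add_neg _ _).symm
  congr 1
  simp only [adLie_apply, map_sum, map_smul, comp_matAct, SobolevSpace.comp_deriv, Finset.smul_sum,
    Finset.sum_smul]
  rw [Finset.sum_comm, ← Finset.sum_neg_distrib]
  refine Finset.sum_congr rfl fun k _ => ?_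
  rw [← Finset.sum_neg_distrib]
  refine Finset.sum_congr rfl fun j _ => ?_
  rw [bracketCLM_swap G, PiLp.neg_apply, neg_smul, smul_neg, smul_assoc, ← smul_comm]

section Invariant

variable {B : EuclideanSpace ℝ (Fin n) →L[ℝ] EuclideanSpace ℝ (Fin n) →L[ℝ] ℝ}

/-- Infinitesimal invariance says that ad is pointwise skew for B; `pair_matAct` integrates this. -/
theorem pair_adLie (hB : ∀ u v w, B (bracketCLM n G u v) w = -B v (bracketCLM n G u w))
    (w : SobolevSpace α n) (A : SobolevSpace (α - 1) n) (v : SobolevSpace α n) :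
    pair B (matAct (adLie G w) A) v = -pair B A (bracketLoop G w v) := by
  rw [← ContinuousLinearMap.map_neg]
  have h := pair_matAct B (T := adLie G w) (T' := -adLie G w)
    (L := fun s => bracketCLM n G (w.eval s)) (L' := fun s => -bracketCLM n G (w.eval s))
    (ev_adLie w) (fun i j s => by
      rw [Pi.neg_apply, Pi.neg_apply, Sc.ev_neg, ev_adLie]
      rfl) (fun s x y => by
      rw [hB, _root_.neg_apply, map_neg]) A v
  rw [h, map_neg]
  rfl

end Invariant

variable [CompactSpace G] [T2Space G]

namespace SobolevLoop

theorem eval_adMat (γ : SobolevLoop α n G) (v : SobolevSpace α n) (s : UnitAddCircle) :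
    (matVec (adMat γ) v).eval s = adjointMap n (γ.toMap s) (v.eval s) :=
  eval_matVec (L := fun s => adjointMap n (γ.toMap s)) (ev_adMat γ) v s

theorem bracketLoop_adMat (γ : SobolevLoop α n G) (v w : SobolevSpace α n) :
    bracketLoop G (matVec (adMat γ) v) (matVec (adMat γ) w) =
      matVec (adMat γ) (bracketLoop G v w) :=
  SobolevSpace.ext_eval fun s => by
    simp only [eval_bracketLoop, eval_adMat]
    exact bracketCLM_adjointMap _ _ _

theorem adMat_adMat_inv (γ : SobolevLoop α n G) (v : SobolevSpace α n) :
    matVec (adMat γ) (matVec (adMat γ⁻¹) v) = v :=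
  SobolevSpace.ext_eval fun s => by
    simp only [eval_adMat, inv_toMap]
    exact adjointMap_apply_adjointMap_inv _ _

/-- The matrix of Ad_γ has derivative ad_R ∘ Ad_γ with R = (dγ)γ⁻¹. The term [R, Ad_γ v] appears as
-ad_{Ad_γ v} R, since only functions may act on the distribution R. -/
theorem deriv_adMat (γ : SobolevLoop α n G) (v : SobolevSpace α n) :
    SobolevSpace.deriv (matVec (adMat γ) v) = matAct (adMat γ) (SobolevSpace.deriv v) -
      matAct (adLie G (matVec (adMat γ) v)) (rightLog γ) := by
  refine SobolevSpace.ext_comp fun i => ?_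
  rw [comp_deriv_matVec, map_sub]
  refine Eq.trans ?_ (sub_eq_add_neg _ _).symm
  congr 1
  have hJ : ∀ j v, ContMDiff (𝓡 n) 𝓘(ℝ, ℝ) ∞ fun g => rightD n (adEntry (G := G) i j) g v :=
    fun j v => (ContinuousLinearMap.apply ℝ ℝ v).contMDiff.comp
      (contMDiff_rightD (contMDiff_adEntry i j))
  have hd : ∀ j g w, rightD n (adEntry (G := G) i j) g w =
      bracketCLM n G w (adjointMap n g (EuclideanSpace.single j 1)) i := by
    intro j g w
    let Φ : (EuclideanSpace ℝ (Fin n) →L[ℝ] EuclideanSpace ℝ (Fin n)) →L[ℝ] ℝ :=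
      (EuclideanSpace.proj i).comp (ContinuousLinearMap.apply ℝ (EuclideanSpace ℝ (Fin n))
        (EuclideanSpace.single j 1))
    have h := rightD_comp (Φ := Φ) contMDiff_adjointMap g Φ.differentiableAt
    have h1 := DFunLike.congr_fun h w
    rw [ContinuousLinearMap.comp_apply, Φ.fderiv, rightD_adjointMap] at h1
    exact h1
  have hc : ∀ k, ∑ j, SobolevSpace.comp j v *
      fn (fun g => rightD n (adEntry (G := G) i j) g (EuclideanSpace.single k 1)) γ =
        -adLie G (matVec (adMat γ) v) i k := by
    intro k
    refine Sc.ext_ev fun s => ?_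
    rw [Sc.ev_neg, ev_adLie, eval_adMat, bracketCLM_swap G, PiLp.neg_apply, neg_neg]
    conv_rhs => rw [EuclideanSpace.eq_sum_single (v.eval s)]
    simp only [Sc.ev_sum, Sc.ev_mul, ev_fn (hJ _ _)]
    simp only [hd, map_sum, map_smul, WithLp.ofLp_sum,
      Finset.sum_apply, PiLp.smul_apply, smul_eq_mul, SobolevSpace.eval_apply]
  simp only [adMat, deriv_fn (contMDiff_adEntry _ _), Finset.smul_sum, comp_matAct, smul_smul]
  rw [Finset.sum_comm, ← Finset.sum_neg_distrib]
  refine Finset.sum_congr rfl fun k _ => ?_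
  rw [← Finset.sum_smul, hc, neg_smul]

theorem pair_adMat [PreconnectedSpace G]
    {B : EuclideanSpace ℝ (Fin n) →L[ℝ] EuclideanSpace ℝ (Fin n) →L[ℝ] ℝ}
    (hB : ∀ u v w, B (bracketCLM n G u v) w = -B v (bracketCLM n G u w)) (γ : SobolevLoop α n G)
    (A : SobolevSpace (α - 1) n) (v : SobolevSpace α n) :
    pair B (matAct (adMat γ) A) (matVec (adMat γ) v) = pair B A v := by
  have h := pair_matAct B (T := adMat γ) (T' := adMat γ⁻¹)
    (L := fun s => adjointMap n (γ.toMap s)) (L' := fun s => adjointMap n (γ.toMap s)⁻¹)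
    (ev_adMat γ) (ev_adMat γ⁻¹) (fun s x y => by
      rw [← apply_adjointMap_adjointMap B hB (γ.toMap s) x, adjointMap_apply_adjointMap_inv])
    A (matVec (adMat γ) v)
  rw [h]
  congr 1
  have := adMat_adMat_inv γ⁻¹ v
  rwa [inv_inv] at this

end SobolevLoop

/-! ### The symplectic form at a point -/

section Omega

variable (G) (B : EuclideanSpace ℝ (Fin n) →L[ℝ] EuclideanSpace ℝ (Fin n) →L[ℝ] ℝ)

/-- The bilinear form `(A₁, v₂) - (A₂, v₁) - (A, [v₁, v₂]) - (v₁, dv₂)`. -/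
def omegaBilin (A : SobolevSpace (α - 1) n) :
    (SobolevSpace α n × SobolevSpace (α - 1) n) →L[ℝ]
      (SobolevSpace α n × SobolevSpace (α - 1) n) →L[ℝ] ℝ :=
  (pair B).bilinearComp (ContinuousLinearMap.snd ℝ _ _) (ContinuousLinearMap.fst ℝ _ _) -
  ((pair B).bilinearComp (ContinuousLinearMap.snd ℝ _ _) (ContinuousLinearMap.fst ℝ _ _)).flip -
  ((ContinuousLinearMap.compL ℝ (SobolevSpace α n) (SobolevSpace α n) ℝ (pair B A)).comp
    (bracketLoop G)).bilinearComp (ContinuousLinearMap.fst ℝ _ _) (ContinuousLinearMap.fst ℝ _ _) -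
  ((pair B).comp SobolevSpace.deriv).flip.bilinearComp
    (ContinuousLinearMap.fst ℝ _ _) (ContinuousLinearMap.fst ℝ _ _)

theorem omegaBilin_apply (A : SobolevSpace (α - 1) n)
    (x y : SobolevSpace α n × SobolevSpace (α - 1) n) : omegaBilin G B A x y =
      pair B x.2 y.1 - pair B y.2 x.1 - pair B A (bracketLoop G x.1 y.1) -
        pair B (SobolevSpace.deriv y.1) x.1 := rfl

variable {G B}

theorem omegaBilin_swap (hB : ∀ u v, B u v = B v u) (A : SobolevSpace (α - 1) n)
    (x y : SobolevSpace α n × SobolevSpace (α - 1) n) :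
    omegaBilin G B A x y = -omegaBilin G B A y x := by
  rw [omegaBilin_apply, omegaBilin_apply, bracketLoop_swap y.1, map_neg,
    pair_deriv_swap hB y.1]
  ring

end Omega

end LoopAlgebra

/-! ### Tangent maps on the loop group -/

section TangentMaps

variable {α : ℝ} [hF : Fact (1 / 2 < α)] {n : ℕ}

/-- Evaluation at a point of the circle as a continuous linear map. -/
def SobolevSpace.evalL (s : UnitAddCircle) : SobolevSpace α n →L[ℝ] EuclideanSpace ℝ (Fin n) :=
  (EuclideanSpace.equiv (Fin n) ℝ).symm.toContinuousLinearMap.comp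
    (ContinuousLinearMap.pi fun i => (Sc.evL s).comp (SobolevSpace.comp i))

@[simp]
theorem SobolevSpace.evalL_apply (s : UnitAddCircle) (u : SobolevSpace α n) :
    SobolevSpace.evalL s u = u.eval s := by
  ext i
  rw [SobolevSpace.eval_apply]
  rfl

/-- The derivative of a map given pointwise near a point is given pointwise. -/
theorem apply_fderiv_of_eventually {X Y : Type*} [NormedAddCommGroup X] [NormedSpace ℝ X]
    [NormedAddCommGroup Y] [NormedSpace ℝ Y] {ψ : SobolevSpace α n → X} {u : SobolevSpace α n}
    (hψ : DifferentiableAt ℝ ψ u) {s : UnitAddCircle} (Λ : X →L[ℝ] Y)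
    {F : EuclideanSpace ℝ (Fin n) → Y} (hF : DifferentiableAt ℝ F (u.eval s))
    (he : ∀ᶠ y in 𝓝 u, Λ (ψ y) = F (y.eval s)) (h : SobolevSpace α n) :
    Λ (fderiv ℝ ψ u h) = fderiv ℝ F (u.eval s) (h.eval s) := by
  have h1 : HasFDerivAt (fun y => Λ (ψ y)) (Λ.comp (fderiv ℝ ψ u)) u :=
    Λ.hasFDerivAt.comp u hψ.hasFDerivAt
  have h2 : HasFDerivAt (fun y : SobolevSpace α n => F (y.eval s))
      ((fderiv ℝ F (u.eval s)).comp (SobolevSpace.evalL s)) u := by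
    have h3 := HasFDerivAt.comp u (g := F) (f := SobolevSpace.evalL s)
      (by rw [SobolevSpace.evalL_apply]; exact hF.hasFDerivAt)
      (SobolevSpace.evalL (α := α) (n := n) s).hasFDerivAt
    simpa only [Function.comp_def, SobolevSpace.evalL_apply] using h3
  have h4 := DFunLike.congr_fun (h1.unique (h2.congr_of_eventuallyEq he)) h
  rw [ContinuousLinearMap.comp_apply, ContinuousLinearMap.comp_apply,
    SobolevSpace.evalL_apply] at h4
  exact h4

variable {G : Type*} [TopologicalSpace G] [ChartedSpace (EuclideanSpace ℝ (Fin n)) G]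
  [Group G] [LieGroup (𝓡 n) ∞ G]

theorem contDiffAt_unitChart_mul_symm_mul (a b : G) {x : EuclideanSpace ℝ (Fin n)}
    (hx : x ∈ (unitChart n G).target)
    (h : a * (unitChart n G).symm x * b ∈ (unitChart n G).source) :
    ContDiffAt ℝ ∞ (fun y => unitChart n G (a * (unitChart n G).symm y * b)) x := by
  refine ContMDiffAt.contDiffAt (ContMDiffAt.comp (I' := 𝓡 n) (g := unitChart n G)
    (f := fun y => a * (unitChart n G).symm y * b) x (contMDiffAt_unitChart h) ?_)
  exact (contMDiffAt_const.mul (contMDiffAt_unitChart_symm hx)).mul contMDiffAt_const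

variable [CompactSpace G] [T2Space G]

namespace SobolevLoop

theorem isOpen_loopChart_target : IsOpen (loopChart α n G).target :=
  (loopChart α n G).open_target

theorem loopChart_symm_toMap {u : SobolevSpace α n} (hu : u ∈ (loopChart α n G).target)
    (s : UnitAddCircle) :
    ((loopChart α n G).symm u).toMap s = (unitChart n G).symm (u.eval s) :=
  ofCoords_toMap hu s

theorem eval_loopChart {γ : SobolevLoop α n G} (hγ : γ ∈ (loopChart α n G).source)
    (s : UnitAddCircle) : (loopChart α n G γ).eval s = unitChart n G (γ.toMap s) :=
  eval_toCoords hγ s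

variable (α n G) in
/-- The coordinates of the unit loop. -/
def unitLoopPt : SobolevSpace α n := loopChart α n G 1

theorem unitLoopPt_mem : unitLoopPt α n G ∈ (loopChart α n G).target :=
  (loopChart α n G).map_source one_mem_loopChart_source

theorem eval_unitLoopPt (s : UnitAddCircle) : (unitLoopPt α n G).eval s = unitPt n G := by
  rw [unitLoopPt, eval_loopChart one_mem_loopChart_source, one_toMap]

theorem loopChart_symm_unitLoopPt : (loopChart α n G).symm (unitLoopPt α n G) = 1 :=
  (loopChart α n G).left_inv one_mem_loopChart_source

theorem loopChartAt_self (γ : SobolevLoop α n G) : loopChartAt γ γ = unitLoopPt α n G := by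
  rw [loopChartAt_apply, inv_mul_cancel, unitLoopPt]

theorem contMDiffAt_loopChart_symm {u : SobolevSpace α n} (hu : u ∈ (loopChart α n G).target) :
    ContMDiffAt 𝓘(ℝ, SobolevSpace α n) 𝓘(ℝ, SobolevSpace α n) ∞ (loopChart α n G).symm u := by
  have h := contMDiffOn_chart_symm (I := 𝓘(ℝ, SobolevSpace α n)) (n := ∞)
    (x := (1 : SobolevLoop α n G))
  rw [chartAt_eq, loopChartAt_one] at h
  exact h.contMDiffAt (isOpen_loopChart_target.mem_nhds hu)

theorem contMDiffAt_loopChart {γ : SobolevLoop α n G} (hγ : γ ∈ (loopChart α n G).source) :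
    ContMDiffAt 𝓘(ℝ, SobolevSpace α n) 𝓘(ℝ, SobolevSpace α n) ∞ (loopChart α n G) γ := by
  have h := contMDiffOn_chart (I := 𝓘(ℝ, SobolevSpace α n)) (n := ∞)
    (x := (1 : SobolevLoop α n G))
  rw [chartAt_eq, loopChartAt_one] at h
  exact h.contMDiffAt ((loopChart α n G).open_source.mem_nhds hγ)

/-- Maps of the form `u ↦ e(γ · e⁻¹(u) · δ)` are differentiable, with pointwise derivative. -/
theorem contDiffAt_loopChart_mul_mul (γ δ : SobolevLoop α n G) {u : SobolevSpace α n}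
    (hu : u ∈ (loopChart α n G).target)
    (h : γ * (loopChart α n G).symm u * δ ∈ (loopChart α n G).source) :
    ContDiffAt ℝ ∞ (fun y => loopChart α n G (γ * (loopChart α n G).symm y * δ)) u := by
  refine ContMDiffAt.contDiffAt (ContMDiffAt.comp (I' := 𝓘(ℝ, SobolevSpace α n))
    (g := loopChart α n G) (f := fun y => γ * (loopChart α n G).symm y * δ) u
    (contMDiffAt_loopChart h) ?_)
  exact (contMDiffAt_const.mul (contMDiffAt_loopChart_symm hu)).mul contMDiffAt_const

/-- Evaluation at s is linear and continuous, and evaluations at all s separate points; this reduces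
tangent maps of the loop group to those of G. -/
theorem eval_fderiv_loopChart_mul_mul (γ δ : SobolevLoop α n G) {u : SobolevSpace α n}
    (hu : u ∈ (loopChart α n G).target)
    (h : γ * (loopChart α n G).symm u * δ ∈ (loopChart α n G).source) (k : SobolevSpace α n)
    (s : UnitAddCircle) :
    (fderiv ℝ (fun y => loopChart α n G (γ * (loopChart α n G).symm y * δ)) u k).eval s =
      fderiv ℝ (fun x => unitChart n G (γ.toMap s * (unitChart n G).symm x * δ.toMap s))
        (u.eval s) (k.eval s) := by
  have hc := contDiffAt_loopChart_mul_mul γ δ hu h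
  rw [← SobolevSpace.evalL_apply]
  refine apply_fderiv_of_eventually (hc.differentiableAt (by simp)) (SobolevSpace.evalL s)
    (F := fun x => unitChart n G (γ.toMap s * (unitChart n G).symm x * δ.toMap s)) ?_ ?_ k
  · refine (contDiffAt_unitChart_mul_symm_mul _ _ (hu s) ?_).differentiableAt (by simp)
    have := h s
    rwa [mul_toMap, mul_toMap, loopChart_symm_toMap hu] at this
  · have h1 : ContinuousAt (fun y => γ * (loopChart α n G).symm y * δ) u :=
      ((contMDiffAt_const (c := γ)).mul (contMDiffAt_loopChart_symm hu)).mul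
        (contMDiffAt_const (c := δ)) |>.continuousAt
    filter_upwards [isOpen_loopChart_target.mem_nhds hu,
      h1.preimage_mem_nhds ((loopChart α n G).open_source.mem_nhds h)] with y hy hy'
    rw [SobolevSpace.evalL_apply, eval_loopChart hy', mul_toMap, mul_toMap,
      loopChart_symm_toMap hy]

end SobolevLoop

end TangentMaps

/-! ### The Maurer–Cartan form of the loop group -/

section LoopMaurerCartan

variable {n : ℕ} {G : Type*} [TopologicalSpace G] [ChartedSpace (EuclideanSpace ℝ (Fin n)) G]
  [Group G] [LieGroup (𝓡 n) ∞ G] {α : ℝ} [hF : Fact (1 / 2 < α)]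

variable (G) in
/-- The matrix of the Maurer–Cartan form at `u`. -/
def mcMat (u : SobolevSpace α n) (i j : Fin n) : Sc α :=
  nem (fun x => maurerCartan n G (WithLp.toLp 2 x) (EuclideanSpace.single j 1) i)
    (SobolevSpace.coords α n u)

variable (G) in
/-- The left-invariant Maurer–Cartan form of the loop group in the chart at the unit. -/
def loopMaurerCartan (u : SobolevSpace α n) : SobolevSpace α n →L[ℝ] SobolevSpace α n :=
  matVec (mcMat G u)

theorem contDiffOn_mcEntry (i j : Fin n) : ContDiffOn ℝ ∞ (fun x : Fin n → ℝ =>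
    maurerCartan n G (WithLp.toLp 2 x) (EuclideanSpace.single j 1) i) (chartDom n G) :=
  contDiffOn_comp_toLp (f := fun y => maurerCartan n G y (EuclideanSpace.single j 1) i)
    fun y hy => ContDiffAt.comp y (g := ((EuclideanSpace.proj (𝕜 := ℝ) i).comp
      (ContinuousLinearMap.apply ℝ (EuclideanSpace ℝ (Fin n)) (EuclideanSpace.single j 1))))
      (ContinuousLinearMap.contDiff _).contDiffAt (contDiffAt_maurerCartan hy)

variable [CompactSpace G] [T2Space G]

theorem eval_loopMaurerCartan {u : SobolevSpace α n}
    (hu : ∀ s, u.eval s ∈ (unitChart n G).target) (h : SobolevSpace α n) (s : UnitAddCircle) :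
    (loopMaurerCartan G u h).eval s = maurerCartan n G (u.eval s) (h.eval s) :=
  eval_matVec (L := fun s => maurerCartan n G (u.eval s)) (fun i j s => by
    rw [mcMat, ev_nem (isOpen_chartDom n G) (contDiffOn_mcEntry i j) fun s => SobolevLoop.mem_chartDom.2 (hu s),
      ← SobolevSpace.eval_eq_toLp]) h s

theorem contDiffAt_loopMaurerCartan {u : SobolevSpace α n}
    (hu : ∀ s, u.eval s ∈ (unitChart n G).target) :
    ContDiffAt ℝ ∞ (loopMaurerCartan (α := α) G) u := by
  refine matVec.contDiff.contDiffAt.comp u (contDiffAt_pi.2 fun i => contDiffAt_pi.2 fun j => ?_)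
  exact (contDiffAt_nem (isOpen_chartDom n G) (contDiffOn_mcEntry i j)
    fun s => SobolevLoop.mem_chartDom.2 (hu s)).comp u (SobolevSpace.coords α n).contDiff.contDiffAt

theorem eval_fderiv_loopMaurerCartan {u : SobolevSpace α n}
    (hu : ∀ s, u.eval s ∈ (unitChart n G).target) (h k : SobolevSpace α n) (s : UnitAddCircle) :
    (fderiv ℝ (loopMaurerCartan G) u k h).eval s =
      fderiv ℝ (maurerCartan n G) (u.eval s) (k.eval s) (h.eval s) := by
  have hd : DifferentiableAt ℝ (maurerCartan n G) (u.eval s) :=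
    (contDiffAt_maurerCartan (hu s)).differentiableAt (by simp)
  have key := apply_fderiv_of_eventually
    ((contDiffAt_loopMaurerCartan hu).differentiableAt (by simp)) (s := s)
    ((SobolevSpace.evalL s).comp (ContinuousLinearMap.apply ℝ (SobolevSpace α n) h))
    (F := fun x => maurerCartan n G x (h.eval s))
    (hd.clm_apply (differentiableAt_const _)) (by
      filter_upwards [(SobolevLoop.isOpen_setOf_eval_mem (α := α) (n := n) (G := G)).mem_nhds hu] with y hy
      rw [ContinuousLinearMap.comp_apply, ContinuousLinearMap.apply_apply,
        SobolevSpace.evalL_apply, eval_loopMaurerCartan hy]) k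
  rw [ContinuousLinearMap.comp_apply, ContinuousLinearMap.apply_apply,
    SobolevSpace.evalL_apply] at key
  rw [key, fderiv_clm_apply hd (differentiableAt_const _)]
  simp

/-- The Maurer–Cartan equation of the loop group. -/
theorem fderiv_loopMaurerCartan {u : SobolevSpace α n}
    (hu : ∀ s, u.eval s ∈ (unitChart n G).target) (h k : SobolevSpace α n) :
    fderiv ℝ (loopMaurerCartan G) u h k = fderiv ℝ (loopMaurerCartan G) u k h -
      bracketLoop G (loopMaurerCartan G u h) (loopMaurerCartan G u k) := by
  refine SobolevSpace.ext_eval fun s => ?_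
  rw [sub_eq_add_neg, SobolevSpace.eval_add, SobolevSpace.eval_neg, eval_bracketLoop,
    eval_fderiv_loopMaurerCartan hu, eval_fderiv_loopMaurerCartan hu, eval_loopMaurerCartan hu,
    eval_loopMaurerCartan hu, ← sub_eq_iff_eq_add']
  exact fderiv_maurerCartan (hu s) _ _

namespace SobolevLoop

/-- The derivative of the inverse of a chart is the Maurer–Cartan form. -/
theorem mfderiv_loopChartAt_symm (γ : SobolevLoop α n G) {u : SobolevSpace α n}
    (hu : u ∈ (loopChart α n G).target) :
    mfderiv 𝓘(ℝ, SobolevSpace α n) 𝓘(ℝ, SobolevSpace α n) (loopChartAt γ).symm u =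
      (loopMaurerCartan G u : SobolevSpace α n →L[ℝ] SobolevSpace α n) := by
  have hm : MDifferentiableAt 𝓘(ℝ, SobolevSpace α n) 𝓘(ℝ, SobolevSpace α n)
      (loopChartAt γ).symm u := by
    have h := contMDiffOn_chart_symm (I := 𝓘(ℝ, SobolevSpace α n)) (n := ∞) (x := γ)
    refine (h.contMDiffAt ((loopChartAt γ).open_target.mem_nhds ?_)).mdifferentiableAt (by simp)
    rwa [loopChartAt_target]
  refine hm.mfderiv_eq_fderiv.trans ?_
  -- The chart at the image point γ e⁻¹(u) absorbs the translation by γ, so the local expression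
  -- does not depend on the base chart.
  have e : (fun y => chartAt (SobolevSpace α n) ((loopChartAt γ).symm u)
      ((loopChartAt γ).symm ((chartAt (SobolevSpace α n) u).symm y))) = fun y =>
      loopChart α n G (((loopChart α n G).symm u)⁻¹ * (loopChart α n G).symm y * 1) := by
    funext y
    rw [chartAt_eq, loopChartAt_apply, loopChartAt_symm_apply, mul_inv_rev, mul_one, mul_assoc]
    congr 2
    exact (congrArg (γ⁻¹ * ·) (loopChartAt_symm_apply γ y)).trans (inv_mul_cancel_left _ _)
  refine (congrArg (fun f => fderiv ℝ f u) e).trans ?_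
  refine ContinuousLinearMap.ext fun k => SobolevSpace.ext_eval fun s => ?_
  rw [eval_fderiv_loopChart_mul_mul _ _ hu (by
    rw [mul_one, inv_mul_cancel]; exact one_mem_loopChart_source), eval_loopMaurerCartan hu]
  simp only [inv_toMap, one_toMap, mul_one, loopChart_symm_toMap hu]
  rfl

/-- In the left-translated charts at γ and γδ, right multiplication by δ becomes conjugation by δ⁻¹
in the chart at the unit. -/
theorem mfderiv_mul_right (γ δ : SobolevLoop α n G) :
    mfderiv 𝓘(ℝ, SobolevSpace α n) 𝓘(ℝ, SobolevSpace α n) (fun x => x * δ) γ =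
      (matVec (adMat δ⁻¹) : SobolevSpace α n →L[ℝ] SobolevSpace α n) := by
  have hm : MDifferentiableAt 𝓘(ℝ, SobolevSpace α n) 𝓘(ℝ, SobolevSpace α n)
      (fun x : SobolevLoop α n G => x * δ) γ :=
    (contMDiff_mul_right (I := 𝓘(ℝ, SobolevSpace α n)) (n := ∞) (a := δ)).contMDiffAt.mdifferentiableAt
      (by simp)
  refine hm.mfderiv_eq_fderiv.trans ?_
  have e : (fun y => chartAt (SobolevSpace α n) (γ * δ)
      ((chartAt (SobolevSpace α n) γ).symm y * δ)) = fun y =>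
      loopChart α n G (δ⁻¹ * (loopChart α n G).symm y * δ) := by
    funext y
    rw [chartAt_eq, chartAt_eq, loopChartAt_apply, loopChartAt_symm_apply]
    congr 1
    group
  have h1 : chartAt (SobolevSpace α n) γ γ = unitLoopPt α n G := loopChartAt_self γ
  refine (congrArg₂ (fun f => fderiv ℝ f) e h1).trans ?_
  refine ContinuousLinearMap.ext fun k => SobolevSpace.ext_eval fun s => ?_
  rw [eval_fderiv_loopChart_mul_mul _ _ unitLoopPt_mem (by
    rw [loopChart_symm_unitLoopPt, mul_one, inv_mul_cancel]; exact one_mem_loopChart_source),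
    eval_adMat, adjointMap_eq, eval_unitLoopPt]
  simp only [inv_toMap, inv_inv]

/-- In the charts at δ and γδ, left multiplication is the identity map near the base point. -/
theorem mfderiv_mul_left (γ δ : SobolevLoop α n G) :
    mfderiv 𝓘(ℝ, SobolevSpace α n) 𝓘(ℝ, SobolevSpace α n) (fun x => γ * x) δ =
      ContinuousLinearMap.id ℝ (SobolevSpace α n) := by
  have hm : MDifferentiableAt 𝓘(ℝ, SobolevSpace α n) 𝓘(ℝ, SobolevSpace α n)
      (fun x : SobolevLoop α n G => γ * x) δ :=
    (contMDiff_mul_left (I := 𝓘(ℝ, SobolevSpace α n)) (n := ∞) (a := γ)).contMDiffAt.mdifferentiableAt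
      (by simp)
  refine hm.mfderiv_eq_fderiv.trans ?_
  have h1 : chartAt (SobolevSpace α n) δ δ = unitLoopPt α n G := loopChartAt_self δ
  refine (congrArg (fderiv ℝ _) h1).trans ?_
  refine (Filter.EventuallyEq.fderiv_eq ?_).trans fderiv_id
  filter_upwards [isOpen_loopChart_target.mem_nhds unitLoopPt_mem] with y hy
  rw [chartAt_eq, chartAt_eq, loopChartAt_apply, loopChartAt_symm_apply, mul_inv_rev, id]
  refine (congrArg (loopChart α n G) ?_).trans ((loopChart α n G).right_inv hy)
  group

/-- The map being differentiated is the preferred chart at γ itself. -/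
theorem leftTrivialization_loopChart (γ : SobolevLoop α n G)
    (X : TangentSpace 𝓘(ℝ, SobolevSpace α n) γ) :
    leftTrivialization (loopChart α n G) γ X = X := by
  have hm : MDifferentiableAt 𝓘(ℝ, SobolevSpace α n) 𝓘(ℝ, SobolevSpace α n)
      (fun δ : SobolevLoop α n G => loopChart α n G (γ⁻¹ * δ)) γ := by
    refine ContMDiffAt.mdifferentiableAt (n := ∞) (ContMDiffAt.comp (I' := 𝓘(ℝ, SobolevSpace α n))
      (g := loopChart α n G) (f := fun δ => γ⁻¹ * δ) γ (contMDiffAt_loopChart ?_) ?_) (by simp)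
    · rw [inv_mul_cancel]; exact one_mem_loopChart_source
    · exact contMDiff_mul_left.contMDiffAt
  have h1 : chartAt (SobolevSpace α n) γ γ = unitLoopPt α n G := loopChartAt_self γ
  have h2 : mfderiv 𝓘(ℝ, SobolevSpace α n) 𝓘(ℝ, SobolevSpace α n)
      (fun δ : SobolevLoop α n G => loopChart α n G (γ⁻¹ * δ)) γ =
        ContinuousLinearMap.id ℝ (SobolevSpace α n) := by
    refine hm.mfderiv_eq_fderiv.trans ?_
    refine (congrArg (fderiv ℝ _) h1).trans ?_
    refine (Filter.EventuallyEq.fderiv_eq ?_).trans fderiv_id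
    filter_upwards [isOpen_loopChart_target.mem_nhds unitLoopPt_mem] with y hy
    rw [chartAt_eq, loopChartAt_symm_apply, id]
    refine Eq.trans (congrArg (loopChart α n G) ?_) ((loopChart α n G).right_inv hy)
    group
  exact DFunLike.congr_fun h2 X

end SobolevLoop

end LoopMaurerCartan

/-! ### The tangent map of the gauge action -/

section ActionTangent

variable {n : ℕ} {G : Type*} [TopologicalSpace G] [ChartedSpace (EuclideanSpace ℝ (Fin n)) G]
  [Group G] [LieGroup (𝓡 n) ∞ G] [CompactSpace G] [T2Space G] {α : ℝ} [hF : Fact (1 / 2 < α)]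

theorem HasFDerivAt.sc_smul {X : Type*} [NormedAddCommGroup X] [NormedSpace ℝ X] {f : X → Sc α}
    {g : X → Sc (α - 1)} {x : X} (hf : DifferentiableAt ℝ f x) (hg : DifferentiableAt ℝ g x) :
    HasFDerivAt (fun y => f y • g y) (((Sc.mulL hF.out (Sc.abs_sub_one_le hF.out)).precompR X (f x)
      (fderiv ℝ g x)) + (Sc.mulL hF.out (Sc.abs_sub_one_le hF.out)).precompL X
        (fderiv ℝ f x) (g x)) x :=
  (Sc.mulL hF.out (Sc.abs_sub_one_le hF.out)).hasFDerivAt_of_bilinear hf.hasFDerivAt hg.hasFDerivAt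

theorem differentiableAt_sc_smul {X : Type*} [NormedAddCommGroup X] [NormedSpace ℝ X] {f : X → Sc α}
    {g : X → Sc (α - 1)} {x : X} (hf : DifferentiableAt ℝ f x) (hg : DifferentiableAt ℝ g x) :
    DifferentiableAt ℝ (fun y => f y • g y) x := (HasFDerivAt.sc_smul hf hg).differentiableAt

theorem fderiv_sc_smul {X : Type*} [NormedAddCommGroup X] [NormedSpace ℝ X] {f : X → Sc α}
    {g : X → Sc (α - 1)} {x : X} (hf : DifferentiableAt ℝ f x) (hg : DifferentiableAt ℝ g x)
    (h : X) : fderiv ℝ (fun y => f y • g y) x h = f x • fderiv ℝ g x h + fderiv ℝ f x h • g x := by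
  rw [(HasFDerivAt.sc_smul hf hg).fderiv]
  rfl

namespace SobolevLoop

theorem contDiffAt_fn_loopChart_symm {f : G → ℝ} (hf : ContMDiff (𝓡 n) 𝓘(ℝ, ℝ) ∞ f) :
    DifferentiableAt ℝ (fun u => fn f ((loopChart α n G).symm u)) (unitLoopPt α n G) := by
  have h := ContMDiffAt.comp (I' := 𝓘(ℝ, SobolevSpace α n)) (unitLoopPt α n G)
    (contMDiff_fn hf).contMDiffAt (contMDiffAt_loopChart_symm (α := α) (n := n) (G := G)
      unitLoopPt_mem)
  exact h.contDiffAt.differentiableAt (by simp)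

theorem ev_fderiv_fn_loopChart_symm {f : G → ℝ} (hf : ContMDiff (𝓡 n) 𝓘(ℝ, ℝ) ∞ f)
    (w : SobolevSpace α n) (s : UnitAddCircle) :
    Sc.ev (fderiv ℝ (fun u => fn f ((loopChart α n G).symm u)) (unitLoopPt α n G) w) s =
      rightD n f 1 (w.eval s) := by
  rw [← Sc.evL_apply]
  have hd : DifferentiableAt ℝ (fun x => f ((unitChart n G).symm x)) (unitPt n G) :=
    differentiableAt_comp_unitChart_symm (one_mem_unitChart n G) hf.contMDiffAt
  refine (apply_fderiv_of_eventually (contDiffAt_fn_loopChart_symm hf)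
    (s := s) (Sc.evL s)
    (F := fun x => f ((unitChart n G).symm x)) (by rwa [eval_unitLoopPt]) ?_ w).trans ?_
  · filter_upwards [isOpen_loopChart_target.mem_nhds (unitLoopPt_mem (G := G))] with u hu
    rw [Sc.evL_apply, ev_fn hf, loopChart_symm_toMap hu]
  · rw [eval_unitLoopPt, rightD]
    simp only [mul_one]

theorem fderiv_adMat_loopChart_symm (i j : Fin n) (w : SobolevSpace α n) :
    fderiv ℝ (fun u => adMat ((loopChart α n G).symm u) i j) (unitLoopPt α n G) w =
      adLie G w i j := by
  refine Sc.ext_ev fun s => ?_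
  have h := ev_fderiv_fn_loopChart_symm (α := α) (contMDiff_adEntry (G := G) i j) w s
  refine h.trans ?_
  let Φ : (EuclideanSpace ℝ (Fin n) →L[ℝ] EuclideanSpace ℝ (Fin n)) →L[ℝ] ℝ :=
    (EuclideanSpace.proj i).comp (ContinuousLinearMap.apply ℝ (EuclideanSpace ℝ (Fin n))
      (EuclideanSpace.single j 1))
  have h1 := DFunLike.congr_fun (rightD_comp (G := G) (Φ := Φ) contMDiff_adjointMap 1
    Φ.differentiableAt) (w.eval s)
  rw [ContinuousLinearMap.comp_apply, Φ.fderiv, rightD_adjointMap, adjointMap_one] at h1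
  rw [ev_adLie]
  exact h1

theorem embL_one (i : Fin (embDim n G)) :
    embL (1 : SobolevLoop α n G) i = emb n G 1 i • (1 : Sc α) := by
  refine Sc.ext_ev fun s => ?_
  rw [Sc.ev_smul, Sc.ev_one, mul_one]
  exact (congrFun (evFam_embL (1 : SobolevLoop α n G) s) i).trans (by rw [one_toMap])

theorem differentiableAt_embL_loopChart_symm (l : Fin (embDim n G)) :
    DifferentiableAt ℝ (fun u => embL ((loopChart α n G).symm u) l) (unitLoopPt α n G) :=
  contDiffAt_fn_loopChart_symm (contMDiff_emb n G l)

theorem differentiableAt_deriv_embL (l : Fin (embDim n G)) :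
    DifferentiableAt ℝ (fun u => Sc.deriv (embL ((loopChart α n G).symm u) l))
      (unitLoopPt α n G) :=
  Sc.deriv.differentiableAt.comp _ (differentiableAt_embL_loopChart_symm l)

/-- In the product rule the derivative of M is multiplied by the derivative of a constant loop,
which is zero. The other term is M J ∂w = ∂w at the unit. -/
theorem fderiv_rightLog_loopChart_symm (i : Fin n) (w : SobolevSpace α n) :
    fderiv ℝ (fun u => SobolevSpace.comp i (rightLog ((loopChart α n G).symm u)))
      (unitLoopPt α n G) w = SobolevSpace.comp i (SobolevSpace.deriv w) := by
  have hM := fun l => (contMDiff_logM n G).clm_apply_coord (Pi.single l 1) i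
  have hdM := fun l => contDiffAt_fn_loopChart_symm (α := α) (hM l)
  simp only [comp_rightLog]
  rw [fderiv_fun_sum fun l _ => differentiableAt_sc_smul (hdM l) (differentiableAt_deriv_embL l)]
  rw [_root_.sum_apply]
  have hJ : ∀ l v, rightD n (fun x => emb n G x l) (1 : G) v = rightD n (emb n G) 1 v l := by
    intro l v
    rw [rightD_comp (Φ := fun v : Fin (embDim n G) → ℝ => v l)
      (isRetractEmbedding_emb n G).contMDiff 1 (ContinuousLinearMap.proj (R := ℝ)
        (φ := fun _ : Fin (embDim n G) => ℝ) l).differentiableAt, ContinuousLinearMap.comp_apply]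
    exact DFunLike.congr_fun (ContinuousLinearMap.proj (R := ℝ)
      (φ := fun _ : Fin (embDim n G) => ℝ) l).fderiv _
  have hE : ∀ l, fderiv ℝ (fun u => embL ((loopChart α n G).symm u) l) (unitLoopPt α n G) w =
      ∑ k, rightD n (emb n G) 1 (EuclideanSpace.single k 1) l • SobolevSpace.comp k w := by
    intro l
    refine Sc.ext_ev fun s => ?_
    refine (ev_fderiv_fn_loopChart_symm (contMDiff_emb n G l) w s).trans ?_
    rw [hJ]
    conv_lhs => rw [EuclideanSpace.eq_sum_single (w.eval s)]
    simp only [map_sum, map_smul, Finset.sum_apply, Pi.smul_apply, smul_eq_mul, Sc.ev_sum,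
      Sc.ev_smul, SobolevSpace.eval_apply]
    exact Finset.sum_congr rfl fun j _ => mul_comm _ _
  have hD : ∀ l, fderiv ℝ (fun u => Sc.deriv (embL ((loopChart α n G).symm u) l))
      (unitLoopPt α n G) w =
      ∑ k, rightD n (emb n G) 1 (EuclideanSpace.single k 1) l •
        SobolevSpace.comp k (SobolevSpace.deriv w) := by
    intro l
    have h := (Sc.deriv.hasFDerivAt.comp (unitLoopPt α n G)
      (differentiableAt_embL_loopChart_symm (α := α) l).hasFDerivAt).fderiv
    have h1 := DFunLike.congr_fun h w
    rw [ContinuousLinearMap.comp_apply, hE, map_sum] at h1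
    refine h1.trans (Finset.sum_congr rfl fun k _ => ?_)
    rw [ContinuousLinearMap.map_smul, SobolevSpace.comp_deriv]
  have hM1 : ∀ l, fn (fun g => logM n G g (Pi.single l 1) i)
      ((loopChart α n G).symm (unitLoopPt α n G)) =
        logM n G 1 (Pi.single l 1) i • (1 : Sc α) := fun l => by
    refine Sc.ext_ev fun s => ?_
    rw [loopChart_symm_unitLoopPt, ev_fn (hM l), one_toMap, Sc.ev_smul, Sc.ev_one, mul_one]
  have h0 : ∀ l, Sc.deriv (embL ((loopChart α n G).symm (unitLoopPt α n G)) l) = 0 := fun l => by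
    rw [loopChart_symm_unitLoopPt, embL_one, ContinuousLinearMap.map_smul]
    exact (congrArg _ Sc.deriv_one).trans (smul_zero _)
  have hterm : ∀ l, fderiv ℝ (fun u => fn (fun g => logM n G g (Pi.single l 1) i)
      ((loopChart α n G).symm u) • Sc.deriv (embL ((loopChart α n G).symm u) l))
      (unitLoopPt α n G) w = ∑ k, (rightD n (emb n G) 1 (EuclideanSpace.single k 1) l *
        logM n G 1 (Pi.single l 1) i) • SobolevSpace.comp k (SobolevSpace.deriv w) := fun l => by
    rw [fderiv_sc_smul (hdM l) (differentiableAt_deriv_embL l), h0, smul_zero, add_zero, hM1, hD,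
      smul_assoc, one_smul, Finset.smul_sum]
    exact Finset.sum_congr rfl fun k _ => by rw [smul_smul, mul_comm]
  rw [Finset.sum_congr rfl fun l _ => hterm l, Finset.sum_comm]
  simp only [← Finset.sum_smul]
  have hk : ∀ k, ∑ l, rightD n (emb n G) 1 (EuclideanSpace.single k 1) l *
      logM n G 1 (Pi.single l 1) i = if i = k then 1 else 0 := by
    intro k
    have h := congrArg (fun v => v i) (logM_rightD (1 : G) (EuclideanSpace.single k 1))
    simp only at h
    rw [pi_eq_sum_single (rightD n (emb n G) _ _)] at h
    simp only [map_sum, map_smul, PiLp.smul_apply, WithLp.ofLp_sum, Finset.sum_apply,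
      smul_eq_mul] at h
    rw [h]
    simp
  simp [hk, ite_smul]

/-- Near δ write the acting loop as δ times a loop y near the unit. Then (δ y)·A = δ·(y·A) is affine
in y·A with linear part Ad_δ, and the derivative of y·A at the unit is [w, A] + ∂w. -/
theorem mfderiv_gauge_smul_left (δ : SobolevLoop α n G) (A : SobolevSpace (α - 1) n)
    (w : SobolevSpace α n) :
    (mfderiv 𝓘(ℝ, SobolevSpace α n) 𝓘(ℝ, SobolevSpace (α - 1) n)
      (fun x : SobolevLoop α n G => x • A) δ w : SobolevSpace (α - 1) n) =
      matAct (adMat δ) (matAct (adLie G w) A + SobolevSpace.deriv w) := by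
  have hs : ContMDiff 𝓘(ℝ, SobolevSpace α n) 𝓘(ℝ, SobolevSpace (α - 1) n) ∞
      fun x : SobolevLoop α n G => x • A :=
    ContMDiff.comp (I' := 𝓘(ℝ, SobolevSpace α n).prod 𝓘(ℝ, SobolevSpace (α - 1) n))
      (g := fun p : SobolevLoop α n G × SobolevSpace (α - 1) n => p.1 • p.2)
      (f := fun x => (x, A)) contMDiff_gauge_smul (contMDiff_id.prodMk contMDiff_const)
  have h1 : chartAt (SobolevSpace α n) δ δ = unitLoopPt α n G := loopChartAt_self δ
  have e : (fun y => chartAt (SobolevSpace (α - 1) n) (δ • A)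
      ((chartAt (SobolevSpace α n) δ).symm y • A)) = fun y =>
      matAct (adMat δ) ((loopChart α n G).symm y • A) + rightLog δ := by
    funext y
    exact (congrArg (· • A) (loopChartAt_symm_apply δ y)).trans (mul_smul _ _ _)
  have hd : DifferentiableAt ℝ (fun y => (loopChart α n G).symm y • A) (unitLoopPt α n G) :=
    (ContMDiffAt.comp (I' := 𝓘(ℝ, SobolevSpace α n)) (unitLoopPt α n G)
      hs.contMDiffAt (contMDiffAt_loopChart_symm (α := α) (n := n) (G := G)
        unitLoopPt_mem)).contDiffAt.differentiableAt (by simp)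
  have h2 : HasFDerivAt (fun y => matAct (adMat δ) ((loopChart α n G).symm y • A) + rightLog δ)
      ((matAct (adMat δ)).comp (fderiv ℝ (fun y => (loopChart α n G).symm y • A)
        (unitLoopPt α n G))) (unitLoopPt α n G) :=
    ((matAct (adMat δ)).hasFDerivAt.comp _ hd.hasFDerivAt).add_const _
  have h3 : mfderiv 𝓘(ℝ, SobolevSpace α n) 𝓘(ℝ, SobolevSpace (α - 1) n)
      (fun x : SobolevLoop α n G => x • A) δ = (matAct (adMat δ)).comp
        (fderiv ℝ (fun y => (loopChart α n G).symm y • A) (unitLoopPt α n G)) :=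
    ((hs.contMDiffAt.mdifferentiableAt (by simp)).mfderiv_eq_fderiv.trans
      (congrArg₂ (fun f => fderiv ℝ f) e h1)).trans h2.fderiv
  refine (DFunLike.congr_fun h3 w).trans (congrArg (matAct (adMat δ)) ?_)
  refine SobolevSpace.ext_comp fun i => ?_
  have h4 := DFunLike.congr_fun ((SobolevSpace.comp i).hasFDerivAt.comp (unitLoopPt α n G)
    hd.hasFDerivAt).fderiv w
  rw [ContinuousLinearMap.comp_apply] at h4
  refine h4.symm.trans ?_
  have e2 : (SobolevSpace.comp i ∘ fun y => (loopChart α n G).symm y • A) = fun y =>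
      (∑ j, adMat ((loopChart α n G).symm y) i j • SobolevSpace.comp j A) +
        SobolevSpace.comp i (rightLog ((loopChart α n G).symm y)) := by
    funext y
    rw [Function.comp_apply, gauge_smul_def, map_add, comp_matAct]
  have hA : ∀ j, DifferentiableAt ℝ (fun y => adMat ((loopChart α n G).symm y) i j)
      (unitLoopPt α n G) := fun j => contDiffAt_fn_loopChart_symm (contMDiff_adEntry i j)
  have hAs : ∀ j, DifferentiableAt ℝ (fun y => adMat ((loopChart α n G).symm y) i j •
      SobolevSpace.comp j A) (unitLoopPt α n G) := fun j =>
    differentiableAt_sc_smul (hA j) (differentiableAt_const _)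
  have hR : DifferentiableAt ℝ (fun u => SobolevSpace.comp i
      (rightLog ((loopChart α n G).symm u))) (unitLoopPt α n G) :=
    (SobolevSpace.comp i).differentiableAt.comp _ ((ContMDiffAt.comp
      (I' := 𝓘(ℝ, SobolevSpace α n)) (unitLoopPt α n G) contMDiff_rightLog.contMDiffAt
      (contMDiffAt_loopChart_symm (α := α) (n := n) (G := G)
        unitLoopPt_mem)).contDiffAt.differentiableAt (by simp))
  rw [e2, fderiv_fun_add (DifferentiableAt.fun_sum fun j _ => hAs j) hR,
    fderiv_fun_sum fun j _ => hAs j, _root_.add_apply, _root_.sum_apply,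
    fderiv_rightLog_loopChart_symm, map_add, comp_matAct]
  congr 1
  refine Finset.sum_congr rfl fun j _ => ?_
  rw [fderiv_sc_smul (hA j) (differentiableAt_const _), fderiv_adMat_loopChart_symm]
  simp

end SobolevLoop

end ActionTangent

/-! ### Alternating forms of degree two from bilinear forms -/

section AltTwo

variable {E E' : Type*} [NormedAddCommGroup E] [NormedSpace ℝ E] [NormedAddCommGroup E']
  [NormedSpace ℝ E']

variable (E) in
/-- The alternating part of a bilinear form. -/
def altTwo : (E →L[ℝ] E →L[ℝ] ℝ) →L[ℝ] E [⋀^Fin 2]→L[ℝ] ℝ :=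
  (1 / 2 : ℝ) • (ContinuousAlternatingMap.alternatizeUncurryFinCLM ℝ E ℝ (n := 1)).comp
    (ContinuousLinearMap.compL ℝ E (E →L[ℝ] ℝ) (E [⋀^Fin 1]→L[ℝ] ℝ)
      (ContinuousAlternatingMap.ofSubsingletonLIE (𝕜 := ℝ) (E := E) (F := ℝ) (0 : Fin 1)).toContinuousLinearEquiv.toContinuousLinearMap)

/-- The factor 1/2 makes alternation the identity on forms that are already skew. -/
theorem altTwo_apply {f : E →L[ℝ] E →L[ℝ] ℝ} (hf : ∀ x y, f x y = -f y x) (v : Fin 2 → E) :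
    altTwo E f v = f (v 0) (v 1) := by
  have h : altTwo E f v = (1 / 2 : ℝ) * (f (v 0) (v 1) - f (v 1) (v 0)) := by
    change (1 / 2 : ℝ) • (ContinuousAlternatingMap.alternatizeUncurryFin
      ((ContinuousAlternatingMap.ofSubsingletonLIE (𝕜 := ℝ) (E := E) (F := ℝ)
        (0 : Fin 1)).toContinuousLinearEquiv.toContinuousLinearMap.comp f)) v = _
    rw [ContinuousAlternatingMap.alternatizeUncurryFin_apply, Fin.sum_univ_two, smul_eq_mul]
    congr 1
    rw [show ((0 : Fin 2) : ℕ) = 0 from rfl, show ((1 : Fin 2) : ℕ) = 1 from rfl, pow_zero, pow_one,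
      one_smul, neg_smul, one_smul, ← sub_eq_add_neg]
    rfl
  rw [h, hf (v 1)]
  ring

/-- The pullback of a bilinear form. -/
def bilinPull (f : E →L[ℝ] E →L[ℝ] ℝ) (g : E' →L[ℝ] E) : E' →L[ℝ] E' →L[ℝ] ℝ :=
  ((ContinuousLinearMap.compL ℝ E' E ℝ).flip g).comp (f.comp g)

theorem bilinPull_apply (f : E →L[ℝ] E →L[ℝ] ℝ) (g : E' →L[ℝ] E) (x y : E') :
    bilinPull f g x y = f (g x) (g y) := rfl

theorem ContDiffAt.bilinPull {X : Type*} [NormedAddCommGroup X] [NormedSpace ℝ X]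
    {f : X → E →L[ℝ] E →L[ℝ] ℝ} {g : X → E' →L[ℝ] E} {x : X} (hf : ContDiffAt ℝ ∞ f x)
    (hg : ContDiffAt ℝ ∞ g x) : ContDiffAt ℝ ∞ (fun y => bilinPull (f y) (g y)) x :=
  (ContDiffAt.comp x (g := (ContinuousLinearMap.compL ℝ E' E ℝ).flip)
    (ContinuousLinearMap.contDiff _).contDiffAt hg).clm_comp (hf.clm_comp hg)

end AltTwo

/-! ### The local expression of the symplectic form -/

section LocalForm

variable {n : ℕ} {G : Type*} [TopologicalSpace G] [ChartedSpace (EuclideanSpace ℝ (Fin n)) G]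
  [Group G] [LieGroup (𝓡 n) ∞ G] {α : ℝ} [hF : Fact (1 / 2 < α)]
  {B : EuclideanSpace ℝ (Fin n) →L[ℝ] EuclideanSpace ℝ (Fin n) →L[ℝ] ℝ}

/-- This is ∫ d(a, [b, c]) = 0, expanded by the Leibniz rule and invariance; it makes the central
term (v₁, dv₂) a cocycle. -/
theorem pair_deriv_bracketLoop_cyclic (hs : ∀ u v, B u v = B v u)
    (hi : ∀ u v w, B (bracketCLM n G u v) w = -B v (bracketCLM n G u w))
    (a b c : SobolevSpace α n) :
    pair B (SobolevSpace.deriv a) (bracketLoop G b c) +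
      pair B (SobolevSpace.deriv b) (bracketLoop G c a) +
      pair B (SobolevSpace.deriv c) (bracketLoop G a b) = 0 := by
  have h := pair_deriv_swap hs (bracketLoop G b c) a
  rw [deriv_bracketLoop, map_sub, _root_.sub_apply, pair_adLie hi, pair_adLie hi,
    bracketLoop_swap b a, map_neg] at h
  linarith

theorem contDiff_omegaBilin : ContDiff ℝ ∞ (omegaBilin (α := α) G B) := by
  have h1 : ContDiff ℝ ∞ fun A : SobolevSpace (α - 1) n =>
      bilinPull ((ContinuousLinearMap.compL ℝ (SobolevSpace α n) (SobolevSpace α n) ℝ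
        (pair B A)).comp (bracketLoop G))
        (ContinuousLinearMap.fst ℝ (SobolevSpace α n) (SobolevSpace (α - 1) n)) := by
    refine contDiff_iff_contDiffAt.2 fun A => ContDiffAt.bilinPull ?_ contDiffAt_const
    exact ContDiff.contDiffAt (((ContinuousLinearMap.compL ℝ (SobolevSpace α n)
      (SobolevSpace α n) ℝ).contDiff.comp (pair B).contDiff).clm_comp contDiff_const)
  exact (contDiff_const.sub h1).sub contDiff_const

variable [CompactSpace G] [T2Space G]

variable (G) in
/-- The differential of the inverse of a chart of `LG × L𝔤^*`. -/
def chartDiff (u : SobolevSpace α n) : (SobolevSpace α n × SobolevSpace (α - 1) n) →L[ℝ]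
    SobolevSpace α n × SobolevSpace (α - 1) n :=
  ((loopMaurerCartan G u).comp (ContinuousLinearMap.fst ℝ _ _)).prod
    (ContinuousLinearMap.snd ℝ _ _)

theorem contDiffAt_chartDiff {u : SobolevSpace α n}
    (hu : ∀ s, u.eval s ∈ (unitChart n G).target) : ContDiffAt ℝ ∞ (chartDiff (α := α) G) u := by
  have e : chartDiff (α := α) G = fun u => (ContinuousLinearMap.inl ℝ _ _).comp
      ((loopMaurerCartan G u).comp (ContinuousLinearMap.fst ℝ _ (SobolevSpace (α - 1) n))) +
        (ContinuousLinearMap.inr ℝ _ _).comp (ContinuousLinearMap.snd ℝ _ _) := by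
    funext u
    refine ContinuousLinearMap.ext fun x => Prod.ext ?_ ?_
    · exact (add_zero _).symm
    · exact (zero_add _).symm
  rw [e]
  exact (contDiffAt_const.clm_comp ((contDiffAt_loopMaurerCartan hu).clm_comp
    contDiffAt_const)).add contDiffAt_const

variable (G B) in
/-- The local expression of the symplectic form. -/
def localForm (p : SobolevSpace α n × SobolevSpace (α - 1) n) :
    (SobolevSpace α n × SobolevSpace (α - 1) n) [⋀^Fin 2]→L[ℝ] ℝ :=
  altTwo _ (bilinPull (omegaBilin G B p.2) (chartDiff G p.1))

theorem localForm_apply (hs : ∀ u v, B u v = B v u)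
    (p : SobolevSpace α n × SobolevSpace (α - 1) n)
    (v : Fin 2 → SobolevSpace α n × SobolevSpace (α - 1) n) :
    localForm G B p v =
      omegaBilin G B p.2 (chartDiff G p.1 (v 0)) (chartDiff G p.1 (v 1)) := by
  have h : ∀ x y, bilinPull (omegaBilin G B p.2) (chartDiff G p.1) x y =
      -bilinPull (omegaBilin G B p.2) (chartDiff G p.1) y x := by
    intro x y
    rw [bilinPull_apply, bilinPull_apply]
    exact omegaBilin_swap hs _ _ _
  rw [localForm, altTwo_apply h, bilinPull_apply]

theorem contDiffAt_localForm {p : SobolevSpace α n × SobolevSpace (α - 1) n}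
    (hp : ∀ s, p.1.eval s ∈ (unitChart n G).target) : ContDiffAt ℝ ∞ (localForm G B) p :=
  ContDiffAt.comp p (g := altTwo (SobolevSpace α n × SobolevSpace (α - 1) n))
    (ContinuousLinearMap.contDiff _).contDiffAt (ContDiffAt.bilinPull
    (contDiff_omegaBilin.contDiffAt.comp p contDiffAt_snd)
    (ContDiffAt.comp p (contDiffAt_chartDiff hp) contDiffAt_fst))

theorem fderiv_omegaBilin_chartDiff {p : SobolevSpace α n × SobolevSpace (α - 1) n}
    (hp : ∀ s, p.1.eval s ∈ (unitChart n G).target)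
    (x y z : SobolevSpace α n × SobolevSpace (α - 1) n) :
    fderiv ℝ (fun p => omegaBilin G B p.2 (chartDiff G p.1 y) (chartDiff G p.1 z)) p x =
      pair B y.2 (fderiv ℝ (loopMaurerCartan G) p.1 x.1 z.1) -
      pair B z.2 (fderiv ℝ (loopMaurerCartan G) p.1 x.1 y.1) -
      (pair B p.2 (bracketLoop G (loopMaurerCartan G p.1 y.1)
          (fderiv ℝ (loopMaurerCartan G) p.1 x.1 z.1) +
        bracketLoop G (fderiv ℝ (loopMaurerCartan G) p.1 x.1 y.1) (loopMaurerCartan G p.1 z.1)) +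
        pair B x.2 (bracketLoop G (loopMaurerCartan G p.1 y.1) (loopMaurerCartan G p.1 z.1))) -
      (pair B (SobolevSpace.deriv (loopMaurerCartan G p.1 z.1))
          (fderiv ℝ (loopMaurerCartan G) p.1 x.1 y.1) +
        pair B (SobolevSpace.deriv (fderiv ℝ (loopMaurerCartan G) p.1 x.1 z.1))
          (loopMaurerCartan G p.1 y.1)) := by
  have hθ := ((contDiffAt_loopMaurerCartan hp).differentiableAt (by simp)).hasFDerivAt
  have hT : ∀ w : SobolevSpace α n × SobolevSpace (α - 1) n, HasFDerivAt
      (fun p : SobolevSpace α n × SobolevSpace (α - 1) n => loopMaurerCartan G p.1 w.1)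
      (((ContinuousLinearMap.apply ℝ (SobolevSpace α n) w.1).comp
        (fderiv ℝ (loopMaurerCartan G) p.1)).comp (ContinuousLinearMap.fst ℝ _ _)) p := fun w =>
    ((ContinuousLinearMap.apply ℝ (SobolevSpace α n) w.1).hasFDerivAt.comp p.1 hθ).comp p
      hasFDerivAt_fst
  have h1 := (pair B y.2).hasFDerivAt.comp p (hT z)
  have h2 := (pair B z.2).hasFDerivAt.comp p (hT y)
  have h3 := (pair B).hasFDerivAt_of_bilinear hasFDerivAt_snd
    ((bracketLoop G).hasFDerivAt_of_bilinear (hT y) (hT z))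
  have h4 := (pair B).hasFDerivAt_of_bilinear
    ((SobolevSpace.deriv (α := α) (n := n)).hasFDerivAt.comp p (hT z)) (hT y)
  have h := (((h1.sub h2).sub h3).sub h4).fderiv
  exact DFunLike.congr_fun h x

/-- The derivatives of θ occur in antisymmetrized pairs, which the Maurer–Cartan equation replaces
by brackets. The terms containing A then cancel by the Jacobi identity, and those without A by
integration by parts and the cyclic identity. -/
theorem extDeriv_localForm (hs : ∀ u v, B u v = B v u)
    (hi : ∀ u v w, B (bracketCLM n G u v) w = -B v (bracketCLM n G u w))
    {p : SobolevSpace α n × SobolevSpace (α - 1) n}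
    (hp : ∀ s, p.1.eval s ∈ (unitChart n G).target) : extDeriv (localForm G B) p = 0 := by
  ext v
  have e : ∀ i : Fin 3, (fun x => localForm G B x (i.removeNth v)) = fun x =>
      omegaBilin G B x.2 (chartDiff G x.1 (v (i.succAbove 0)))
        (chartDiff G x.1 (v (i.succAbove 1))) := fun i => funext fun x => localForm_apply hs x _
  rw [extDeriv_apply ((contDiffAt_localForm hp).differentiableAt (by simp)), Fin.sum_univ_three]
  simp only [e, fderiv_omegaBilin_chartDiff hp]
  have e00 : (0 : Fin 3).succAbove 0 = 1 := rfl
  have e01 : (0 : Fin 3).succAbove 1 = 2 := rfl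
  have e10 : (1 : Fin 3).succAbove 0 = 0 := rfl
  have e11 : (1 : Fin 3).succAbove 1 = 2 := rfl
  have e20 : (2 : Fin 3).succAbove 0 = 0 := rfl
  have e21 : (2 : Fin 3).succAbove 1 = 1 := rfl
  have z0 : ((0 : Fin 3) : ℕ) = 0 := rfl
  have z1 : ((1 : Fin 3) : ℕ) = 1 := rfl
  have z2 : ((2 : Fin 3) : ℕ) = 2 := rfl
  -- Only one ordering of arguments is kept in each derivative of θ; after this, all derivatives and
  -- values of θ are independent letters and the claim is linear in the pairings.
  rw [e00, e01, e10, e11, e20, e21, z0, z1, z2, fderiv_loopMaurerCartan hp (v 0).1 (v 1).1,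
    fderiv_loopMaurerCartan hp (v 0).1 (v 2).1, fderiv_loopMaurerCartan hp (v 1).1 (v 2).1]
  generalize fderiv ℝ (loopMaurerCartan G) p.1 (v 1).1 (v 0).1 = s₁₀
  generalize fderiv ℝ (loopMaurerCartan G) p.1 (v 2).1 (v 0).1 = s₂₀
  generalize fderiv ℝ (loopMaurerCartan G) p.1 (v 2).1 (v 1).1 = s₂₁
  generalize loopMaurerCartan G p.1 (v 0).1 = t₀
  generalize loopMaurerCartan G p.1 (v 1).1 = t₁
  generalize loopMaurerCartan G p.1 (v 2).1 = t₂
  have h1 := congrArg (pair B p.2) (bracketLoop_jacobi (G := G) t₀ t₁ t₂)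
  have h2 := congrArg (pair B p.2) (bracketLoop_swap (G := G) s₂₀ t₁)
  have h3 := pair_deriv_bracketLoop_cyclic hs hi t₀ t₁ t₂
  have h4 := pair_deriv_swap hs s₂₀ t₁
  have h5 := pair_deriv_swap hs (bracketLoop G t₀ t₂) t₁
  have h6 := pair_deriv_swap hs (bracketLoop G t₁ t₂) t₀
  have h7 := congrArg (pair B (SobolevSpace.deriv t₁)) (bracketLoop_swap (G := G) t₀ t₂)
  simp only [map_add, map_sub, map_neg, _root_.sub_apply, pow_zero, pow_one, one_smul, neg_smul, neg_one_sq] at h1 h2 h3 h4 h5 h6 h7 ⊢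
  have e0 : (0 : (SobolevSpace α n × SobolevSpace (α - 1) n) [⋀^Fin 3]→L[ℝ] ℝ) v = 0 := rfl
  refine Eq.trans ?_ e0.symm
  linarith

end LocalForm

/-! ### The symplectic form on `LG × L𝔤^*` -/

section LoopForm

variable {n : ℕ} {G : Type*} [TopologicalSpace G] [ChartedSpace (EuclideanSpace ℝ (Fin n)) G]
  [Group G] [LieGroup (𝓡 n) ∞ G] [CompactSpace G] [T2Space G] {α : ℝ} [hF : Fact (1 / 2 < α)]
  {B : EuclideanSpace ℝ (Fin n) →L[ℝ] EuclideanSpace ℝ (Fin n) →L[ℝ] ℝ}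

variable (α n G) in
/-- The model of the manifold `LG × L𝔤^*`. -/
abbrev loopModel : ModelWithCorners ℝ (SobolevSpace α n × SobolevSpace (α - 1) n)
    (ModelProd (SobolevSpace α n) (SobolevSpace (α - 1) n)) :=
  𝓘(ℝ, SobolevSpace α n).prod 𝓘(ℝ, SobolevSpace (α - 1) n)

variable (α n G) in
/-- The space `LG × L𝔤^*`. -/
abbrev LoopArrows : Type _ := SobolevLoop α n G × SobolevSpace (α - 1) n

variable (α G B) in
/-- The 2-form on `LG × L𝔤^*`. -/
def loopForm : TwoFormField (loopModel n α) (LoopArrows n G α) := fun p =>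
  altTwo (SobolevSpace α n × SobolevSpace (α - 1) n) (omegaBilin G B p.2)

theorem loopForm_apply (hs : ∀ u v, B u v = B v u) (p : LoopArrows n G α)
    (x y : SobolevSpace α n × SobolevSpace (α - 1) n) :
    loopForm G α B p ![x, y] = omegaBilin G B p.2 x y :=
  altTwo_apply (f := omegaBilin G B p.2) (fun _ _ => omegaBilin_swap hs _ _ _) ![x, y]

open SobolevLoop

theorem mem_extChartAt_loopArrows_target (x : LoopArrows n G α)
    (p : SobolevSpace α n × SobolevSpace (α - 1) n) :
    p ∈ (extChartAt (loopModel n α) x).target ↔ p.1 ∈ (loopChart α n G).target := by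
  rw [extChartAt_prod, PartialEquiv.prod_target, extChartAt_target, extChartAt_target,
    chartAt_eq, loopChartAt_target]
  simp only [modelWithCornersSelf_coe_symm, modelWithCornersSelf_coe, Set.range_id, Set.preimage_id,
    Set.inter_univ, Set.mem_prod]
  exact and_iff_left (Set.mem_univ _)

theorem mfderiv_extChartAt_loopArrows_symm (x : LoopArrows n G α)
    {p : SobolevSpace α n × SobolevSpace (α - 1) n} (hp : p.1 ∈ (loopChart α n G).target) :
    mfderiv 𝓘(ℝ, SobolevSpace α n × SobolevSpace (α - 1) n) (loopModel n α)
      (extChartAt (loopModel n α) x).symm p =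
      (chartDiff G p.1 : (SobolevSpace α n × SobolevSpace (α - 1) n) →L[ℝ] _) := by
  have h1 : MDifferentiableAt 𝓘(ℝ, SobolevSpace α n) 𝓘(ℝ, SobolevSpace α n)
      (loopChartAt x.1).symm p.1 := by
    have h := contMDiffOn_chart_symm (I := 𝓘(ℝ, SobolevSpace α n)) (n := ∞) (x := x.1)
    refine (h.contMDiffAt ((loopChartAt x.1).open_target.mem_nhds ?_)).mdifferentiableAt (by simp)
    rwa [loopChartAt_target]
  have h2 : HasMFDerivAt 𝓘(ℝ, SobolevSpace α n × SobolevSpace (α - 1) n) 𝓘(ℝ, SobolevSpace α n)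
      (fun p : SobolevSpace α n × SobolevSpace (α - 1) n => p.1) p
      (ContinuousLinearMap.fst ℝ (SobolevSpace α n) (SobolevSpace (α - 1) n)) :=
    hasFDerivAt_fst.hasMFDerivAt
  have h3 : HasMFDerivAt 𝓘(ℝ, SobolevSpace α n × SobolevSpace (α - 1) n)
      𝓘(ℝ, SobolevSpace (α - 1) n)
      (fun p : SobolevSpace α n × SobolevSpace (α - 1) n => p.2) p
      (ContinuousLinearMap.snd ℝ (SobolevSpace α n) (SobolevSpace (α - 1) n)) :=
    hasFDerivAt_snd.hasMFDerivAt
  have h4 := (HasMFDerivAt.comp p (g := (loopChartAt x.1).symm) h1.hasMFDerivAt h2).prodMk h3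
  refine h4.mfderiv.trans ?_
  refine ContinuousLinearMap.ext fun v => Prod.ext ?_ rfl
  exact DFunLike.congr_fun (mfderiv_loopChartAt_symm x.1 hp) v.1

theorem inChart_loopForm (hs : ∀ u v, B u v = B v u) (x : LoopArrows n G α)
    {p : SobolevSpace α n × SobolevSpace (α - 1) n} (hp : p.1 ∈ (loopChart α n G).target) :
    TwoFormField.inChart (loopModel n α) (loopForm G α B) x p = localForm G B p := by
  ext v
  rw [localForm_apply hs]
  have h1 : mfderivWithin 𝓘(ℝ, SobolevSpace α n × SobolevSpace (α - 1) n) (loopModel n α)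
      (extChartAt (loopModel n α) x).symm (Set.range (loopModel n α)) p =
        (chartDiff G p.1 : (SobolevSpace α n × SobolevSpace (α - 1) n) →L[ℝ] _) := by
    rw [ModelWithCorners.range_eq_univ, mfderivWithin_univ]
    exact mfderiv_extChartAt_loopArrows_symm x hp
  have h2 : TwoFormField.inChart (loopModel n α) (loopForm G α B) x p v =
      altTwo (SobolevSpace α n × SobolevSpace (α - 1) n) (omegaBilin G B p.2)
        (fun i => chartDiff G p.1 (v i)) :=
    congrArg (fun L : (SobolevSpace α n × SobolevSpace (α - 1) n) →L[ℝ]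
      SobolevSpace α n × SobolevSpace (α - 1) n => altTwo _ (omegaBilin G B p.2)
        (fun i => L (v i))) h1
  rw [h2]
  exact altTwo_apply (fun _ _ => omegaBilin_swap hs _ _ _) _

theorem isSymplecticForm_loopForm (hs : ∀ u v, B u v = B v u)
    (hi : ∀ u v w, B (bracketCLM n G u v) w = -B v (bracketCLM n G u w))
    (hn : ∀ i, ∃ x, ∀ y, B x y = y i) :
    IsSymplecticForm (loopModel n α) (loopForm G α B) where
  smooth x p hp := by
    rw [mem_extChartAt_loopArrows_target] at hp
    have h := contDiffAt_localForm (B := B) hp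
    refine (h.congr_of_eventuallyEq ?_).contDiffWithinAt
    filter_upwards [(isOpen_loopChart_target.preimage continuous_fst).mem_nhds hp] with q hq
    exact inChart_loopForm hs x hq
  closed x p hp := by
    rw [mem_extChartAt_loopArrows_target] at hp
    rw [ModelWithCorners.range_eq_univ, extDerivWithin_univ]
    refine (Filter.EventuallyEq.extDeriv_eq ?_).trans (extDeriv_localForm hs hi hp)
    filter_upwards [(isOpen_loopChart_target.preimage continuous_fst).mem_nhds hp] with q hq
    exact inChart_loopForm hs x hq
  nondegenerate p v h := by
    change SobolevSpace α n × SobolevSpace (α - 1) n at v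
    have h' : ∀ w : SobolevSpace α n × SobolevSpace (α - 1) n,
        omegaBilin G B p.2 v w = 0 := fun w =>
      (loopForm_apply hs p v w).symm.trans (h w)
    simp only [omegaBilin_apply] at h'
    -- Vectors (0, A) see only the first component of v; once it vanishes, vectors (w, 0) see only
    -- the second.
    have h1 : v.1 = 0 := eq_zero_of_forall_pair_left hn fun A => by
      have := h' (0, A)
      simpa using this
    have h2 : v.2 = 0 := eq_zero_of_forall_pair_right
      (fun i => (hn i).imp fun x hx y => by rw [hs, hx]) fun w => by
        have := h' (w, 0)
        simpa [h1] using this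
    exact Prod.ext h1 h2

end LoopForm

/-! ### Comparison with Fourier series -/

section Comparison

variable {n : ℕ} {G : Type*} [TopologicalSpace G] [ChartedSpace (EuclideanSpace ℝ (Fin n)) G]
  [Group G] {α : ℝ} [hF : Fact (1 / 2 < α)]

variable (B : LinearMap.BilinForm ℝ (GroupLieAlgebra (𝓡 n) G))

/-- An invariant form as a continuous bilinear form. -/
def formCLM : EuclideanSpace ℝ (Fin n) →L[ℝ] EuclideanSpace ℝ (Fin n) →L[ℝ] ℝ :=
  LinearMap.toContinuousLinearMap
    ((LinearMap.toContinuousLinearMap (𝕜 := ℝ) (E := EuclideanSpace ℝ (Fin n))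
      (F' := ℝ)).toLinearMap.comp
      (B : EuclideanSpace ℝ (Fin n) →ₗ[ℝ] EuclideanSpace ℝ (Fin n) →ₗ[ℝ] ℝ))

theorem loopPairing_eq_pair (A : SobolevSpace (α - 1) n) (v : SobolevSpace α n) :
    loopPairing B A.coeff v.coeff = pair (formCLM B) A v := by
  have hs : ∀ i j, Summable fun k : ℤ => (B (lieBasis n G i) (lieBasis n G j) : ℂ) *
      A.coeff (-k) i * v.coeff k j := fun i j => by
    have h := (Sc.summable_int_smul (SobolevSpace.comp j v) (SobolevSpace.comp i A)).mul_left
      (B (lieBasis n G i) (lieBasis n G j) : ℂ)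
    refine h.congr fun k => ?_
    rw [SobolevSpace.c_comp, SobolevSpace.c_comp]
    ring
  rw [loopPairing, Summable.tsum_finsetSum fun i _ => summable_sum fun j _ => hs i j, Complex.re_sum,
    pair_eq]
  refine Finset.sum_congr rfl fun i _ => ?_
  rw [Summable.tsum_finsetSum fun j _ => hs i j, Complex.re_sum]
  refine Finset.sum_congr rfl fun j _ => ?_
  have h : ∑' k : ℤ, (B (lieBasis n G i) (lieBasis n G j) : ℂ) * A.coeff (-k) i * v.coeff k j =
      ((B (lieBasis n G i) (lieBasis n G j) *
        Sc.int (SobolevSpace.comp j v • SobolevSpace.comp i A) : ℝ) : ℂ) := by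
    rw [Complex.ofReal_mul, Sc.int_smul_eq_tsum, ← tsum_mul_left]
    refine tsum_congr fun k => ?_
    rw [SobolevSpace.c_comp, SobolevSpace.c_comp]
    ring
  rw [h, Complex.ofReal_re]
  rfl

theorem loopPairing_swap (hs : ∀ u v, B u v = B v u) (a b : FourierSeq n) :
    loopPairing B a b = loopPairing B b a := by
  rw [loopPairing, loopPairing, ← (Equiv.neg ℤ).tsum_eq]
  congr 1
  refine tsum_congr fun k => ?_
  rw [Finset.sum_comm]
  refine Finset.sum_congr rfl fun i _ => Finset.sum_congr rfl fun j _ => ?_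
  rw [hs, Equiv.neg_apply, neg_neg]
  ring

variable [LieGroup (𝓡 n) ∞ G] [CompactSpace G] [T2Space G]

theorem loopBracket_eq_coeff (v w : SobolevSpace α n) :
    loopBracket n G v w = (bracketLoop G v w).coeff := by
  funext k
  ext i
  rw [← SobolevSpace.c_comp, ← Sc.realFourierCoeff_ev]
  refine congrArg (fun f => realFourierCoeff f k) (funext fun s => ?_)
  rw [← SobolevSpace.eval_apply, eval_bracketLoop]
  rfl

theorem derivFourier_eq_coeff (v : SobolevSpace α n) :
    derivFourier v.coeff = (SobolevSpace.deriv v).coeff := by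
  funext k
  ext i
  rw [← SobolevSpace.c_comp, SobolevSpace.comp_deriv, Sc.c_deriv, SobolevSpace.c_comp]
  rfl

/-- The pairing is swapped in the last term because `pair` expects the distribution dv₂ first. -/
theorem loopOmega_eq (hs : ∀ u v, B u v = B v u) (A : SobolevSpace (α - 1) n)
    (v₁ : SobolevSpace α n) (A₁ : SobolevSpace (α - 1) n) (v₂ : SobolevSpace α n)
    (A₂ : SobolevSpace (α - 1) n) :
    loopOmega B A v₁ A₁ v₂ A₂ = omegaBilin G (formCLM B) A (v₁, A₁) (v₂, A₂) := by
  rw [loopOmega, omegaBilin_apply, loopPairing_swap B hs v₁.coeff, loopBracket_eq_coeff,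
    derivFourier_eq_coeff, loopPairing_eq_pair, loopPairing_eq_pair, loopPairing_eq_pair,
    loopPairing_eq_pair]

end Comparison

/-! ### Submersions -/

section Submersions

variable {E E' F : Type*} [NormedAddCommGroup E] [NormedSpace ℝ E] [NormedAddCommGroup E']
  [NormedSpace ℝ E'] [NormedAddCommGroup F] [NormedSpace ℝ F] {H H' : Type*} [TopologicalSpace H]
  [TopologicalSpace H'] {I : ModelWithCorners ℝ E H} {J : ModelWithCorners ℝ E' H'}
  {M N : Type*} [TopologicalSpace M] [ChartedSpace H M] [TopologicalSpace N] [ChartedSpace H' N]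
  {k : WithTop ℕ∞}

theorem Diffeomorph.trans_mem_maximalAtlas [IsManifold I k M] (Φ : M ≃ₘ^k⟮I, I⟯ M)
    {e : OpenPartialHomeomorph M H} (he : e ∈ IsManifold.maximalAtlas I k M) :
    Φ.toHomeomorph.toOpenPartialHomeomorph.trans e ∈ IsManifold.maximalAtlas I k M := by
  refine OpenPartialHomeomorph.mem_maximalAtlas_of_contMDiffOn (I := I) (n := k) _ ?_ ?_
  · refine (contMDiffOn_of_mem_maximalAtlas he).comp (t := e.source) Φ.contMDiff.contMDiffOn ?_
    intro x hx
    simpa using hx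
  · refine Φ.symm.contMDiff.comp_contMDiffOn
      ((contMDiffOn_symm_of_mem_maximalAtlas he).mono ?_)
    intro x hx
    simpa using hx

/-- The chart of the domain is precomposed with the diffeomorphism, which leaves the map in charts
unchanged. -/
theorem Manifold.IsSubmersionAtOfComplement.comp_diffeomorph [IsManifold I k M] {f : M → N}
    (Φ : M ≃ₘ^k⟮I, I⟯ M) {x : M} (h : IsSubmersionAtOfComplement F I J k f (Φ x)) :
    IsSubmersionAtOfComplement F I J k (f ∘ Φ) x := by
  refine IsSubmersionAtOfComplement.mk_of_charts h.equiv
    (Φ.toHomeomorph.toOpenPartialHomeomorph.trans h.domChart) h.codChart ?_ h.mem_codChart_source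
    (Φ.trans_mem_maximalAtlas h.domChart_mem_maximalAtlas) h.codChart_mem_maximalAtlas ?_ ?_
  · simpa using h.mem_domChart_source
  · intro y hy
    exact h.source_subset_preimage_source (by simpa using hy)
  · intro y hy
    have hy' : y ∈ (h.domChart.extend I).target := by simpa using hy
    refine Eq.trans ?_ (h.writtenInCharts hy')
    simp

theorem Manifold.isSubmersionAtOfComplement_snd [IsManifold I k M] [IsManifold J k N] (x : M × N) :
    IsSubmersionAtOfComplement E (I.prod J) J k (Prod.snd : M × N → N) x := by
  refine IsSubmersionAtOfComplement.mk_of_charts (ContinuousLinearEquiv.prodComm ℝ E E')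
    (chartAt (ModelProd H H') x) (chartAt H' x.2) (mem_chart_source _ _) (mem_chart_source _ _)
    (IsManifold.chart_mem_maximalAtlas x) (IsManifold.chart_mem_maximalAtlas x.2) ?_ ?_
  · intro y hy
    rw [prodChartedSpace_chartAt] at hy
    exact hy.2
  · intro y hy
    have h : y.2 ∈ ((chartAt H' x.2).extend J).target := by
      have h' : y ∈ (extChartAt (I.prod J) x).target := hy
      rw [extChartAt_prod] at h'
      exact h'.2
    exact ((chartAt H' x.2).extend J).right_inv h

end Submersions

/-! ### The Lie groupoid of the gauge action -/

section LoopGroupoid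

variable {n : ℕ} {G : Type*} [TopologicalSpace G] [ChartedSpace (EuclideanSpace ℝ (Fin n)) G]
  [Group G] [LieGroup (𝓡 n) ∞ G] [CompactSpace G] [T2Space G] {α : ℝ} [hF : Fact (1 / 2 < α)]

namespace SobolevLoop

theorem contMDiff_inv_loop :
    ContMDiff 𝓘(ℝ, SobolevSpace α n) 𝓘(ℝ, SobolevSpace α n) ∞ fun γ : SobolevLoop α n G => γ⁻¹ :=
  contMDiff_inv 𝓘(ℝ, SobolevSpace α n) ∞

variable (α n G) in
/-- The diffeomorphism `(γ, A) ↦ (γ, γ • A)`. -/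
def gaugeShear : LoopArrows n G α ≃ₘ^∞⟮loopModel n α, loopModel n α⟯ LoopArrows n G α where
  toFun p := (p.1, p.1 • p.2)
  invFun p := (p.1, p.1⁻¹ • p.2)
  left_inv p := Prod.ext rfl (inv_smul_smul p.1 p.2)
  right_inv p := Prod.ext rfl (smul_inv_smul p.1 p.2)
  contMDiff_toFun := contMDiff_fst.prodMk contMDiff_gauge_smul
  contMDiff_invFun := contMDiff_fst.prodMk
    (ContMDiff.comp (I' := loopModel n α) (g := fun p : LoopArrows n G α => p.1 • p.2)
      (f := fun p : LoopArrows n G α => (p.1⁻¹, p.2)) contMDiff_gauge_smul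
      ((ContMDiff.comp (I' := 𝓘(ℝ, SobolevSpace α n)) (g := fun γ : SobolevLoop α n G => γ⁻¹)
        (f := fun p : LoopArrows n G α => p.1) contMDiff_inv_loop contMDiff_fst).prodMk
          contMDiff_snd))

theorem contMDiff_action_comp : ContMDiff ((loopModel n α).prod (loopModel n α)) (loopModel n α) ∞
    fun q : LoopArrows n G α × LoopArrows n G α => (q.1.1 * q.2.1, q.2.2) := by
  have h1 : ContMDiff ((loopModel n α).prod (loopModel n α)) 𝓘(ℝ, SobolevSpace α n) ∞
      fun q : LoopArrows n G α × LoopArrows n G α => q.1.1 :=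
    ContMDiff.comp (I' := loopModel n α) (g := fun p : LoopArrows n G α => p.1)
      (f := fun q : LoopArrows n G α × LoopArrows n G α => q.1) contMDiff_fst contMDiff_fst
  have h2 : ContMDiff ((loopModel n α).prod (loopModel n α)) 𝓘(ℝ, SobolevSpace α n) ∞
      fun q : LoopArrows n G α × LoopArrows n G α => q.2.1 :=
    ContMDiff.comp (I' := loopModel n α) (g := fun p : LoopArrows n G α => p.1)
      (f := fun q : LoopArrows n G α × LoopArrows n G α => q.2) contMDiff_fst contMDiff_snd
  have h3 : ContMDiff ((loopModel n α).prod (loopModel n α)) 𝓘(ℝ, SobolevSpace (α - 1) n) ∞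
      fun q : LoopArrows n G α × LoopArrows n G α => q.2.2 :=
    ContMDiff.comp (I' := loopModel n α) (g := fun p : LoopArrows n G α => p.2)
      (f := fun q : LoopArrows n G α × LoopArrows n G α => q.2) contMDiff_snd contMDiff_snd
  exact (h1.mul h2).prodMk h3

theorem isLocalCompExtension_action (p : LoopArrows n G α × LoopArrows n G α) :
    IsLocalCompExtension (loopModel n α)
      (actionGroupoid (SobolevLoop α n G) (SobolevSpace (α - 1) n))
      (fun q => (q.1.1 * q.2.1, q.2.2)) p where
  smooth := contMDiff_action_comp.contMDiffAt
  extends_comp := Filter.Eventually.of_forall fun _ _ => rfl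

variable (α n G) in
theorem isLieGroupoid_action : IsLieGroupoid (loopModel n α) 𝓘(ℝ, SobolevSpace (α - 1) n)
    (actionGroupoid (SobolevLoop α n G) (SobolevSpace (α - 1) n)) where
  isManifold_arrows := inferInstance
  isManifold_objects := inferInstance
  t2_arrows := inferInstance
  t2_objects := inferInstance
  contMDiff_src := contMDiff_snd
  contMDiff_tgt := contMDiff_gauge_smul
  contMDiff_unit := contMDiff_const.prodMk contMDiff_id
  contMDiff_inv := (ContMDiff.comp (I' := 𝓘(ℝ, SobolevSpace α n))
    (g := fun γ : SobolevLoop α n G => γ⁻¹) (f := fun p : LoopArrows n G α => p.1)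
    contMDiff_inv_loop contMDiff_fst).prodMk contMDiff_gauge_smul
  contMDiff_comp g h _ := ⟨_, isLocalCompExtension_action (g, h)⟩
  isSubmersion_src := Manifold.IsSubmersionOfComplement.isSubmersion
    (F := SobolevSpace α n) fun x => Manifold.isSubmersionAtOfComplement_snd x
  -- The target map is the second projection after the shear (γ, A) ↦ (γ, γ·A).
  isSubmersion_tgt := Manifold.IsSubmersionOfComplement.isSubmersion (F := SobolevSpace α n)
    fun _ => Manifold.IsSubmersionAtOfComplement.comp_diffeomorph (f := Prod.snd)
      (gaugeShear n G α) (Manifold.isSubmersionAtOfComplement_snd _)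

end SobolevLoop

end LoopGroupoid

/-! ### Multiplicativity -/

section Multiplicativity

variable {n : ℕ} {G : Type*} [TopologicalSpace G] [ChartedSpace (EuclideanSpace ℝ (Fin n)) G]
  [Group G] [LieGroup (𝓡 n) ∞ G] [CompactSpace G] [T2Space G] {α : ℝ} [hF : Fact (1 / 2 < α)]
  {B : EuclideanSpace ℝ (Fin n) →L[ℝ] EuclideanSpace ℝ (Fin n) →L[ℝ] ℝ}

namespace SobolevLoop

/-- The infinitesimal content of multiplicativity. Ad-invariance removes Ad_δ, and the contributions
of the logarithmic derivative of δ from δ·A and from ∂(Ad_δ u₂) cancel each other. The cross terms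
between u and w match by invariance and one integration by parts. -/
theorem omegaBilin_gauge_add [PreconnectedSpace G] (hs : ∀ u v, B u v = B v u)
    (hi : ∀ u v w, B (bracketCLM n G u v) w = -B v (bracketCLM n G u w))
    (δ : SobolevLoop α n G) (A a₁ a₂ : SobolevSpace (α - 1) n) (u₁ u₂ w₁ w₂ : SobolevSpace α n) :
    omegaBilin G B (δ • A)
        (matVec (adMat δ) u₁, matAct (adMat δ) (a₁ + (matAct (adLie G w₁) A + SobolevSpace.deriv w₁)))
        (matVec (adMat δ) u₂, matAct (adMat δ) (a₂ + (matAct (adLie G w₂) A + SobolevSpace.deriv w₂)))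
      + omegaBilin G B A (w₁, a₁) (w₂, a₂) = omegaBilin G B A (u₁ + w₁, a₁) (u₂ + w₂, a₂) := by
  have h1 : pair B (rightLog δ) (matVec (adMat δ) (bracketLoop G u₂ u₁)) =
      -pair B (rightLog δ) (matVec (adMat δ) (bracketLoop G u₁ u₂)) := by
    rw [bracketLoop_swap, map_neg, map_neg]
  have h2 := congrArg (pair B A) (bracketLoop_swap (G := G) u₁ w₂)
  rw [map_neg] at h2
  have h3 := pair_deriv_swap hs u₂ w₁
  simp only [omegaBilin_apply, gauge_smul_def, bracketLoop_adMat, deriv_adMat, map_add, map_sub,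
    _root_.add_apply, _root_.sub_apply, pair_adMat hi, pair_adLie hi]
  linarith

theorem mfderiv_tgt (h : LoopArrows n G α) (Y : SobolevSpace α n × SobolevSpace (α - 1) n) :
    (mfderiv (loopModel n α) 𝓘(ℝ, SobolevSpace (α - 1) n)
      (fun p : LoopArrows n G α => p.1 • p.2) h Y : SobolevSpace (α - 1) n) =
      matAct (adMat h.1) (Y.2 + (matAct (adLie G Y.1) h.2 + SobolevSpace.deriv Y.1)) := by
  have h1 := mfderiv_prod_eq_add_apply (v := Y)
    (contMDiff_gauge_smul.mdifferentiableAt (by simp) : MDifferentiableAt (loopModel n α)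
      𝓘(ℝ, SobolevSpace (α - 1) n) (fun p : LoopArrows n G α => p.1 • p.2) h)
  have h2 : HasFDerivAt (fun A : SobolevSpace (α - 1) n => h.1 • A) (matAct (adMat h.1)) h.2 :=
    (matAct (adMat h.1)).hasFDerivAt.add_const (rightLog h.1)
  have h3 : mfderiv 𝓘(ℝ, SobolevSpace (α - 1) n) 𝓘(ℝ, SobolevSpace (α - 1) n)
      (fun A : SobolevSpace (α - 1) n => h.1 • A) h.2 = matAct (adMat h.1) :=
    h2.hasMFDerivAt.mfderiv
  refine h1.trans ((congrArg₂ (· + ·) (mfderiv_gauge_smul_left h.1 h.2 Y.1)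
    (DFunLike.congr_fun h3 Y.2)).trans ?_)
  exact ((matAct (adMat h.1)).map_add _ _).symm.trans (congrArg _ (add_comm _ _))

/-- Left multiplication has derivative the identity and right multiplication by the loop of h has
derivative Ad of its inverse. -/
theorem mfderiv_mul_fst (γ : SobolevLoop α n G) (h : LoopArrows n G α) (v : SobolevSpace α n)
    (Y : SobolevSpace α n × SobolevSpace (α - 1) n) :
    (mfderiv (𝓘(ℝ, SobolevSpace α n).prod (loopModel n α)) (loopModel n α)
      (fun p : SobolevLoop α n G × LoopArrows n G α => (p.1 * p.2.1, p.2.2)) (γ, h) (v, Y) :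
        SobolevSpace α n × SobolevSpace (α - 1) n) = (matVec (adMat h.1⁻¹) v + Y.1, Y.2) := by
  have s1 : ContMDiff (𝓘(ℝ, SobolevSpace α n).prod (loopModel n α)) 𝓘(ℝ, SobolevSpace α n) ∞
      fun p : SobolevLoop α n G × LoopArrows n G α => p.2.1 :=
    ContMDiff.comp (I' := loopModel n α) (g := fun p : LoopArrows n G α => p.1)
      (f := fun q : SobolevLoop α n G × LoopArrows n G α => q.2) contMDiff_fst contMDiff_snd
  have s2 : ContMDiff (𝓘(ℝ, SobolevSpace α n).prod (loopModel n α)) 𝓘(ℝ, SobolevSpace α n) ∞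
      fun p : SobolevLoop α n G × LoopArrows n G α => p.1 * p.2.1 := contMDiff_fst.mul s1
  have s3 : MDifferentiableAt (𝓘(ℝ, SobolevSpace α n).prod (loopModel n α)) 𝓘(ℝ, SobolevSpace α n)
      (fun p : SobolevLoop α n G × LoopArrows n G α => p.1 * p.2.1) (γ, h) :=
    s2.mdifferentiableAt (by simp)
  have h1 := mfderiv_prod_eq_add_apply (v := (v, Y)) s3
  have h2 : HasMFDerivAt (loopModel n α) 𝓘(ℝ, SobolevSpace α n)
      (fun p : LoopArrows n G α => γ * p.1) h
      (ContinuousLinearMap.fst ℝ (SobolevSpace α n) (SobolevSpace (α - 1) n)) := by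
    have h3 : MDifferentiableAt 𝓘(ℝ, SobolevSpace α n) 𝓘(ℝ, SobolevSpace α n)
        (fun x => γ * x) h.1 :=
      (contMDiff_mul_left (I := 𝓘(ℝ, SobolevSpace α n)) (n := ∞) (a := γ)).mdifferentiableAt
        (by simp)
    have h4 := HasMFDerivAt.comp h (g := fun x => γ * x) h3.hasMFDerivAt
      (hasMFDerivAt_fst (I := 𝓘(ℝ, SobolevSpace α n)) (I' := 𝓘(ℝ, SobolevSpace (α - 1) n)) h)
    have e : (mfderiv 𝓘(ℝ, SobolevSpace α n) 𝓘(ℝ, SobolevSpace α n) (fun x => γ * x) h.1).comp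
        (ContinuousLinearMap.fst ℝ (SobolevSpace α n) (SobolevSpace (α - 1) n)) =
        ContinuousLinearMap.fst ℝ (SobolevSpace α n) (SobolevSpace (α - 1) n) :=
      (congrArg (fun L : SobolevSpace α n →L[ℝ] SobolevSpace α n => L.comp
        (ContinuousLinearMap.fst ℝ (SobolevSpace α n) (SobolevSpace (α - 1) n)))
        (mfderiv_mul_left γ h.1)).trans (ContinuousLinearMap.id_comp _)
    exact e ▸ h4
  have h5 := h1.trans (congrArg₂ (· + ·) (DFunLike.congr_fun (mfderiv_mul_right γ h.1) v)
    (DFunLike.congr_fun h2.mfderiv Y))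
  have h6 : HasMFDerivAt (𝓘(ℝ, SobolevSpace α n).prod (loopModel n α))
      𝓘(ℝ, SobolevSpace (α - 1) n)
      (fun p : SobolevLoop α n G × LoopArrows n G α => p.2.2) (γ, h)
      ((ContinuousLinearMap.snd ℝ (SobolevSpace α n) (SobolevSpace (α - 1) n)).comp
        (ContinuousLinearMap.snd ℝ (SobolevSpace α n)
          (SobolevSpace α n × SobolevSpace (α - 1) n))) :=
    HasMFDerivAt.comp (γ, h) (g := fun p : LoopArrows n G α => p.2)
      (hasMFDerivAt_snd (I := 𝓘(ℝ, SobolevSpace α n)) (I' := 𝓘(ℝ, SobolevSpace (α - 1) n)) h)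
      (hasMFDerivAt_snd (I := 𝓘(ℝ, SobolevSpace α n)) (I' := loopModel n α) (γ, h))
  exact (DFunLike.congr_fun (s3.hasMFDerivAt.prodMk h6).mfderiv (v, Y)).trans (Prod.ext h5 rfl)

/-- The parametrization `(γ, h) ↦ ((γ, t(h)), h)` of the composable pairs of arrows. -/
def composablePair (p : SobolevLoop α n G × LoopArrows n G α) :
    LoopArrows n G α × LoopArrows n G α := ((p.1, p.2.1 • p.2.2), p.2)

theorem hasMFDerivAt_composablePair (γ : SobolevLoop α n G) (h : LoopArrows n G α) :
    HasMFDerivAt (𝓘(ℝ, SobolevSpace α n).prod (loopModel n α))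
      ((loopModel n α).prod (loopModel n α)) composablePair (γ, h)
      (((ContinuousLinearMap.fst ℝ (SobolevSpace α n)
          (SobolevSpace α n × SobolevSpace (α - 1) n)).prod
        ((mfderiv (loopModel n α) 𝓘(ℝ, SobolevSpace (α - 1) n)
          (fun p : LoopArrows n G α => p.1 • p.2) h :
            (SobolevSpace α n × SobolevSpace (α - 1) n) →L[ℝ] SobolevSpace (α - 1) n).comp
          (ContinuousLinearMap.snd ℝ (SobolevSpace α n)
            (SobolevSpace α n × SobolevSpace (α - 1) n)))).prod
        (ContinuousLinearMap.snd ℝ (SobolevSpace α n)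
          (SobolevSpace α n × SobolevSpace (α - 1) n))) := by
  have h1 : MDifferentiableAt (loopModel n α) 𝓘(ℝ, SobolevSpace (α - 1) n)
      (fun p : LoopArrows n G α => p.1 • p.2) h := contMDiff_gauge_smul.mdifferentiableAt (by simp)
  have h2 : HasMFDerivAt (𝓘(ℝ, SobolevSpace α n).prod (loopModel n α)) (loopModel n α)
      (fun p : SobolevLoop α n G × LoopArrows n G α => p.2) (γ, h)
      (ContinuousLinearMap.snd ℝ (SobolevSpace α n) (SobolevSpace α n × SobolevSpace (α - 1) n)) :=
    hasMFDerivAt_snd (I := 𝓘(ℝ, SobolevSpace α n)) (I' := loopModel n α) (γ, h)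
  have h3 : HasMFDerivAt (𝓘(ℝ, SobolevSpace α n).prod (loopModel n α)) 𝓘(ℝ, SobolevSpace α n)
      (fun p : SobolevLoop α n G × LoopArrows n G α => p.1) (γ, h)
      (ContinuousLinearMap.fst ℝ (SobolevSpace α n) (SobolevSpace α n × SobolevSpace (α - 1) n)) :=
    hasMFDerivAt_fst (I := 𝓘(ℝ, SobolevSpace α n)) (I' := loopModel n α) (γ, h)
  have h4 := HasMFDerivAt.comp (I' := loopModel n α) (γ, h)
    (f := fun p : SobolevLoop α n G × LoopArrows n G α => p.2)
    (g := fun p : LoopArrows n G α => p.1 • p.2) h1.hasMFDerivAt h2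
  have h5 := h3.prodMk h4
  exact HasMFDerivAt.prodMk (f := fun p : SobolevLoop α n G × LoopArrows n G α =>
    (p.1, p.2.1 • p.2.2)) (g := fun p : SobolevLoop α n G × LoopArrows n G α => p.2) h5 h2

variable {m : LoopArrows n G α × LoopArrows n G α → LoopArrows n G α} {γ : SobolevLoop α n G}
  {h : LoopArrows n G α}

theorem compExtension_comp_composablePair (hm : IsLocalCompExtension (loopModel n α)
      (actionGroupoid (SobolevLoop α n G) (SobolevSpace (α - 1) n)) m (composablePair (γ, h))) :
    m ∘ composablePair =ᶠ[𝓝 (γ, h)] fun p => (p.1 * p.2.1, p.2.2) := by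
  have h1 := (hasMFDerivAt_composablePair γ h).continuousAt.eventually hm.extends_comp
  filter_upwards [h1] with p hp
  exact hp rfl

/-- A local extension of the composition is arbitrary off the composable pairs, but composed with
the parametrization `composablePair` it is the explicit product. The hypothesis puts (X, Y) in the
image of the differential of that parametrization, so the chain rule determines the derivative. -/
theorem mfderiv_compExtension (hm : IsLocalCompExtension (loopModel n α)
      (actionGroupoid (SobolevLoop α n G) (SobolevSpace (α - 1) n)) m (composablePair (γ, h)))
    (X Y : SobolevSpace α n × SobolevSpace (α - 1) n)
    (hX : X.2 = matAct (adMat h.1) (Y.2 + (matAct (adLie G Y.1) h.2 + SobolevSpace.deriv Y.1))) :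
    (mfderiv ((loopModel n α).prod (loopModel n α)) (loopModel n α) m (composablePair (γ, h)) (X, Y) :
        SobolevSpace α n × SobolevSpace (α - 1) n) = (matVec (adMat h.1⁻¹) X.1 + Y.1, Y.2) := by
  have h1 : MDifferentiableAt ((loopModel n α).prod (loopModel n α)) (loopModel n α) m
      (composablePair (γ, h)) := hm.smooth.mdifferentiableAt (by simp)
  have h2 := HasMFDerivAt.comp (γ, h) h1.hasMFDerivAt (hasMFDerivAt_composablePair γ h)
  have h3 := (h2.congr_of_eventuallyEq (compExtension_comp_composablePair hm).symm).mfderiv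
  refine Eq.trans ?_ ((DFunLike.congr_fun h3 (X.1, Y)).symm.trans (mfderiv_mul_fst γ h X.1 Y))
  exact congrArg (mfderiv ((loopModel n α).prod (loopModel n α)) (loopModel n α) m
    (composablePair (γ, h))) (Prod.ext (Prod.ext rfl (hX.trans (mfderiv_tgt h Y).symm)) rfl)

theorem isMultiplicative_loopForm [PreconnectedSpace G] (hs : ∀ u v, B u v = B v u)
    (hi : ∀ u v w, B (bracketCLM n G u v) w = -B v (bracketCLM n G u w)) :
    IsMultiplicative (loopModel n α) 𝓘(ℝ, SobolevSpace (α - 1) n)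
      (actionGroupoid (SobolevLoop α n G) (SobolevSpace (α - 1) n)) (loopForm G α B) := by
  rintro ⟨γ, A'⟩ h hc m hm X₁ X₂ Y₁ Y₂ h1 h2
  obtain rfl : A' = h.1 • h.2 := hc
  change SobolevSpace α n × SobolevSpace (α - 1) n at X₁ X₂ Y₁ Y₂
  have e : ∀ X Y : SobolevSpace α n × SobolevSpace (α - 1) n,
      (mfderiv (loopModel n α) 𝓘(ℝ, SobolevSpace (α - 1) n)
        (Prod.snd : LoopArrows n G α → _) (γ, h.1 • h.2) X : SobolevSpace (α - 1) n) =
      mfderiv (loopModel n α) 𝓘(ℝ, SobolevSpace (α - 1) n)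
        (fun p : LoopArrows n G α => p.1 • p.2) h Y →
      X.2 = matAct (adMat h.1) (Y.2 + (matAct (adLie G Y.1) h.2 + SobolevSpace.deriv Y.1)) :=
    fun X Y hXY => (DFunLike.congr_fun (mfderiv_snd (I := 𝓘(ℝ, SobolevSpace α n))
      (I' := 𝓘(ℝ, SobolevSpace (α - 1) n)) (x := (γ, h.1 • h.2))) X).symm.trans
      (hXY.trans (mfderiv_tgt h Y))
  have e1 := e X₁ Y₁ h1
  have e2 := e X₂ Y₂ h2
  have hq : m (composablePair (γ, h)) = (γ * h.1, h.2) :=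
    (compExtension_comp_composablePair hm).self_of_nhds
  have hv : (m (composablePair (γ, h))).2 = h.2 :=
    (Prod.ext_iff.1 hq).2
  refine (congrArg₂ (· + ·) (loopForm_apply hs (γ, h.1 • h.2) X₁ X₂)
    (loopForm_apply hs h Y₁ Y₂)).trans (Eq.trans ?_ (loopForm_apply hs _ _ _).symm)
  -- The vectors u are chosen as Ad_{δ⁻¹} of the loop components of X, so that Ad_δ u gives these
  -- components back and u + w is the loop component of the derivative of the composition.
  have h3 := omegaBilin_gauge_add hs hi h.1 h.2 Y₁.2 Y₂.2 (matVec (adMat h.1⁻¹) X₁.1)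
    (matVec (adMat h.1⁻¹) X₂.1) Y₁.1 Y₂.1
  rw [adMat_adMat_inv, adMat_adMat_inv, ← e1, ← e2] at h3
  refine h3.trans ?_
  have h4 := mfderiv_compExtension hm X₁ Y₁ e1
  have h5 := mfderiv_compExtension hm X₂ Y₂ e2
  exact (congrArg (fun A => omegaBilin G B A _ _) hv.symm).trans
    (congrArg₂ (fun x y => omegaBilin G B (m (composablePair (γ, h))).2 x y) h4.symm h5.symm)

end SobolevLoop

end Multiplicativity

/-! ### The hypotheses on the bilinear form, and the conclusion -/

theorem LinearMap.BilinForm.Nondegenerate.exists_apply_eq {V : Type*} [AddCommGroup V] [Module ℝ V]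
    [FiniteDimensional ℝ V] {B : LinearMap.BilinForm ℝ V} (hB : B.Nondegenerate)
    (f : Module.Dual ℝ V) : ∃ x, ∀ y, B x y = f y :=
  ⟨(B.toDual hB).symm f, fun y => B.apply_toDual_symm_apply (hB := hB) f y⟩

/-- Invariance with the first two arguments exchanged, combined with antisymmetry of the bracket: ad
is skew for the form, which is how invariance is used throughout. -/
theorem formCLM_bracketCLM {n : ℕ} {G : Type*} [TopologicalSpace G]
    [ChartedSpace (EuclideanSpace ℝ (Fin n)) G] [Group G] [LieGroup (𝓡 n) ∞ G]
    {B : LinearMap.BilinForm ℝ (GroupLieAlgebra (𝓡 n) G)}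
    (hi : ∀ u v w : GroupLieAlgebra (𝓡 n) G, B ⁅u, v⁆ w = B u ⁅v, w⁆)
    (u v w : EuclideanSpace ℝ (Fin n)) :
    formCLM B (bracketCLM n G u v) w = -formCLM B v (bracketCLM n G u w) := by
  have h1 : formCLM B (bracketCLM n G v u) w = formCLM B v (bracketCLM n G u w) := hi v u w
  rw [← h1, bracketCLM_swap, map_neg, _root_.neg_apply]

end

theorem mainTheorem5 {n : ℕ} {G : Type*} [TopologicalSpace G] [T2Space G] [CompactSpace G]
    [ConnectedSpace G] [ChartedSpace (EuclideanSpace ℝ (Fin n)) G] [Group G]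
    [LieGroup (𝓡 n) ∞ G]
    (B : LinearMap.BilinForm ℝ (GroupLieAlgebra (𝓡 n) G))
    (hB_symm : ∀ u v, B u v = B v u)
    (hB_inv : ∀ u v w : GroupLieAlgebra (𝓡 n) G, B ⁅u, v⁆ w = B u ⁅v, w⁆)
    (hB_nondeg : B.Nondegenerate)
    (α : ℝ) (hα : 1 / 2 < α) :
    ∃ (_ : Group (SobolevLoop α n G)) (_ : TopologicalSpace (SobolevLoop α n G))
      (_ : ChartedSpace (SobolevSpace α n) (SobolevLoop α n G))
      (e : OpenPartialHomeomorph (SobolevLoop α n G) (SobolevSpace α n)),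
      IsLoopLieGroup e ∧
      ∃ _ : MulAction (SobolevLoop α n G) (SobolevSpace (α - 1) n),
        (∀ (γ : SobolevLoop α n G) (A : SobolevSpace (α - 1) n), IsGaugeTransform γ A (γ • A)) ∧
        ∃ Ω : TwoFormField
            (𝓘(ℝ, SobolevSpace α n).prod 𝓘(ℝ, SobolevSpace (α - 1) n))
            (SobolevLoop α n G × SobolevSpace (α - 1) n),
          (∀ (γ : SobolevLoop α n G) (A : SobolevSpace (α - 1) n)
            (X₁ X₂ : TangentSpace 𝓘(ℝ, SobolevSpace α n) γ)
            (A₁ A₂ : TangentSpace 𝓘(ℝ, SobolevSpace (α - 1) n) A),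
            Ω (γ, A) ![(X₁, A₁), (X₂, A₂)] =
              loopOmega B A (leftTrivialization e γ X₁) A₁ (leftTrivialization e γ X₂) A₂) ∧
          IsSymplecticGroupoid (𝓘(ℝ, SobolevSpace α n).prod 𝓘(ℝ, SobolevSpace (α - 1) n))
            𝓘(ℝ, SobolevSpace (α - 1) n)
            (actionGroupoid (SobolevLoop α n G) (SobolevSpace (α - 1) n)) Ω := by
  have : Fact (1 / 2 < α) := ⟨hα⟩
  have hs : ∀ u v, formCLM B u v = formCLM B v u := hB_symm
  have : FiniteDimensional ℝ (GroupLieAlgebra (𝓡 n) G) :=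
    inferInstanceAs (FiniteDimensional ℝ (EuclideanSpace ℝ (Fin n)))
  have hn : ∀ i, ∃ x, ∀ y, formCLM B x y = y i := fun i =>
    hB_nondeg.exists_apply_eq 
      (EuclideanSpace.proj i : EuclideanSpace ℝ (Fin n) →L[ℝ] ℝ).toLinearMap
  have hi := formCLM_bracketCLM hB_inv
  refine ⟨inferInstance, inferInstance, inferInstance, SobolevLoop.loopChart α n G,
    SobolevLoop.isLoopLieGroup_loopChart, inferInstance, SobolevLoop.isGaugeTransform_smul,
    loopForm G α (formCLM B), fun γ A X₁ X₂ A₁ A₂ => ?_,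
    ⟨SobolevLoop.isLieGroupoid_action n G α, isSymplecticForm_loopForm hs hi hn,
      SobolevLoop.isMultiplicative_loopForm hs hi⟩⟩
  refine (loopForm_apply hs (γ, A) (X₁, A₁) (X₂, A₂)).trans ?_
  refine (loopOmega_eq B hB_symm A X₁ A₁ X₂ A₂).symm.trans ?_
  exact congrArg₂ (fun v₁ v₂ => loopOmega B A v₁ A₁ v₂ A₂)
    (SobolevLoop.leftTrivialization_loopChart γ X₁).symm
    (SobolevLoop.leftTrivialization_loopChart γ X₂).symm
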